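/- Let $\mathbb K=\mathbb R$ or $\mathbb C$, let $G$ be an abelian group with a commutation factor $\rho\colon G\times G\to\mathbb K$ (so $\rho(i,j)\rho(j,i)=1$ and $\rho(i+j,k)=\rho(i,k)\rho(j,k)$); $i\in G$ is even if $\rho(i,i)=1$ and odd if $\rho(i,i)=-1$. On $\mathbb Z\times G$ put $\rho'((s,i),(t,j))=(-1)^{st}\rho(i,j)$. Let $M$ be a $\rho$-manifold: a connected $n$-dimensional (smooth, real analytic or holomorphic) manifold with a sheaf $\mathscr O_\rho$ of $G$-graded algebras that has local coordinates $x=(x^1,\dots,x^{n+m})$ around every point, where $x^1,\dots,x^n$ are coordinates of the underlying manifold, of degree $0$, and $\mathscr O_\rho(U)\cong\mathscr O(U)[[x^{n+1},\dots,x^{n+m}]]_\bullet$, the direct sum of the spaces of homogeneous formal power series in indeterminates of fixed degrees $|x^a|\in G$ with $x^ax^b=\rho(|x^a|,|x^b|)x^bx^a$ (odd ones having square $0$). Let $\partial/\partial x^a$ denote the (left) $\rho$-derivations with $\partial x^b/\partial x^a=\delta_{ab}$. *Berezinian.* For a square matrix $F$ with $|F_{kl}|=i_k-i_l$, cut into blocks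 by the parity of $I=(i_1,i_2,\dots)$, let $\rho\mathrm{Ber}(F)=\rho\mathrm{det}(F_{00}-F_{01}F_{11}^{-1}F_{10})\,\rho\mathrm{det}(F_{11})^{-1}$ if $F_{00},F_{11}$ are invertible, and $0$ otherwise. Here, for $I$ of constant parity, $\rho\mathrm{det}(F)$ is defined by $\rho\mathrm{det}(F)\,t_1\cdots t_r=\sum_\sigma F_{1\sigma(1)}t_{\sigma(1)}\cdots F_{r\sigma(r)}t_{\sigma(r)}$ with indeterminates $t_k$ of degree $i_k$ that are $\rho$-antisymmetric ($t_kt_l=-\rho(i_k,i_l)t_lt_k$) if $I$ is even and $\rho$-symmetric ($t_kt_l=\rho(i_k,i_l)t_lt_k$) if $I$ is odd, and $t_kf=\rho(i_k,|f|)ft_k$. *Volume forms.* For coordinates $x,y$, the Jacobian matrix on the overlap is $J_{xy}=\bigl(\rho(|x^b|,|y^a|-|x^b|)\,\partial y^a/\partial x^b\bigr)_{a,b}$, i.e. the matrix with $\sum_b dx^b\,\partial y^a/\partial x^b=\sum_b (J_{xy})_{ab}\,dx^b$ for symbols $dx^b$ of degree $|x^b|$. A section of the $\rho$-Berezinian bundle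 is a family $D(x)s(x)$ of local expressions, where $D(y)=D(x)\,\rho\mathrm{Ber}(J_{xy})$, i.e. $s(x)=\rho\mathrm{Ber}(J_{xy})\,s(y)$ on overlaps; it is a $\rho$-Berezin volume form if all $s(x)$ are invertible of degree $0$. *Bundles.* The total spaces of the following bundles have coordinates $(x^a,\xi_a)_a$ over coordinates $x$ of $M$, the $\xi_a$ being graded indeterminates with the following degrees and transition rules from $(x,\xi)$ to $(y,\eta)$; for $\Pi TM$ and $\Pi T^*M$, which are $\rho'$-manifolds, $x^a$ has degree $(0,|x^a|)$. - $TM$: $|\xi_a|=|x^a|$; $\Pi TM$: $|\xi_a|=(1,|x^a|)$; both with $\eta_a=\sum_b\xi_b\,\partial y^a/\partial x^b$. - $T^*M$: $|\xi_a|=-|x^a|$; $\Pi T^*M$: $|\xi_a|=(1,-|x^a|)$; $[-i]T^*M$ for $i\in G$: $|\xi_a|=-|x^a|-i$; all with $\eta_a=\sum_b(\partial x^b/\partial y^a)\,\xi_b$. Then the following hold, for all coordinates $x,y$ of $M$. 1. The $\rho'$-Berezinian of the Jacobian matrix $J_{(x,\xi),(y,\eta)}$ of $\Pi TM$ is $1$,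 and $D(x,\xi)\cdot 1$ is a $\rho'$-Berezin volume form on $\Pi TM$. 2. The $\rho$-Berezinian of $J_{(x,\xi),(y,\eta)}$ for $T^*M$, and for $[-i]T^*M$ with $i$ even, is $1$, and $D(x,\xi)\cdot1$ is a $\rho$-Berezin volume form on these. 3. The $\rho$-Berezinian (for $\Pi T^*M$: the $\rho'$-Berezinian) of $J_{(x,\xi),(y,\eta)}$ for $TM$, for $\Pi T^*M$, and for $[-i]T^*M$ with $i$ odd, is $(\rho\mathrm{Ber}\,J_{xy})^2$; and if $D(x)s(x)$ is a $\rho$-Berezin volume form on $M$, then $D(x,\xi)\,s(x)^2$ is a $\rho$-Berezin ($\rho'$-Berezin) volume form on these. -/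

import Mathlib

open scoped ContDiff Manifold Topology
open TopologicalSpace (Opens)

set_option linter.unusedSectionVars false
noncomputable section

/-! ### Commutation factors -/

/-- A commutation factor on the abelian group `G` with values in `𝕂`. -/
structure CommutationFactor (G 𝕂 : Type*) [AddCommGroup G] [Field 𝕂] where
  toFun : G → G → 𝕂
  mul_swap : ∀ i j, toFun i j * toFun j i = 1
  add_left : ∀ i j k, toFun (i + j) k = toFun i k * toFun j k

namespace CommutationFactor

variable {G 𝕂 : Type*} [AddCommGroup G] [Field 𝕂]

instance : CoeFun (CommutationFactor G 𝕂) fun _ => G → G → 𝕂 := ⟨toFun⟩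

/-- `i` is even, i.e. `i ∈ G₀`. -/
def IsEven (ρ : CommutationFactor G 𝕂) (i : G) : Prop := ρ i i = 1

/-- `i` is odd, i.e. `i ∈ G₁`. -/
def IsOdd (ρ : CommutationFactor G 𝕂) (i : G) : Prop := ρ i i = -1

theorem add_right (ρ : CommutationFactor G 𝕂) (i j k : G) :
    ρ i (j + k) = ρ i j * ρ i k := by
  have h1 := ρ.mul_swap i (j + k)
  have h2 := ρ.mul_swap i j
  have h3 := ρ.mul_swap i k
  rw [ρ.add_left] at h1
  calc ρ i (j + k) = ρ i (j + k) * (ρ i j * ρ j i) * (ρ i k * ρ k i) := by rw [h2, h3]; ring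
    _ = (ρ i (j + k) * (ρ j i * ρ k i)) * (ρ i j * ρ i k) := by ring
    _ = _ := by rw [h1, one_mul]

/-- The commutation factor `ρ'((s, i), (t, j)) = (-1) ^ (s t) ρ(i, j)` on `ℤ × G`. -/
def prime (ρ : CommutationFactor G 𝕂) : CommutationFactor (ℤ × G) 𝕂 where
  toFun x y := (-1 : 𝕂) ^ (x.1 * y.1) * ρ x.2 y.2
  mul_swap x y := by
    have h : (-1 : 𝕂) ^ (x.1 * y.1) * (-1 : 𝕂) ^ (y.1 * x.1) = 1 := by
      rw [mul_comm y.1, ← mul_zpow]; simp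
    calc _ = ((-1 : 𝕂) ^ (x.1 * y.1) * (-1 : 𝕂) ^ (y.1 * x.1)) * (ρ x.2 y.2 * ρ y.2 x.2) := by ring
      _ = 1 := by rw [h, ρ.mul_swap, one_mul]
  add_left x y z := by
    have h : (-1 : 𝕂) ^ ((x + y).1 * z.1) = (-1 : 𝕂) ^ (x.1 * z.1) * (-1 : 𝕂) ^ (y.1 * z.1) := by
      rw [Prod.fst_add, add_mul, zpow_add₀ (by simp)]
    rw [h, Prod.snd_add, ρ.add_left]; ring

end CommutationFactor

/-! ### Formal power series in graded indeterminates -/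

section Series

variable {G 𝕂 κ : Type*} [AddCommGroup G] [Field 𝕂] [Fintype κ] [LinearOrder κ]

/-- Exponents of the monomials that survive: odd indeterminates square to zero. -/
def Admissible (ρ : CommutationFactor G 𝕂) (d : κ → G) (w : κ →₀ ℕ) : Prop :=
  ∀ b, ρ.IsOdd (d b) → w b ≤ 1

theorem Admissible.mono {ρ : CommutationFactor G 𝕂} {d : κ → G} {u w : κ →₀ ℕ}
    (h : Admissible ρ d w) (huw : u ≤ w) : Admissible ρ d u :=
  fun b hb => (huw b).trans (h b hb)

theorem admissible_zero (ρ : CommutationFactor G 𝕂) (d : κ → G) : Admissible ρ d 0 :=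
  fun _ _ => by simp

/-- The degree of the monomial `x ^ w` when `x b` has degree `d b`. -/
def monomialDegree (d : κ → G) (w : κ →₀ ℕ) : G := ∑ b, w b • d b

/-- The factor in `x ^ u * x ^ v = exchange u v • x ^ (u + v)`, where monomials are written with
increasing indices: every `x b` of the second monomial passes every `x c`, `b < c`, of the first. -/
def exchange (ρ : CommutationFactor G 𝕂) (d : κ → G) (u v : κ →₀ ℕ) : 𝕂 :=
  ∏ b, ∏ c ∈ Finset.univ.filter (b < ·), ρ (d c) (d b) ^ (u c * v b)

theorem exchange_add_left (ρ : CommutationFactor G 𝕂) (d : κ → G) (u v w : κ →₀ ℕ) :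
    exchange ρ d (u + v) w = exchange ρ d u w * exchange ρ d v w := by
  simp only [exchange, ← Finset.prod_mul_distrib, Finsupp.add_apply, add_mul, pow_add]

theorem exchange_add_right (ρ : CommutationFactor G 𝕂) (d : κ → G) (u v w : κ →₀ ℕ) :
    exchange ρ d u (v + w) = exchange ρ d u v * exchange ρ d u w := by
  simp only [exchange, ← Finset.prod_mul_distrib, Finsupp.add_apply, mul_add, pow_add]

@[simp] theorem exchange_zero_left (ρ : CommutationFactor G 𝕂) (d : κ → G) (v : κ →₀ ℕ) :
    exchange ρ d 0 v = 1 := by simp [exchange]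

@[simp] theorem exchange_zero_right (ρ : CommutationFactor G 𝕂) (d : κ → G) (u : κ →₀ ℕ) :
    exchange ρ d u 0 = 1 := by simp [exchange]

/-- The formal power series `∑ f_w x ^ w` over the commutative algebra `R` (whose elements have
degree `0`) in indeterminates `x b`, `b : κ`, of degrees `d b`, with
`x b * x c = ρ (d b) (d c) • x c * x b`. -/
@[ext]
structure RhoSeries (ρ : CommutationFactor G 𝕂) (d : κ → G) (R : Type*) [CommRing R] where
  coeff : (κ →₀ ℕ) → R
  coeff_eq_zero : ∀ w, ¬ Admissible ρ d w → coeff w = 0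

namespace RhoSeries

variable {ρ : CommutationFactor G 𝕂} {d : κ → G} {R : Type*} [CommRing R] [Algebra 𝕂 R]

open Classical in
/-- The series with the coefficients `F w` at the admissible exponents. -/
def ofCoeff (F : (κ →₀ ℕ) → R) : RhoSeries ρ d R where
  coeff w := if Admissible ρ d w then F w else 0
  coeff_eq_zero _ h := if_neg h

instance : Zero (RhoSeries ρ d R) := ⟨⟨fun _ => 0, fun _ _ => rfl⟩⟩
instance : Add (RhoSeries ρ d R) :=
  ⟨fun f g => ⟨fun w => f.coeff w + g.coeff w, fun w h => by
    simp [f.coeff_eq_zero w h, g.coeff_eq_zero w h]⟩⟩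
instance : Neg (RhoSeries ρ d R) :=
  ⟨fun f => ⟨fun w => - f.coeff w, fun w h => by simp [f.coeff_eq_zero w h]⟩⟩
instance : Sub (RhoSeries ρ d R) :=
  ⟨fun f g => ⟨fun w => f.coeff w - g.coeff w, fun w h => by
    simp [f.coeff_eq_zero w h, g.coeff_eq_zero w h]⟩⟩
instance {S : Type*} [SMulZeroClass S R] : SMul S (RhoSeries ρ d R) :=
  ⟨fun a f => ⟨fun w => a • f.coeff w, fun w h => by simp [f.coeff_eq_zero w h]⟩⟩
instance : One (RhoSeries ρ d R) := ⟨ofCoeff (Pi.single 0 1)⟩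

open Classical in
instance : Mul (RhoSeries ρ d R) :=
  ⟨fun f g => ofCoeff fun w =>
    ∑ p ∈ Finset.HasAntidiagonal.antidiagonal w, exchange ρ d p.1 p.2 • (f.coeff p.1 * g.coeff p.2)⟩

open Classical in
theorem coeff_mul (f g : RhoSeries ρ d R) (w : κ →₀ ℕ) :
    (f * g).coeff w = if Admissible ρ d w then
      ∑ p ∈ Finset.HasAntidiagonal.antidiagonal w, exchange ρ d p.1 p.2 • (f.coeff p.1 * g.coeff p.2) else 0 := rfl

open Classical in
theorem coeff_one (w : κ →₀ ℕ) : (1 : RhoSeries ρ d R).coeff w = if w = 0 then 1 else 0 := by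
  show (if Admissible ρ d w then (Pi.single 0 1 : (κ →₀ ℕ) → R) w else 0) = _
  by_cases h : w = 0
  · subst h; simp [admissible_zero]
  · simp [h]

theorem coeff_injective : Function.Injective (coeff : RhoSeries ρ d R → (κ →₀ ℕ) → R) :=
  fun _ _ h => RhoSeries.ext h

instance : AddCommGroup (RhoSeries ρ d R) :=
  coeff_injective.addCommGroup coeff rfl (fun _ _ => rfl) (fun _ => rfl) (fun _ _ => rfl)
    (fun _ _ => rfl) (fun _ _ => rfl)

/-- Coefficients, as an additive map. -/
def coeffHom : RhoSeries ρ d R →+ ((κ →₀ ℕ) → R) where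
  toFun := coeff
  map_zero' := rfl
  map_add' _ _ := rfl

instance : Module 𝕂 (RhoSeries ρ d R) :=
  coeff_injective.module 𝕂 coeffHom (fun _ _ => rfl)

theorem coeff_add (f g : RhoSeries ρ d R) (w) : (f + g).coeff w = f.coeff w + g.coeff w := rfl

theorem coeff_smul (a : 𝕂) (f : RhoSeries ρ d R) (w) : (a • f).coeff w = a • f.coeff w := rfl

theorem one_mul' (f : RhoSeries ρ d R) : 1 * f = f := by
  ext w
  rw [coeff_mul]
  split_ifs with h
  · rw [Finset.sum_eq_single (0, w)]
    · simp [coeff_one]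
    · rintro ⟨u, v⟩ hp hne
      have hu : u ≠ 0 := by
        rintro rfl
        simp only [Finset.HasAntidiagonal.mem_antidiagonal, zero_add] at hp
        exact hne (by rw [hp])
      simp [coeff_one, hu]
    · simp
  · exact (f.coeff_eq_zero w h).symm

theorem mul_one' (f : RhoSeries ρ d R) : f * 1 = f := by
  ext w
  rw [coeff_mul]
  split_ifs with h
  · rw [Finset.sum_eq_single (w, 0)]
    · simp [coeff_one]
    · rintro ⟨u, v⟩ hp hne
      have hv : v ≠ 0 := by
        rintro rfl
        simp only [Finset.HasAntidiagonal.mem_antidiagonal, add_zero] at hp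
        exact hne (by rw [hp])
      simp [coeff_one, hv]
    · simp
  · exact (f.coeff_eq_zero w h).symm

theorem mul_assoc' (f g h : RhoSeries ρ d R) : f * g * h = f * (g * h) := by
  ext w
  rw [coeff_mul, coeff_mul]
  split_ifs with hw
  swap
  · rfl
  have e1 : ∀ p ∈ Finset.HasAntidiagonal.antidiagonal w,
      exchange ρ d p.1 p.2 • ((f * g).coeff p.1 * h.coeff p.2) =
      ∑ q ∈ Finset.HasAntidiagonal.antidiagonal p.1, (exchange ρ d q.1 q.2 * exchange ρ d q.1 p.2 *
        exchange ρ d q.2 p.2) • (f.coeff q.1 * g.coeff q.2 * h.coeff p.2) := by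
    intro p hp
    rw [Finset.HasAntidiagonal.mem_antidiagonal] at hp
    rw [coeff_mul, if_pos (hw.mono (hp ▸ le_self_add)), Finset.sum_mul, Finset.smul_sum]
    refine Finset.sum_congr rfl fun q hq => ?_
    rw [Finset.HasAntidiagonal.mem_antidiagonal] at hq
    rw [← hq, exchange_add_left, smul_mul_assoc, smul_smul]
    congr 1; ring
  have e2 : ∀ p ∈ Finset.HasAntidiagonal.antidiagonal w,
      exchange ρ d p.1 p.2 • (f.coeff p.1 * (g * h).coeff p.2) =
      ∑ q ∈ Finset.HasAntidiagonal.antidiagonal p.2, (exchange ρ d p.1 q.1 * exchange ρ d p.1 q.2 *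
        exchange ρ d q.1 q.2) • (f.coeff p.1 * g.coeff q.1 * h.coeff q.2) := by
    intro p hp
    rw [Finset.HasAntidiagonal.mem_antidiagonal] at hp
    rw [coeff_mul, if_pos (hw.mono (hp ▸ le_add_self)), Finset.mul_sum, Finset.smul_sum]
    refine Finset.sum_congr rfl fun q hq => ?_
    rw [Finset.HasAntidiagonal.mem_antidiagonal] at hq
    rw [← hq, exchange_add_right, mul_smul_comm, smul_smul, mul_assoc (f.coeff _)]
  rw [Finset.sum_congr rfl e1, Finset.sum_congr rfl e2, Finset.sum_sigma', Finset.sum_sigma']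
  apply Finset.sum_nbij' (fun ⟨⟨_i, j⟩, ⟨k, l⟩⟩ ↦ ⟨(k, l + j), (l, j)⟩)
    (fun ⟨⟨i, _j⟩, ⟨k, l⟩⟩ ↦ ⟨(i + k, l), (i, k)⟩)
  · rintro ⟨⟨i, j⟩, ⟨k, l⟩⟩ h
    simp only [Finset.mem_sigma, Finset.HasAntidiagonal.mem_antidiagonal] at h ⊢
    rw [← h.1, ← h.2, add_assoc]; exact ⟨rfl, trivial⟩
  · rintro ⟨⟨i, j⟩, ⟨k, l⟩⟩ h
    simp only [Finset.mem_sigma, Finset.HasAntidiagonal.mem_antidiagonal] at h ⊢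
    rw [← h.1, ← h.2, add_assoc]; exact ⟨rfl, trivial⟩
  · rintro ⟨⟨i, j⟩, ⟨k, l⟩⟩ h
    simp only [Finset.mem_sigma, Finset.HasAntidiagonal.mem_antidiagonal] at h
    obtain ⟨h1, rfl⟩ := h
    rfl
  · rintro ⟨⟨i, j⟩, ⟨k, l⟩⟩ h
    simp only [Finset.mem_sigma, Finset.HasAntidiagonal.mem_antidiagonal] at h
    obtain ⟨h1, rfl⟩ := h
    rfl
  · rintro ⟨⟨i, j⟩, ⟨k, l⟩⟩ h
    rfl

instance : Ring (RhoSeries ρ d R) :=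
  { (inferInstance : AddCommGroup (RhoSeries ρ d R)) with
    mul := (· * ·)
    one := 1
    one_mul := one_mul'
    mul_one := mul_one'
    mul_assoc := mul_assoc'
    zero_mul := fun f => by
      ext w
      have h : ∀ u, (0 : RhoSeries ρ d R).coeff u = 0 := fun _ => rfl
      simp [coeff_mul, h]
    mul_zero := fun f => by
      ext w
      have h : ∀ u, (0 : RhoSeries ρ d R).coeff u = 0 := fun _ => rfl
      simp [coeff_mul, h]
    left_distrib := fun f g h => by
      ext w
      simp only [coeff_mul, coeff_add, mul_add, smul_add, Finset.sum_add_distrib]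
      split_ifs <;> simp
    right_distrib := fun f g h => by
      ext w
      simp only [coeff_mul, coeff_add, add_mul, smul_add, Finset.sum_add_distrib]
      split_ifs <;> simp }

instance : Algebra 𝕂 (RhoSeries ρ d R) :=
  Algebra.ofModule
    (fun a f g => by
      ext w
      simp only [coeff_mul, coeff_smul, smul_mul_assoc]
      split_ifs
      · rw [Finset.smul_sum]; exact Finset.sum_congr rfl fun p _ => smul_comm _ _ _
      · simp)
    (fun a f g => by
      ext w
      simp only [coeff_mul, coeff_smul, mul_smul_comm]
      split_ifs
      · rw [Finset.smul_sum]; exact Finset.sum_congr rfl fun p _ => smul_comm _ _ _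
      · simp)

/-- An element of `R`, as a series. -/
def C (a : R) : RhoSeries ρ d R := ofCoeff (Pi.single 0 a)

/-- The indeterminate `x b`. -/
def X (b : κ) : RhoSeries ρ d R := ofCoeff (Pi.single (Finsupp.single b 1) 1)

/-- The `ρ`-derivation `∂/∂x_b` of degree `- d b`: on the monomials `x ^ (w + b)` it passes the
indeterminates `x c`, `c < b`, and then acts on `x b ^ (w b + 1)`. -/
def formalPartial (b : κ) (f : RhoSeries ρ d R) : RhoSeries ρ d R :=
  ofCoeff fun w => (((w b + 1 : ℕ) : 𝕂) *
    ∏ c ∈ Finset.univ.filter (· < b), ρ (- d b) (d c) ^ w c) • f.coeff (w + Finsupp.single b 1)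

end RhoSeries

end Series

/-! ### Graded determinant and Berezinian -/

section Berezinian

variable {G 𝕂 ι A : Type*} [AddCommGroup G] [Field 𝕂] [Fintype ι] [LinearOrder ι]
  [Ring A] [Algebra 𝕂 A]

/-- The product of the `f k` in increasing order of the indices `k`. -/
def orderedProd (f : ι → A) : A := ((Finset.univ.sort).map f).prod

/-- With indeterminates `t k` of degree `I k` satisfying `t k * t l = ε ρ (I k) (I l) t l * t k`, and
a matrix `F` of degree `0`, i.e. with entries `F k l` of degree `I k - I l`, this is the element
`det F` such that
`det F * (t 1 ⋯ t n) = ∑ σ, (F 1 (σ 1) * t (σ 1)) * ⋯ * (F n (σ n) * t (σ n))`.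
The first factor comes from moving `t (σ j)` past `F k (σ k)` for `j < k`, the second one from
sorting `t (σ 1) ⋯ t (σ n)`. -/
def rhoDetAux (ε : 𝕂) (ρ : CommutationFactor G 𝕂) (I : ι → G) (F : Matrix ι ι A) : A :=
  ∑ σ : Equiv.Perm ι,
    (∏ j, ∏ k ∈ Finset.univ.filter (j < ·),
      ρ (I (σ j)) (I k - I (σ k)) * (if σ k < σ j then ε * ρ (I (σ j)) (I (σ k)) else 1)) •
    orderedProd fun k => F k (σ k)

/-- The graded determinant for even `I`: the `t k` are `ρ`-antisymmetric. -/
def rhoDetEven (ρ : CommutationFactor G 𝕂) (I : ι → G) (F : Matrix ι ι A) : A :=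
  rhoDetAux (-1) ρ I F

/-- The graded determinant for odd `I`: the `t k` are `ρ`-symmetric. -/
def rhoDetOdd (ρ : CommutationFactor G 𝕂) (I : ι → G) (F : Matrix ι ι A) : A :=
  rhoDetAux 1 ρ I F

open Classical in
/-- The graded Berezinian of a matrix `F` of degree `0` whose rows and columns have the degrees
`I`; its blocks are cut out by the parity of `I`. -/
def rhoBer (ρ : CommutationFactor G 𝕂) (I : ι → G) (F : Matrix ι ι A) : A :=
  let ev : ι → Prop := fun a => ρ.IsEven (I a)
  let od : ι → Prop := fun a => ρ.IsOdd (I a)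
  let F₀₀ := F.toBlock ev ev
  let F₀₁ := F.toBlock ev od
  let F₁₀ := F.toBlock od ev
  let F₁₁ := F.toBlock od od
  if IsUnit F₀₀ ∧ IsUnit F₁₁ then
    rhoDetEven ρ (fun a : {a // ev a} => I a) (F₀₀ - F₀₁ * Ring.inverse F₁₁ * F₁₀) *
      Ring.inverse (rhoDetOdd ρ (fun a : {a // od a} => I a) F₁₁)
  else 0

end Berezinian

/-! ### Local functions on a domain of a manifold -/

section Local

variable {𝕜 𝕂 : Type*} [RCLike 𝕜] [RCLike 𝕂] [NormedAlgebra 𝕜 𝕂]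
  {G : Type*} [AddCommGroup G] {n : ℕ} {M : Type*} [TopologicalSpace M]
  {κ : Type*} [Fintype κ] [LinearOrder κ]

/-- Formal power series whose coefficients are functions `V → 𝕂`. -/
abbrev LocalSeries (ρ : CommutationFactor G 𝕂) (d : κ → G) (V : Opens M) : Type _ :=
  RhoSeries ρ d (V → 𝕂)

/-- Restriction of the coefficients to a smaller open set. -/
def LocalSeries.restrict {ρ : CommutationFactor G 𝕂} {d : κ → G} {V U : Opens M} (h : V ≤ U)
    (f : LocalSeries ρ d U) : LocalSeries ρ d V where
  coeff w := fun p => f.coeff w (Set.inclusion h p)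
  coeff_eq_zero w hw := by rw [f.coeff_eq_zero w hw]; rfl

variable (𝕜) in
/-- `f` is a homogeneous element of degree `i` of `𝒪(V)⟦x⟧`: its coefficients are `𝕂`-valued
functions of class `C^r` over `𝕜`, and only monomials of degree `i` occur. -/
def LocalSeries.IsFunction (n : ℕ) [ChartedSpace (EuclideanSpace 𝕜 (Fin n)) M] (r : WithTop ℕ∞)
    {ρ : CommutationFactor G 𝕂} {d : κ → G} {V : Opens M} (i : G) (f : LocalSeries ρ d V) : Prop :=
  (∀ w, ContMDiff 𝓘(𝕜, EuclideanSpace 𝕜 (Fin n)) 𝓘(𝕜, 𝕂) r (f.coeff w)) ∧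
    ∀ w, f.coeff w ≠ 0 → monomialDegree d w = i

/-- Degrees of the coordinates `x^1, …, x^n` (degree `0`) and of the graded ones. -/
def coordDegree (n : ℕ) (d : κ → G) : Fin n ⊕ₗ κ → G := fun a => Sum.elim (fun _ => 0) d (ofLex a)

/-- The coordinate functions determined by a chart `φ` and the graded indeterminates. -/
def coordSeries (ρ : CommutationFactor G 𝕂) (d : κ → G)
    (φ : OpenPartialHomeomorph M (EuclideanSpace 𝕜 (Fin n))) (V : Opens M) :
    Fin n ⊕ₗ κ → LocalSeries ρ d V := fun a =>
  Sum.elim (fun k => RhoSeries.C fun p : V => algebraMap 𝕜 𝕂 (φ p k)) RhoSeries.X (ofLex a)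

/-- Partial derivative of a function on `V` along the `k`-th coordinate of the chart `φ`. -/
def basePartial (φ : OpenPartialHomeomorph M (EuclideanSpace 𝕜 (Fin n))) {V : Opens M} (k : Fin n)
    (f : V → 𝕂) : V → 𝕂 := fun p =>
  fderiv 𝕜 (fun e => Function.extend Subtype.val f 0 (φ.symm e)) (φ p) (EuclideanSpace.single k 1)

/-- The `ρ`-derivations `∂/∂x^a` with respect to the coordinates given by a chart `φ` and the
graded indeterminates. -/
def coordPartial {ρ : CommutationFactor G 𝕂} {d : κ → G}
    (φ : OpenPartialHomeomorph M (EuclideanSpace 𝕜 (Fin n))) {V : Opens M} (a : Fin n ⊕ₗ κ)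
    (f : LocalSeries ρ d V) : LocalSeries ρ d V :=
  Sum.elim (fun k => RhoSeries.ofCoeff fun w => basePartial φ k (f.coeff w))
    (fun b => f.formalPartial b) (ofLex a)

end Local

/-! ### Coordinate neighbourhoods and their transition rules -/

/-- A family of coordinate neighbourhoods over `M`. A chart `c` consists of an open set, a chart
of `M` on it, and graded coordinates of degrees `d`; functions in these coordinates over `V` are
elements of `LocalSeries ρ d V`. On open sets `V` in the overlap, `trans c c' V` rewrites a function
given in the coordinates of `c'` as a function in the coordinates of `c`. This is only the raw data
of charts and transition rules; below it is constructed from an arbitrary `ρ`-manifold (all its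
coordinate neighbourhoods) and for the vector bundles over it. -/
structure CoordAtlas (𝕜 : Type*) {𝕂 G κ : Type*} [RCLike 𝕜] [RCLike 𝕂] [NormedAlgebra 𝕜 𝕂]
    [AddCommGroup G] [Fintype κ] [LinearOrder κ] (n : ℕ) (ρ : CommutationFactor G 𝕂) (d : κ → G)
    (M : Type*) [TopologicalSpace M] where
  Chart : Type*
  dom : Chart → Opens M
  base : Chart → OpenPartialHomeomorph M (EuclideanSpace 𝕜 (Fin n))
  trans : ∀ (c c' : Chart) (V : Opens M), V ≤ dom c → V ≤ dom c' →
    LocalSeries ρ d V → LocalSeries ρ d V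

namespace CoordAtlas

variable {𝕜 𝕂 G κ : Type*} [RCLike 𝕜] [RCLike 𝕂] [NormedAlgebra 𝕜 𝕂]
  [AddCommGroup G] [Fintype κ] [LinearOrder κ] {n : ℕ} {ρ : CommutationFactor G 𝕂} {d : κ → G}
  {M : Type*} [TopologicalSpace M] (A : CoordAtlas 𝕜 n ρ d M)

/-- `∂y^a/∂x^b` in the coordinates `x`, where `x` are the coordinates of `c` and `y` those
of `c'`. -/
def derivative (c c' : A.Chart) (V : Opens M) (hc : V ≤ A.dom c) (hc' : V ≤ A.dom c')
    (a b : Fin n ⊕ₗ κ) : LocalSeries ρ d V :=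
  coordPartial (A.base c) b (A.trans c c' V hc hc' (coordSeries ρ d (A.base c') V a))

/-- `∂x^b/∂y^a` in the coordinates `x`, where `x` are the coordinates of `c` and `y` those
of `c'`. -/
def inverseDerivative (c c' : A.Chart) (V : Opens M) (hc : V ≤ A.dom c) (hc' : V ≤ A.dom c')
    (a b : Fin n ⊕ₗ κ) : LocalSeries ρ d V :=
  A.trans c c' V hc hc' (A.derivative c' c V hc' hc b a)

/-- The Jacobian matrix `J_xy`. The derivations `∂/∂x^b` act from the left; the sign
`ρ(|x^b|, |y^a| - |x^b|)` moves `dx^b` to the right of `∂y^a/∂x^b`, so that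
`dy^a = ∑ b, dx^b * ∂y^a/∂x^b = ∑ b, J a b * dx^b` for symbols `dx^b` of degree `|x^b|`. -/
def jacobian (c c' : A.Chart) (V : Opens M) (hc : V ≤ A.dom c) (hc' : V ≤ A.dom c') :
    Matrix (Fin n ⊕ₗ κ) (Fin n ⊕ₗ κ) (LocalSeries ρ d V) :=
  Matrix.of fun a b => ρ (coordDegree n d b) (coordDegree n d a - coordDegree n d b) •
    A.derivative c c' V hc hc' a b

/-- The Berezinian of the Jacobian matrix `J_xy`. -/
def berJacobian (c c' : A.Chart) (V : Opens M) (hc : V ≤ A.dom c) (hc' : V ≤ A.dom c') :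
    LocalSeries ρ d V :=
  rhoBer ρ (coordDegree n d) (A.jacobian c c' V hc hc')

/-- `D(x) s_x` over all coordinate neighbourhoods is a section of the Berezinian bundle: since
`D(y) = D(x) Ber J_xy`, the condition is `s_x = Ber J_xy * s_y`. -/
def IsBerezinianSection (s : ∀ c : A.Chart, LocalSeries ρ d (A.dom c)) : Prop :=
  ∀ (c c' : A.Chart) (V : Opens M) (hc : V ≤ A.dom c) (hc' : V ≤ A.dom c'),
    (s c).restrict hc =
      A.berJacobian c c' V hc hc' * A.trans c c' V hc hc' ((s c').restrict hc')

/-- A Berezin volume form `D(x) s_x`: a section of the Berezinian bundle whose local densities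
`s_x` are functions of degree `0` that are invertible. -/
def IsVolumeForm [ChartedSpace (EuclideanSpace 𝕜 (Fin n)) M] (r : WithTop ℕ∞)
    (s : ∀ c : A.Chart, LocalSeries ρ d (A.dom c)) : Prop :=
  A.IsBerezinianSection s ∧ ∀ c, (s c).IsFunction 𝕜 n r 0 ∧
    ∃ t : LocalSeries ρ d (A.dom c), t.IsFunction 𝕜 n r 0 ∧ s c * t = 1 ∧ t * s c = 1

end CoordAtlas

/-! ### Manifolds modelled on graded-commutative function algebras -/

/-- A sheaf on `M` of `G`-graded `ρ`-commutative algebras. The algebras `obj U` are the direct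
sums of their homogeneous parts; the sheaf axiom concerns the homogeneous parts. -/
structure RhoRingedSpace {𝕂 G : Type*} [Field 𝕂] [AddCommGroup G] (ρ : CommutationFactor G 𝕂)
    (M : Type*) [TopologicalSpace M] where
  obj : Opens M → Type*
  [ring : ∀ U, Ring (obj U)]
  [algebra : ∀ U, Algebra 𝕂 (obj U)]
  gr : ∀ U, G → Submodule 𝕂 (obj U)
  isInternal : ∀ U, letI := Classical.decEq G; DirectSum.IsInternal (gr U)
  one_mem : ∀ U, (1 : obj U) ∈ gr U 0
  mul_mem : ∀ U i j (f g : obj U), f ∈ gr U i → g ∈ gr U j → f * g ∈ gr U (i + j)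
  rho_comm : ∀ U i j (f g : obj U), f ∈ gr U i → g ∈ gr U j → f * g = ρ i j • (g * f)
  res : ∀ {V U : Opens M}, V ≤ U → obj U →ₐ[𝕂] obj V
  res_mem : ∀ {V U : Opens M} (h : V ≤ U) i (f : obj U), f ∈ gr U i → res h f ∈ gr V i
  res_self : ∀ (U : Opens M) (f : obj U), res le_rfl f = f
  res_res : ∀ {W V U : Opens M} (h : W ≤ V) (h' : V ≤ U) (f : obj U),
    res h (res h' f) = res (h.trans h') f
  existsUnique_glue : ∀ (S : Set (Opens M)) (i : G) (f : ∀ U : S, obj U.1),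
    (∀ U, f U ∈ gr U.1 i) →
    (∀ U V : S, res (inf_le_left : U.1 ⊓ V.1 ≤ U.1) (f U) = res inf_le_right (f V)) →
    ∃! F : obj (sSup S), F ∈ gr (sSup S) i ∧ ∀ U : S, res (le_sSup U.2) F = f U

attribute [instance] RhoRingedSpace.ring RhoRingedSpace.algebra

/-- Coordinates on the open set `U` of `M` for the structure sheaf `S`: a chart of `M` with
domain `U`, and isomorphisms of graded algebras, compatible with restrictions, from `S.obj V` onto
`𝒪(V)⟦x⟧`, the direct sum of the spaces of homogeneous formal power series, for `V ≤ U`. -/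
structure RhoRingedSpace.Coordinates {𝕜 𝕂 G κ : Type*} [RCLike 𝕜] [RCLike 𝕂] [NormedAlgebra 𝕜 𝕂]
    [AddCommGroup G] [Fintype κ] [LinearOrder κ] {n : ℕ} {ρ : CommutationFactor G 𝕂}
    {M : Type*} [TopologicalSpace M] [ChartedSpace (EuclideanSpace 𝕜 (Fin n)) M]
    (S : RhoRingedSpace ρ M) (r : WithTop ℕ∞) (d : κ → G) (U : Opens M) where
  chart : OpenPartialHomeomorph M (EuclideanSpace 𝕜 (Fin n))
  chart_mem : chart ∈ IsManifold.maximalAtlas 𝓘(𝕜, EuclideanSpace 𝕜 (Fin n)) r M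
  source_eq : chart.source = U
  expand : ∀ V : Opens M, V ≤ U → S.obj V →ₐ[𝕂] LocalSeries ρ d V
  expand_injective : ∀ V h, Function.Injective (expand V h)
  image_gr : ∀ V h i, expand V h '' (S.gr V i) = {s | s.IsFunction 𝕜 n r i}
  expand_res : ∀ {W V : Opens M} (hW : W ≤ V) (hV : V ≤ U) (f : S.obj V),
    expand W (hW.trans hV) (S.res hW f) = (expand V hV f).restrict hW

/-- A `ρ`-manifold with underlying manifold `M` and graded coordinates of degrees `d`. -/
structure RhoManifold (𝕜 : Type*) {𝕂 G κ : Type*} [RCLike 𝕜] [RCLike 𝕂] [NormedAlgebra 𝕜 𝕂]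
    [AddCommGroup G] [Fintype κ] [LinearOrder κ] (r : WithTop ℕ∞) (n : ℕ)
    (ρ : CommutationFactor G 𝕂) (d : κ → G) (M : Type*) [TopologicalSpace M]
    [ChartedSpace (EuclideanSpace 𝕜 (Fin n)) M] extends RhoRingedSpace ρ M where
  exists_coordinates : ∀ p : M, ∃ U : Opens M, p ∈ U ∧
    Nonempty (toRhoRingedSpace.Coordinates (𝕜 := 𝕜) (n := n) r d U)

namespace RhoManifold

variable {𝕜 𝕂 G κ : Type*} [RCLike 𝕜] [RCLike 𝕂] [NormedAlgebra 𝕜 𝕂]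
    [AddCommGroup G] [Fintype κ] [LinearOrder κ] {r : WithTop ℕ∞} {n : ℕ}
    {ρ : CommutationFactor G 𝕂} {d : κ → G} {M : Type*} [TopologicalSpace M]
    [ChartedSpace (EuclideanSpace 𝕜 (Fin n)) M]

/-- All coordinate neighbourhoods of a `ρ`-manifold. -/
def atlas (X : RhoManifold 𝕜 r n ρ d M) : CoordAtlas 𝕜 n ρ d M where
  Chart := Σ U : Opens M, X.toRhoRingedSpace.Coordinates (𝕜 := 𝕜) (n := n) r d U
  dom c := c.1
  base c := c.2.chart
  trans c c' V hc hc' s := c.2.expand V hc (Function.invFun (c'.2.expand V hc') s)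

end RhoManifold

/-! ### Vector bundles -/

namespace CoordAtlas

variable {𝕜 𝕂 G κ : Type*} [RCLike 𝕜] [RCLike 𝕂] [NormedAlgebra 𝕜 𝕂]
  [AddCommGroup G] [Fintype κ] [LinearOrder κ] {n : ℕ} {ρ : CommutationFactor G 𝕂} {d : κ → G}
  {M : Type*} [TopologicalSpace M]
  {G' ι : Type*} [AddCommGroup G'] [Fintype ι] [LinearOrder ι]

/-- Degrees of the graded coordinates on the total space of a vector bundle: those of the base,
followed by those of the linear coordinates. -/
def bundleDegree (d' : κ → G') (e : ι → G') : κ ⊕ₗ ι → G' := fun a => Sum.elim d' e (ofLex a)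

/-- The exponents of the graded coordinates of the base. -/
def baseExponent (w : (κ ⊕ₗ ι) →₀ ℕ) : κ →₀ ℕ :=
  Finsupp.equivFunOnFinite.symm fun b => w (toLex (Sum.inl b))

/-- The exponents of the linear coordinates. -/
def fibreExponent (w : (κ ⊕ₗ ι) →₀ ℕ) : ι →₀ ℕ :=
  Finsupp.equivFunOnFinite.symm fun a => w (toLex (Sum.inr a))

/-- The exponent with prescribed parts. -/
def joinExponent (u : κ →₀ ℕ) (v : ι →₀ ℕ) : (κ ⊕ₗ ι) →₀ ℕ :=
  Finsupp.equivFunOnFinite.symm fun a => Sum.elim u v (ofLex a)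

open Classical in
/-- The pullback of a function on the base to the total space. -/
def pullback {σ : CommutationFactor G' 𝕂} {d' : κ → G'} {e : ι → G'} {V : Opens M}
    (f : LocalSeries ρ d V) : LocalSeries σ (bundleDegree d' e) V :=
  RhoSeries.ofCoeff fun w => if fibreExponent w = 0 then f.coeff (baseExponent w) else 0

/-- The coefficient function `f_v` in the expansion `f = ∑ v, f_v ξ ^ v` of a function on the total
space with respect to the linear coordinates `ξ`. -/
def fibreCoeff {σ : CommutationFactor G' 𝕂} {d' : κ → G'} {e : ι → G'} {V : Opens M}
    (f : LocalSeries σ (bundleDegree d' e) V) (v : ι →₀ ℕ) : LocalSeries ρ d V :=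
  RhoSeries.ofCoeff fun u => f.coeff (joinExponent u v)

/-- The linear coordinate `ξ^a`. -/
def linearCoord {σ : CommutationFactor G' 𝕂} {d' : κ → G'} {e : ι → G'} {V : Opens M} (a : ι) :
    LocalSeries σ (bundleDegree d' e) V :=
  RhoSeries.X (toLex (Sum.inr a))

/-- The total space of a vector bundle, with coordinates `(x, ξ)` over the coordinates `x` of the
base. The degrees of the base coordinates and of the linear coordinates are `d'` and `e`, with
respect to the commutation factor `σ`. For charts `c` and `c'` with coordinates `(x, ξ)` and `(y, η)`,
`fibre c c' V _ _ a` is `η^a` in the coordinates `(x, ξ)`, homogeneous linear in `ξ`. A function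
`∑ v, f_v(y) η ^ v` is rewritten by rewriting the `f_v` and by substituting for `η`; only the finitely
many `v` of total degree `k` contribute to the part of total degree `k` in `ξ`. -/
def totalSpace (A : CoordAtlas 𝕜 n ρ d M) (σ : CommutationFactor G' 𝕂) (d' : κ → G') (e : ι → G')
    (fibre : ∀ (c c' : A.Chart) (V : Opens M), V ≤ A.dom c → V ≤ A.dom c' →
      ι → LocalSeries σ (bundleDegree d' e) V) :
    CoordAtlas 𝕜 n σ (bundleDegree d' e) M where
  Chart := A.Chart
  dom := A.dom
  base := A.base
  trans c c' V hc hc' f := RhoSeries.ofCoeff fun w =>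
    ∑ v ∈ Finset.finsuppAntidiag Finset.univ (∑ a, fibreExponent w a),
      RhoSeries.coeff (pullback (A.trans c c' V hc hc' (fibreCoeff f v)) *
        orderedProd fun a => fibre c c' V hc hc' a ^ v a) w

variable (A : CoordAtlas 𝕜 n ρ d M)

/-- The tangent bundle `TM`: linear coordinates `(∂_x^a)^*` of degree `|x^a|`, with
`(∂_y^a)^* = ∑ b, (∂_x^b)^* ∂y^a/∂x^b`. -/
def tangentBundle : CoordAtlas 𝕜 n ρ (bundleDegree d (coordDegree n d)) M :=
  A.totalSpace ρ d (coordDegree n d) fun c c' V hc hc' a =>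
    ∑ b, linearCoord b * pullback (A.derivative c c' V hc hc' a b)

/-- The shifted tangent bundle `ΠTM`: linear coordinates `dx^a` of degree `(1, |x^a|)`, with
`dy^a = ∑ b, dx^b ∂y^a/∂x^b`. -/
def shiftedTangentBundle : CoordAtlas 𝕜 n ρ.prime
    (bundleDegree (fun b => ((0 : ℤ), d b)) fun a => ((1 : ℤ), coordDegree n d a)) M :=
  A.totalSpace ρ.prime _ _ fun c c' V hc hc' a =>
    ∑ b, linearCoord b * pullback (A.derivative c c' V hc hc' a b)

/-- The degree-`i` shift `[-i]T^*M` of the cotangent bundle: linear coordinates `x^*_a` of degree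
`- |x^a| - i`, with `y^*_a = ∑ b, ∂x^b/∂y^a x^*_b`. -/
def degreeShiftedCotangentBundle (i : G) :
    CoordAtlas 𝕜 n ρ (bundleDegree d fun a => - coordDegree n d a - i) M :=
  A.totalSpace ρ d _ fun c c' V hc hc' a =>
    ∑ b, pullback (A.inverseDerivative c c' V hc hc' a b) * linearCoord b

/-- The cotangent bundle `T^*M`: linear coordinates `p_a` of degree `- |x^a|`, with
`q_a = ∑ b, ∂x^b/∂y^a p_b`. -/
def cotangentBundle : CoordAtlas 𝕜 n ρ (bundleDegree d fun a => - coordDegree n d a) M :=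
  A.totalSpace ρ d _ fun c c' V hc hc' a =>
    ∑ b, pullback (A.inverseDerivative c c' V hc hc' a b) * linearCoord b

/-- The shifted cotangent bundle `ΠT^*M`: linear coordinates `x^*_a` of degree `(1, - |x^a|)`, with
`y^*_a = ∑ b, ∂x^b/∂y^a x^*_b`. -/
def shiftedCotangentBundle : CoordAtlas 𝕜 n ρ.prime
    (bundleDegree (fun b => ((0 : ℤ), d b)) fun a => ((1 : ℤ), - coordDegree n d a)) M :=
  A.totalSpace ρ.prime _ _ fun c c' V hc hc' a =>
    ∑ b, pullback (A.inverseDerivative c c' V hc hc' a b) * linearCoord b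

end CoordAtlas

end

/-! ### Hadamard's lemma -/

section Hadamard

variable {𝕜 : Type*} [RCLike 𝕜] {E : Type*} [NormedAddCommGroup E] [NormedSpace 𝕜 E]

/-! On the total space of a vector bundle the new base coordinates `y` do not involve the linear
coordinates `ξ`, so the Jacobian matrix of `(x, ξ) → (y, η)` is block triangular. One diagonal block
is `J_xy`, the other is the matrix of the `η` with respect to the `ξ`, and the Berezinian is the
product of the two (`rhoBer_blockTriangular`, `totalSpace_berJacobian`). For tangent bundles the
fibre block is `J_xy` again, with all degrees shifted by `0` or `(1, 0)`. For cotangent bundles it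
is the matrix of the `∂x^b/∂y^a` with degrees `-|x^a|`, again shifted. An even shift preserves the
Berezinian; an odd shift exchanges the even and the odd block and inverts it
(`rhoBer_shift_of_isEven`, `rhoBer_shift_of_isOdd_mul`). Graded transposition and inversion
(`rhoBer_gradedTranspose`, `rhoBer_mul_eq_one`) show that the unshifted cotangent block has
Berezinian `(Ber J_xy)⁻¹`. Hence each product is `1` or `(Ber J_xy)^2`, and the densities `1` and
`s(x)^2` transform accordingly.

The algebra rests on removing the commutation factor. Adjoin invertible symbols of all degrees that
obey `ρ` with its odd signs removed, realised as operators. Conjugating the entry in place `k, l` by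
the symbols of degrees `I k` and `I l` gives an operator of total degree zero; even ones commute
with all, odd ones anticommute among themselves. Graded determinants thereby become ordinary
determinants over a commutative ring (`leftMul_rhoDetAux`), which yields their multiplicativity,
shifts and transposes. The one super ingredient is `det (1 - a b) * det (1 - b a) = 1` for odd `a`
and `b`: these products are nilpotent, the traces of their powers cancel, and in characteristic zero
this fixes the determinant. It says that the two Schur complement formulas for the Berezinian agree
(`blockBer_mul_flip`).

The analysis is the chain rule, which makes the matrices of the `∂y/∂x` and `∂x/∂y` mutually
inverse. Its failure is a derivation along the transition map that kills constants and coordinates.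
Hadamard's lemma writes a function near `p` as a constant plus a combination of `y^a - y^a(p)`, and
since transition maps preserve bodies, induction on the order of the monomials shows that the
failure vanishes (`coeff_chainError`). -/

theorem homothety_mem_ball {x₀ x : E} {ε t : ℝ} (hx : x ∈ Metric.ball x₀ ε)
    (ht : t ∈ Set.Icc (0 : ℝ) 1) : x₀ + (t : 𝕜) • (x - x₀) ∈ Metric.ball x₀ ε := by
  rw [Metric.mem_ball, dist_eq_norm] at *
  rw [add_sub_cancel_left, norm_smul, RCLike.norm_ofReal, abs_of_nonneg ht.1]
  exact (mul_le_of_le_one_left (norm_nonneg _) ht.2).trans_lt hx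

variable {H : Type*} [NormedAddCommGroup H] [NormedSpace 𝕜 H] [NormedSpace ℝ H]
  [IsScalarTower ℝ 𝕜 H] [CompleteSpace H]

/-- The mean of `F` along the segments from `x₀`, with weight `t ^ k`. -/
noncomputable def segmentMean (𝕜 : Type*) [RCLike 𝕜] {E : Type*} [NormedAddCommGroup E]
    [NormedSpace 𝕜 E] {H : Type*} [NormedAddCommGroup H] [NormedSpace 𝕜 H] [NormedSpace ℝ H]
    (x₀ : E) (k : ℕ) (F : E → H) (x : E) : H :=
  ∫ t in (0 : ℝ)..1, ((t : 𝕜) ^ k) • F (x₀ + (t : 𝕜) • (x - x₀))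

theorem continuousOn_segment {x₀ x : E} {ε : ℝ} {F : E → H}
    (hF : ContinuousOn F (Metric.ball x₀ ε)) (k : ℕ) (hx : x ∈ Metric.ball x₀ ε) :
    ContinuousOn (fun t : ℝ => ((t : 𝕜) ^ k) • F (x₀ + (t : 𝕜) • (x - x₀))) (Set.Icc 0 1) := by
  refine ContinuousOn.smul (by fun_prop) (hF.comp (by fun_prop) ?_)
  intro t ht
  exact homothety_mem_ball hx ht

theorem intervalIntegrable_segment {x₀ x : E} {ε : ℝ} {F : E → H}
    (hF : ContinuousOn F (Metric.ball x₀ ε)) (k : ℕ) (hx : x ∈ Metric.ball x₀ ε) :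
    IntervalIntegrable (fun t : ℝ => ((t : 𝕜) ^ k) • F (x₀ + (t : 𝕜) • (x - x₀)))
      MeasureTheory.volume 0 1 := by
  refine ContinuousOn.intervalIntegrable ?_
  rw [Set.uIcc_of_le zero_le_one]
  exact continuousOn_segment hF k hx

/-- Differentiation under the integral sign. The homothety towards `x₀` contributes one more factor
`t`, hence the weight `k + 1` on the right. -/
theorem hasFDerivAt_segmentMean [ProperSpace E] {x₀ x : E} {ε : ℝ} {F : E → H}
    (hF : DifferentiableOn 𝕜 F (Metric.ball x₀ ε))
    (hF' : ContinuousOn (fderiv 𝕜 F) (Metric.ball x₀ ε)) (k : ℕ) (hx : x ∈ Metric.ball x₀ ε) :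
    HasFDerivAt (segmentMean 𝕜 x₀ k F) (segmentMean 𝕜 x₀ (k + 1) (fderiv 𝕜 F) x) x := by
  have hdist : dist x x₀ < ε := hx
  obtain ⟨δ, hδ1, hδ2⟩ := exists_between hdist
  have hsub : Metric.closedBall x₀ δ ⊆ Metric.ball x₀ ε := Metric.closedBall_subset_ball hδ2
  -- On a compact ball of intermediate radius `δ` the derivative is bounded, and homotheties with `t
  -- ≤ 1` stay inside, so one constant dominates the integrand for all `t`.
  obtain ⟨K, hK⟩ := (isCompact_closedBall x₀ δ).exists_bound_of_continuousOn (hF'.mono hsub)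
  have hxs : Metric.ball x₀ δ ∈ 𝓝 x := Metric.isOpen_ball.mem_nhds hδ1
  have hIoc : ∀ t : ℝ, t ∈ Set.uIoc (0 : ℝ) 1 → t ∈ Set.Icc (0 : ℝ) 1 := fun t ht => by
    rw [Set.uIoc_of_le zero_le_one] at ht
    exact ⟨ht.1.le, ht.2⟩
  refine intervalIntegral.hasFDerivAt_integral_of_dominated_of_fderiv_le
    (bound := fun _ => K) hxs ?_ (intervalIntegrable_segment hF.continuousOn k hx)
    (F' := fun x (t : ℝ) => ((t : 𝕜) ^ (k + 1)) • fderiv 𝕜 F (x₀ + (t : 𝕜) • (x - x₀)))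
    ?_ ?_ ?_ ?_
  · filter_upwards [hxs] with y hy
    exact (intervalIntegrable_iff.1 (intervalIntegrable_segment hF.continuousOn k
      (hsub (Metric.ball_subset_closedBall hy)))).aestronglyMeasurable
  · exact (intervalIntegrable_iff.1
      (intervalIntegrable_segment hF' (k + 1) hx)).aestronglyMeasurable
  · refine Filter.Eventually.of_forall fun t ht y hy => ?_
    have ht' := hIoc t ht
    have h1 := hK _ (Metric.ball_subset_closedBall (homothety_mem_ball (𝕜 := 𝕜) hy ht'))
    rw [norm_smul, norm_pow, RCLike.norm_ofReal, abs_of_nonneg ht'.1]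
    exact (mul_le_of_le_one_left (norm_nonneg _) (pow_le_one₀ ht'.1 ht'.2)).trans h1
  · exact intervalIntegrable_const
  · refine Filter.Eventually.of_forall fun t ht y hy => ?_
    have h1 := homothety_mem_ball (𝕜 := 𝕜) (hsub (Metric.ball_subset_closedBall hy)) (hIoc t ht)
    have h2 := (hF.differentiableAt (Metric.isOpen_ball.mem_nhds h1)).hasFDerivAt
    have h3 : HasFDerivAt (fun y => x₀ + (t : 𝕜) • (y - x₀))
        ((t : 𝕜) • ContinuousLinearMap.id 𝕜 E) y :=
      (((hasFDerivAt_id y).sub_const x₀).const_smul (t : 𝕜)).const_add x₀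
    have h4 := (h2.comp y h3).const_smul ((t : 𝕜) ^ k)
    refine h4.congr_fderiv ?_
    ext v
    simp [pow_succ, mul_smul]

/-- The derivative of a mean is the mean of the derivative, with values in `E →L[𝕜] H` and a larger
weight. The induction therefore has to quantify over `H`, `F` and `k`, and the universe `max u v` is
chosen so that it contains `E →L[𝕜] H` along with `H`. -/
theorem contDiffOn_segmentMean.{u, v} {E : Type u} [NormedAddCommGroup E] [NormedSpace 𝕜 E]
    [ProperSpace E] {x₀ : E} {ε : ℝ} (n : ℕ) :
    ∀ {H : Type (max u v)} [NormedAddCommGroup H] [NormedSpace 𝕜 H] [NormedSpace ℝ H]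
      [IsScalarTower ℝ 𝕜 H] [CompleteSpace H] (F : E → H) (k : ℕ),
      ContDiffOn 𝕜 ∞ F (Metric.ball x₀ ε) →
        ContDiffOn 𝕜 n (segmentMean 𝕜 x₀ k F) (Metric.ball x₀ ε) := by
  induction n with
  | zero =>
    intro H _ _ _ _ _ F k hF
    have h := (contDiffOn_infty_iff_fderiv_of_isOpen Metric.isOpen_ball).1 hF
    exact contDiffOn_zero.2 fun x hx =>
      (hasFDerivAt_segmentMean h.1 h.2.continuousOn k hx).continuousAt.continuousWithinAt
  | succ n ih =>
    intro H _ _ _ _ _ F k hF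
    have h := (contDiffOn_infty_iff_fderiv_of_isOpen Metric.isOpen_ball).1 hF
    have hd := fun x hx => hasFDerivAt_segmentMean h.1 h.2.continuousOn k (x := x) hx
    rw [Nat.cast_add, Nat.cast_one, contDiffOn_succ_iff_fderiv_of_isOpen Metric.isOpen_ball]
    refine ⟨fun x hx => (hd x hx).differentiableAt.differentiableWithinAt, fun hn => ?_, ?_⟩
    · exact absurd hn (by simp)
    · exact (ih (fderiv 𝕜 F) (k + 1) h.2).congr fun x hx => (hd x hx).fderiv

/-- The fundamental theorem of calculus along the segment from `x₀` to `x`. -/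
theorem eq_add_segmentMean_apply [NormedSpace ℝ E] [IsScalarTower ℝ 𝕜 E] {x₀ x : E} {ε : ℝ} {F : E → H}
    (hF : DifferentiableOn 𝕜 F (Metric.ball x₀ ε))
    (hF' : ContinuousOn (fderiv 𝕜 F) (Metric.ball x₀ ε)) (hx : x ∈ Metric.ball x₀ ε) :
    F x = F x₀ + segmentMean 𝕜 x₀ 0 (fderiv 𝕜 F) x (x - x₀) := by
  have hc := continuousOn_segment (𝕜 := 𝕜) hF' 0 hx
  have hint := intervalIntegrable_segment (𝕜 := 𝕜) hF' 0 hx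
  have h1 := intervalIntegral.integral_eq_sub_of_hasDerivAt
    (f := fun t : ℝ => F (x₀ + (t : 𝕜) • (x - x₀)))
    (f' := fun t : ℝ => (((t : 𝕜) ^ 0) • fderiv 𝕜 F (x₀ + (t : 𝕜) • (x - x₀))) (x - x₀))
    (a := 0) (b := 1) ?_ ?_
  · rw [segmentMean, ContinuousLinearMap.intervalIntegral_apply hint, h1]
    simp
  · intro t ht
    rw [Set.uIcc_of_le zero_le_one] at ht
    have h2 := (hF.differentiableAt (Metric.isOpen_ball.mem_nhds
      (homothety_mem_ball (𝕜 := 𝕜) hx ht))).hasFDerivAt.restrictScalars ℝ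
    have h3 : HasDerivAt (fun t : ℝ => x₀ + (t : 𝕜) • (x - x₀)) (x - x₀) t := by
      have h4 := ((hasDerivAt_id t).smul_const (x - x₀)).const_add x₀
      rw [one_smul] at h4
      refine h4.congr_of_eventuallyEq (Filter.Eventually.of_forall fun s => ?_)
      exact congrArg (x₀ + ·) (RCLike.real_smul_eq_coe_smul (K := 𝕜) s (x - x₀)).symm
    rw [pow_zero, one_smul]
    exact h2.comp_hasDerivAt t h3
  · exact (ContinuousOn.intervalIntegrable (by
      rw [Set.uIcc_of_le zero_le_one]
      exact hc.clm_apply continuousOn_const))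

end Hadamard

/-- Here `D` is the sum of the power series shifted by one degree. Unshifting it with constant term
`F x₀` gives back the series of `F`, so the two sides have the same sum near `x₀`. -/
theorem AnalyticAt.exists_analyticAt_sub_apply {𝕜 E H : Type*} [RCLike 𝕜] [NormedAddCommGroup E]
    [NormedSpace 𝕜 E] [NormedAddCommGroup H] [NormedSpace 𝕜 H] [CompleteSpace H] {F : E → H}
    {x₀ : E} (hF : AnalyticAt 𝕜 F x₀) :
    ∃ D : E → E →L[𝕜] H, AnalyticAt 𝕜 D x₀ ∧ ∀ᶠ x in 𝓝 x₀, F x = F x₀ + D x (x - x₀) := by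
  obtain ⟨p, ρ, hp⟩ := hF
  have hr : 0 < p.shift.radius := by
    rw [FormalMultilinearSeries.radius_shift]
    exact hp.r_pos.trans_le hp.r_le
  have hq : HasFPowerSeriesAt (fun x => p.shift.sum (x - x₀)) p.shift x₀ := by
    have := (p.shift.hasFPowerSeriesOnBall hr).comp_sub x₀
    rw [zero_add] at this
    exact this.hasFPowerSeriesAt
  refine ⟨_, hq.analyticAt, ?_⟩
  obtain ⟨s, hs⟩ := hq
  have h1 := (hs.unshift (z := F x₀))
  have h2 : p.shift.unshift (F x₀) = p := by
    funext n
    cases n with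
    | zero =>
      ext v
      rw [← hp.coeff_zero v]
      rfl
    | succ n => exact (continuousMultilinearCurryRightEquiv' 𝕜 n E H).symm_apply_apply (p (n + 1))
  rw [h2] at h1
  have h4 := (hp.mono (lt_min hp.r_pos h1.r_pos) (min_le_left _ _)).unique
    (h1.mono (lt_min hp.r_pos h1.r_pos) (min_le_right _ _))
  filter_upwards [Metric.eball_mem_nhds x₀ (lt_min hp.r_pos h1.r_pos)] with x hx
  exact h4 hx

/-- Hadamard's lemma for smooth and for analytic functions. -/
theorem ContDiffOn.exists_contDiffOn_sub_apply {𝕜 E H : Type*} [RCLike 𝕜] [NormedAddCommGroup E]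
    [NormedSpace 𝕜 E] [ProperSpace E] [NormedAddCommGroup H] [NormedSpace 𝕜 H]
    [CompleteSpace H] {r : WithTop ℕ∞} (hr : r = ∞ ∨ r = ω) {F : E → H} {x₀ : E} {ε : ℝ}
    (hε : 0 < ε) (hF : ContDiffOn 𝕜 r F (Metric.ball x₀ ε)) :
    ∃ δ > 0, ∃ D : E → E →L[𝕜] H, ContDiffOn 𝕜 r D (Metric.ball x₀ δ) ∧
      ∀ x ∈ Metric.ball x₀ δ, F x = F x₀ + D x (x - x₀) := by
  let : NormedSpace ℝ H := NormedSpace.restrictScalars ℝ 𝕜 H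
  let : NormedSpace ℝ E := NormedSpace.restrictScalars ℝ 𝕜 E
  have : IsScalarTower ℝ 𝕜 H := RestrictScalars.isScalarTower ℝ 𝕜 H
  have : IsScalarTower ℝ 𝕜 E := RestrictScalars.isScalarTower ℝ 𝕜 E
  rcases hr with rfl | rfl
  · have h := (contDiffOn_infty_iff_fderiv_of_isOpen Metric.isOpen_ball).1 hF
    refine ⟨ε, hε, segmentMean 𝕜 x₀ 0 (fderiv 𝕜 F), ?_, fun x hx =>
      eq_add_segmentMean_apply h.1 h.2.continuousOn hx⟩
    exact contDiffOn_infty.2 fun n => contDiffOn_segmentMean n _ 0 h.2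
  · have hF' : AnalyticAt 𝕜 F x₀ :=
      (hF.contDiffAt (Metric.ball_mem_nhds x₀ hε)).analyticAt
    obtain ⟨D, hD, hFD⟩ := hF'.exists_analyticAt_sub_apply
    obtain ⟨δ, hδ, h⟩ := Metric.eventually_nhds_iff_ball.1 (hD.eventually_analyticAt.and hFD)
    exact ⟨δ, hδ, D, fun x hx => (h x hx).1.contDiffAt.contDiffWithinAt, fun x hx => (h x hx).2⟩

/-! ### Commutation factors as bicharacters -/

namespace CommutationFactor

variable {G 𝕂 : Type*} [AddCommGroup G] [Field 𝕂] (ρ : CommutationFactor G 𝕂)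

theorem ne_zero (i j : G) : ρ i j ≠ 0 := left_ne_zero_of_mul_eq_one (ρ.mul_swap i j)

@[simp] theorem zero_left (j : G) : ρ 0 j = 1 := by
  have h := ρ.add_left 0 0 j
  rw [add_zero] at h
  exact (mul_right_cancel₀ (ρ.ne_zero 0 j) ((one_mul _).trans h)).symm

@[simp] theorem zero_right (j : G) : ρ j 0 = 1 := by
  have h := ρ.mul_swap j 0
  rwa [zero_left, mul_one] at h

theorem swap (i j : G) : ρ i j = (ρ j i)⁻¹ := eq_inv_of_mul_eq_one_left (ρ.mul_swap i j)

theorem neg_left (i j : G) : ρ (-i) j = (ρ i j)⁻¹ := by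
  refine eq_inv_of_mul_eq_one_left ?_
  rw [← ρ.add_left, neg_add_cancel, zero_left]

theorem neg_right (i j : G) : ρ i (-j) = (ρ i j)⁻¹ := by
  refine eq_inv_of_mul_eq_one_left ?_
  rw [← ρ.add_right, neg_add_cancel, zero_right]

theorem sub_left (i j k : G) : ρ (i - j) k = ρ i k * (ρ j k)⁻¹ := by
  rw [sub_eq_add_neg, ρ.add_left, ρ.neg_left]

theorem sub_right (i j k : G) : ρ i (j - k) = ρ i j * (ρ i k)⁻¹ := by
  rw [sub_eq_add_neg, ρ.add_right, ρ.neg_right]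

theorem nsmul_left (n : ℕ) (i j : G) : ρ (n • i) j = ρ i j ^ n := by
  induction n with
  | zero => simp
  | succ n ih => rw [succ_nsmul, ρ.add_left, ih, pow_succ]

theorem nsmul_right (n : ℕ) (i j : G) : ρ i (n • j) = ρ i j ^ n := by
  induction n with
  | zero => simp
  | succ n ih => rw [succ_nsmul, ρ.add_right, ih, pow_succ]

theorem sum_left {κ : Type*} (s : Finset κ) (f : κ → G) (j : G) :
    ρ (∑ b ∈ s, f b) j = ∏ b ∈ s, ρ (f b) j := by
  classical
  induction s using Finset.induction_on with
  | empty => simp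
  | insert a s ha ih => rw [Finset.sum_insert ha, Finset.prod_insert ha, ρ.add_left, ih]

theorem sum_right {κ : Type*} (s : Finset κ) (f : κ → G) (j : G) :
    ρ j (∑ b ∈ s, f b) = ∏ b ∈ s, ρ j (f b) := by
  classical
  induction s using Finset.induction_on with
  | empty => simp
  | insert a s ha ih => rw [Finset.sum_insert ha, Finset.prod_insert ha, ρ.add_right, ih]

theorem self_mul_self (i : G) : ρ i i * ρ i i = 1 := ρ.mul_swap i i

theorem isEven_or_isOdd (i : G) : ρ.IsEven i ∨ ρ.IsOdd i := mul_self_eq_one_iff.1 (ρ.self_mul_self i)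

/-- The cross factors `ρ i j` and `ρ j i` cancel, so `i ↦ ρ i i` is a homomorphism to the signs. All
later parity computations rest on this. -/
theorem self_add (i j : G) : ρ (i + j) (i + j) = ρ i i * ρ j j := by
  rw [ρ.add_left, ρ.add_right, ρ.add_right]
  linear_combination (ρ i i * ρ j j) * ρ.mul_swap i j

theorem self_neg (i : G) : ρ (-i) (-i) = ρ i i := by
  rw [ρ.neg_left, ρ.neg_right, inv_inv]

theorem inv_self (i : G) : (ρ i i)⁻¹ = ρ i i := (ρ.swap i i).symm

theorem self_sub (i j : G) : ρ (i - j) (i - j) = ρ i i * ρ j j := by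
  rw [sub_eq_add_neg, self_add, self_neg]

theorem self_nsmul (n : ℕ) (i : G) : ρ (n • i) (n • i) = ρ i i ^ n := by
  induction n with
  | zero => simp
  | succ n ih => rw [succ_nsmul, self_add, ih, pow_succ]

theorem self_sum {κ : Type*} (s : Finset κ) (f : κ → G) :
    ρ (∑ b ∈ s, f b) (∑ b ∈ s, f b) = ∏ b ∈ s, ρ (f b) (f b) := by
  classical
  induction s using Finset.induction_on with
  | empty => simp
  | insert a s ha ih => rw [Finset.sum_insert ha, Finset.prod_insert ha, self_add, ih]

end CommutationFactor

/-! ### Monomials -/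

section Monomial

variable {G 𝕂 κ : Type*} [AddCommGroup G] [Field 𝕂] [Fintype κ] [LinearOrder κ]
  (ρ : CommutationFactor G 𝕂) (d : κ → G)

@[simp] theorem monomialDegree_zero : monomialDegree d 0 = 0 := by simp [monomialDegree]

theorem monomialDegree_add (u v : κ →₀ ℕ) :
    monomialDegree d (u + v) = monomialDegree d u + monomialDegree d v := by
  simp [monomialDegree, add_smul, Finset.sum_add_distrib]

@[simp] theorem monomialDegree_single (b : κ) (n : ℕ) :
    monomialDegree d (Finsupp.single b n) = n • d b := by
  classical
  simp [monomialDegree, Finsupp.single_apply, ite_smul]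

theorem admissible_single (b : κ) : Admissible ρ d (Finsupp.single b 1) := by
  classical
  intro c _
  rw [Finsupp.single_apply]
  split_ifs <;> simp

theorem exchange_single_left (b : κ) (v : κ →₀ ℕ) :
    exchange ρ d (Finsupp.single b 1) v = ∏ c ∈ Finset.univ.filter (· < b), ρ (d b) (d c) ^ v c := by
  classical
  rw [exchange, Finset.prod_filter]
  refine Finset.prod_congr rfl fun c _ => ?_
  split_ifs with h
  · rw [Finset.prod_eq_single b]
    · simp
    · intro e _ he
      simp [he.symm]
    · simp [h]
  · refine Finset.prod_eq_one fun e he => ?_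
    have : e ≠ b := by
      rintro rfl
      exact h (Finset.mem_filter.1 he).2
    simp [this.symm]

theorem exchange_single_right (b : κ) (u : κ →₀ ℕ) :
    exchange ρ d u (Finsupp.single b 1) = ∏ c ∈ Finset.univ.filter (b < ·), ρ (d c) (d b) ^ u c := by
  classical
  rw [exchange, Finset.prod_eq_single b]
  · simp
  · intro e _ he
    exact Finset.prod_eq_one fun c _ => by simp [he.symm]
  · simp

variable {ρ d} in
/-- Exchanging two monomials in a product. -/
theorem exchange_swap {u v : κ →₀ ℕ} (h : Admissible ρ d (u + v)) :
    exchange ρ d u v = ρ (monomialDegree d u) (monomialDegree d v) * exchange ρ d v u := by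
  classical
  have h1 : ρ (monomialDegree d u) (monomialDegree d v) =
      ∏ b, ∏ c, ρ (d c) (d b) ^ (u c * v b) := by
    rw [monomialDegree, ρ.sum_left, Finset.prod_comm]
    refine Finset.prod_congr rfl fun c _ => ?_
    rw [monomialDegree, ρ.sum_right]
    refine Finset.prod_congr rfl fun b _ => ?_
    rw [ρ.nsmul_left, ρ.nsmul_right, ← pow_mul, mul_comm (v b)]
  -- All pairs of indices are split by their order. The diagonal contributes nothing: an even index
  -- has factor `1`, and an odd one occurs at most once in `u + v`, hence not in both monomials.
  have h2 : ∀ b c, ρ (d c) (d b) ^ (u c * v b) =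
      (if b < c then ρ (d c) (d b) ^ (u c * v b) else 1) *
        (if c < b then ρ (d c) (d b) ^ (u c * v b) else 1) := by
    intro b c
    rcases lt_trichotomy b c with hbc | rfl | hbc
    · simp [hbc, hbc.not_gt]
    · simp only [lt_irrefl, if_false, mul_one]
      rcases ρ.isEven_or_isOdd (d b) with hb | hb
      · rw [show ρ (d b) (d b) = 1 from hb, one_pow]
      · have := h b hb
        rw [Finsupp.add_apply] at this
        have : u b * v b = 0 := by
          rcases Nat.eq_zero_or_pos (u b) with h0 | h0
          · simp [h0]
          · have : v b = 0 := by omega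
            simp [this]
        rw [this, pow_zero]
    · simp [hbc, hbc.not_gt]
  -- The pairs that are already in order cancel against the exchanges made in the opposite product.
  have h3 : (∏ b, ∏ c, if c < b then ρ (d c) (d b) ^ (u c * v b) else 1) * exchange ρ d v u = 1 := by
    rw [Finset.prod_comm, exchange, ← Finset.prod_mul_distrib]
    refine Finset.prod_eq_one fun c _ => ?_
    rw [← Finset.prod_filter, ← Finset.prod_mul_distrib]
    refine Finset.prod_eq_one fun b _ => ?_
    rw [mul_comm (v b), ← mul_pow, ρ.mul_swap, one_pow]
  rw [h1, Finset.prod_congr rfl fun b _ => Finset.prod_congr rfl fun c _ => h2 b c]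
  simp_rw [Finset.prod_mul_distrib]
  rw [mul_assoc, h3, mul_one, exchange]
  simp_rw [Finset.prod_filter]

end Monomial

/-! ### Homogeneous series -/

namespace RhoSeries

variable {G 𝕂 κ : Type*} [AddCommGroup G] [Field 𝕂] [Fintype κ] [LinearOrder κ]
  {ρ : CommutationFactor G 𝕂} {d : κ → G} {R : Type*} [CommRing R] [Algebra 𝕂 R]

@[simp] theorem coeff_zero (w) : (0 : RhoSeries ρ d R).coeff w = 0 := rfl

theorem coeff_neg (f : RhoSeries ρ d R) (w) : (-f).coeff w = -f.coeff w := rfl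
theorem coeff_sub (f g : RhoSeries ρ d R) (w) : (f - g).coeff w = f.coeff w - g.coeff w := rfl

theorem coeff_sum {α : Type*} (s : Finset α) (f : α → RhoSeries ρ d R) (w) :
    (∑ a ∈ s, f a).coeff w = ∑ a ∈ s, (f a).coeff w := by
  have h : (∑ a ∈ s, f a).coeff = ∑ a ∈ s, (f a).coeff := map_sum coeffHom f s
  rw [h, Finset.sum_apply]

open Classical in
theorem coeff_ofCoeff (F : (κ →₀ ℕ) → R) (w) :
    (ofCoeff F : RhoSeries ρ d R).coeff w = if Admissible ρ d w then F w else 0 := rfl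

theorem admissible_of_coeff_ne_zero {f : RhoSeries ρ d R} {w} (h : f.coeff w ≠ 0) :
    Admissible ρ d w := by
  by_contra h'
  exact h (f.coeff_eq_zero w h')

open Classical in
theorem coeff_C (a : R) (w) : (C a : RhoSeries ρ d R).coeff w = if w = 0 then a else 0 := by
  rw [C, coeff_ofCoeff]
  by_cases h : w = 0
  · subst h; simp [admissible_zero]
  · simp [h]

open Classical in
theorem coeff_X (b : κ) (w) :
    (X b : RhoSeries ρ d R).coeff w = if w = Finsupp.single b 1 then 1 else 0 := by
  rw [X, coeff_ofCoeff]
  by_cases h : w = Finsupp.single b 1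
  · subst h; simp [admissible_single]
  · simp [h]

/-- All monomials of `f` have degree `i`. -/
def IsHomogeneous (i : G) (f : RhoSeries ρ d R) : Prop :=
  ∀ w, f.coeff w ≠ 0 → monomialDegree d w = i

theorem isHomogeneous_zero (i : G) : IsHomogeneous i (0 : RhoSeries ρ d R) :=
  fun _ h => absurd rfl h

theorem isHomogeneous_C (a : R) : IsHomogeneous 0 (C a : RhoSeries ρ d R) := by
  classical
  intro w h
  rw [coeff_C] at h
  split_ifs at h with hw
  · simp [hw]
  · exact absurd rfl h

theorem isHomogeneous_one : IsHomogeneous 0 (1 : RhoSeries ρ d R) := isHomogeneous_C 1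

theorem isHomogeneous_X (b : κ) : IsHomogeneous (d b) (X b : RhoSeries ρ d R) := by
  classical
  intro w h
  rw [coeff_X] at h
  split_ifs at h with hw
  · simp [hw]
  · exact absurd rfl h

theorem IsHomogeneous.add {i : G} {f g : RhoSeries ρ d R} (hf : IsHomogeneous i f)
    (hg : IsHomogeneous i g) : IsHomogeneous i (f + g) := by
  intro w h
  by_cases h1 : f.coeff w = 0
  · refine hg w fun h2 => h ?_
    rw [coeff_add, h1, h2, add_zero]
  · exact hf w h1

theorem IsHomogeneous.neg {i : G} {f : RhoSeries ρ d R} (hf : IsHomogeneous i f) :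
    IsHomogeneous i (-f) := fun w h => hf w fun h' => h (by rw [coeff_neg, h', neg_zero])

theorem IsHomogeneous.sub {i : G} {f g : RhoSeries ρ d R} (hf : IsHomogeneous i f)
    (hg : IsHomogeneous i g) : IsHomogeneous i (f - g) := by
  rw [sub_eq_add_neg]
  exact hf.add hg.neg

theorem IsHomogeneous.smul {i : G} {f : RhoSeries ρ d R} (hf : IsHomogeneous i f) (a : 𝕂) :
    IsHomogeneous i (a • f) := fun w h => hf w fun h' => h (by rw [coeff_smul, h', smul_zero])

theorem IsHomogeneous.sum {α : Type*} {s : Finset α} {i : G} {f : α → RhoSeries ρ d R}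
    (hf : ∀ a ∈ s, IsHomogeneous i (f a)) : IsHomogeneous i (∑ a ∈ s, f a) := by
  classical
  induction s using Finset.induction_on with
  | empty => exact isHomogeneous_zero i
  | insert a s ha ih =>
    rw [Finset.sum_insert ha]
    exact (hf a (Finset.mem_insert_self a s)).add
      (ih fun b hb => hf b (Finset.mem_insert_of_mem hb))

theorem IsHomogeneous.mul {i j : G} {f g : RhoSeries ρ d R} (hf : IsHomogeneous i f)
    (hg : IsHomogeneous j g) : IsHomogeneous (i + j) (f * g) := by
  intro w h
  rw [coeff_mul] at h
  split_ifs at h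
  · obtain ⟨p, hp, hne⟩ := Finset.exists_ne_zero_of_sum_ne_zero h
    rw [Finset.HasAntidiagonal.mem_antidiagonal] at hp
    rw [← hp, monomialDegree_add, hf p.1 fun h => hne (by simp [h]),
      hg p.2 fun h => hne (by simp [h])]
  · exact absurd rfl h

theorem IsHomogeneous.mul_swap {i j : G} {f g : RhoSeries ρ d R} (hf : IsHomogeneous i f)
    (hg : IsHomogeneous j g) : f * g = ρ i j • (g * f) := by
  classical
  ext w
  rw [coeff_smul, coeff_mul, coeff_mul]
  split_ifs with hw
  · rw [Finset.smul_sum]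
    refine Finset.sum_nbij' Prod.swap Prod.swap ?_ ?_ ?_ ?_ ?_
    · simp [add_comm]
    · simp [add_comm]
    · simp
    · simp
    · rintro ⟨u, v⟩ hp
      rw [Finset.HasAntidiagonal.mem_antidiagonal] at hp
      simp only [Prod.fst_swap, Prod.snd_swap]
      by_cases h1 : f.coeff u = 0
      · simp [h1]
      by_cases h2 : g.coeff v = 0
      · simp [h2]
      dsimp only at hp
      rw [smul_smul, exchange_swap (hp ▸ hw), hf u h1, hg v h2, mul_comm (g.coeff v)]
  · rw [smul_zero]

theorem IsHomogeneous.mul_comm {j : G} {f g : RhoSeries ρ d R} (hf : IsHomogeneous 0 f)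
    (hg : IsHomogeneous j g) : f * g = g * f := by
  rw [hf.mul_swap hg, ρ.zero_left, one_smul]

open Classical in
/-- The homogeneous component of degree `i`. -/
noncomputable def component (i : G) (f : RhoSeries ρ d R) : RhoSeries ρ d R :=
  ofCoeff fun w => if monomialDegree d w = i then f.coeff w else 0

open Classical in
theorem coeff_component (i : G) (f : RhoSeries ρ d R) (w) :
    (component i f).coeff w = if monomialDegree d w = i then f.coeff w else 0 := by
  rw [component, coeff_ofCoeff]
  by_cases h : Admissible ρ d w
  · rw [if_pos h]
  · rw [if_neg h, f.coeff_eq_zero w h, ite_self]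

theorem isHomogeneous_component (i : G) (f : RhoSeries ρ d R) :
    IsHomogeneous i (component i f) := by
  classical
  intro w h
  rw [coeff_component] at h
  by_contra h'
  exact h (if_neg h')

theorem IsHomogeneous.component_eq {i : G} {f : RhoSeries ρ d R} (hf : IsHomogeneous i f) :
    component i f = f := by
  classical
  ext w
  rw [coeff_component]
  split_ifs with h
  · rfl
  · by_contra h'
    exact h (hf w fun h2 => h' h2.symm)

theorem component_sum {α : Type*} (s : Finset α) (i : G) (f : α → RhoSeries ρ d R) :
    component i (∑ a ∈ s, f a) = ∑ a ∈ s, component i (f a) := by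
  classical
  ext w
  simp only [coeff_component, coeff_sum]
  split_ifs <;> simp

/-- Multiplication by a homogeneous factor commutes with taking components. This is what later shows
that inverses of graded matrices are graded. -/
theorem IsHomogeneous.component_mul {i : G} {f : RhoSeries ρ d R} (hf : IsHomogeneous i f) (j : G)
    (g : RhoSeries ρ d R) : component (i + j) (f * g) = f * component j g := by
  classical
  ext w
  rw [coeff_component, coeff_mul, coeff_mul]
  by_cases hw : Admissible ρ d w
  · rw [if_pos hw, if_pos hw]
    split_ifs with h
    · refine Finset.sum_congr rfl fun p hp => ?_
      rw [Finset.HasAntidiagonal.mem_antidiagonal] at hp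
      by_cases h1 : f.coeff p.1 = 0
      · simp [h1]
      rw [coeff_component, if_pos]
      rw [← hp, monomialDegree_add, hf _ h1] at h
      exact add_left_cancel h
    · refine (Finset.sum_eq_zero fun p hp => ?_).symm
      rw [Finset.HasAntidiagonal.mem_antidiagonal] at hp
      by_cases h1 : f.coeff p.1 = 0
      · simp [h1]
      rw [coeff_component, if_neg]
      · simp
      · intro h2
        rw [← hp, monomialDegree_add, hf _ h1, h2] at h
        exact h rfl
  · simp [hw]

theorem coeff_zero_mul (f g : RhoSeries ρ d R) :
    (f * g).coeff 0 = f.coeff 0 * g.coeff 0 := by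
  rw [coeff_mul, if_pos (admissible_zero ρ d)]
  simp

theorem coeff_C_mul (a : R) (f : RhoSeries ρ d R) (w) : (C a * f).coeff w = a * f.coeff w := by
  classical
  rw [coeff_mul]
  split_ifs with h
  · rw [Finset.sum_eq_single (0, w)]
    · simp [coeff_C]
    · rintro ⟨u, v⟩ hp hne
      have hu : u ≠ 0 := by
        rintro rfl
        simp only [Finset.HasAntidiagonal.mem_antidiagonal, zero_add] at hp
        exact hne (by rw [hp])
      simp [coeff_C, hu]
    · simp
  · rw [f.coeff_eq_zero w h, mul_zero]

/-! #### Derivations with respect to the indeterminates -/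

open Classical in
theorem coeff_formalPartial (b : κ) (f : RhoSeries ρ d R) (w) :
    (formalPartial b f).coeff w = if Admissible ρ d w then (((w b + 1 : ℕ) : 𝕂) *
      ∏ c ∈ Finset.univ.filter (· < b), ρ (- d b) (d c) ^ w c) • f.coeff (w + Finsupp.single b 1)
      else 0 := rfl

theorem formalPartial_add (b : κ) (f g : RhoSeries ρ d R) :
    formalPartial b (f + g) = formalPartial b f + formalPartial b g := by
  ext w
  simp only [coeff_formalPartial, coeff_add]
  split_ifs <;> simp [smul_add]

@[simp] theorem formalPartial_zero (b : κ) : formalPartial b (0 : RhoSeries ρ d R) = 0 := by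
  ext w
  simp [coeff_formalPartial]

theorem formalPartial_C (b : κ) (a : R) : formalPartial b (C a : RhoSeries ρ d R) = 0 := by
  classical
  ext w
  have : w + Finsupp.single b 1 ≠ 0 := fun h => by
    have := DFunLike.congr_fun h b
    simp at this
  rw [coeff_formalPartial, coeff_C, if_neg this, smul_zero, ite_self]
  rfl

theorem formalPartial_X (b c : κ) :
    formalPartial b (X c : RhoSeries ρ d R) = if c = b then 1 else 0 := by
  classical
  ext w
  rw [coeff_formalPartial, coeff_X]
  by_cases hw : w = 0
  · subst hw
    by_cases hcb : c = b
    · subst hcb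
      simp [admissible_zero, coeff_one]
    · have : Finsupp.single b 1 ≠ Finsupp.single c 1 := fun h => hcb
        (((Finsupp.single_left_injective one_ne_zero).eq_iff.1 h).symm)
      simp [hcb, this]
  · have h1 : w + Finsupp.single b 1 ≠ Finsupp.single c 1 := by
      intro h
      apply hw
      have hb := DFunLike.congr_fun h b
      by_cases hcb : c = b
      · subst hcb
        exact add_eq_right.1 h
      · simp [hcb] at hb
    rw [if_neg h1, smul_zero, ite_self]
    split_ifs
    · rw [coeff_one, if_neg hw]
    · rfl

theorem IsHomogeneous.formalPartial {i : G} {f : RhoSeries ρ d R} (hf : IsHomogeneous i f) (b : κ) :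
    IsHomogeneous (i - d b) (formalPartial b f) := by
  classical
  intro w h
  rw [coeff_formalPartial] at h
  split_ifs at h
  · have := hf (w + Finsupp.single b 1) fun h' => h (by rw [h', smul_zero])
    rw [monomialDegree_add, monomialDegree_single, one_smul] at this
    rw [← this, add_sub_cancel_right]
  · exact absurd rfl h

/-- Splittings of `w` correspond to the splittings of `w + single b 1` whose first part contains
`b`; `F` vanishes on the others. This brings all terms of the Leibniz rule to a common index set. -/
theorem sum_antidiagonal_add_single (b : κ) (w : κ →₀ ℕ) (F : (κ →₀ ℕ) × (κ →₀ ℕ) → R)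
    (hF : ∀ p, p.1 b = 0 → F p = 0) :
    ∑ p ∈ Finset.HasAntidiagonal.antidiagonal w, F (p.1 + Finsupp.single b 1, p.2) =
      ∑ p ∈ Finset.HasAntidiagonal.antidiagonal (w + Finsupp.single b 1), F p := by
  refine Finset.sum_of_injOn (fun p => (p.1 + Finsupp.single b 1, p.2)) ?_ ?_ ?_ fun _ _ => rfl
  · rintro ⟨u, v⟩ _ ⟨u', v'⟩ _ h
    simp only [Prod.mk.injEq, add_left_inj] at h
    exact Prod.ext h.1 h.2
  · rintro ⟨u, v⟩ h
    simp only [Finset.mem_coe, Finset.HasAntidiagonal.mem_antidiagonal] at h ⊢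
    rw [← h, add_right_comm]
  · rintro ⟨u, v⟩ h h'
    rw [Finset.HasAntidiagonal.mem_antidiagonal] at h
    refine hF _ ?_
    by_contra hu
    have hle : Finsupp.single b 1 ≤ u := Finsupp.single_le_iff.2 (Nat.one_le_iff_ne_zero.2 hu)
    refine h' ⟨(u - Finsupp.single b 1, v), ?_, ?_⟩
    · rw [Finset.mem_coe, Finset.HasAntidiagonal.mem_antidiagonal]
      refine add_right_cancel (b := Finsupp.single b 1) ?_
      rw [← h, add_right_comm, tsub_add_cancel_of_le hle]
    · simp only [tsub_add_cancel_of_le hle]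

theorem sum_antidiagonal_add_single_right (b : κ) (w : κ →₀ ℕ) (F : (κ →₀ ℕ) × (κ →₀ ℕ) → R)
    (hF : ∀ p, p.2 b = 0 → F p = 0) :
    ∑ p ∈ Finset.HasAntidiagonal.antidiagonal w, F (p.1, p.2 + Finsupp.single b 1) =
      ∑ p ∈ Finset.HasAntidiagonal.antidiagonal (w + Finsupp.single b 1), F p := by
  have h := sum_antidiagonal_add_single b w (fun p => F p.swap) (fun p hp => hF _ hp)
  refine (Finset.sum_nbij' Prod.swap Prod.swap ?_ ?_ ?_ ?_ ?_).trans
    (h.trans (Finset.sum_nbij' Prod.swap Prod.swap ?_ ?_ ?_ ?_ ?_)) <;> simp [add_comm]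

variable (ρ d) in
/-- The factor in `∂/∂x_b (x ^ w)`. -/
noncomputable def partialFactor (b : κ) (w : κ →₀ ℕ) : 𝕂 :=
  ∏ c ∈ Finset.univ.filter (· < b), ρ (- d b) (d c) ^ w c

theorem partialFactor_add (b : κ) (u v : κ →₀ ℕ) :
    partialFactor ρ d b (u + v) = partialFactor ρ d b u * partialFactor ρ d b v := by
  simp only [partialFactor, Finsupp.add_apply, pow_add, Finset.prod_mul_distrib]

theorem partialFactor_mul_exchange (b : κ) (v : κ →₀ ℕ) :
    partialFactor ρ d b v * exchange ρ d (Finsupp.single b 1) v = 1 := by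
  rw [exchange_single_left, partialFactor, ← Finset.prod_mul_distrib]
  refine Finset.prod_eq_one fun c _ => ?_
  rw [← mul_pow, ρ.neg_left, inv_mul_cancel₀ (ρ.ne_zero _ _), one_pow]

/-- The factor for moving `∂/∂x_b` past all of `x ^ u`, sorted into the indices equal to `b`, below
`b` and above `b`. -/
theorem rho_neg_monomialDegree (b : κ) (u : κ →₀ ℕ) :
    ρ (- d b) (monomialDegree d u) =
      ρ (d b) (d b) ^ u b * partialFactor ρ d b u * exchange ρ d u (Finsupp.single b 1) := by
  classical
  have h1 : ρ (- d b) (monomialDegree d u) = ∏ c, ρ (- d b) (d c) ^ u c := by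
    rw [monomialDegree, ρ.sum_right]
    exact Finset.prod_congr rfl fun c _ => ρ.nsmul_right _ _ _
  have h2 : ∀ c, ρ (- d b) (d c) ^ u c = (if c = b then ρ (d b) (d b) ^ u b else 1) *
      (if c < b then ρ (- d b) (d c) ^ u c else 1) *
      (if b < c then ρ (d c) (d b) ^ u c else 1) := by
    intro c
    have h3 : ρ (- d b) (d c) = ρ (d c) (d b) := by rw [ρ.neg_left, ← ρ.swap]
    rcases lt_trichotomy b c with hbc | rfl | hbc
    · simp [hbc, hbc.not_gt, hbc.ne', h3]
    · simp [h3]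
    · simp [hbc, hbc.not_gt, hbc.ne]
  rw [h1, Finset.prod_congr rfl fun c _ => h2 c, Finset.prod_mul_distrib, Finset.prod_mul_distrib,
    partialFactor, exchange_single_right, Finset.prod_filter, Finset.prod_filter]
  simp

/-- The graded Leibniz rule. -/
theorem formalPartial_mul {i : G} {f : RhoSeries ρ d R} (hf : IsHomogeneous i f) (b : κ)
    (g : RhoSeries ρ d R) : formalPartial b (f * g) =
      formalPartial b f * g + ρ (- d b) i • (f * formalPartial b g) := by
  classical
  ext w
  by_cases hw : Admissible ρ d w
  swap
  · rw [RhoSeries.coeff_eq_zero _ _ hw, RhoSeries.coeff_eq_zero _ _ hw]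
  set s : κ →₀ ℕ := Finsupp.single b 1 with hs
  have h1 : (formalPartial b f * g).coeff w =
      ∑ p ∈ Finset.HasAntidiagonal.antidiagonal (w + s),
        ((p.1 b : 𝕂) * (partialFactor ρ d b w * exchange ρ d p.1 p.2)) •
          (f.coeff p.1 * g.coeff p.2) := by
    rw [← sum_antidiagonal_add_single b w _ (fun p hp => by simp [hp]), coeff_mul, if_pos hw]
    refine Finset.sum_congr rfl fun p hp => ?_
    rw [Finset.HasAntidiagonal.mem_antidiagonal] at hp
    have hp1 : Admissible ρ d p.1 := hw.mono (hp ▸ le_self_add)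
    rw [coeff_formalPartial, if_pos hp1, smul_mul_assoc, smul_smul]
    congr 1
    change _ * (_ * partialFactor ρ d b p.1) = _
    rw [exchange_add_left, ← hp, partialFactor_add, Finsupp.add_apply, Finsupp.single_eq_same]
    linear_combination (-(exchange ρ d p.1 p.2 * ((p.1 b + 1 : ℕ) : 𝕂) * partialFactor ρ d b p.1)) *
      partialFactor_mul_exchange (ρ := ρ) (d := d) b p.2
  have h2 : (ρ (- d b) i • (f * formalPartial b g)).coeff w =
      ∑ p ∈ Finset.HasAntidiagonal.antidiagonal (w + s),
        ((p.2 b : 𝕂) * (ρ (d b) (d b) ^ p.1 b * (partialFactor ρ d b w * exchange ρ d p.1 p.2))) •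
          (f.coeff p.1 * g.coeff p.2) := by
    rw [← sum_antidiagonal_add_single_right b w _ (fun p hp => by simp [hp]), coeff_smul,
      coeff_mul, if_pos hw, Finset.smul_sum]
    refine Finset.sum_congr rfl fun p hp => ?_
    rw [Finset.HasAntidiagonal.mem_antidiagonal] at hp
    have hp2 : Admissible ρ d p.2 := hw.mono (hp ▸ le_add_self)
    by_cases hf0 : f.coeff p.1 = 0
    · simp [hf0]
    rw [coeff_formalPartial, if_pos hp2, mul_smul_comm, smul_smul, smul_smul, ← hf _ hf0]
    congr 1
    change _ * (_ * partialFactor ρ d b p.2) = _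
    rw [exchange_add_right, ← hp, partialFactor_add, Finsupp.add_apply, Finsupp.single_eq_same,
      rho_neg_monomialDegree]
    ring
  have h3 : (formalPartial b (f * g)).coeff w =
      ∑ p ∈ Finset.HasAntidiagonal.antidiagonal (w + s),
        ((if Admissible ρ d (w + s) then ((w b + 1 : ℕ) : 𝕂) else 0) *
          (partialFactor ρ d b w * exchange ρ d p.1 p.2)) • (f.coeff p.1 * g.coeff p.2) := by
    rw [coeff_formalPartial, if_pos hw, coeff_mul]
    split_ifs with h
    · rw [Finset.smul_sum]
      refine Finset.sum_congr rfl fun p _ => ?_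
      rw [smul_smul, mul_assoc]
      rfl
    · simp
  rw [coeff_add, h1, h2, h3, ← Finset.sum_add_distrib]
  refine Finset.sum_congr rfl fun p hp => ?_
  rw [Finset.HasAntidiagonal.mem_antidiagonal] at hp
  by_cases hf0 : f.coeff p.1 = 0
  · simp [hf0]
  by_cases hg0 : g.coeff p.2 = 0
  · simp [hg0]
  rw [← add_smul]
  congr 1
  have hpb : p.1 b + p.2 b = w b + 1 := by
    have := DFunLike.congr_fun hp b
    simpa [hs] using this
  -- Once the common factor is removed, the Leibniz rule is this identity of scalars. For even `b`
  -- it says that the exponents add up. For odd `b` both exponents are at most `1`, and if both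
  -- equal `1` then `1 - 1 = 0` matches the vanishing of `x_b ^ 2`.
  suffices h : (if Admissible ρ d (w + s) then ((w b + 1 : ℕ) : 𝕂) else 0) =
      p.1 b + p.2 b * ρ (d b) (d b) ^ p.1 b by
    rw [h]; ring
  by_cases hb : ρ.IsOdd (d b)
  · have hb1 := admissible_of_coeff_ne_zero hf0 b hb
    have hb2 := admissible_of_coeff_ne_zero hg0 b hb
    have hA : Admissible ρ d (w + s) ↔ w b = 0 := by
      constructor
      · intro h
        have := h b hb
        simp only [hs, Finsupp.add_apply, Finsupp.single_eq_same] at this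
        omega
      · intro h c hc
        by_cases hcb : c = b
        · subst hcb
          simp [hs, h]
        · simpa [hs, Finsupp.single_apply, Ne.symm hcb] using hw c hc
    rw [show ρ (d b) (d b) = -1 from hb]
    rcases Nat.lt_or_ge 0 (w b) with h0 | h0
    · rw [if_neg (by rw [hA]; omega), show p.1 b = 1 by omega, show p.2 b = 1 by omega]
      simp
    · rw [if_pos (hA.2 (by omega)), show w b = 0 by omega]
      rcases Nat.eq_zero_or_pos (p.1 b) with h1 | h1
      · rw [h1, show p.2 b = 1 by omega]; simp
      · rw [show p.1 b = 1 by omega, show p.2 b = 0 by omega]; simp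
  · have hA : Admissible ρ d (w + s) := by
      intro c hc
      have hcb : c ≠ b := by rintro rfl; exact hb hc
      simpa [hs, Finsupp.single_apply, hcb.symm] using hw c hc
    rw [if_pos hA, show ρ (d b) (d b) = 1 from (ρ.isEven_or_isOdd (d b)).resolve_right hb, one_pow,
      mul_one, ← hpb]
    push_cast
    rfl

/-! #### Nilpotency of odd series -/

variable (ρ d) in
open Classical in
/-- The number of odd indeterminates in a monomial. -/
noncomputable def oddOrder (w : κ →₀ ℕ) : ℕ := ∑ b ∈ Finset.univ.filter fun b => ρ.IsOdd (d b), w b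

theorem oddOrder_add (u v : κ →₀ ℕ) : oddOrder ρ d (u + v) = oddOrder ρ d u + oddOrder ρ d v := by
  simp [oddOrder, Finset.sum_add_distrib]

theorem oddOrder_le {w : κ →₀ ℕ} (hw : Admissible ρ d w) : oddOrder ρ d w ≤ Fintype.card κ := by
  classical
  calc oddOrder ρ d w ≤ ∑ b ∈ Finset.univ.filter fun b => ρ.IsOdd (d b), 1 := by
        exact Finset.sum_le_sum fun b hb => hw b (Finset.mem_filter.1 hb).2
    _ ≤ Fintype.card κ := by
        rw [Finset.sum_const, smul_eq_mul, mul_one]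
        exact Finset.card_le_univ _

/-- The parity of a monomial is the parity of the number of its odd indeterminates. -/
theorem rho_self_monomialDegree (w : κ →₀ ℕ) :
    ρ (monomialDegree d w) (monomialDegree d w) = (-1) ^ oddOrder ρ d w := by
  classical
  rw [monomialDegree, ρ.self_sum, oddOrder, ← Finset.prod_pow_eq_pow_sum, Finset.prod_filter]
  refine Finset.prod_congr rfl fun b _ => ?_
  rw [ρ.self_nsmul]
  split_ifs with h
  · rw [show ρ (d b) (d b) = -1 from h]
  · rw [show ρ (d b) (d b) = 1 from (ρ.isEven_or_isOdd (d b)).resolve_right h, one_pow]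

/-- All monomials of `f` contain at least `n` odd indeterminates. -/
def OddOrderGE (n : ℕ) (f : RhoSeries ρ d R) : Prop := ∀ w, f.coeff w ≠ 0 → n ≤ oddOrder ρ d w

theorem OddOrderGE.mul {m n : ℕ} {f g : RhoSeries ρ d R} (hf : OddOrderGE m f)
    (hg : OddOrderGE n g) : OddOrderGE (m + n) (f * g) := by
  intro w h
  rw [coeff_mul] at h
  split_ifs at h
  · obtain ⟨p, hp, hne⟩ := Finset.exists_ne_zero_of_sum_ne_zero h
    rw [Finset.HasAntidiagonal.mem_antidiagonal] at hp
    rw [← hp, oddOrder_add]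
    exact add_le_add (hf p.1 fun h => hne (by simp [h])) (hg p.2 fun h => hne (by simp [h]))
  · exact absurd rfl h

theorem OddOrderGE.sum {α : Type*} {s : Finset α} {n : ℕ} {f : α → RhoSeries ρ d R}
    (hf : ∀ a ∈ s, OddOrderGE n (f a)) : OddOrderGE n (∑ a ∈ s, f a) := by
  intro w h
  rw [coeff_sum] at h
  obtain ⟨a, ha, hne⟩ := Finset.exists_ne_zero_of_sum_ne_zero h
  exact hf a ha w hne

theorem oddOrderGE_zero (f : RhoSeries ρ d R) : OddOrderGE 0 f := fun _ _ => Nat.zero_le _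

theorem OddOrderGE.eq_zero {n : ℕ} {f : RhoSeries ρ d R} (hf : OddOrderGE n f)
    (hn : Fintype.card κ < n) : f = 0 := by
  ext w
  by_contra h
  exact absurd (hn.trans_le (hf w h)) (not_lt.2 (oddOrder_le (admissible_of_coeff_ne_zero h)))

/-- A monomial of odd degree contains an odd number of odd indeterminates, hence at least one. The
hypothesis on `2` separates the signs. -/
theorem IsHomogeneous.oddOrderGE_one [NeZero (2 : 𝕂)] {i : G} {f : RhoSeries ρ d R}
    (hf : IsHomogeneous i f) (hi : ρ.IsOdd i) : OddOrderGE 1 f := by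
  intro w h
  by_contra h0
  have h1 := rho_self_monomialDegree (ρ := ρ) (d := d) w
  rw [show oddOrder ρ d w = 0 by omega, pow_zero, hf w h, show ρ i i = -1 from hi] at h1
  have h2 : (2 : 𝕂) = 0 := by linear_combination (-1 : 𝕂) * h1
  exact two_ne_zero h2

end RhoSeries

/-! ### Removing the signs from a commutation factor -/

namespace CommutationFactor

variable {G 𝕂 : Type*} [AddCommGroup G] [Field 𝕂] (ρ : CommutationFactor G 𝕂)

open Classical in
/-- The sign `-1` if both degrees are odd, and `1` otherwise. -/
noncomputable def superSign : CommutationFactor G 𝕂 where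
  toFun i j := if ρ j j = 1 then 1 else ρ i i
  mul_swap i j := by
    rcases ρ.isEven_or_isOdd i with hi | hi <;> rcases ρ.isEven_or_isOdd j with hj | hj <;>
      simp only [IsEven, IsOdd] at hi hj <;> simp only [hi, hj] <;> split_ifs <;> simp_all
  add_left i j k := by
    split_ifs
    · simp
    · exact ρ.self_add i j

/-- The commutation factor `ρ`, with the signs for odd degrees removed. -/
noncomputable def evenPart : CommutationFactor G 𝕂 where
  toFun i j := ρ i j * ρ.superSign i j
  mul_swap i j := by
    linear_combination (ρ.superSign i j * ρ.superSign j i) * ρ.mul_swap i j + ρ.superSign.mul_swap i j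
  add_left i j k := by
    rw [ρ.add_left, ρ.superSign.add_left]; ring

theorem evenPart_apply (i j : G) : ρ.evenPart i j = ρ i j * ρ.superSign i j := rfl

theorem superSign_of_isEven_right {i j : G} (h : ρ.IsEven j) : ρ.superSign i j = 1 := if_pos h

theorem superSign_of_isEven_left {i j : G} (h : ρ.IsEven i) : ρ.superSign i j = 1 := by
  rw [swap, superSign_of_isEven_right ρ h, inv_one]

theorem superSign_self (i : G) : ρ.superSign i i = ρ i i := by
  rcases ρ.isEven_or_isOdd i with hi | hi
  · rw [superSign_of_isEven_right ρ hi]; exact hi.symm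
  · by_cases h : ρ i i = 1
    · rw [superSign_of_isEven_right ρ h, h]
    · exact if_neg h

/-- If the parities agree then `i - j` is even, and even degrees do not affect the sign, so `i` may
be replaced by `j`. -/
theorem superSign_eq_of_self_eq {i j : G} (h : ρ i i = ρ j j) : ρ.superSign i j = ρ j j := by
  have h1 : ρ.IsEven (i - j) := by
    rw [IsEven, self_sub, h, self_mul_self]
  have h2 := ρ.superSign.add_left (i - j) j j
  rwa [sub_add_cancel, superSign_of_isEven_left ρ h1, one_mul, superSign_self] at h2

theorem superSign_of_isOdd {i j : G} (hi : ρ.IsOdd i) (hj : ρ.IsOdd j) : ρ.superSign i j = -1 := by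
  rw [superSign_eq_of_self_eq, hj]
  rw [hi, hj]

/-- With the sign removed a symbol commutes with itself, so no symbol is forced to have square zero
and all of them can be made invertible. -/
theorem evenPart_self (i : G) : ρ.evenPart i i = 1 := by
  rw [evenPart_apply, superSign_self, self_mul_self]

theorem superSign_inv (i j : G) : (ρ.superSign i j)⁻¹ = ρ.superSign i j := by
  rcases ρ.isEven_or_isOdd i with hi | hi
  · simp [superSign_of_isEven_left ρ hi]
  rcases ρ.isEven_or_isOdd j with hj | hj
  · simp [superSign_of_isEven_right ρ hj]
  · rw [superSign_of_isOdd ρ hi hj]; norm_num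

theorem mul_evenPart_inv (i j : G) : ρ i j * (ρ.evenPart i j)⁻¹ = ρ.superSign i j := by
  rw [evenPart_apply, mul_inv, ← mul_assoc, mul_inv_cancel₀ (ρ.ne_zero i j), one_mul, superSign_inv]

end CommutationFactor

/-! ### Adjoining invertible symbols of all degrees -/

namespace RhoSeries

variable {G 𝕂 κ : Type*} [AddCommGroup G] [Field 𝕂] [Fintype κ] [LinearOrder κ]
  {ρ : CommutationFactor G 𝕂} {d : κ → G} {R : Type*} [CommRing R] [Algebra 𝕂 R]

/-- Multiplication of the part of degree `i` by `ρ₊ (g, i)`. -/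
noncomputable def twist (g : G) : RhoSeries ρ d R →ₗ[𝕂] RhoSeries ρ d R where
  toFun f := ⟨fun w => ρ.evenPart g (monomialDegree d w) • f.coeff w, fun w h => by
    rw [f.coeff_eq_zero w h, smul_zero]⟩
  map_add' f g := by ext w; simp [coeff_add]
  map_smul' a f := by ext w; exact smul_comm _ _ _

theorem coeff_twist (g : G) (f : RhoSeries ρ d R) (w) :
    (twist g f).coeff w = ρ.evenPart g (monomialDegree d w) • f.coeff w := rfl

theorem twist_twist (g h : G) (f : RhoSeries ρ d R) : twist g (twist h f) = twist (g + h) f := by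
  ext w
  simp only [coeff_twist, smul_smul, ρ.evenPart.add_left]

theorem twist_zero (f : RhoSeries ρ d R) : twist 0 f = f := by
  ext w
  simp [coeff_twist]

theorem IsHomogeneous.twist_mul {i : G} {f : RhoSeries ρ d R} (hf : IsHomogeneous i f) (g : G)
    (h : RhoSeries ρ d R) : twist g (f * h) = ρ.evenPart g i • (f * twist g h) := by
  ext w
  rw [coeff_twist, coeff_smul, coeff_mul, coeff_mul]
  split_ifs
  · rw [Finset.smul_sum, Finset.smul_sum]
    refine Finset.sum_congr rfl fun p hp => ?_
    rw [Finset.HasAntidiagonal.mem_antidiagonal] at hp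
    by_cases h0 : f.coeff p.1 = 0
    · simp [h0]
    rw [← hp, monomialDegree_add, ρ.evenPart.add_right, hf _ h0, coeff_twist, mul_smul_comm,
      smul_smul, smul_smul, smul_smul]
    congr 1
    ring
  · simp

variable (ρ d R) in
/-- Linear operators on the Laurent polynomials in symbols of all degrees. -/
abbrev Operators : Type _ := Module.End 𝕂 ((G →₀ ℤ) → RhoSeries ρ d R)

/-- Left multiplication, as an operator. -/
noncomputable def leftMul : RhoSeries ρ d R →ₐ[𝕂] Operators ρ d R where
  toFun f :=
    { toFun := fun φ v => f * φ v
      map_add' := fun φ ψ => by funext v; exact mul_add _ _ _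
      map_smul' := fun a φ => by funext v; exact mul_smul_comm a f (φ v) }
  map_one' := by ext φ v; simp
  map_mul' f g := by ext φ v; simp [mul_assoc]
  map_zero' := by ext φ v; simp
  map_add' f g := by ext φ v; simp [add_mul]
  commutes' a := by
    ext φ v
    simp [Algebra.smul_def]

theorem leftMul_apply (f : RhoSeries ρ d R) (φ : (G →₀ ℤ) → RhoSeries ρ d R) (v) :
    leftMul f φ v = f * φ v := rfl

/-- Apply both operators to the constant function `1`. Identities between graded determinants may
therefore be checked among operators. -/
theorem leftMul_injective : Function.Injective (leftMul (ρ := ρ) (d := d) (R := R)) := by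
  intro f g h
  have := congrFun (DFunLike.congr_fun h 1) 0
  simpa [leftMul_apply] using this

variable (ρ) in
open Classical in
/-- The factor from moving the symbol of degree `g` to its place in the monomial `v`. -/
noncomputable def symbolFactor (g : G) (v : G →₀ ℤ) : 𝕂 :=
  v.prod fun m e => (if WellOrderingRel m g then ρ.evenPart g m else 1) ^ e

open Classical in
theorem symbolFactor_base_ne_zero (g m : G) :
    (if WellOrderingRel m g then ρ.evenPart g m else 1) ≠ 0 := by
  split_ifs
  · exact ρ.evenPart.ne_zero _ _
  · exact one_ne_zero

theorem symbolFactor_add (g : G) (v w : G →₀ ℤ) :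
    symbolFactor ρ g (v + w) = symbolFactor ρ g v * symbolFactor ρ g w := by
  classical
  exact Finsupp.prod_add_index' (fun _ => zpow_zero _)
    fun m e e' => zpow_add₀ (symbolFactor_base_ne_zero g m) e e'

theorem symbolFactor_ne_zero (g : G) (v : G →₀ ℤ) : symbolFactor ρ g v ≠ 0 := by
  classical
  exact Finset.prod_ne_zero_iff.2 fun m _ => zpow_ne_zero _ (symbolFactor_base_ne_zero g m)

theorem symbolFactor_sub (g : G) (v w : G →₀ ℤ) :
    symbolFactor ρ g (v - w) = symbolFactor ρ g v * (symbolFactor ρ g w)⁻¹ := by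
  rw [eq_mul_inv_iff_mul_eq₀ (symbolFactor_ne_zero g w), ← symbolFactor_add, sub_add_cancel]

open Classical in
theorem symbolFactor_single (g h : G) : symbolFactor ρ g (Finsupp.single h 1) =
    if WellOrderingRel h g then ρ.evenPart g h else 1 := by
  rw [symbolFactor, Finsupp.prod_single_index (zpow_zero _), zpow_one]

/-- The invertible symbol of degree `g`, as an operator. -/
noncomputable def symbol (g : G) : (Operators ρ d R)ˣ where
  val :=
    { toFun := fun φ v => symbolFactor ρ g v • twist g (φ (v - Finsupp.single g 1))
      map_add' := fun φ ψ => by funext v; simp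
      map_smul' := fun a φ => by
        funext v
        simp only [Pi.smul_apply, map_smul, RingHom.id_apply]
        exact smul_comm _ _ _ }
  inv :=
    { toFun := fun φ v =>
        (symbolFactor ρ g (v + Finsupp.single g 1))⁻¹ • twist (-g) (φ (v + Finsupp.single g 1))
      map_add' := fun φ ψ => by funext v; simp
      map_smul' := fun a φ => by
        funext v
        simp only [Pi.smul_apply, map_smul, RingHom.id_apply]
        exact smul_comm _ _ _ }
  val_inv := by
    refine LinearMap.ext fun φ => funext fun v => ?_
    simp [twist_twist, twist_zero, smul_smul, symbolFactor_ne_zero]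
  inv_val := by
    refine LinearMap.ext fun φ => funext fun v => ?_
    simp [twist_twist, twist_zero, smul_smul, symbolFactor_ne_zero]

theorem symbol_apply (g : G) (φ : (G →₀ ℤ) → RhoSeries ρ d R) (v) :
    (symbol g : (Operators ρ d R)ˣ).1 φ v =
      symbolFactor ρ g v • twist g (φ (v - Finsupp.single g 1)) := rfl

theorem symbol_mul_leftMul {i : G} {f : RhoSeries ρ d R} (hf : IsHomogeneous i f) (g : G) :
    (symbol g).1 * leftMul f = ρ.evenPart g i • (leftMul f * (symbol g).1) := by
  refine LinearMap.ext fun φ => funext fun v => ?_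
  simp only [Module.End.mul_apply, LinearMap.smul_apply, Pi.smul_apply, leftMul_apply, symbol_apply,
    hf.twist_mul, mul_smul_comm]
  rw [smul_comm]

/-- Both products twist by `g + h` and shift the exponent by both symbols. They differ only in which
symbol passes the other on the way to its place in the well order, and the case `g = h` uses
`evenPart_self`. -/
theorem symbol_mul_symbol (g h : G) : (symbol g : (Operators ρ d R)ˣ).1 * (symbol h).1 =
    ρ.evenPart g h • ((symbol h).1 * (symbol g).1) := by
  classical
  refine LinearMap.ext fun φ => funext fun v => ?_
  simp only [Module.End.mul_apply, LinearMap.smul_apply, Pi.smul_apply, symbol_apply, map_smul,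
    twist_twist, smul_smul]
  rw [sub_right_comm, add_comm h g]
  congr 1
  rw [symbolFactor_sub, symbolFactor_sub, symbolFactor_single, symbolFactor_single]
  rcases trichotomous_of WellOrderingRel g h with hgh | rfl | hgh
  · rw [if_pos hgh, if_neg (asymm_of WellOrderingRel hgh), ρ.evenPart.swap h g]
    simp only [inv_inv, inv_one]; ring
  · rw [ρ.evenPart_self, if_neg (irrefl_of WellOrderingRel g)]; ring
  · rw [if_pos hgh, if_neg (asymm_of WellOrderingRel hgh)]
    have := ρ.evenPart.ne_zero g h
    field_simp

end RhoSeries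

/-! ### Ordered products -/

section OrderedProducts

variable {𝕂 ι : Type*} [Field 𝕂]

/-- The product of the `q a b` over all pairs `a`, `b` of entries, `a` before `b`. -/
def List.pairProd (q : ι → ι → 𝕂) : List ι → 𝕂
  | [] => 1
  | a :: l => (l.map (q a)).prod * List.pairProd q l

theorem List.pairProd_map {ι' : Type*} (q : ι → ι → 𝕂) (σ : ι' → ι) (l : List ι') :
    (l.map σ).pairProd q = l.pairProd fun a b => q (σ a) (σ b) := by
  induction l with
  | nil => rfl
  | cons a l ih => simp [List.pairProd, ih, Function.comp_def]

theorem List.pairProd_eq_prod [LinearOrder ι] (q : ι → ι → 𝕂) {l : List ι} (hl : l.Pairwise (· < ·)) :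
    l.pairProd q = ∏ a ∈ l.toFinset, ∏ b ∈ l.toFinset.filter (a < ·), q a b := by
  induction l with
  | nil => simp [List.pairProd]
  | cons a l ih =>
    rw [List.pairwise_cons] at hl
    have hal : a ∉ l.toFinset := fun h => lt_irrefl a (hl.1 a (List.mem_toFinset.1 h))
    have hnd : l.Nodup := hl.2.imp ne_of_lt
    rw [List.pairProd, ih hl.2, List.toFinset_cons, Finset.prod_insert hal]
    congr 1
    · rw [Finset.filter_insert, if_neg (lt_irrefl a), Finset.filter_true_of_mem
        (fun b hb => hl.1 b (List.mem_toFinset.1 hb)), List.prod_toFinset _ hnd]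
    · refine Finset.prod_congr rfl fun b hb => ?_
      rw [Finset.filter_insert, if_neg (hl.1 b (List.mem_toFinset.1 hb)).not_gt]

theorem pairProd_sort_univ [Fintype ι] [LinearOrder ι] (q : ι → ι → 𝕂) :
    (Finset.univ.sort).pairProd q = ∏ a : ι, ∏ b ∈ Finset.univ.filter (a < ·), q a b := by
  rw [List.pairProd_eq_prod q (Finset.sortedLT_sort _).pairwise, Finset.sort_toFinset]

variable {B : Type*} [Ring B] [Algebra 𝕂 B]

theorem List.prod_map_mul_of_commute (u x : ι → B) (h : ∀ a b, Commute (x a) (u b)) (l : List ι) :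
    (l.map fun a => u a * x a).prod = (l.map u).prod * (l.map x).prod := by
  induction l with
  | nil => simp
  | cons a l ih =>
    have h1 : Commute (x a) (l.map u).prod := Commute.list_prod_right _ _ fun y hy => by
      obtain ⟨b, -, rfl⟩ := List.mem_map.1 hy
      exact h a b
    rw [List.map_cons, List.prod_cons, ih, List.map_cons, List.prod_cons, List.map_cons,
      List.prod_cons, mul_assoc, ← mul_assoc (x a), h1.eq]
    simp only [mul_assoc]

theorem List.mul_prod_map_smul (c : ι → 𝕂) (y : B) (x : ι → B)
    (h : ∀ a, y * x a = c a • (x a * y)) (l : List ι) :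
    y * (l.map x).prod = (l.map c).prod • ((l.map x).prod * y) := by
  induction l with
  | nil => simp
  | cons a l ih =>
    rw [List.map_cons, List.prod_cons, ← mul_assoc, h a, smul_mul_assoc, mul_assoc, ih,
      mul_smul_comm, smul_smul, List.map_cons, List.prod_cons, mul_assoc]

/-- All the `x` are collected on the left: every `y a` passes each `x b` that stands after it. -/
theorem List.prod_map_mul_of_smul (c : ι → ι → 𝕂) (x y : ι → B)
    (h : ∀ a b, y a * x b = c a b • (x b * y a)) (l : List ι) :
    (l.map fun a => x a * y a).prod = l.pairProd c • ((l.map x).prod * (l.map y).prod) := by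
  induction l with
  | nil => simp [List.pairProd]
  | cons a l ih =>
    rw [List.map_cons, List.prod_cons, ih, mul_smul_comm, mul_assoc, ← mul_assoc (y a),
      List.mul_prod_map_smul (c a) (y a) x (h a), smul_mul_assoc, mul_smul_comm, smul_smul,
      List.pairProd, mul_comm (List.prod _) (List.pairProd _ _)]
    simp only [List.map_cons, List.prod_cons, mul_assoc]

variable [LinearOrder ι]

theorem List.mul_prod_map_orderedInsert (q : ι → ι → 𝕂) (u : ι → B)
    (h : ∀ a b, u a * u b = q a b • (u b * u a)) (a : ι) {l : List ι} (hl : l.Pairwise (· ≤ ·)) :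
    u a * (l.map u).prod = (l.map fun b => if b < a then q a b else 1).prod •
      ((l.orderedInsert (· ≤ ·) a).map u).prod := by
  induction l with
  | nil => simp
  | cons b l ih =>
    rw [List.pairwise_cons] at hl
    by_cases hab : a ≤ b
    · rw [List.orderedInsert_cons_of_le _ _ hab]
      have : ((b :: l).map fun b => if b < a then q a b else 1).prod = 1 := by
        refine List.prod_eq_one fun x hx => ?_
        obtain ⟨c, hc, rfl⟩ := List.mem_map.1 hx
        rw [if_neg]
        rcases List.mem_cons.1 hc with rfl | hc
        · exact hab.not_gt
        · exact (hab.trans (hl.1 c hc)).not_gt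
      rw [this, one_smul]; simp only [List.map_cons, List.prod_cons]
    · rw [List.orderedInsert_of_not_le _ _ hab]
      simp only [List.map_cons, List.prod_cons]
      rw [if_pos (not_le.1 hab), ← mul_assoc, h a b, smul_mul_assoc, mul_assoc, ih hl.2,
        mul_smul_comm, smul_smul]

/-- Insertion sort realises the reordering by exchanges of neighbours, one for each inversion of the
list. -/
theorem List.prod_map_insertionSort (q : ι → ι → 𝕂) (u : ι → B)
    (h : ∀ a b, u a * u b = q a b • (u b * u a)) (l : List ι) :
    (l.map u).prod = l.pairProd (fun a b => if b < a then q a b else 1) •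
      ((l.insertionSort (· ≤ ·)).map u).prod := by
  induction l with
  | nil => simp [List.pairProd]
  | cons a l ih =>
    -- The factor for inserting `a` depends only on which entries follow it, not on their order, so
    -- it may be read off from `l` instead of its sorted version.
    rw [List.map_cons, List.prod_cons, ih, mul_smul_comm,
      List.mul_prod_map_orderedInsert q u h a (List.pairwise_insertionSort _ l), smul_smul,
      List.insertionSort_cons, List.pairProd, mul_comm,
      ((List.perm_insertionSort (· ≤ ·) l).map _).prod_eq]

theorem prod_map_sort_perm [Fintype ι] (q : ι → ι → 𝕂) (u : ι → B)
    (h : ∀ a b, u a * u b = q a b • (u b * u a)) (σ : Equiv.Perm ι) :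
    (Finset.univ.sort.map fun a => u (σ a)).prod =
      (∏ j, ∏ k ∈ Finset.univ.filter (j < ·), if σ k < σ j then q (σ j) (σ k) else 1) •
        (Finset.univ.sort.map u).prod := by
  have h1 := List.prod_map_insertionSort q u h ((Finset.univ.sort (α := ι)).map σ)
  have h2 : ((Finset.univ.sort (α := ι)).map σ).insertionSort (· ≤ ·) = Finset.univ.sort := by
    refine List.Perm.eq_of_pairwise' (r := (· ≤ ·)) (List.pairwise_insertionSort _ _)
      (Finset.pairwise_sort _ _) ?_
    refine (List.perm_insertionSort _ _).trans ?_
    rw [List.perm_ext_iff_of_nodup ((Finset.sort_nodup _ _).map σ.injective) (Finset.sort_nodup _ _)]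
    intro a
    simp only [List.mem_map, Finset.mem_sort, Finset.mem_univ, true_and, iff_true]
    exact ⟨σ.symm a, σ.apply_symm_apply a⟩
  rw [h2, List.pairProd_map, pairProd_sort_univ, List.map_map] at h1
  exact h1

/-- The sign counts inversions; the formula for `Fin` is transported along the order isomorphism. -/
theorem sign_eq_prod_prod [Fintype ι] (σ : Equiv.Perm ι) :
    ((Equiv.Perm.sign σ : ℤ) : 𝕂) =
      ∏ j, ∏ k ∈ Finset.univ.filter (j < ·), if σ k < σ j then (-1 : 𝕂) else 1 := by
  let e : Fin (Fintype.card ι) ≃o ι := Fintype.orderIsoFinOfCardEq ι rfl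
  rw [← Equiv.Perm.sign_permCongr e.symm.toEquiv σ, Equiv.Perm.sign_eq_prod_prod_Ioi]
  push_cast
  rw [← Equiv.prod_comp e.toEquiv]
  refine Finset.prod_congr rfl fun j _ => ?_
  refine Finset.prod_bij (fun k _ => e k) ?_ ?_ ?_ ?_
  · intro k hk
    simpa using hk
  · intro k _ k' _ h
    exact e.injective h
  · intro k hk
    exact ⟨e.symm k, by simpa [← e.lt_iff_lt] using hk, e.apply_symm_apply k⟩
  · intro k hk
    have hjk : j ≠ k := (Finset.mem_Ioi.1 hk).ne
    have h1 : σ (e j) ≠ σ (e k) := fun h => hjk (e.injective (σ.injective h))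
    have h2 : ((e.symm.toEquiv.permCongr σ) j < (e.symm.toEquiv.permCongr σ) k) ↔
        σ (e j) < σ (e k) := by
      simp [Equiv.permCongr_apply]
    rw [apply_ite Units.val]
    rcases lt_or_gt_of_ne h1 with h | h
    · rw [if_pos (h2.2 h)]; simp [h.not_gt]
    · rw [if_neg (by rw [h2]; exact h.not_gt)]; simp [h]

end OrderedProducts

/-! ### Commutation up to a factor -/

section QCommute

variable {𝕂 B : Type*} [Field 𝕂] [Ring B] [Algebra 𝕂 B]

/-- `x` and `y` commute up to the factor `c`. -/
def QCommute (c : 𝕂) (x y : B) : Prop := x * y = c • (y * x)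

theorem QCommute.mul_right {c c' : 𝕂} {x y y' : B} (h : QCommute c x y) (h' : QCommute c' x y') :
    QCommute (c * c') x (y * y') := by
  rw [QCommute] at *
  rw [← mul_assoc, h, smul_mul_assoc, mul_assoc, h', mul_smul_comm, smul_smul, mul_assoc]

theorem QCommute.symm {c : 𝕂} {x y : B} (hc : c ≠ 0) (h : QCommute c x y) : QCommute c⁻¹ y x := by
  rw [QCommute] at *
  rw [h, smul_smul, inv_mul_cancel₀ hc, one_smul]

theorem QCommute.mul_left {c c' : 𝕂} {x x' y : B} (h : QCommute c x y) (h' : QCommute c' x' y) :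
    QCommute (c * c') (x * x') y := by
  rw [QCommute] at *
  rw [mul_assoc, h', mul_smul_comm, ← mul_assoc, h, smul_mul_assoc, smul_smul, mul_assoc,
    mul_comm c]

theorem QCommute.inv_right {c : 𝕂} {x : B} {u : Bˣ} (hc : c ≠ 0) (h : QCommute c x u) :
    QCommute c⁻¹ x (u⁻¹).1 := by
  rw [QCommute] at *
  have h1 : (u⁻¹).1 * (x * u.1) * (u⁻¹).1 = c • ((u⁻¹).1 * (u.1 * x) * (u⁻¹).1) := by
    rw [h, mul_smul_comm, smul_mul_assoc]
  rw [Units.inv_mul_cancel_left, mul_assoc, Units.mul_inv_cancel_right] at h1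
  rw [h1, smul_smul, inv_mul_cancel₀ hc, one_smul]

theorem QCommute.inv_left {c : 𝕂} {x : B} {u : Bˣ} (hc : c ≠ 0) (h : QCommute c u.1 x) :
    QCommute c⁻¹ (u⁻¹).1 x := by
  have := (h.symm hc).inv_right (inv_ne_zero hc)
  have h2 := this.symm (inv_ne_zero (inv_ne_zero hc))
  rwa [inv_inv] at h2

end QCommute

/-! ### Graded determinants as ordinary determinants of conjugated entries. -/

namespace RhoSeries

variable {G 𝕂 κ : Type*} [AddCommGroup G] [Field 𝕂] [Fintype κ] [LinearOrder κ]
  {ρ : CommutationFactor G 𝕂} {d : κ → G} {R : Type*} [CommRing R] [Algebra 𝕂 R]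

/-- The units `u k` behave like even symbols of degrees `J k`. -/
structure IsSymbolFamily {ι : Type*} (J : ι → G) (u : ι → (Operators ρ d R)ˣ) : Prop where
  leftMul : ∀ k i (f : RhoSeries ρ d R), IsHomogeneous i f →
    QCommute (ρ.evenPart (J k) i) (u k).1 (leftMul f)
  symbol : ∀ k l, QCommute (ρ.evenPart (J k) (J l)) (u k).1 (u l).1

theorem isSymbolFamily_symbol {ι : Type*} (J : ι → G) :
    IsSymbolFamily (ρ := ρ) (d := d) (R := R) J fun k => symbol (J k) where
  leftMul k _ _ hf := symbol_mul_leftMul hf (J k)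
  symbol k l := symbol_mul_symbol (J k) (J l)

/-- Inverse symbols have the opposite degrees. This family serves for the determinants of graded
transposes, the next one for shifts of degrees. -/
theorem IsSymbolFamily.inv {ι : Type*} {J : ι → G} {u : ι → (Operators ρ d R)ˣ}
    (hu : IsSymbolFamily J u) : IsSymbolFamily (fun k => - J k) fun k => (u k)⁻¹ where
  leftMul k i f hf := by
    rw [ρ.evenPart.neg_left]
    exact (hu.leftMul k i f hf).inv_left (ρ.evenPart.ne_zero _ _)
  symbol k l := by
    rw [ρ.evenPart.neg_left, ρ.evenPart.neg_right]
    exact ((hu.symbol k l).inv_left (ρ.evenPart.ne_zero _ _)).inv_right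
      (inv_ne_zero (ρ.evenPart.ne_zero _ _))

theorem isSymbolFamily_symbol_mul {ι : Type*} (J : ι → G) (i : G) :
    IsSymbolFamily (ρ := ρ) (d := d) (R := R) (fun k => J k + i)
      fun k => symbol (J k) * symbol i where
  leftMul k _ _ hf := by
    rw [ρ.evenPart.add_left]
    exact QCommute.mul_left (symbol_mul_leftMul hf (J k)) (symbol_mul_leftMul hf i)
  symbol k l := by
    rw [ρ.evenPart.add_left, ρ.evenPart.add_right, ρ.evenPart.add_right]
    exact QCommute.mul_left
      (QCommute.mul_right (symbol_mul_symbol _ _) (symbol_mul_symbol _ _))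
      (QCommute.mul_right (symbol_mul_symbol _ _) (symbol_mul_symbol _ _))

/-- The conjugated entry has total degree zero, so the factors from passing its three constituents
cancel. -/
theorem IsSymbolFamily.commute_conj {ι : Type*} {J : ι → G} {u : ι → (Operators ρ d R)ˣ}
    (hu : IsSymbolFamily J u) {k l : ι} {f : RhoSeries ρ d R} (hf : IsHomogeneous (J k - J l) f)
    (m : ι) : Commute (u m).1 ((u k)⁻¹.1 * RhoSeries.leftMul f * (u l).1) := by
  have h := (((hu.symbol m k).inv_right (ρ.evenPart.ne_zero _ _)).mul_right
    (hu.leftMul m _ f hf)).mul_right (hu.symbol m l)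
  have hc : (ρ.evenPart (J m) (J k))⁻¹ * ρ.evenPart (J m) (J k - J l) * ρ.evenPart (J m) (J l) = 1 := by
    rw [ρ.evenPart.sub_right]
    have := ρ.evenPart.ne_zero (J m) (J k)
    have := ρ.evenPart.ne_zero (J m) (J l)
    field_simp
  rw [hc, QCommute, one_smul] at h
  exact h

variable {ι : Type*} [Fintype ι] [LinearOrder ι]

theorem isHomogeneous_list_prod {α : Type*} (I : α → G) (f : α → RhoSeries ρ d R)
    (hf : ∀ a, IsHomogeneous (I a) (f a)) (l : List α) :
    IsHomogeneous (l.map I).sum (l.map f).prod := by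
  induction l with
  | nil => exact isHomogeneous_one
  | cons a l ih => exact (hf a).mul ih

theorem sum_map_sort (I : ι → G) : ((Finset.univ.sort (α := ι)).map I).sum = ∑ k, I k := by
  conv_rhs => rw [← Finset.sort_toFinset (Finset.univ : Finset ι) (r := (· ≤ ·))]
  exact (List.sum_toFinset _ (Finset.sort_nodup _ _)).symm

/-- The degrees `J k - J (σ k)` add up to zero because `σ` permutes the indices. -/
theorem isHomogeneous_orderedProd (J : ι → G) {F : Matrix ι ι (RhoSeries ρ d R)}
    (hF : ∀ k l, IsHomogeneous (J k - J l) (F k l)) (σ : Equiv.Perm ι) :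
    IsHomogeneous 0 (orderedProd fun k => F k (σ k)) := by
  have h := isHomogeneous_list_prod (fun k => J k - J (σ k)) (fun k => F k (σ k))
    (fun k => hF k (σ k)) (Finset.univ.sort (α := ι))
  rwa [sum_map_sort, Finset.sum_sub_distrib, Equiv.sum_comp σ J, sub_self] at h

theorem isHomogeneous_rhoDetAux (ε : 𝕂) (J J' : ι → G) {F : Matrix ι ι (RhoSeries ρ d R)}
    (hF : ∀ k l, IsHomogeneous (J k - J l) (F k l)) : IsHomogeneous 0 (rhoDetAux ε ρ J' F) :=
  IsHomogeneous.sum fun σ _ => (isHomogeneous_orderedProd J hF σ).smul _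

/-- The summands of the graded determinant are the products of the conjugated entries. -/
theorem IsSymbolFamily.prod_conj {J : ι → G} {u : ι → (Operators ρ d R)ˣ}
    (hu : IsSymbolFamily J u) {s : 𝕂} (hJ : ∀ k, ρ (J k) (J k) = s)
    {F : Matrix ι ι (RhoSeries ρ d R)} (hF : ∀ k l, IsHomogeneous (J k - J l) (F k l))
    (σ : Equiv.Perm ι) :
    ((Equiv.Perm.sign σ : ℤ) : 𝕂) • (Finset.univ.sort.map fun k =>
      (u k)⁻¹.1 * RhoSeries.leftMul (F k (σ k)) * (u (σ k)).1).prod =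
    RhoSeries.leftMul ((∏ j, ∏ k ∈ Finset.univ.filter (j < ·),
      ρ (J (σ j)) (J k - J (σ k)) * (if σ k < σ j then (-s) * ρ (J (σ j)) (J (σ k)) else 1)) •
        orderedProd fun k => F k (σ k)) := by
  set L : List ι := Finset.univ.sort with hL
  set x : ι → Operators ρ d R := fun k => (u k)⁻¹.1 * RhoSeries.leftMul (F k (σ k)) * (u (σ k)).1
  -- The conjugates commute with all `u k`, so multiplying the product by all the `u k` in front
  -- cancels every `(u k)⁻¹`. In what remains, the `u (σ k)` are moved behind the entries (`h3`) and
  -- then sorted (`h4`).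
  have h1 := List.prod_map_mul_of_commute (fun k => (u k).1) x
    (fun a b => (hu.commute_conj (hF a (σ a)) b).symm) L
  have h2 : ∀ k, (u k).1 * x k = RhoSeries.leftMul (F k (σ k)) * (u (σ k)).1 := fun k => by
    simp only [x, mul_assoc, Units.mul_inv_cancel_left]
  have h3 := List.prod_map_mul_of_smul (fun a b => ρ.evenPart (J (σ a)) (J b - J (σ b)))
    (fun k => RhoSeries.leftMul (F k (σ k))) (fun k => (u (σ k)).1)
    (fun a b => hu.leftMul (σ a) _ _ (hF b (σ b))) L
  have h4 := prod_map_sort_perm (fun a b => ρ.evenPart (J a) (J b)) (fun k => (u k).1)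
    hu.symbol σ
  have h5 : (L.map fun k => RhoSeries.leftMul (F k (σ k))).prod =
      RhoSeries.leftMul (orderedProd fun k => F k (σ k)) := by
    rw [orderedProd, map_list_prod, List.map_map]
    rfl
  simp only [h2] at h1
  rw [h1] at h3
  rw [← hL] at h4
  rw [h4, h5, hL, pairProd_sort_univ, ← hL] at h3
  -- The product of the entries has degree zero and commutes with the symbols, so the sorted product
  -- of the `u k` stands on the same side in both expressions and can be cancelled as a unit.
  have h6 : ∀ (l : List ι), Commute (l.map fun k => (u k).1).prod
      (RhoSeries.leftMul (orderedProd fun k => F k (σ k))) := by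
    intro l
    refine Commute.list_prod_left _ _ fun y hy => ?_
    obtain ⟨k, -, rfl⟩ := List.mem_map.1 hy
    have := hu.leftMul k 0 _ (isHomogeneous_orderedProd J hF σ)
    rwa [ρ.evenPart.zero_right, QCommute, one_smul] at this
  have h7 : IsUnit (L.map fun k => (u k).1).prod := by
    rw [show (L.map fun k => (u k).1) = (L.map u).map (Units.coeHom _) by
      rw [List.map_map]; rfl, ← map_list_prod]
    exact Units.isUnit _
  rw [mul_smul_comm, ← (h6 L).eq, smul_smul, ← mul_smul_comm] at h3
  rw [h7.mul_left_cancel h3, smul_smul, map_smul]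
  congr 1
  rw [sign_eq_prod_prod (𝕂 := 𝕂) σ]
  simp only [← Finset.prod_mul_distrib]
  refine Finset.prod_congr rfl fun j _ => Finset.prod_congr rfl fun k _ => ?_
  -- For constant parity the differences of degrees are even, so `ρ` and its even part agree there.
  -- On two of the `J` they differ by `s`. Together with the `-1` for each inversion in the sign of
  -- `σ` this gives the coefficient `-s`.
  have h8 : ρ.evenPart (J (σ j)) (J k - J (σ k)) = ρ (J (σ j)) (J k - J (σ k)) := by
    rw [ρ.evenPart_apply, ρ.superSign_of_isEven_right, mul_one]
    rw [CommutationFactor.IsEven, ρ.self_sub, hJ (σ k), ← hJ k, ρ.self_mul_self]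
  have h9 : ρ.evenPart (J (σ j)) (J (σ k)) = s * ρ (J (σ j)) (J (σ k)) := by
    rw [ρ.evenPart_apply, ρ.superSign_eq_of_self_eq (by rw [hJ, hJ]), hJ, mul_comm]
  rw [h8, h9]
  split_ifs <;> ring

/-- The graded determinant as the determinant of a matrix over a commutative ring. -/
theorem IsSymbolFamily.leftMul_rhoDetAux {J : ι → G} {u : ι → (Operators ρ d R)ˣ}
    (hu : IsSymbolFamily J u) {s : 𝕂} (hJ : ∀ k, ρ (J k) (J k) = s)
    {F : Matrix ι ι (RhoSeries ρ d R)} (hF : ∀ k l, IsHomogeneous (J k - J l) (F k l))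
    {S : Type*} [CommRing S] (φ : S →+* Operators ρ d R) (N : Matrix ι ι S)
    (hN : ∀ k l, φ (N k l) = (u k)⁻¹.1 * RhoSeries.leftMul (F k l) * (u l).1) :
    RhoSeries.leftMul (rhoDetAux (-s) ρ J F) = φ N.det := by
  rw [← Matrix.det_transpose, Matrix.det_apply', map_sum, rhoDetAux, map_sum]
  refine Finset.sum_congr rfl fun σ _ => ?_
  rw [← hu.prod_conj hJ hF σ, map_mul, map_intCast, ← zsmul_eq_mul]
  refine (Int.cast_smul_eq_zsmul 𝕂 _ (_ : Operators ρ d R)).trans (congrArg _ ?_)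
  have h : (∏ k, N.transpose (σ k) k) = ((Finset.univ.sort (α := ι)).map fun k => N k (σ k)).prod := by
    conv_lhs => rw [← Finset.sort_toFinset (Finset.univ : Finset ι) (r := (· ≤ ·))]
    exact List.prod_toFinset _ (Finset.sort_nodup _ _)
  rw [h, map_list_prod, List.map_map]
  congr 1
  exact List.map_congr_left fun k _ => (hN k (σ k)).symm

end RhoSeries

/-! ### Nilpotent matrices with vanishing traces -/

section Trace

open Polynomial in
/-- If a nilpotent matrix and all its powers have trace `0`, then `det (1 + t M)` is constant. -/
theorem Matrix.derivative_det_one_add_X_smul_eq_zero {S n : Type*} [CommRing S] [Fintype n]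
    [DecidableEq n] (M : Matrix n n S) (hM : IsNilpotent M)
    (htr : ∀ k : ℕ, (M ^ (k + 1)).trace = 0) :
    derivative (det (1 + (X : S[X]) • M.map C)) = 0 := by
  set f := det (1 + (X : S[X]) • M.map C) with hf
  obtain ⟨m, hm⟩ := hM
  set N : Matrix n n S[X] := (X : S[X]) • M.map C with hN
  have hMC : ∀ k, (M.map C) ^ k = (M ^ k).map (C : S →+* S[X]) := fun k =>
    (map_pow (C : S →+* S[X]).mapMatrix M k).symm
  have hNk : ∀ k, N ^ k = (X : S[X]) ^ k • (M ^ k).map C := fun k => by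
    rw [hN, _root_.smul_pow, hMC]
  -- The inverse of `1 + N` is a finite geometric series, so the trace of `W` times the matrix is a
  -- combination of traces of positive powers.
  set W : Matrix n n S[X] := ∑ k ∈ Finset.range m, (-N) ^ k with hW
  have hNW : (1 + N) * W = 1 := by
    have h := mul_neg_geom_sum (-N) m
    rw [sub_neg_eq_add] at h
    rw [hW, h, neg_pow, hNk, hm]
    simp
  have htrW : (W * M.map C).trace = 0 := by
    rw [hW, Finset.sum_mul, Matrix.trace_sum]
    refine Finset.sum_eq_zero fun k _ => ?_
    have h1 : (-N) ^ k * M.map C = ((-1 : S[X]) ^ k * X ^ k) • (M ^ (k + 1)).map C := by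
      rw [← neg_one_smul S[X] N, _root_.smul_pow, hNk, smul_smul, Matrix.smul_mul, pow_succ,
        Matrix.map_mul]
    rw [h1, Matrix.trace_smul]
    have h2 : ((M ^ (k + 1)).map (C : S →+* S[X])).trace = C (M ^ (k + 1)).trace :=
      (AddMonoidHom.map_trace (C : S →+* S[X]).toAddMonoidHom _).symm
    rw [h2, htr, map_zero, smul_zero]
  -- With `T` for the outer variable this is `f (T + X) = det (1 + N) * det (1 + T W M)`. Taking the
  -- derivative at `T = 0` reduces the derivative of `f` at an arbitrary point to the trace formula
  -- at zero.
  have h1 : (f.map (C : S →+* S[X])).comp (X + C X) =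
      C (det (1 + N)) * det (1 + (X : S[X][X]) • (W * M.map C).map C) := by
    have h2 : (f.map (C : S →+* S[X])).comp (X + C X) =
        ((Polynomial.compRingHom (X + C X)).comp (Polynomial.mapRingHom (C : S →+* S[X]))) f := rfl
    rw [h2, hf, RingHom.map_det, ← RingHom.map_det, RingHom.map_det, RingHom.map_det, ← Matrix.det_mul]
    congr 1
    have h3 : (C : S[X] →+* S[X][X]).mapMatrix (1 + N) * (C : S[X] →+* S[X][X]).mapMatrix W = 1 := by
      rw [← map_mul, hNW, map_one]
    have h4 : (W * M.map C).map (C : S[X] →+* S[X][X]) =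
      (C : S[X] →+* S[X][X]).mapMatrix W * (C : S[X] →+* S[X][X]).mapMatrix (M.map C) := by
      rw [← map_mul]; rfl
    rw [mul_add, mul_one, h4, Matrix.mul_smul, ← mul_assoc, h3, one_mul, map_add, map_one, map_add,
      map_one, add_assoc]
    congr 1
    ext1 i j
    simp [hN]
    ring
  have h2 := congrArg (fun g => (derivative g).eval 0) h1
  simp only [derivative_C_mul, eval_mul, derivative_det_one_add_X_smul, htrW, mul_zero] at h2
  rw [derivative_comp, eval_mul, eval_comp, derivative_map] at h2
  simpa [eval_map, eval₂_C_X] using h2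

-- The polynomial `det (1 + t M)` has zero derivative, and without integer torsion it is then
-- constant. Its values at `0` and `1` are compared.
open Polynomial in
theorem Matrix.det_one_add_eq_one {S n : Type*} [CommRing S] [Fintype n] [DecidableEq n]
    (hS : ∀ (k : ℕ) (x : S), ((k + 1 : ℕ) : S) * x = 0 → x = 0) (M : Matrix n n S)
    (hM : IsNilpotent M) (htr : ∀ k : ℕ, (M ^ (k + 1)).trace = 0) : det (1 + M) = 1 := by
  set f := det (1 + (X : S[X]) • M.map C) with hf
  have h := M.derivative_det_one_add_X_smul_eq_zero hM htr
  have hfC : f = C (f.coeff 0) := by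
    ext k
    cases k with
    | zero => simp
    | succ k =>
      rw [coeff_C_succ]
      have h1 := congrArg (fun g => g.coeff k) h
      simp only [coeff_derivative, coeff_zero] at h1
      refine hS k _ ?_
      rw [mul_comm]
      exact_mod_cast h1
  have h0 : f.eval 0 = 1 := by
    rw [hf, ← coe_evalRingHom, RingHom.map_det, map_add, map_one]
    have : (evalRingHom (0 : S)).mapMatrix ((X : S[X]) • M.map C) = 0 := by
      ext i j; simp
    rw [this, add_zero, det_one]
  have h1 : f.eval 1 = det (1 + M) := by
    rw [hf, ← coe_evalRingHom, RingHom.map_det, map_add, map_one]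
    congr 2
    ext i j; simp
  rw [← h1, hfC, eval_C]
  rw [hfC, eval_C] at h0
  exact h0

/-- The previous statement for minus the block diagonal matrix with blocks `X` and `Y`: only the
sums of the traces need to vanish. -/
theorem Matrix.det_one_sub_mul_det_one_sub {S p q : Type*} [CommRing S] [Fintype p] [Fintype q]
    [DecidableEq p] [DecidableEq q]
    (hS : ∀ (k : ℕ) (x : S), ((k + 1 : ℕ) : S) * x = 0 → x = 0) (X : Matrix p p S)
    (Y : Matrix q q S) (hX : IsNilpotent X) (hY : IsNilpotent Y)
    (htr : ∀ k : ℕ, (X ^ (k + 1)).trace + (Y ^ (k + 1)).trace = 0) :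
    det (1 - X) * det (1 - Y) = 1 := by
  have h1 : ∀ k, (-Matrix.fromBlocks X 0 0 Y) ^ k = (-1 : S) ^ k •
      Matrix.fromBlocks (X ^ k) 0 0 (Y ^ k) := fun k => by
    rw [← neg_one_smul S, smul_pow, Matrix.fromBlocks_diagonal_pow]
  have h2 : 1 + -Matrix.fromBlocks X 0 0 Y = Matrix.fromBlocks (1 - X) 0 0 (1 - Y) := by
    rw [← Matrix.fromBlocks_one, Matrix.fromBlocks_neg, Matrix.fromBlocks_add]
    simp [sub_eq_add_neg]
  rw [← Matrix.det_fromBlocks_zero₂₁ (1 - X) 0 (1 - Y), ← h2]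
  refine Matrix.det_one_add_eq_one hS _ ?_ fun k => ?_
  · obtain ⟨a, ha⟩ := hX
    obtain ⟨b, hb⟩ := hY
    refine ⟨a + b, ?_⟩
    rw [h1, pow_add X, ha, zero_mul, pow_add Y, hb, mul_zero]
    simp
  · rw [h1, Matrix.trace_smul, Matrix.trace, Fintype.sum_sum_type]
    exact (congrArg _ (htr k)).trans (smul_zero _)

end Trace

namespace RhoSeries

variable {G 𝕂 κ : Type*} [AddCommGroup G] [Field 𝕂] [Fintype κ] [LinearOrder κ]
  {ρ : CommutationFactor G 𝕂} {d : κ → G} {R : Type*} [CommRing R] [Algebra 𝕂 R]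

/-! ### The commutative ring of even operators of total degree zero -/

/-- An entry `f` of degree `k - l` turned into an operator of total degree `0`. -/
noncomputable def conj (k l : G) (f : RhoSeries ρ d R) : Operators ρ d R :=
  (symbol k)⁻¹.1 * leftMul f * (symbol l).1

theorem conj_mul (k l m : G) (f g : RhoSeries ρ d R) :
    conj k l f * conj l m g = conj k m (f * g) := by
  simp only [conj, map_mul, mul_assoc, Units.mul_inv_cancel_left]

theorem conj_one (k : G) : conj k k (1 : RhoSeries ρ d R) = 1 := by
  simp [conj]

theorem conj_sum {α : Type*} (s : Finset α) (k l : G) (f : α → RhoSeries ρ d R) :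
    conj k l (∑ a ∈ s, f a) = ∑ a ∈ s, conj k l (f a) := by
  simp only [conj, map_sum, Finset.mul_sum, Finset.sum_mul]

theorem conj_sub (k l : G) (f g : RhoSeries ρ d R) :
    conj k l (f - g) = conj k l f - conj k l g := by
  simp only [conj, map_sub, mul_sub, sub_mul]

theorem conj_zero (k l : G) : conj k l (0 : RhoSeries ρ d R) = 0 := by
  simp [conj]

theorem conj_smul (a : 𝕂) (k l : G) (f : RhoSeries ρ d R) : conj k l (a • f) = a • conj k l f := by
  simp only [conj, map_smul, mul_smul_comm, smul_mul_assoc]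

theorem qCommute_conj_symbol {k l : G} {f : RhoSeries ρ d R} (hf : IsHomogeneous (k - l) f)
    (m : G) : QCommute (1 : 𝕂) (conj k l f) (symbol m).1 := by
  rw [QCommute, one_smul]
  exact ((isSymbolFamily_symbol (ρ := ρ) (d := d) (R := R) id).commute_conj hf m).symm

/-- The symbols contribute the inverse of the even part of `ρ (k - l) i`, so of the commutation
factor only the super sign survives. -/
theorem qCommute_conj_leftMul {k l i : G} {f g : RhoSeries ρ d R} (hf : IsHomogeneous (k - l) f)
    (hg : IsHomogeneous i g) : QCommute (ρ.superSign (k - l) i) (conj k l f) (leftMul g) := by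
  have hu := isSymbolFamily_symbol (ρ := ρ) (d := d) (R := R) id
  have h1 : QCommute (ρ (k - l) i) (leftMul f) (leftMul g) := by
    rw [QCommute, ← map_mul, hf.mul_swap hg, map_smul, map_mul]
  have h := (((hu.leftMul k i g hg).inv_left (ρ.evenPart.ne_zero _ _)).mul_left h1).mul_left
    (hu.leftMul l i g hg)
  have hc : (ρ.evenPart k i)⁻¹ * ρ (k - l) i * ρ.evenPart l i = ρ.superSign (k - l) i := by
    rw [← ρ.mul_evenPart_inv, ρ.evenPart.sub_left, mul_inv, inv_inv]
    ring
  rw [← hc]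
  exact h

/-- Conjugated entries commute, except that two odd ones anticommute. This is the whole purpose of
the symbols. -/
theorem qCommute_conj_conj {k l p q : G} {f g : RhoSeries ρ d R} (hf : IsHomogeneous (k - l) f)
    (hg : IsHomogeneous (p - q) g) :
    QCommute (ρ.superSign (k - l) (p - q)) (conj k l f) (conj p q g) := by
  have h := (((qCommute_conj_symbol hf p).inv_right one_ne_zero).mul_right
    (qCommute_conj_leftMul hf hg)).mul_right (qCommute_conj_symbol hf q)
  rwa [inv_one, one_mul, mul_one] at h

variable (ρ d R) in
/-- The conjugates of the entries of even degree. -/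
def evenSet : Set (Operators ρ d R) :=
  {x | ∃ k l f, IsHomogeneous (k - l) f ∧ ρ.IsEven (k - l) ∧ x = conj k l f}

theorem evenSet_comm : ∀ x ∈ evenSet ρ d R, ∀ y ∈ evenSet ρ d R, x * y = y * x := by
  rintro _ ⟨k, l, f, hf, hkl, rfl⟩ _ ⟨p, q, g, hg, -, rfl⟩
  have h := qCommute_conj_conj hf hg
  rwa [ρ.superSign_of_isEven_left hkl, QCommute, one_smul] at h

variable (ρ d R) in
/-- The commutative ring generated by the conjugates of the entries of even degree. -/
def EvenRing : Type _ := Algebra.adjoin 𝕂 (evenSet ρ d R)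

noncomputable instance : CommRing (EvenRing ρ d R) :=
  { (inferInstanceAs (Ring (Algebra.adjoin 𝕂 (evenSet ρ d R))) : Ring (EvenRing ρ d R)) with
    mul_comm := (Algebra.isMulCommutative_adjoin 𝕂
      (evenSet_comm (ρ := ρ) (d := d) (R := R))).is_comm.comm }

/-- The inclusion of the commutative ring into the ring of operators. -/
noncomputable def toOperators : EvenRing ρ d R →+* Operators ρ d R where
  toFun x := x.1
  map_one' := rfl
  map_mul' _ _ := rfl
  map_zero' := rfl
  map_add' _ _ := rfl

theorem toOperators_injective : Function.Injective (toOperators (ρ := ρ) (d := d) (R := R)) :=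
  Subtype.val_injective

/-- The absence of torsion that is needed to recover a polynomial from its derivative; it comes from
the scalars in `𝕂`. -/
theorem evenRing_eq_zero_of_natCast_mul [CharZero 𝕂] (k : ℕ) (x : EvenRing ρ d R)
    (h : ((k + 1 : ℕ) : EvenRing ρ d R) * x = 0) : x = 0 := by
  apply toOperators_injective
  have h1 := congrArg toOperators h
  rw [map_mul, map_natCast, map_zero] at h1
  have h2 : ((k + 1 : ℕ) : 𝕂) • toOperators x = 0 := by
    rw [Nat.cast_smul_eq_nsmul, nsmul_eq_mul]
    exact h1
  rw [map_zero]
  exact (smul_eq_zero.1 h2).resolve_left (Nat.cast_ne_zero.2 (Nat.succ_ne_zero k))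

open Classical in
/-- An operator as an element of the commutative ring, where possible. -/
noncomputable def ofOperator (x : Operators ρ d R) : EvenRing ρ d R :=
  if h : x ∈ Algebra.adjoin 𝕂 (evenSet ρ d R) then ⟨x, h⟩ else 0

theorem toOperators_ofOperator {x : Operators ρ d R} (h : x ∈ evenSet ρ d R) :
    toOperators (ofOperator x) = x := by
  have h' : x ∈ Algebra.adjoin 𝕂 (evenSet ρ d R) := Algebra.subset_adjoin h
  rw [show ofOperator x = ⟨x, h'⟩ from dif_pos h']
  rfl

/-! ### Graded matrices -/

/-- The entries of `F` have the degrees `I k - J l`. -/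
def IsGraded {ι ι' : Type*} (I : ι → G) (J : ι' → G) (F : Matrix ι ι' (RhoSeries ρ d R)) : Prop :=
  ∀ k l, IsHomogeneous (I k - J l) (F k l)

section Graded

variable {ι ι' ι'' : Type*} {I : ι → G} {J : ι' → G} {K : ι'' → G}

theorem IsGraded.mul [Fintype ι'] {F : Matrix ι ι' (RhoSeries ρ d R)}
    {H : Matrix ι' ι'' (RhoSeries ρ d R)} (hF : IsGraded I J F) (hH : IsGraded J K H) :
    IsGraded I K (F * H) := by
  intro k l
  rw [Matrix.mul_apply]
  refine IsHomogeneous.sum fun m _ => ?_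
  rw [← sub_add_sub_cancel (I k) (J m) (K l)]
  exact (hF k m).mul (hH m l)

theorem isGraded_one [DecidableEq ι] : IsGraded I I (1 : Matrix ι ι (RhoSeries ρ d R)) := by
  intro k l
  rw [Matrix.one_apply]
  split_ifs with h
  · subst h
    rw [sub_self]
    exact isHomogeneous_one
  · exact isHomogeneous_zero _

theorem IsGraded.sub {F H : Matrix ι ι' (RhoSeries ρ d R)} (hF : IsGraded I J F)
    (hH : IsGraded I J H) : IsGraded I J (F - H) := fun k l => (hF k l).sub (hH k l)

theorem IsGraded.pow [Fintype ι] [DecidableEq ι] {F : Matrix ι ι (RhoSeries ρ d R)}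
    (hF : IsGraded I I F) (n : ℕ) : IsGraded I I (F ^ n) := by
  induction n with
  | zero => exact isGraded_one
  | succ n ih => rw [pow_succ]; exact ih.mul hF

/-- The inverse of a graded matrix is graded. -/
theorem IsGraded.of_mul_eq_one [Fintype ι] [DecidableEq ι]
    {F H : Matrix ι ι (RhoSeries ρ d R)} (hF : IsGraded I I F) (h1 : F * H = 1) (h2 : H * F = 1) :
    IsGraded I I H := by
  -- Keeping only the component of the expected degree in each entry of `H` leaves a right inverse
  -- of `F`. Since `F` is invertible it must be `H` itself.
  have h3 : F * (Matrix.of fun k l => component (I k - I l) (H k l)) = 1 := by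
    ext1 k l
    have h4 := congrFun (congrFun h1 k) l
    rw [Matrix.mul_apply] at h4 ⊢
    rw [← IsHomogeneous.component_eq (isGraded_one (I := I) k l), ← h4, component_sum]
    refine Finset.sum_congr rfl fun m _ => ?_
    rw [← sub_add_sub_cancel (I k) (I m) (I l), (hF k m).component_mul]
    rfl
  have h5 : H = Matrix.of fun k l => component (I k - I l) (H k l) := by
    conv_rhs => rw [← one_mul (Matrix.of _), ← h2, mul_assoc, h3, mul_one]
  intro k l
  rw [h5]
  exact isHomogeneous_component _ _

theorem IsGraded.isHomogeneous_inverse [Fintype ι] [DecidableEq ι]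
    {F : Matrix ι ι (RhoSeries ρ d R)} (hF : IsGraded I I F) : IsGraded I I (Ring.inverse F) := by
  by_cases h : IsUnit F
  · exact hF.of_mul_eq_one (Ring.mul_inverse_cancel F h) (Ring.inverse_mul_cancel F h)
  · rw [Ring.inverse_non_unit F h]
    exact fun k l => isHomogeneous_zero _

end Graded

end RhoSeries

/-! ### Properties of the graded determinant -/

namespace RhoSeries

variable {G 𝕂 κ : Type*} [AddCommGroup G] [Field 𝕂] [Fintype κ] [LinearOrder κ]
  {ρ : CommutationFactor G 𝕂} {d : κ → G} {R : Type*} [CommRing R] [Algebra 𝕂 R]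

/-- A graded matrix of constant parity as a matrix over a commutative ring. -/
noncomputable def liftMatrix {ι : Type*} (J : ι → G) (F : Matrix ι ι (RhoSeries ρ d R)) :
    Matrix ι ι (EvenRing ρ d R) := Matrix.of fun k l => ofOperator (conj (J k) (J l) (F k l))

section

variable {ι : Type*} {J : ι → G} {s : 𝕂} (hJ : ∀ k, ρ (J k) (J k) = s)
include hJ

theorem isEven_sub_of_constant (k l : ι) : ρ.IsEven (J k - J l) := by
  rw [CommutationFactor.IsEven, ρ.self_sub, hJ l, ← hJ k, ρ.self_mul_self]

theorem toOperators_liftMatrix {F : Matrix ι ι (RhoSeries ρ d R)} (hF : IsGraded J J F) (k l : ι) :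
    toOperators (liftMatrix J F k l) = conj (J k) (J l) (F k l) :=
  toOperators_ofOperator ⟨_, _, _, hF k l, isEven_sub_of_constant hJ k l, rfl⟩

theorem liftMatrix_mul [Fintype ι] {F H : Matrix ι ι (RhoSeries ρ d R)} (hF : IsGraded J J F)
    (hH : IsGraded J J H) : liftMatrix J (F * H) = liftMatrix J F * liftMatrix J H := by
  ext1 k l
  apply toOperators_injective
  rw [toOperators_liftMatrix hJ (hF.mul hH), Matrix.mul_apply, Matrix.mul_apply, map_sum, conj_sum]
  refine Finset.sum_congr rfl fun m _ => ?_
  rw [map_mul, toOperators_liftMatrix hJ hF, toOperators_liftMatrix hJ hH, conj_mul]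

theorem liftMatrix_one [DecidableEq ι] :
    liftMatrix J (1 : Matrix ι ι (RhoSeries ρ d R)) = 1 := by
  ext1 k l
  apply toOperators_injective
  rw [toOperators_liftMatrix hJ isGraded_one, Matrix.one_apply, Matrix.one_apply]
  split_ifs with h
  · rw [h, conj_one, map_one]
  · rw [conj_zero, map_zero]

theorem liftMatrix_zero : liftMatrix J (0 : Matrix ι ι (RhoSeries ρ d R)) = 0 := by
  ext1 k l
  apply toOperators_injective
  exact (toOperators_liftMatrix hJ (fun k l => isHomogeneous_zero _) k l).trans
    ((conj_zero _ _).trans (map_zero _).symm)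

theorem liftMatrix_sub {F H : Matrix ι ι (RhoSeries ρ d R)} (hF : IsGraded J J F)
    (hH : IsGraded J J H) : liftMatrix J (F - H) = liftMatrix J F - liftMatrix J H := by
  ext1 k l
  apply toOperators_injective
  rw [toOperators_liftMatrix hJ (hF.sub hH), Matrix.sub_apply, Matrix.sub_apply, map_sub, conj_sub,
    toOperators_liftMatrix hJ hF, toOperators_liftMatrix hJ hH]

theorem liftMatrix_pow [Fintype ι] [DecidableEq ι] {F : Matrix ι ι (RhoSeries ρ d R)}
    (hF : IsGraded J J F) (n : ℕ) : liftMatrix J (F ^ n) = liftMatrix J F ^ n := by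
  induction n with
  | zero => rw [pow_zero, pow_zero, liftMatrix_one hJ]
  | succ n ih => rw [pow_succ, pow_succ, liftMatrix_mul hJ (hF.pow n) hF, ih]

variable [Fintype ι] [LinearOrder ι]

/-- The parameter `s` treats both parities at once: `s = 1` gives `rhoDetEven`, and `s = -1` gives
`rhoDetOdd`. -/
theorem leftMul_rhoDetAux {F : Matrix ι ι (RhoSeries ρ d R)} (hF : IsGraded J J F) :
    leftMul (rhoDetAux (-s) ρ J F) = toOperators (liftMatrix J F).det :=
  (isSymbolFamily_symbol J).leftMul_rhoDetAux hJ hF toOperators _ (toOperators_liftMatrix hJ hF)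

theorem rhoDetAux_mul {F H : Matrix ι ι (RhoSeries ρ d R)} (hF : IsGraded J J F)
    (hH : IsGraded J J H) :
    rhoDetAux (-s) ρ J (F * H) = rhoDetAux (-s) ρ J F * rhoDetAux (-s) ρ J H := by
  apply leftMul_injective
  rw [map_mul, leftMul_rhoDetAux hJ (hF.mul hH), leftMul_rhoDetAux hJ hF, leftMul_rhoDetAux hJ hH,
    liftMatrix_mul hJ hF hH, Matrix.det_mul, map_mul]

theorem rhoDetAux_one : rhoDetAux (-s) ρ J (1 : Matrix ι ι (RhoSeries ρ d R)) = 1 := by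
  apply leftMul_injective
  rw [leftMul_rhoDetAux hJ isGraded_one, liftMatrix_one hJ, Matrix.det_one, map_one, map_one]

theorem rhoDetAux_mul_eq_one {F H : Matrix ι ι (RhoSeries ρ d R)} (hF : IsGraded J J F)
    (hH : IsGraded J J H) (h : F * H = 1) :
    rhoDetAux (-s) ρ J F * rhoDetAux (-s) ρ J H = 1 := by
  rw [← rhoDetAux_mul hJ hF hH, h, rhoDetAux_one hJ]

/-- The graded determinant of a block triangular matrix. -/
theorem rhoDetAux_blockTriangular {ι₁ ι₂ : Type*} [Fintype ι₁] [LinearOrder ι₁] [Fintype ι₂]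
    [LinearOrder ι₂] (e : ι₁ ⊕ ι₂ ≃ ι) {F : Matrix ι ι (RhoSeries ρ d R)} (hF : IsGraded J J F)
    (h0 : ∀ k l, F (e (Sum.inl k)) (e (Sum.inr l)) = 0) :
    rhoDetAux (-s) ρ J F =
      rhoDetAux (-s) ρ (fun k => J (e (Sum.inl k)))
        (F.submatrix (fun k => e (Sum.inl k)) fun k => e (Sum.inl k)) *
      rhoDetAux (-s) ρ (fun k => J (e (Sum.inr k)))
        (F.submatrix (fun k => e (Sum.inr k)) fun k => e (Sum.inr k)) := by
  classical
  apply leftMul_injective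
  have h1 : (liftMatrix J F).submatrix e e = Matrix.fromBlocks
      (liftMatrix (fun k => J (e (Sum.inl k)))
        (F.submatrix (fun k => e (Sum.inl k)) fun k => e (Sum.inl k))) 0
      (Matrix.of fun k l => liftMatrix J F (e (Sum.inr k)) (e (Sum.inl l)))
      (liftMatrix (fun k => J (e (Sum.inr k)))
        (F.submatrix (fun k => e (Sum.inr k)) fun k => e (Sum.inr k))) := by
    ext1 k l
    rcases k with k | k <;> rcases l with l | l
    · rfl
    · apply toOperators_injective
      rw [Matrix.submatrix_apply, toOperators_liftMatrix hJ hF, h0, conj_zero]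
      exact (map_zero _).symm
    · rfl
    · rfl
  rw [map_mul, leftMul_rhoDetAux hJ hF, leftMul_rhoDetAux (fun k => hJ (e (Sum.inl k)))
      (F := F.submatrix (fun k => e (Sum.inl k)) fun k => e (Sum.inl k)) (fun k l => hF _ _),
    leftMul_rhoDetAux (fun k => hJ (e (Sum.inr k)))
      (F := F.submatrix (fun k => e (Sum.inr k)) fun k => e (Sum.inr k)) (fun k l => hF _ _),
    ← map_mul,
    ← Matrix.det_fromBlocks_zero₁₂, ← h1, Matrix.det_submatrix_equiv_self]

/-- A shift of all degrees. -/
theorem rhoDetAux_shift (i : G) {F : Matrix ι ι (RhoSeries ρ d R)} (hF : IsGraded J J F) :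
    rhoDetAux (-(s * ρ i i)) ρ (fun k => J k + i) F = rhoDetAux (-s) ρ J F := by
  apply leftMul_injective
  rw [leftMul_rhoDetAux hJ hF]
  refine (isSymbolFamily_symbol_mul J i).leftMul_rhoDetAux (fun k => by rw [ρ.self_add, hJ])
    (fun k l => by rw [add_sub_add_right_eq_sub]; exact hF k l) toOperators _ fun k l => ?_
  -- A conjugate of total degree zero commutes with the additional symbol, so the shifted family
  -- produces the same matrix over the commutative ring.
  have h : conj (J k) (J l) (F k l) * (symbol i).1 = (symbol i).1 * conj (J k) (J l) (F k l) :=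
    (qCommute_conj_symbol (hF k l) i).trans (one_smul _ _)
  have h2 : (symbol (J k) * symbol i)⁻¹.1 * leftMul (F k l) * (symbol (J l) * symbol i).1 =
      (symbol i)⁻¹.1 * (conj (J k) (J l) (F k l) * (symbol i).1) := by
    simp only [mul_inv_rev, Units.val_mul, conj, mul_assoc]
  rw [toOperators_liftMatrix hJ hF, h2, h, Units.inv_mul_cancel_left]

/-- The graded transpose, whose degrees are opposite to those of `F`. -/
def gradedTranspose (ρ : CommutationFactor G 𝕂) {ι ι' : Type*} (I : ι → G) (J : ι' → G)
    (F : Matrix ι' ι (RhoSeries ρ d R)) :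
    Matrix ι ι' (RhoSeries ρ d R) := Matrix.of fun k l => ρ (J l) (I k - J l) • F l k

/-- Conjugation by the inverse symbols suits the degrees `-J`. Exchanging the symbols of degrees `J
k` and `J l` turns the result into the conjugate used for `J`, in transposed position and with
exactly the sign of `gradedTranspose`. Ordinary determinants are invariant under transposition. -/
theorem rhoDetAux_gradedTranspose {F : Matrix ι ι (RhoSeries ρ d R)}
    (hF : ∀ k l, IsHomogeneous (J l - J k) (F k l)) :
    rhoDetAux (-s) ρ (fun k => - J k) F = rhoDetAux (-s) ρ J (gradedTranspose ρ J J F) := by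
  have hT : IsGraded J J (gradedTranspose ρ J J F) := fun k l => (hF l k).smul _
  apply leftMul_injective
  rw [leftMul_rhoDetAux hJ hT, ← Matrix.det_transpose]
  refine (isSymbolFamily_symbol J).inv.leftMul_rhoDetAux (fun k => by rw [ρ.self_neg, hJ])
    (fun k l => by rw [neg_sub_neg]; exact hF k l) toOperators _ fun k l => ?_
  rw [Matrix.transpose_apply, toOperators_liftMatrix hJ hT]
  have h1 : ∀ m, conj (J l) (J k) (F k l) * (symbol m).1 =
      (symbol m).1 * conj (J l) (J k) (F k l) := fun m =>
    (qCommute_conj_symbol (hF k l) m).trans (one_smul _ _)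
  have h2 : leftMul (F k l) =
      (symbol (J l)).1 * conj (J l) (J k) (F k l) * (symbol (J k))⁻¹.1 := by
    simp only [conj, mul_assoc, Units.mul_inv_cancel_left, Units.mul_inv, mul_one]
  have h3 : (symbol (J k) : (Operators ρ d R)ˣ).1 * (symbol (J l)).1 =
      ρ (J k) (J l - J k) • ((symbol (J l)).1 * (symbol (J k)).1) := by
    rw [symbol_mul_symbol, ρ.evenPart_apply, ρ.superSign_eq_of_self_eq (by rw [hJ, hJ]), ρ.sub_right,
      ρ.inv_self, hJ, hJ]
  have h4 : (((symbol (J k))⁻¹)⁻¹).1 * leftMul (F k l) * ((symbol (J l))⁻¹).1 =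
      (symbol (J k)).1 * (symbol (J l)).1 * conj (J l) (J k) (F k l) * (symbol (J k))⁻¹.1 *
        (symbol (J l))⁻¹.1 := by
    rw [h2, inv_inv]
    simp only [mul_assoc]
  have h5 : (symbol (J l)).1 * (symbol (J k)).1 * conj (J l) (J k) (F k l) =
      conj (J l) (J k) (F k l) * ((symbol (J l)).1 * (symbol (J k)).1) := by
    rw [mul_assoc, ← h1, ← mul_assoc, ← h1, mul_assoc]
  rw [h4, h3, smul_mul_assoc, h5]
  refine (conj_smul _ _ _ _).trans ?_
  simp only [smul_mul_assoc, mul_assoc, Units.mul_inv, mul_one]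

end

/-- Conjugated odd entries anticommute, so the summands of the two traces cancel in pairs. -/
theorem sum_conj_mul_of_isOdd {ι ι' : Type*} [Fintype ι] [Fintype ι'] {J : ι → G} {J' : ι' → G}
    (hodd : ∀ k l, ρ.IsOdd (J k - J' l)) {a : Matrix ι ι' (RhoSeries ρ d R)}
    {b : Matrix ι' ι (RhoSeries ρ d R)} (ha : IsGraded J J' a) (hb : IsGraded J' J b) :
    ∑ k, conj (J k) (J k) ((a * b) k k) + ∑ l, conj (J' l) (J' l) ((b * a) l l) = 0 := by
  simp only [Matrix.mul_apply, conj_sum]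
  rw [Finset.sum_comm (γ := ι), ← Finset.sum_add_distrib]
  refine Finset.sum_eq_zero fun l _ => ?_
  rw [← Finset.sum_add_distrib]
  refine Finset.sum_eq_zero fun k _ => ?_
  have h := qCommute_conj_conj (ha k l) (hb l k)
  rw [ρ.superSign_of_isOdd (hodd k l) (by
    rw [← neg_sub, CommutationFactor.IsOdd, ρ.self_neg]; exact hodd k l), QCommute] at h
  rw [← conj_mul _ (J' l), ← conj_mul _ (J k), h, neg_one_smul, neg_add_cancel]

/-- Powers of products of odd matrices have high odd order. -/
theorem oddOrderGE_pow [NeZero (2 : 𝕂)] {ι ι' : Type*} [Fintype ι] [DecidableEq ι] [Fintype ι']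
    {J : ι → G} {J' : ι' → G} (hodd : ∀ k l, ρ.IsOdd (J k - J' l))
    {a : Matrix ι ι' (RhoSeries ρ d R)} (b : Matrix ι' ι (RhoSeries ρ d R)) (ha : IsGraded J J' a)
    (n : ℕ) (k l : ι) : OddOrderGE n (((a * b) ^ n) k l) := by
  induction n generalizing k l with
  | zero => exact oddOrderGE_zero _
  | succ n ih =>
    rw [pow_succ, Matrix.mul_apply]
    refine OddOrderGE.sum fun m _ => (ih k m).mul ?_
    rw [Matrix.mul_apply]
    refine OddOrderGE.sum fun m' _ => ?_
    exact ((ha m m').oddOrderGE_one (hodd m m')).mul (oddOrderGE_zero _)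

/-- Each factor `a` contributes an odd indeterminate to every monomial, and no monomial contains
more than `Fintype.card κ` of them. -/
theorem isNilpotent_mul_of_isOdd [NeZero (2 : 𝕂)] {ι ι' : Type*} [Fintype ι] [DecidableEq ι]
    [Fintype ι'] {J : ι → G} {J' : ι' → G} (hodd : ∀ k l, ρ.IsOdd (J k - J' l))
    {a : Matrix ι ι' (RhoSeries ρ d R)} (b : Matrix ι' ι (RhoSeries ρ d R)) (ha : IsGraded J J' a) :
    IsNilpotent (a * b) :=
  ⟨Fintype.card κ + 1, Matrix.ext fun k l => (oddOrderGE_pow hodd b ha _ k l).eq_zero (by omega)⟩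

/-- The determinants of `1 - a b` and `1 - b a` for odd matrices `a` and `b`. -/
theorem rhoDetAux_one_sub_mul_rhoDetAux_one_sub [CharZero 𝕂] {ι ι' : Type*} [Fintype ι]
    [LinearOrder ι] [Fintype ι'] [LinearOrder ι'] {J : ι → G} {J' : ι' → G} {s s' : 𝕂}
    (hJ : ∀ k, ρ (J k) (J k) = s) (hJ' : ∀ k, ρ (J' k) (J' k) = s') (hss : s * s' = -1)
    {a : Matrix ι ι' (RhoSeries ρ d R)} {b : Matrix ι' ι (RhoSeries ρ d R)}
    (ha : IsGraded J J' a) (hb : IsGraded J' J b) :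
    rhoDetAux (-s) ρ J (1 - a * b) * rhoDetAux (-s') ρ J' (1 - b * a) = 1 := by
  have hodd : ∀ k l, ρ.IsOdd (J k - J' l) := fun k l => by
    rw [CommutationFactor.IsOdd, ρ.self_sub, hJ, hJ', hss]
  have hodd' : ∀ k l, ρ.IsOdd (J' k - J l) := fun k l => by
    rw [CommutationFactor.IsOdd, ρ.self_sub, hJ, hJ', mul_comm, hss]
  have hab := ha.mul hb
  have hba := hb.mul ha
  apply leftMul_injective
  rw [map_mul, leftMul_rhoDetAux hJ (isGraded_one.sub hab),
    leftMul_rhoDetAux hJ' (isGraded_one.sub hba), ← map_mul,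
    liftMatrix_sub hJ isGraded_one hab, liftMatrix_sub hJ' isGraded_one hba, liftMatrix_one hJ,
    liftMatrix_one hJ', Matrix.det_one_sub_mul_det_one_sub evenRing_eq_zero_of_natCast_mul,
    map_one, map_one]
  · obtain ⟨n, hn⟩ := isNilpotent_mul_of_isOdd hodd b ha
    refine ⟨n, ?_⟩
    rw [← liftMatrix_pow hJ hab, hn]
    exact liftMatrix_zero hJ
  · obtain ⟨n, hn⟩ := isNilpotent_mul_of_isOdd hodd' a hb
    refine ⟨n, ?_⟩
    rw [← liftMatrix_pow hJ' hba, hn]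
    exact liftMatrix_zero hJ'
  · intro n
    apply toOperators_injective
    rw [← liftMatrix_pow hJ hab, ← liftMatrix_pow hJ' hba, map_add, Matrix.trace, Matrix.trace,
      map_sum, map_sum, map_zero]
    simp only [Matrix.diag_apply, toOperators_liftMatrix hJ (hab.pow _),
      toOperators_liftMatrix hJ' (hba.pow _)]
    -- The powers of `a b` and `b a` are again products, in the two orders, of the odd matrices `(a
    -- b) ^ n a` and `b`.
    have h1 : (a * b) ^ (n + 1) = ((a * b) ^ n * a) * b := by
      rw [pow_succ, Matrix.mul_assoc]
    have h2 : (b * a) ^ (n + 1) = b * ((a * b) ^ n * a) := by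
      clear h1
      induction n with
      | zero => simp
      | succ n ih => rw [pow_succ, ih, pow_succ]; simp only [Matrix.mul_assoc]
    rw [h1, h2]
    exact sum_conj_mul_of_isOdd hodd ((hab.pow n).mul ha) hb

end RhoSeries

/-! ### The graded Berezinian -/

theorem Ring.isUnit_and_inverse_eq {A : Type*} [Ring A] {a b : A} (h : a * b = 1) (h' : b * a = 1) :
    IsUnit a ∧ Ring.inverse a = b :=
  ⟨⟨⟨a, b, h, h'⟩, rfl⟩, Ring.inverse_unit ⟨a, b, h, h'⟩⟩

namespace RhoSeries

variable {G 𝕂 κ : Type*} [AddCommGroup G] [Field 𝕂] [Fintype κ] [LinearOrder κ]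
  {ρ : CommutationFactor G 𝕂} {d : κ → G} {R : Type*} [CommRing R] [Algebra 𝕂 R]

section Transpose

variable {ι ι' ι'' : Type*} {I : ι → G} {J : ι' → G} {K : ι'' → G}

/-- Reversing the order of the entries costs a commutation factor, which is just what distinguishes
the sign of the product from the product of the two signs. -/
theorem gradedTranspose_mul [Fintype ι'] {F : Matrix ι ι' (RhoSeries ρ d R)}
    {H : Matrix ι' ι'' (RhoSeries ρ d R)} (hF : ∀ k l, IsHomogeneous (J l - I k) (F k l))
    (hH : ∀ k l, IsHomogeneous (K l - J k) (H k l)) :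
    gradedTranspose ρ K I (F * H) = gradedTranspose ρ K J H * gradedTranspose ρ J I F := by
  ext1 k l
  simp only [gradedTranspose, Matrix.of_apply, Matrix.mul_apply, Finset.smul_sum, smul_mul_assoc,
    mul_smul_comm, smul_smul]
  refine Finset.sum_congr rfl fun m _ => ?_
  rw [(hF l m).mul_swap (hH m k), smul_smul]
  congr 1
  simp only [ρ.sub_left, ρ.sub_right, mul_inv, inv_inv, ρ.inv_self]
  have h := ρ.ne_zero (I l) (K k)
  field_simp

theorem gradedTranspose_sub (F H : Matrix ι ι' (RhoSeries ρ d R)) :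
    gradedTranspose ρ J I (F - H) = gradedTranspose ρ J I F - gradedTranspose ρ J I H := by
  ext1 k l
  exact smul_sub (ρ (I l) (J k - I l)) (F l k) (H l k)

theorem gradedTranspose_one [DecidableEq ι] :
    gradedTranspose ρ I I (1 : Matrix ι ι (RhoSeries ρ d R)) = 1 := by
  ext1 k l
  simp only [gradedTranspose, Matrix.of_apply, Matrix.one_apply]
  by_cases h : k = l
  · subst h; simp
  · simp [h, Ne.symm h]

theorem isGraded_gradedTranspose {F : Matrix ι' ι (RhoSeries ρ d R)}
    (hF : ∀ k l, IsHomogeneous (I l - J k) (F k l)) : IsGraded I J (gradedTranspose ρ I J F) :=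
  fun k l => (hF l k).smul _

end Transpose

theorem inverse_mul_comm {f : RhoSeries ρ d R} (hf : IsHomogeneous 0 f) {g : RhoSeries ρ d R}
    {i : G} (hg : IsHomogeneous i g) : Ring.inverse f * g = g * Ring.inverse f := by
  by_cases h : IsUnit f
  · calc Ring.inverse f * g = Ring.inverse f * (g * f) * Ring.inverse f := by
          rw [mul_assoc, mul_assoc, Ring.mul_inverse_cancel f h, mul_one]
      _ = g * Ring.inverse f := by
          rw [← hf.mul_comm hg, ← mul_assoc, Ring.inverse_mul_cancel f h, one_mul]
  · rw [Ring.inverse_non_unit f h, zero_mul, mul_zero]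

/-! ### Berezinians of matrices given by parity blocks. -/

section Blocks

variable {p q : Type*} [Fintype p] [LinearOrder p] [Fintype q] [LinearOrder q]
  {J₀ : p → G} {J₁ : q → G}

open Classical in
/-- The Berezinian of a matrix given by its blocks. -/
noncomputable def blockBer (ρ : CommutationFactor G 𝕂) (J₀ : p → G) (J₁ : q → G)
    (A : Matrix p p (RhoSeries ρ d R)) (B : Matrix p q (RhoSeries ρ d R))
    (C : Matrix q p (RhoSeries ρ d R)) (D : Matrix q q (RhoSeries ρ d R)) : RhoSeries ρ d R :=
  if IsUnit A ∧ IsUnit D then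
    rhoDetEven ρ J₀ (A - B * Ring.inverse D * C) * Ring.inverse (rhoDetOdd ρ J₁ D)
  else 0

variable {A A' : Matrix p p (RhoSeries ρ d R)} {B B' : Matrix p q (RhoSeries ρ d R)}
  {C C' : Matrix q p (RhoSeries ρ d R)} {D D' : Matrix q q (RhoSeries ρ d R)}

/-- The products `A A'` and `A' A` differ from `1` by products with an odd factor, which are
nilpotent. So `A` has a right and a left inverse. -/
theorem isUnit_of_fromBlocks_mul [NeZero (2 : 𝕂)] (hodd : ∀ k l, ρ.IsOdd (J₀ k - J₁ l))
    (hB : IsGraded J₀ J₁ B) (hB' : IsGraded J₀ J₁ B')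
    (h : Matrix.fromBlocks A B C D * Matrix.fromBlocks A' B' C' D' = 1)
    (h' : Matrix.fromBlocks A' B' C' D' * Matrix.fromBlocks A B C D = 1) : IsUnit A := by
  rw [Matrix.fromBlocks_multiply, ← Matrix.fromBlocks_one, Matrix.fromBlocks_inj] at h h'
  obtain ⟨u, hu⟩ := (isNilpotent_mul_of_isOdd hodd C' hB).isUnit_one_sub
  obtain ⟨v, hv⟩ := (isNilpotent_mul_of_isOdd hodd C hB').isUnit_one_sub
  rw [← eq_sub_iff_add_eq.2 h.1] at hu
  rw [← eq_sub_iff_add_eq.2 h'.1] at hv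
  have h1 : A * (A' * (u⁻¹).1) = 1 := by rw [← mul_assoc, ← hu, Units.mul_inv]
  have h2 : ((v⁻¹).1 * A') * A = 1 := by rw [mul_assoc, ← hv, Units.inv_mul]
  have h3 := left_inv_eq_right_inv h2 h1
  exact (Ring.isUnit_and_inverse_eq h1 (h3 ▸ h2)).1

/-- The upper left block of the inverse matrix is the inverse of the Schur complement: eliminate
`C'` or `B'` from the block equations. -/
theorem schur_mul_inverse_block (hD : IsUnit D)
    (h : Matrix.fromBlocks A B C D * Matrix.fromBlocks A' B' C' D' = 1)
    (h' : Matrix.fromBlocks A' B' C' D' * Matrix.fromBlocks A B C D = 1) :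
    (A - B * Ring.inverse D * C) * A' = 1 ∧ A' * (A - B * Ring.inverse D * C) = 1 := by
  rw [Matrix.fromBlocks_multiply, ← Matrix.fromBlocks_one, Matrix.fromBlocks_inj] at h h'
  constructor
  · have h1 : C' = - (Ring.inverse D * (C * A')) := by
      rw [eq_neg_of_add_eq_zero_left h.2.2.1, Matrix.mul_neg, neg_neg, ← Matrix.mul_assoc,
        Ring.inverse_mul_cancel D hD, Matrix.one_mul]
    have h2 := h.1
    rw [h1, Matrix.mul_neg, ← sub_eq_add_neg] at h2
    rw [Matrix.sub_mul, ← h2]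
    simp only [Matrix.mul_assoc]
  · have h1 : B' = - (A' * B * Ring.inverse D) := by
      rw [eq_neg_of_add_eq_zero_left h'.2.1, Matrix.neg_mul, neg_neg, Matrix.mul_assoc,
        Ring.mul_inverse_cancel D hD, Matrix.mul_one]
    have h2 := h'.1
    rw [h1, Matrix.neg_mul, ← sub_eq_add_neg] at h2
    rw [Matrix.mul_sub, ← h2]
    simp only [Matrix.mul_assoc]

theorem fromBlocks_mul_swap
    (h : Matrix.fromBlocks A B C D * Matrix.fromBlocks A' B' C' D' = 1) :
    Matrix.fromBlocks D C B A * Matrix.fromBlocks D' C' B' A' = 1 := by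
  rw [Matrix.fromBlocks_multiply, ← Matrix.fromBlocks_one, Matrix.fromBlocks_inj] at *
  refine ⟨?_, ?_, ?_, ?_⟩
  · rw [add_comm]; exact h.2.2.2
  · rw [add_comm]; exact h.2.2.1
  · rw [add_comm]; exact h.2.1
  · rw [add_comm]; exact h.1

section

variable (hJ₀ : ∀ k, ρ (J₀ k) (J₀ k) = 1) (hJ₁ : ∀ k, ρ (J₁ k) (J₁ k) = -1)

/-- The sign `1` is written as `-s` with `s = -1`, to fit the statements that are uniform in the
parity. -/
theorem rhoDetOdd_eq {ι : Type*} [Fintype ι] [LinearOrder ι] (J : ι → G)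
    (F : Matrix ι ι (RhoSeries ρ d R)) : rhoDetOdd ρ J F = rhoDetAux (-(-1)) ρ J F := by
  rw [neg_neg]; rfl

include hJ₀ in
theorem isUnit_rhoDetEven (hA : IsGraded J₀ J₀ A) (hu : IsUnit A) :
    IsUnit (rhoDetEven ρ J₀ A) :=
  (Ring.isUnit_and_inverse_eq
    (rhoDetAux_mul_eq_one hJ₀ hA hA.isHomogeneous_inverse (Ring.mul_inverse_cancel A hu))
    (rhoDetAux_mul_eq_one hJ₀ hA.isHomogeneous_inverse hA (Ring.inverse_mul_cancel A hu))).1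

include hJ₁ in
theorem isUnit_rhoDetOdd (hD : IsGraded J₁ J₁ D) (hu : IsUnit D) :
    IsUnit (rhoDetOdd ρ J₁ D) := by
  rw [rhoDetOdd_eq]
  exact (Ring.isUnit_and_inverse_eq
    (rhoDetAux_mul_eq_one hJ₁ hD hD.isHomogeneous_inverse (Ring.mul_inverse_cancel D hu))
    (rhoDetAux_mul_eq_one hJ₁ hD.isHomogeneous_inverse hD (Ring.inverse_mul_cancel D hu))).1

include hJ₀ hJ₁

/-- The two expressions for the Berezinian agree. -/
theorem blockBer_mul_flip [CharZero 𝕂] (hA : IsGraded J₀ J₀ A) (hB : IsGraded J₀ J₁ B)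
    (hC : IsGraded J₁ J₀ C) (hD : IsGraded J₁ J₁ D) (uA : IsUnit A) (uD : IsUnit D) :
    rhoDetEven ρ J₀ (A - B * Ring.inverse D * C) * Ring.inverse (rhoDetOdd ρ J₁ D) *
      (rhoDetOdd ρ J₁ (D - C * Ring.inverse A * B) * Ring.inverse (rhoDetEven ρ J₀ A)) = 1 := by
  have gA := hA.isHomogeneous_inverse
  have gD := hD.isHomogeneous_inverse
  -- Taking out `A` and `D` leaves `1 - a b` and `1 - b a` for the odd matrices `a = A⁻¹ B` and `b =
  -- D⁻¹ C`, whose determinants are inverse to each other.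
  have h1 : A - B * Ring.inverse D * C =
      A * (1 - (Ring.inverse A * B) * (Ring.inverse D * C)) := by
    rw [mul_sub, mul_one, ← Matrix.mul_assoc, ← Matrix.mul_assoc, ← Matrix.mul_assoc,
      Ring.mul_inverse_cancel A uA, Matrix.one_mul]
  have h2 : D - C * Ring.inverse A * B =
      D * (1 - (Ring.inverse D * C) * (Ring.inverse A * B)) := by
    rw [mul_sub, mul_one, ← Matrix.mul_assoc, ← Matrix.mul_assoc, ← Matrix.mul_assoc,
      Ring.mul_inverse_cancel D uD, Matrix.one_mul]
  have h3 := rhoDetAux_one_sub_mul_rhoDetAux_one_sub hJ₀ hJ₁ (one_mul _) (gA.mul hB) (gD.mul hC)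
  have h4 : rhoDetEven ρ J₀ (A - B * Ring.inverse D * C) = rhoDetEven ρ J₀ A *
      rhoDetEven ρ J₀ (1 - (Ring.inverse A * B) * (Ring.inverse D * C)) := by
    rw [h1]
    exact rhoDetAux_mul hJ₀ hA (isGraded_one.sub ((gA.mul hB).mul (gD.mul hC)))
  have h5 : rhoDetOdd ρ J₁ (D - C * Ring.inverse A * B) = rhoDetOdd ρ J₁ D *
      rhoDetOdd ρ J₁ (1 - (Ring.inverse D * C) * (Ring.inverse A * B)) := by
    rw [h2, rhoDetOdd_eq, rhoDetOdd_eq, rhoDetOdd_eq]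
    exact rhoDetAux_mul hJ₁ hD (isGraded_one.sub ((gD.mul hC).mul (gA.mul hB)))
  rw [← rhoDetOdd_eq] at h3
  rw [h4, h5, ← mul_assoc, ← mul_assoc, mul_assoc _ (Ring.inverse _) (rhoDetOdd ρ J₁ D),
    Ring.inverse_mul_cancel _ (isUnit_rhoDetOdd hJ₁ hD uD), mul_one, mul_assoc (rhoDetEven ρ J₀ A)]
  erw [h3]
  rw [mul_one, Ring.mul_inverse_cancel _ (isUnit_rhoDetEven hJ₀ hA uA)]

end

theorem blockBer_eq (uA : IsUnit A) (uD : IsUnit D) : blockBer ρ J₀ J₁ A B C D =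
    rhoDetEven ρ J₀ (A - B * Ring.inverse D * C) * Ring.inverse (rhoDetOdd ρ J₁ D) :=
  if_pos ⟨uA, uD⟩

theorem Matrix.ringInverse_submatrix {m m' S : Type*} [Fintype m] [DecidableEq m] [Fintype m']
    [LinearOrder m'] [Ring S] (e : m' ≃ m) {F : Matrix m m S} (hF : IsUnit F) :
    IsUnit (F.submatrix e e) ∧ Ring.inverse (F.submatrix e e) = (Ring.inverse F).submatrix e e := by
  refine Ring.isUnit_and_inverse_eq ?_ ?_
  · rw [Matrix.submatrix_mul_equiv, Ring.mul_inverse_cancel F hF, Matrix.submatrix_one_equiv]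
  · rw [Matrix.submatrix_mul_equiv, Ring.inverse_mul_cancel F hF, Matrix.submatrix_one_equiv]

/-- The defining sum depends on the order of the indices, but the ordinary determinant that
represents it does not. -/
theorem rhoDetAux_submatrix {s : 𝕂} {ι ι' : Type*} [Fintype ι] [LinearOrder ι] [Fintype ι']
    [LinearOrder ι'] {J : ι → G} (hJ : ∀ k, ρ (J k) (J k) = s) (e : ι' ≃ ι)
    {F : Matrix ι ι (RhoSeries ρ d R)} (hF : IsGraded J J F) :
    rhoDetAux (-s) ρ (J ∘ e) (F.submatrix e e) = rhoDetAux (-s) ρ J F := by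
  apply leftMul_injective
  rw [leftMul_rhoDetAux hJ hF, leftMul_rhoDetAux (J := J ∘ e) (F := F.submatrix e e)
    (fun k => hJ (e k)) (fun k l => hF (e k) (e l)), ← Matrix.det_submatrix_equiv_self e]
  rfl

section

variable {p' q' : Type*} [Fintype p'] [LinearOrder p'] [Fintype q'] [LinearOrder q']
  (hJ₀ : ∀ k, ρ (J₀ k) (J₀ k) = 1) (hJ₁ : ∀ k, ρ (J₁ k) (J₁ k) = -1)

include hJ₀ hJ₁

theorem blockBer_submatrix (e : p' ≃ p) (e' : q' ≃ q) (hA : IsGraded J₀ J₀ A)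
    (hB : IsGraded J₀ J₁ B) (hC : IsGraded J₁ J₀ C) (hD : IsGraded J₁ J₁ D) :
    blockBer ρ (J₀ ∘ e) (J₁ ∘ e') (A.submatrix e e) (B.submatrix e e') (C.submatrix e' e)
      (D.submatrix e' e') = blockBer ρ J₀ J₁ A B C D := by
  by_cases h : IsUnit A ∧ IsUnit D
  · obtain ⟨uA, uD⟩ := h
    obtain ⟨uD', hD'⟩ := Matrix.ringInverse_submatrix e' uD
    rw [blockBer_eq uA uD, blockBer_eq (Matrix.ringInverse_submatrix e uA).1 uD', hD',
      Matrix.submatrix_mul_equiv, Matrix.submatrix_mul_equiv, rhoDetOdd_eq, rhoDetOdd_eq, rhoDetAux_submatrix hJ₁ e' hD]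
    congr 1
    exact rhoDetAux_submatrix hJ₀ e (hA.sub ((hB.mul hD.isHomogeneous_inverse).mul hC))
  · rw [blockBer, blockBer, if_neg h, if_neg]
    rintro ⟨uA, uD⟩
    refine h ⟨?_, ?_⟩
    · simpa using (Matrix.ringInverse_submatrix e.symm uA).1
    · simpa using (Matrix.ringInverse_submatrix e'.symm uD).1

/-- Any splitting of the indices by parity, with any orders on the two parts, computes the
Berezinian. The freedom is used for exchanged parities and for sums of index sets. -/
theorem rhoBer_eq_blockBer [NeZero (2 : 𝕂)] {ι : Type*} [Fintype ι] [LinearOrder ι] {I : ι → G}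
    (e : p ⊕ q ≃ ι) (h₀ : ∀ k, I (e (Sum.inl k)) = J₀ k) (h₁ : ∀ k, I (e (Sum.inr k)) = J₁ k)
    {F : Matrix ι ι (RhoSeries ρ d R)} (hF : IsGraded I I F) :
    rhoBer ρ I F = blockBer ρ J₀ J₁ (F.submatrix e e).toBlocks₁₁ (F.submatrix e e).toBlocks₁₂
      (F.submatrix e e).toBlocks₂₁ (F.submatrix e e).toBlocks₂₂ := by
  classical
  have hne : (1 : 𝕂) ≠ -1 := fun h => by
    have : (2 : 𝕂) = 0 := by rw [← one_add_one_eq_two]; nth_rewrite 2 [h]; ring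
    exact NeZero.ne _ this
  let e₀ : p ≃ {a // ρ.IsEven (I a)} := Equiv.ofBijective
    (fun k => ⟨e (Sum.inl k), by rw [CommutationFactor.IsEven, h₀, hJ₀]⟩)
    ⟨fun k l h => Sum.inl_injective (e.injective (congrArg Subtype.val h)), fun ⟨a, ha⟩ => by
      obtain ⟨k | k, rfl⟩ := e.surjective a
      · exact ⟨k, rfl⟩
      · rw [CommutationFactor.IsEven, h₁, hJ₁] at ha
        exact absurd ha.symm hne⟩
  let e₁ : q ≃ {a // ρ.IsOdd (I a)} := Equiv.ofBijective
    (fun k => ⟨e (Sum.inr k), by rw [CommutationFactor.IsOdd, h₁, hJ₁]⟩)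
    ⟨fun k l h => Sum.inr_injective (e.injective (congrArg Subtype.val h)), fun ⟨a, ha⟩ => by
      obtain ⟨k | k, rfl⟩ := e.surjective a
      · rw [CommutationFactor.IsOdd, h₀, hJ₀] at ha
        exact absurd ha hne
      · exact ⟨k, rfl⟩⟩
  have h := blockBer_submatrix (ρ := ρ) (J₀ := fun a : {a // ρ.IsEven (I a)} => I a)
    (J₁ := fun a : {a // ρ.IsOdd (I a)} => I a) (fun k => k.2) (fun k => k.2) e₀ e₁
    (A := F.toBlock _ _) (B := F.toBlock _ _) (C := F.toBlock _ _) (D := F.toBlock _ _)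
    (fun k l => hF k l) (fun k l => hF k l) (fun k l => hF k l) (fun k l => hF k l)
  rw [show (fun a : {a // ρ.IsEven (I a)} => I a) ∘ e₀ = J₀ from funext h₀,
    show (fun a : {a // ρ.IsOdd (I a)} => I a) ∘ e₁ = J₁ from funext h₁] at h
  exact h.symm

end

section

variable (hJ₀ : ∀ k, ρ (J₀ k) (J₀ k) = 1) (hJ₁ : ∀ k, ρ (J₁ k) (J₁ k) = -1)

theorem isHomogeneous_rhoDetAux_of_isGraded {ι : Type*} [Fintype ι] [LinearOrder ι] {J : ι → G}
    (ε : 𝕂) {F : Matrix ι ι (RhoSeries ρ d R)} (hF : IsGraded J J F) :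
    IsHomogeneous 0 (rhoDetAux ε ρ J F) :=
  isHomogeneous_rhoDetAux ε J J hF

include hJ₀ hJ₁

theorem blockBer_shift_of_isEven {i : G} (hi : ρ.IsEven i) (hA : IsGraded J₀ J₀ A)
    (hB : IsGraded J₀ J₁ B) (hC : IsGraded J₁ J₀ C) (hD : IsGraded J₁ J₁ D) :
    blockBer ρ (fun k => J₀ k + i) (fun k => J₁ k + i) A B C D = blockBer ρ J₀ J₁ A B C D := by
  by_cases h : IsUnit A ∧ IsUnit D
  · rw [blockBer_eq h.1 h.2, blockBer_eq h.1 h.2]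
    have e1 := rhoDetAux_shift hJ₀ i (hA.sub ((hB.mul hD.isHomogeneous_inverse).mul hC))
    have e2 := rhoDetAux_shift hJ₁ i hD
    rw [show ρ i i = 1 from hi, mul_one] at e1 e2
    rw [rhoDetOdd_eq, rhoDetOdd_eq, e2]
    exact congrArg (· * _) e1
  · rw [blockBer, blockBer, if_neg h, if_neg h]

/-- An odd shift exchanges the two parities and thereby `rhoDetEven` with `rhoDetOdd`. The shifted
Berezinian is therefore the second factor in `blockBer_mul_flip`. -/
theorem blockBer_shift_of_isOdd_mul [CharZero 𝕂] {i : G} (hi : ρ.IsOdd i) (hA : IsGraded J₀ J₀ A)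
    (hB : IsGraded J₀ J₁ B) (hC : IsGraded J₁ J₀ C) (hD : IsGraded J₁ J₁ D) (uA : IsUnit A)
    (uD : IsUnit D) :
    blockBer ρ J₀ J₁ A B C D * blockBer ρ (fun k => J₁ k + i) (fun k => J₀ k + i) D C B A = 1 := by
  rw [blockBer_eq uA uD, blockBer_eq uD uA, ← blockBer_mul_flip hJ₀ hJ₁ hA hB hC hD uA uD]
  have e1 := rhoDetAux_shift hJ₀ i hA
  have e2 := rhoDetAux_shift hJ₁ i (hD.sub ((hC.mul hA.isHomogeneous_inverse).mul hB))
  rw [show ρ i i = -1 from hi] at e1 e2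
  rw [mul_neg_one, neg_neg] at e1
  rw [mul_neg_one, neg_neg, neg_neg] at e2
  rw [rhoDetOdd, rhoDetOdd, rhoDetOdd, rhoDetEven, rhoDetEven, rhoDetEven, e1, e2]

/-- No general multiplicativity is needed. By `schur_mul_inverse_block` the even determinant for the
first matrix is inverse to that of `A'`, and the odd determinant of `D` is inverse to that of the
other Schur complement of the second matrix. Inserting this, the claim becomes `blockBer_mul_flip`
for the second matrix. -/
theorem blockBer_mul_eq_one [CharZero 𝕂] (hA : IsGraded J₀ J₀ A) (hB : IsGraded J₀ J₁ B)
    (hC : IsGraded J₁ J₀ C) (hD : IsGraded J₁ J₁ D) (hA' : IsGraded J₀ J₀ A')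
    (hB' : IsGraded J₀ J₁ B') (hC' : IsGraded J₁ J₀ C') (hD' : IsGraded J₁ J₁ D')
    (uA : IsUnit A) (uD : IsUnit D) (uA' : IsUnit A') (uD' : IsUnit D')
    (h : Matrix.fromBlocks A B C D * Matrix.fromBlocks A' B' C' D' = 1)
    (h' : Matrix.fromBlocks A' B' C' D' * Matrix.fromBlocks A B C D = 1) :
    blockBer ρ J₀ J₁ A B C D * blockBer ρ J₀ J₁ A' B' C' D' = 1 := by
  have gS := hA.sub ((hB.mul hD.isHomogeneous_inverse).mul hC)
  have gS' := hD'.sub ((hC'.mul hA'.isHomogeneous_inverse).mul hB')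
  obtain ⟨s1, s2⟩ := schur_mul_inverse_block uD h h'
  obtain ⟨s3, s4⟩ := schur_mul_inverse_block uA' (fromBlocks_mul_swap h') (fromBlocks_mul_swap h)
  have e1 : Ring.inverse (rhoDetEven ρ J₀ A') = rhoDetEven ρ J₀ (A - B * Ring.inverse D * C) :=
    (Ring.isUnit_and_inverse_eq (rhoDetAux_mul_eq_one hJ₀ hA' gS s2)
      (rhoDetAux_mul_eq_one hJ₀ gS hA' s1)).2
  have e2 : Ring.inverse (rhoDetOdd ρ J₁ D) =
      rhoDetOdd ρ J₁ (D' - C' * Ring.inverse A' * B') := by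
    rw [rhoDetOdd_eq, rhoDetOdd_eq]
    exact (Ring.isUnit_and_inverse_eq (rhoDetAux_mul_eq_one hJ₁ hD gS' s4)
      (rhoDetAux_mul_eq_one hJ₁ gS' hD s3)).2
  have h3 := blockBer_mul_flip hJ₀ hJ₁ hA' hB' hC' hD' uA' uD'
  have c1 : IsHomogeneous 0 (rhoDetOdd ρ J₁ (D' - C' * Ring.inverse A' * B')) :=
    isHomogeneous_rhoDetAux_of_isGraded _ gS'
  have c2 : IsHomogeneous 0 (rhoDetEven ρ J₀ (A - B * Ring.inverse D * C)) :=
    isHomogeneous_rhoDetAux_of_isGraded _ gS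
  rw [e1] at h3
  rw [blockBer_eq uA uD, blockBer_eq uA' uD', e2]
  have c3 : IsHomogeneous 0 (rhoDetEven ρ J₀ (A' - B' * Ring.inverse D' * C')) :=
    isHomogeneous_rhoDetAux_of_isGraded _
      (hA'.sub ((hB'.mul hD'.isHomogeneous_inverse).mul hC'))
  have c4 : IsHomogeneous 0 (rhoDetOdd ρ J₁ D') := isHomogeneous_rhoDetAux_of_isGraded _ hD'
  have c5 := c1.mul c2
  rw [add_zero] at c5
  rw [← h3, c2.mul_comm c1]
  rw [← mul_assoc, c5.mul_comm c3, mul_assoc, mul_assoc,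
    mul_assoc (rhoDetEven ρ J₀ (A' - _)), inverse_mul_comm c4 c5, mul_assoc]

end

theorem Matrix.ringInverse_gradedTranspose {ι : Type*} [Fintype ι] [DecidableEq ι] {J : ι → G}
    {F : Matrix ι ι (RhoSeries ρ d R)} (hF : ∀ k l, IsHomogeneous (J l - J k) (F k l))
    (hu : IsUnit F) : IsUnit (gradedTranspose ρ J J F) ∧
      Ring.inverse (gradedTranspose ρ J J F) = gradedTranspose ρ J J (Ring.inverse F) := by
  have hF' : IsGraded (fun k => - J k) (fun k => - J k) F := fun k l => by
    rw [neg_sub_neg]; exact hF k l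
  have hI : ∀ k l, IsHomogeneous (J l - J k) (Ring.inverse F k l) := fun k l => by
    have h := hF'.isHomogeneous_inverse k l
    rwa [neg_sub_neg] at h
  refine Ring.isUnit_and_inverse_eq ?_ ?_
  · rw [← gradedTranspose_mul hI hF, Ring.inverse_mul_cancel F hu, gradedTranspose_one]
  · rw [← gradedTranspose_mul hF hI, Ring.mul_inverse_cancel F hu, gradedTranspose_one]

/-- Transposition reverses products and exchanges the roles of `B` and `C`, so it carries Schur
complements to Schur complements. Each determinant is then treated by `rhoDetAux_gradedTranspose`.
-/
theorem blockBer_gradedTranspose (hJ₀ : ∀ k, ρ (J₀ k) (J₀ k) = 1)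
    (hJ₁ : ∀ k, ρ (J₁ k) (J₁ k) = -1) (hA : ∀ k l, IsHomogeneous (J₀ l - J₀ k) (A k l))
    (hB : ∀ k l, IsHomogeneous (J₁ l - J₀ k) (B k l))
    (hC : ∀ k l, IsHomogeneous (J₀ l - J₁ k) (C k l))
    (hD : ∀ k l, IsHomogeneous (J₁ l - J₁ k) (D k l)) (uA : IsUnit A) (uD : IsUnit D) :
    blockBer ρ (fun k => - J₀ k) (fun k => - J₁ k) A B C D =
      blockBer ρ J₀ J₁ (gradedTranspose ρ J₀ J₀ A) (gradedTranspose ρ J₀ J₁ C)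
        (gradedTranspose ρ J₁ J₀ B) (gradedTranspose ρ J₁ J₁ D) := by
  have hD' : IsGraded (fun k => - J₁ k) (fun k => - J₁ k) D := fun k l => by
    rw [neg_sub_neg]; exact hD k l
  have hI : ∀ k l, IsHomogeneous (J₁ l - J₁ k) (Ring.inverse D k l) := fun k l => by
    have h := hD'.isHomogeneous_inverse k l
    rwa [neg_sub_neg] at h
  have hBI : ∀ k l, IsHomogeneous (J₁ l - J₀ k) ((B * Ring.inverse D) k l) := fun k l => by
    have h := IsGraded.mul (I := fun k => - J₀ k) (J := fun k => - J₁ k) (K := fun k => - J₁ k)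
      (F := B) (fun k l => by rw [neg_sub_neg]; exact hB k l) hD'.isHomogeneous_inverse k l
    rwa [neg_sub_neg] at h
  have hBC : ∀ k l, IsHomogeneous (J₀ l - J₀ k) ((B * Ring.inverse D * C) k l) := fun k l => by
    have h := IsGraded.mul (I := fun k => - J₀ k) (J := fun k => - J₁ k) (K := fun k => - J₀ k)
      (F := B * Ring.inverse D) (H := C) (fun k l => by rw [neg_sub_neg]; exact hBI k l)
      (fun k l => by rw [neg_sub_neg]; exact hC k l) k l
    rwa [neg_sub_neg] at h
  obtain ⟨uD', hD''⟩ := Matrix.ringInverse_gradedTranspose hD uD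
  rw [blockBer_eq uA uD, blockBer_eq (Matrix.ringInverse_gradedTranspose hA uA).1 uD', hD'',
    rhoDetOdd_eq, rhoDetOdd_eq, rhoDetAux_gradedTranspose hJ₁ hD,
    Matrix.mul_assoc (gradedTranspose ρ J₀ J₁ C),
    ← gradedTranspose_mul hB hI, ← gradedTranspose_mul hBI hC, ← gradedTranspose_sub]
  exact congrArg (· * _) (rhoDetAux_gradedTranspose hJ₀ fun k l => (hA k l).sub (hBC k l))

/-! ### Block triangular matrices. -/

section Triangular

variable {p' q' : Type*} [Fintype p'] [LinearOrder p'] [Fintype q'] [LinearOrder q']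
  {J₀' : p' → G} {J₁' : q' → G} {A'' : Matrix p' p' (RhoSeries ρ d R)}
  {B'' : Matrix p' q' (RhoSeries ρ d R)} {C'' : Matrix q' p' (RhoSeries ρ d R)}
  {D'' : Matrix q' q' (RhoSeries ρ d R)} {A₂₁ : Matrix p' p (RhoSeries ρ d R)}
  {B₂₁ : Matrix p' q (RhoSeries ρ d R)} {C₂₁ : Matrix q' p (RhoSeries ρ d R)}
  {D₂₁ : Matrix q' q (RhoSeries ρ d R)}

theorem Matrix.ringInverse_fromBlocks_zero₁₂ {m m' S : Type*} [Fintype m] [DecidableEq m]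
    [Fintype m'] [DecidableEq m'] [Ring S] {F : Matrix m m S} {F' : Matrix m' m' S}
    (E : Matrix m' m S) (hF : IsUnit F) (hF' : IsUnit F') :
    IsUnit (Matrix.fromBlocks F 0 E F') ∧ Ring.inverse (Matrix.fromBlocks F 0 E F') =
      Matrix.fromBlocks (Ring.inverse F) 0 (-(Ring.inverse F' * E * Ring.inverse F))
        (Ring.inverse F') := by
  refine Ring.isUnit_and_inverse_eq ?_ ?_
  · rw [Matrix.fromBlocks_multiply, ← Matrix.fromBlocks_one, Matrix.mul_neg,
      Matrix.mul_neg, Matrix.mul_assoc (Ring.inverse F'), ← Matrix.mul_assoc F', Ring.mul_inverse_cancel F hF, Ring.mul_inverse_cancel F' hF']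
    simp
  · rw [Matrix.fromBlocks_multiply, ← Matrix.fromBlocks_one, Matrix.neg_mul,
      Matrix.mul_assoc _ (Ring.inverse F) F, Ring.inverse_mul_cancel F hF,
      Ring.inverse_mul_cancel F' hF']
    simp

/-- If all four parity blocks are lower triangular, so is the Schur complement, and its diagonal
blocks are the Schur complements of the diagonal parts. The determinants then factor. -/
theorem blockBer_fromBlocks (hJ₀ : ∀ k, ρ (J₀ k) (J₀ k) = 1)
    (hJ₁ : ∀ k, ρ (J₁ k) (J₁ k) = -1) (hJ₀' : ∀ k, ρ (J₀' k) (J₀' k) = 1)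
    (hJ₁' : ∀ k, ρ (J₁' k) (J₁' k) = -1)
    (hA : IsGraded (Sum.elim J₀ J₀') (Sum.elim J₀ J₀') (Matrix.fromBlocks A 0 A₂₁ A''))
    (hB : IsGraded (Sum.elim J₀ J₀') (Sum.elim J₁ J₁') (Matrix.fromBlocks B 0 B₂₁ B''))
    (hC : IsGraded (Sum.elim J₁ J₁') (Sum.elim J₀ J₀') (Matrix.fromBlocks C 0 C₂₁ C''))
    (hD : IsGraded (Sum.elim J₁ J₁') (Sum.elim J₁ J₁') (Matrix.fromBlocks D 0 D₂₁ D''))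
    (uA : IsUnit A) (uD : IsUnit D) (uA'' : IsUnit A'') (uD'' : IsUnit D'') :
    blockBer ρ (Sum.elim J₀ J₀' ∘ ofLex) (Sum.elim J₁ J₁' ∘ ofLex)
      ((Matrix.fromBlocks A 0 A₂₁ A'').submatrix ofLex ofLex)
      ((Matrix.fromBlocks B 0 B₂₁ B'').submatrix ofLex ofLex)
      ((Matrix.fromBlocks C 0 C₂₁ C'').submatrix ofLex ofLex)
      ((Matrix.fromBlocks D 0 D₂₁ D'').submatrix ofLex ofLex) =
    blockBer ρ J₀ J₁ A B C D * blockBer ρ J₀' J₁' A'' B'' C'' D'' := by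
  have gD : IsGraded J₁ J₁ D := fun k l => hD (Sum.inl k) (Sum.inl l)
  have gD'' : IsGraded J₁' J₁' D'' := fun k l => hD (Sum.inr k) (Sum.inr l)
  have kJ₀ : ∀ k, ρ ((Sum.elim J₀ J₀' ∘ ofLex) k) ((Sum.elim J₀ J₀' ∘ ofLex) k) = 1 := by
    intro k
    rcases h : ofLex k with l | l <;> simp [h, hJ₀, hJ₀']
  have kJ₁ : ∀ k, ρ ((Sum.elim J₁ J₁' ∘ ofLex) k) ((Sum.elim J₁ J₁' ∘ ofLex) k) = -1 := by
    intro k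
    rcases h : ofLex k with l | l <;> simp [h, hJ₁, hJ₁']
  obtain ⟨vA, -⟩ := Matrix.ringInverse_fromBlocks_zero₁₂ A₂₁ uA uA''
  obtain ⟨vD, hDi⟩ := Matrix.ringInverse_fromBlocks_zero₁₂ D₂₁ uD uD''
  obtain ⟨wA, -⟩ := Matrix.ringInverse_submatrix (ofLex (α := p ⊕ p')) vA
  obtain ⟨wD, hDi'⟩ := Matrix.ringInverse_submatrix (ofLex (α := q ⊕ q')) vD
  have gS := hA.sub ((hB.mul hD.isHomogeneous_inverse).mul hC)
  have dD := rhoDetAux_blockTriangular kJ₁ (toLex (α := q ⊕ q'))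
    (F := (Matrix.fromBlocks D 0 D₂₁ D'').submatrix ofLex ofLex)
    (fun k l => hD (ofLex k) (ofLex l)) (fun k l => rfl)
  rw [blockBer_eq wA wD, hDi', Matrix.submatrix_mul_equiv, Matrix.submatrix_mul_equiv,
    blockBer_eq uA uD, blockBer_eq uA'' uD'', rhoDetOdd_eq, dD]
  rw [hDi, Matrix.fromBlocks_multiply, Matrix.fromBlocks_multiply] at gS ⊢
  have e1 : ∀ F : Matrix (p ⊕ p') (p ⊕ p') (RhoSeries ρ d R),
    ((Matrix.fromBlocks A 0 A₂₁ A'').submatrix ofLex ofLex - F.submatrix ofLex ofLex :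
      Matrix (p ⊕ₗ p') (p ⊕ₗ p') (RhoSeries ρ d R)) =
      (Matrix.fromBlocks A 0 A₂₁ A'' - F).submatrix ofLex ofLex := fun F => rfl
  rw [e1]
  have dS := rhoDetAux_blockTriangular kJ₀ (toLex (α := p ⊕ p'))
    (fun k l => gS (ofLex k) (ofLex l)) (fun k l => by simp)
  have u1 := isUnit_rhoDetOdd hJ₁ gD uD
  have u2 := isUnit_rhoDetOdd hJ₁' gD'' uD''
  have c1 : IsHomogeneous 0 (rhoDetOdd ρ J₁ D) := isHomogeneous_rhoDetAux_of_isGraded _ gD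
  have c2 : IsHomogeneous 0 (rhoDetOdd ρ J₁' D'') := isHomogeneous_rhoDetAux_of_isGraded _ gD''
  have c3 : IsHomogeneous 0 (rhoDetEven ρ J₀' (A'' - B'' * Ring.inverse D'' * C'')) := by
    refine isHomogeneous_rhoDetAux_of_isGraded _ (IsGraded.sub (fun k l => hA (Sum.inr k) (Sum.inr l))
      (IsGraded.mul (IsGraded.mul (fun k l => hB (Sum.inr k) (Sum.inr l))
        gD''.isHomogeneous_inverse) fun k l => hC (Sum.inr k) (Sum.inr l)))
  -- Only a reordering: determinants have degree zero and therefore commute.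
  have key : rhoDetEven ρ J₀ (A - B * Ring.inverse D * C) *
      rhoDetEven ρ J₀' (A'' - B'' * Ring.inverse D'' * C'') *
        Ring.inverse (rhoDetOdd ρ J₁ D * rhoDetOdd ρ J₁' D'') =
      rhoDetEven ρ J₀ (A - B * Ring.inverse D * C) * Ring.inverse (rhoDetOdd ρ J₁ D) *
        (rhoDetEven ρ J₀' (A'' - B'' * Ring.inverse D'' * C'') *
          Ring.inverse (rhoDetOdd ρ J₁' D'')) := by
    rw [← mul_assoc, mul_assoc (rhoDetEven ρ J₀ _) (Ring.inverse _), inverse_mul_comm c1 c3,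
      ← mul_assoc, mul_assoc (_ * _) (Ring.inverse _) (Ring.inverse _),
      ← Ring.mul_inverse_rev' (c2.mul_comm c1), c2.mul_comm c1]
  refine (congrArg (· * _) dS).trans (Eq.trans ?_ key)
  rw [rhoDetOdd_eq, rhoDetOdd_eq]
  refine congrArg₂ (· * ·) (congrArg₂ (· * ·) ?_ ?_) rfl
  · refine congrArg (rhoDetEven ρ J₀) ?_
    ext1 k l
    change A k l - ((B * Ring.inverse D + (0 : Matrix p q' (RhoSeries ρ d R)) *
      (_ : Matrix q' q (RhoSeries ρ d R))) * C + (B * (0 : Matrix q q' (RhoSeries ρ d R)) +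
      (0 : Matrix p q' (RhoSeries ρ d R)) * Ring.inverse D'') * C₂₁) k l = _
    simp
  · refine congrArg (rhoDetEven ρ J₀') ?_
    ext1 k l
    change A'' k l - ((B₂₁ * Ring.inverse D + B'' * (_ : Matrix q' q (RhoSeries ρ d R))) *
      (0 : Matrix q p' (RhoSeries ρ d R)) + (B₂₁ * (0 : Matrix q q' (RhoSeries ρ d R)) + B'' * Ring.inverse D'') * C'') k l = _
    simp

end Triangular

end Blocks

open Classical in
/-- The splitting of the indices by parity. -/
noncomputable def parityEquiv [NeZero (2 : 𝕂)] (ρ : CommutationFactor G 𝕂) {ι : Type*} (I : ι → G) :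
    {a // ρ.IsEven (I a)} ⊕ {a // ρ.IsOdd (I a)} ≃ ι :=
  Equiv.ofBijective (Sum.elim Subtype.val Subtype.val) (by
    have hne : ∀ a, ρ.IsEven (I a) → ¬ ρ.IsOdd (I a) := fun a h h' => by
      rw [CommutationFactor.IsEven] at h
      rw [CommutationFactor.IsOdd, h] at h'
      have : (2 : 𝕂) = 0 := by rw [← one_add_one_eq_two]; nth_rewrite 2 [h']; ring
      exact NeZero.ne _ this
    constructor
    · rintro (⟨a, ha⟩ | ⟨a, ha⟩) (⟨b, hb⟩ | ⟨b, hb⟩) (h : a = b)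
      · subst h; rfl
      · subst h; exact absurd hb (hne _ ha)
      · subst h; exact absurd ha (hne _ hb)
      · subst h; rfl
    · intro a
      rcases ρ.isEven_or_isOdd (I a) with h | h
      · exact ⟨Sum.inl ⟨a, h⟩, rfl⟩
      · exact ⟨Sum.inr ⟨a, h⟩, rfl⟩)

/-! ### Berezinians of invertible graded matrices. -/

section Berezinian

variable [CharZero 𝕂] {ι : Type*} [Fintype ι] [LinearOrder ι] {I : ι → G}
  {F H : Matrix ι ι (RhoSeries ρ d R)}

theorem fromBlocks_toBlocks_mul {p q : Type*} [Fintype p] [DecidableEq p] [Fintype q]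
    [DecidableEq q] (e : p ⊕ q ≃ ι) (h : F * H = 1) :
    Matrix.fromBlocks (F.submatrix e e).toBlocks₁₁ (F.submatrix e e).toBlocks₁₂
      (F.submatrix e e).toBlocks₂₁ (F.submatrix e e).toBlocks₂₂ *
    Matrix.fromBlocks (H.submatrix e e).toBlocks₁₁ (H.submatrix e e).toBlocks₁₂
      (H.submatrix e e).toBlocks₂₁ (H.submatrix e e).toBlocks₂₂ = 1 := by
  rw [Matrix.fromBlocks_toBlocks, Matrix.fromBlocks_toBlocks, Matrix.submatrix_mul_equiv, h,
    Matrix.submatrix_one_equiv]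

/-- An invertible graded matrix has invertible diagonal parity blocks, so its Berezinian is never
the default value `0`. -/
theorem isUnit_toBlocks {p q : Type*} [Fintype p] [LinearOrder p] [Fintype q]
    [LinearOrder q] (e : p ⊕ q ≃ ι) (h₀ : ∀ k, ρ.IsEven (I (e (Sum.inl k))))
    (h₁ : ∀ k, ρ.IsOdd (I (e (Sum.inr k)))) (hF : IsGraded I I F) (hH : IsGraded I I H)
    (h : F * H = 1) (h' : H * F = 1) :
    IsUnit (F.submatrix e e).toBlocks₁₁ ∧ IsUnit (F.submatrix e e).toBlocks₂₂ := by
  have k := fromBlocks_toBlocks_mul e h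
  have k' := fromBlocks_toBlocks_mul e h'
  refine ⟨isUnit_of_fromBlocks_mul (J₀ := fun k => I (e (Sum.inl k)))
    (J₁ := fun k => I (e (Sum.inr k))) (fun k l => ?_) (fun k l => hF _ _) (fun k l => hH _ _) k k',
    isUnit_of_fromBlocks_mul (J₀ := fun k => I (e (Sum.inr k)))
    (J₁ := fun k => I (e (Sum.inl k))) (fun k l => ?_) (fun k l => hF _ _) (fun k l => hH _ _)
    (fromBlocks_mul_swap k) (fromBlocks_mul_swap k')⟩ <;>
  · rw [CommutationFactor.IsOdd, ρ.self_sub, show ρ _ _ = -1 from h₁ _, show ρ _ _ = 1 from h₀ _]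
    ring

variable (hF : IsGraded I I F) (hH : IsGraded I I H) (h : F * H = 1) (h' : H * F = 1)

include hF hH h h'

theorem rhoBer_mul_eq_one : rhoBer ρ I F * rhoBer ρ I H = 1 := by
  classical
  have h₀ : ∀ k, ρ.IsEven (I (parityEquiv ρ I (Sum.inl k))) := fun k => k.2
  have h₁ : ∀ k, ρ.IsOdd (I (parityEquiv ρ I (Sum.inr k))) := fun k => k.2
  obtain ⟨uA, uD⟩ := isUnit_toBlocks _ h₀ h₁ hF hH h h'
  obtain ⟨uA', uD'⟩ := isUnit_toBlocks _ h₀ h₁ hH hF h' h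
  rw [rhoBer_eq_blockBer h₀ h₁ _ (fun _ => rfl) (fun _ => rfl) hF,
    rhoBer_eq_blockBer h₀ h₁ _ (fun _ => rfl) (fun _ => rfl) hH]
  exact blockBer_mul_eq_one h₀ h₁ (fun k l => hF _ _) (fun k l => hF _ _) (fun k l => hF _ _)
    (fun k l => hF _ _) (fun k l => hH _ _) (fun k l => hH _ _) (fun k l => hH _ _)
    (fun k l => hH _ _) uA uD uA' uD' (fromBlocks_toBlocks_mul _ h) (fromBlocks_toBlocks_mul _ h')

/-- The splitting by parity for the shifted degrees is the old one with its halves exchanged. This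
inversion separates the bundles with Berezinian `1` from those with a square. -/
theorem rhoBer_shift_of_isOdd_mul {i : G} (hi : ρ.IsOdd i) :
    rhoBer ρ I F * rhoBer ρ (fun k => I k + i) F = 1 := by
  classical
  have h₀ : ∀ k, ρ.IsEven (I (parityEquiv ρ I (Sum.inl k))) := fun k => k.2
  have h₁ : ∀ k, ρ.IsOdd (I (parityEquiv ρ I (Sum.inr k))) := fun k => k.2
  obtain ⟨uA, uD⟩ := isUnit_toBlocks _ h₀ h₁ hF hH h h'
  have hF' : IsGraded (fun k => I k + i) (fun k => I k + i) F := fun k l => by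
    rw [add_sub_add_right_eq_sub]; exact hF k l
  rw [rhoBer_eq_blockBer h₀ h₁ _ (fun _ => rfl) (fun _ => rfl) hF,
    rhoBer_eq_blockBer (I := fun k => I k + i)
      (J₀ := fun k => I (parityEquiv ρ I (Sum.inr k)) + i)
      (J₁ := fun k => I (parityEquiv ρ I (Sum.inl k)) + i)
      (fun k => by rw [ρ.self_add, show ρ i i = -1 from hi, show ρ _ _ = -1 from h₁ k]; ring)
      (fun k => by rw [ρ.self_add, show ρ i i = -1 from hi, show ρ _ _ = 1 from h₀ k]; ring)
      ((Equiv.sumComm _ _).trans (parityEquiv ρ I)) (fun _ => rfl) (fun _ => rfl) hF']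
  exact blockBer_shift_of_isOdd_mul h₀ h₁ hi (fun k l => hF _ _) (fun k l => hF _ _)
    (fun k l => hF _ _) (fun k l => hF _ _) uA uD

omit hH h h' in
theorem rhoBer_shift_of_isEven {i : G} (hi : ρ.IsEven i) :
    rhoBer ρ (fun k => I k + i) F = rhoBer ρ I F := by
  classical
  have h₀ : ∀ k, ρ.IsEven (I (parityEquiv ρ I (Sum.inl k))) := fun k => k.2
  have h₁ : ∀ k, ρ.IsOdd (I (parityEquiv ρ I (Sum.inr k))) := fun k => k.2
  have hF' : IsGraded (fun k => I k + i) (fun k => I k + i) F := fun k l => by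
    rw [add_sub_add_right_eq_sub]; exact hF k l
  rw [rhoBer_eq_blockBer h₀ h₁ _ (fun _ => rfl) (fun _ => rfl) hF,
    rhoBer_eq_blockBer (I := fun k => I k + i)
      (J₀ := fun k => I (parityEquiv ρ I (Sum.inl k)) + i)
      (J₁ := fun k => I (parityEquiv ρ I (Sum.inr k)) + i)
      (fun k => by rw [ρ.self_add, show ρ i i = 1 from hi, show ρ _ _ = 1 from h₀ k]; ring)
      (fun k => by rw [ρ.self_add, show ρ i i = 1 from hi, show ρ _ _ = -1 from h₁ k]; ring)
      (parityEquiv ρ I) (fun _ => rfl) (fun _ => rfl) hF']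
  exact blockBer_shift_of_isEven h₀ h₁ hi (fun k l => hF _ _) (fun k l => hF _ _)
    (fun k l => hF _ _) (fun k l => hF _ _)

omit hF hH in
theorem rhoBer_gradedTranspose (hF : ∀ k l, IsHomogeneous (I l - I k) (F k l))
    (hH : ∀ k l, IsHomogeneous (I l - I k) (H k l)) :
    rhoBer ρ (fun k => - I k) F = rhoBer ρ I (gradedTranspose ρ I I F) := by
  classical
  have h₀ : ∀ k, ρ.IsEven (I (parityEquiv ρ I (Sum.inl k))) := fun k => k.2
  have h₁ : ∀ k, ρ.IsOdd (I (parityEquiv ρ I (Sum.inr k))) := fun k => k.2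
  have h₀' : ∀ k, ρ.IsEven (-I (parityEquiv ρ I (Sum.inl k))) := fun k => (ρ.self_neg _).trans k.2
  have h₁' : ∀ k, ρ.IsOdd (-I (parityEquiv ρ I (Sum.inr k))) := fun k => (ρ.self_neg _).trans k.2
  have gF : IsGraded (fun k => - I k) (fun k => - I k) F := fun k l => by
    rw [neg_sub_neg]; exact hF k l
  have gH : IsGraded (fun k => - I k) (fun k => - I k) H := fun k l => by
    rw [neg_sub_neg]; exact hH k l
  obtain ⟨uA, uD⟩ := isUnit_toBlocks _ h₀' h₁' gF gH h h'
  rw [rhoBer_eq_blockBer h₀' h₁' _ (fun _ => rfl) (fun _ => rfl) gF,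
    rhoBer_eq_blockBer h₀ h₁ _ (fun _ => rfl) (fun _ => rfl) (isGraded_gradedTranspose hF)]
  exact blockBer_gradedTranspose h₀ h₁ (fun k l => hF _ _) (fun k l => hF _ _)
    (fun k l => hF _ _) (fun k l => hF _ _) uA uD

omit h h' hF hH in
/-- The Berezinian of a block triangular matrix. -/
theorem rhoBer_blockTriangular {ι₁ ι₂ : Type*} [Fintype ι₁] [LinearOrder ι₁] [Fintype ι₂]
    [LinearOrder ι₂] (e : ι₁ ⊕ ι₂ ≃ ι) (hF : IsGraded I I F)
    (h0 : ∀ k l, F (e (Sum.inl k)) (e (Sum.inr l)) = 0)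
    {I₁ : ι₁ → G} {I₂ : ι₂ → G} {F₁ H₁ : Matrix ι₁ ι₁ (RhoSeries ρ d R)}
    {F₂ H₂ : Matrix ι₂ ι₂ (RhoSeries ρ d R)}
    (hI₁ : ∀ k, I (e (Sum.inl k)) = I₁ k) (hI₂ : ∀ k, I (e (Sum.inr k)) = I₂ k)
    (h₁ : ∀ k l, F (e (Sum.inl k)) (e (Sum.inl l)) = F₁ k l)
    (h₂ : ∀ k l, F (e (Sum.inr k)) (e (Sum.inr l)) = F₂ k l)
    (gH₁ : IsGraded I₁ I₁ H₁) (gH₂ : IsGraded I₂ I₂ H₂)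
    (hFH₁ : F₁ * H₁ = 1) (hHF₁ : H₁ * F₁ = 1) (hFH₂ : F₂ * H₂ = 1) (hHF₂ : H₂ * F₂ = 1) :
    rhoBer ρ I F = rhoBer ρ I₁ F₁ * rhoBer ρ I₂ F₂ := by
  classical
  have gF₁ : IsGraded I₁ I₁ F₁ := fun k l => by rw [← h₁, ← hI₁, ← hI₁]; exact hF _ _
  have gF₂ : IsGraded I₂ I₂ F₂ := fun k l => by rw [← h₂, ← hI₂, ← hI₂]; exact hF _ _
  let e₁ := parityEquiv ρ I₁
  let e₂ := parityEquiv ρ I₂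
  have a₀ : ∀ k, ρ.IsEven (I₁ (e₁ (Sum.inl k))) := fun k => k.2
  have a₁ : ∀ k, ρ.IsOdd (I₁ (e₁ (Sum.inr k))) := fun k => k.2
  have b₀ : ∀ k, ρ.IsEven (I₂ (e₂ (Sum.inl k))) := fun k => k.2
  have b₁ : ∀ k, ρ.IsOdd (I₂ (e₂ (Sum.inr k))) := fun k => k.2
  obtain ⟨uA, uD⟩ := isUnit_toBlocks e₁ a₀ a₁ gF₁ gH₁ hFH₁ hHF₁
  obtain ⟨uA', uD'⟩ := isUnit_toBlocks e₂ b₀ b₁ gF₂ gH₂ hFH₂ hHF₂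
  -- The indices are regrouped by parity first and by block second, so that each parity block of `F`
  -- is itself lower triangular.
  let e' : ({a // ρ.IsEven (I₁ a)} ⊕ₗ {a // ρ.IsEven (I₂ a)}) ⊕
      ({a // ρ.IsOdd (I₁ a)} ⊕ₗ {a // ρ.IsOdd (I₂ a)}) ≃ ι :=
    ((Equiv.sumCongr ofLex ofLex).trans (Equiv.sumSumSumComm _ _ _ _)).trans
      ((Equiv.sumCongr e₁ e₂).trans e)
  have c₀ : ∀ k, I (e' (Sum.inl k)) =
      (Sum.elim (fun k => I₁ (e₁ (Sum.inl k))) (fun k => I₂ (e₂ (Sum.inl k))) ∘ ofLex) k := by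
    intro k
    induction k using Lex.rec with | _ k
    rcases k with k | k
    · exact hI₁ _
    · exact hI₂ _
  have c₁ : ∀ k, I (e' (Sum.inr k)) =
      (Sum.elim (fun k => I₁ (e₁ (Sum.inr k))) (fun k => I₂ (e₂ (Sum.inr k))) ∘ ofLex) k := by
    intro k
    induction k using Lex.rec with | _ k
    rcases k with k | k
    · exact hI₁ _
    · exact hI₂ _
  have block : ∀ {p p' q q' : Type _} (f : p ⊕ₗ p' → ι) (g : q ⊕ₗ q' → ι) (f₁ : p → ι₁) (g₁ : q → ι₁)
      (f₂ : p' → ι₂) (g₂ : q' → ι₂) (hf₁ : ∀ k, f (toLex (Sum.inl k)) = e (Sum.inl (f₁ k)))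
      (hf₂ : ∀ k, f (toLex (Sum.inr k)) = e (Sum.inr (f₂ k)))
      (hg₁ : ∀ k, g (toLex (Sum.inl k)) = e (Sum.inl (g₁ k)))
      (hg₂ : ∀ k, g (toLex (Sum.inr k)) = e (Sum.inr (g₂ k))),
      F.submatrix f g = (Matrix.fromBlocks (F₁.submatrix f₁ g₁) 0
        (Matrix.of fun k l => F (f (toLex (Sum.inr k))) (g (toLex (Sum.inl l))))
        (F₂.submatrix f₂ g₂)).submatrix ofLex ofLex := by
    intro p p' q q' f g f₁ g₁ f₂ g₂ hf₁ hf₂ hg₁ hg₂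
    ext1 k l
    induction k using Lex.rec with | _ k
    induction l using Lex.rec with | _ l
    rcases k with k | k <;> rcases l with l | l
    · change F _ _ = F₁ _ _
      rw [hf₁, hg₁, h₁]
    · change F _ _ = 0
      rw [hf₁, hg₂, h0]
    · rfl
    · change F _ _ = F₂ _ _
      rw [hf₂, hg₂, h₂]
  have kA := block (fun k => e' (Sum.inl k)) (fun k => e' (Sum.inl k))
    (fun k => e₁ (Sum.inl k)) (fun k => e₁ (Sum.inl k)) (fun k => e₂ (Sum.inl k))
    (fun k => e₂ (Sum.inl k)) (fun _ => rfl) (fun _ => rfl) (fun _ => rfl) (fun _ => rfl)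
  have kB := block (fun k => e' (Sum.inl k)) (fun k => e' (Sum.inr k))
    (fun k => e₁ (Sum.inl k)) (fun k => e₁ (Sum.inr k)) (fun k => e₂ (Sum.inl k))
    (fun k => e₂ (Sum.inr k)) (fun _ => rfl) (fun _ => rfl) (fun _ => rfl) (fun _ => rfl)
  have kC := block (fun k => e' (Sum.inr k)) (fun k => e' (Sum.inl k))
    (fun k => e₁ (Sum.inr k)) (fun k => e₁ (Sum.inl k)) (fun k => e₂ (Sum.inr k))
    (fun k => e₂ (Sum.inl k)) (fun _ => rfl) (fun _ => rfl) (fun _ => rfl) (fun _ => rfl)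
  have kD := block (fun k => e' (Sum.inr k)) (fun k => e' (Sum.inr k))
    (fun k => e₁ (Sum.inr k)) (fun k => e₁ (Sum.inr k)) (fun k => e₂ (Sum.inr k))
    (fun k => e₂ (Sum.inr k)) (fun _ => rfl) (fun _ => rfl) (fun _ => rfl) (fun _ => rfl)
  have d₀ : ∀ k, ρ.IsEven ((Sum.elim (fun k => I₁ (e₁ (Sum.inl k)))
      (fun k => I₂ (e₂ (Sum.inl k))) ∘ ofLex) k) := by
    intro k
    induction k using Lex.rec with | _ k
    rcases k with k | k
    · exact a₀ k
    · exact b₀ k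
  have d₁ : ∀ k, ρ.IsOdd ((Sum.elim (fun k => I₁ (e₁ (Sum.inr k)))
      (fun k => I₂ (e₂ (Sum.inr k))) ∘ ofLex) k) := by
    intro k
    induction k using Lex.rec with | _ k
    rcases k with k | k
    · exact a₁ k
    · exact b₁ k
  have gF : ∀ {p p' q q' : Type _} (f : p ⊕ₗ p' → ι) (g : q ⊕ₗ q' → ι) (f₁ : p ⊕ p' → G) (g₁ : q ⊕ q' → G)
    (hf : ∀ k, I (f k) = f₁ (ofLex k)) (hg : ∀ k, I (g k) = g₁ (ofLex k))
    (N : Matrix (p ⊕ p') (q ⊕ q') (RhoSeries ρ d R)) (hN : F.submatrix f g = N.submatrix ofLex ofLex),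
    IsGraded f₁ g₁ N := by
    intro p p' q q' f g f₁ g₁ hf hg N hN k l
    have h1 := hF (f (toLex k)) (g (toLex l))
    have h2 := congrFun (congrFun hN (toLex k)) (toLex l)
    rw [Matrix.submatrix_apply] at h2
    rw [hf, hg, h2] at h1
    exact h1
  rw [rhoBer_eq_blockBer d₀ d₁ e' c₀ c₁ hF,
    rhoBer_eq_blockBer a₀ a₁ e₁ (fun _ => rfl) (fun _ => rfl) gF₁,
    rhoBer_eq_blockBer b₀ b₁ e₂ (fun _ => rfl) (fun _ => rfl) gF₂,
    show (F.submatrix e' e').toBlocks₁₁ = _ from kA, show (F.submatrix e' e').toBlocks₁₂ = _ from kB,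
    show (F.submatrix e' e').toBlocks₂₁ = _ from kC, show (F.submatrix e' e').toBlocks₂₂ = _ from kD]
  exact blockBer_fromBlocks a₀ a₁ b₀ b₁ (gF _ _ _ _ c₀ c₀ _ kA) (gF _ _ _ _ c₀ c₁ _ kB)
    (gF _ _ _ _ c₁ c₀ _ kC) (gF _ _ _ _ c₁ c₁ _ kD) uA uD uA' uD'

omit hH h h' in
theorem isHomogeneous_rhoBer : IsHomogeneous 0 (rhoBer ρ I F) := by
  classical
  have h₀ : ∀ k, ρ.IsEven (I (parityEquiv ρ I (Sum.inl k))) := fun k => k.2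
  have h₁ : ∀ k, ρ.IsOdd (I (parityEquiv ρ I (Sum.inr k))) := fun k => k.2
  rw [rhoBer_eq_blockBer h₀ h₁ _ (fun _ => rfl) (fun _ => rfl) hF, blockBer]
  split_ifs with hu
  · have gD : IsGraded (fun k => I (parityEquiv ρ I (Sum.inr k))) _
      (F.submatrix (parityEquiv ρ I) (parityEquiv ρ I)).toBlocks₂₂ := fun k l => hF _ _
    have i1 := isHomogeneous_rhoDetAux_of_isGraded (-1) (IsGraded.sub
      (I := fun k => I (parityEquiv ρ I (Sum.inl k)))
      (F := (F.submatrix (parityEquiv ρ I) (parityEquiv ρ I)).toBlocks₁₁)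
      (fun k l => hF _ _) (((IsGraded.mul (F := (F.submatrix (parityEquiv ρ I)
        (parityEquiv ρ I)).toBlocks₁₂) (fun k l => hF _ _) gD.isHomogeneous_inverse).mul
        (H := (F.submatrix (parityEquiv ρ I) (parityEquiv ρ I)).toBlocks₂₁) (fun k l => hF _ _))))
    have i2 : IsHomogeneous 0 (Ring.inverse (rhoDetOdd ρ
        (fun k => I (parityEquiv ρ I (Sum.inr k)))
        (F.submatrix (parityEquiv ρ I) (parityEquiv ρ I)).toBlocks₂₂)) := by
      rw [rhoDetOdd_eq, (Ring.isUnit_and_inverse_eq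
        (rhoDetAux_mul_eq_one h₁ gD gD.isHomogeneous_inverse (Ring.mul_inverse_cancel _ hu.2))
        (rhoDetAux_mul_eq_one h₁ gD.isHomogeneous_inverse gD
          (Ring.inverse_mul_cancel _ hu.2))).2]
      exact isHomogeneous_rhoDetAux_of_isGraded _ gD.isHomogeneous_inverse
    have i3 := i1.mul i2
    rwa [add_zero] at i3
  · exact isHomogeneous_zero _

/-! ### Berezinians under homomorphisms. -/

section Map

variable {G' κ' R' : Type*} [AddCommGroup G'] [Fintype κ'] [LinearOrder κ'] [CommRing R']
  [Algebra 𝕂 R'] {σ : CommutationFactor G' 𝕂} {d' : κ' → G'}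

omit [CharZero 𝕂] hF hH h h' in
theorem map_rhoDetAux (Φ : RhoSeries ρ d R →ₐ[𝕂] RhoSeries σ d' R') (φ : G →+ G')
    (hφ : ∀ i j, σ (φ i) (φ j) = ρ i j) (ε : 𝕂) (I : ι → G) (F : Matrix ι ι (RhoSeries ρ d R)) :
    rhoDetAux ε σ (fun k => φ (I k)) (F.map Φ) = Φ (rhoDetAux ε ρ I F) := by
  simp only [rhoDetAux, map_sum, map_smul, ← map_sub, hφ, orderedProd, map_list_prod, List.map_map]
  rfl

/-- By `hφ` all parities and all scalar factors are preserved. The invertibility of `F` ensures that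
both sides are given by the formula with determinants; in general `Φ` could turn a non-invertible
block into an invertible one. -/
theorem map_rhoBer (Φ : RhoSeries ρ d R →ₐ[𝕂] RhoSeries σ d' R') (φ : G →+ G')
    (hφ : ∀ i j, σ (φ i) (φ j) = ρ i j)
    (hΦ : ∀ i f, IsHomogeneous i f → IsHomogeneous (φ i) (Φ f)) :
    rhoBer σ (fun k => φ (I k)) (F.map Φ) = Φ (rhoBer ρ I F) := by
  classical
  have h₀ : ∀ k, ρ.IsEven (I (parityEquiv ρ I (Sum.inl k))) := fun k => k.2
  have h₁ : ∀ k, ρ.IsOdd (I (parityEquiv ρ I (Sum.inr k))) := fun k => k.2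
  have h₀' : ∀ k, σ.IsEven (φ (I (parityEquiv ρ I (Sum.inl k)))) := fun k => (hφ _ _).trans k.2
  have h₁' : ∀ k, σ.IsOdd (φ (I (parityEquiv ρ I (Sum.inr k)))) := fun k => (hφ _ _).trans k.2
  have gF : IsGraded (fun k => φ (I k)) (fun k => φ (I k)) (F.map Φ) := fun k l => by
    rw [← map_sub]; exact hΦ _ _ (hF k l)
  obtain ⟨uA, uD⟩ := isUnit_toBlocks _ h₀ h₁ hF hH h h'
  rw [rhoBer_eq_blockBer h₀ h₁ _ (fun _ => rfl) (fun _ => rfl) hF,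
    rhoBer_eq_blockBer h₀' h₁' (parityEquiv ρ I) (fun _ => rfl) (fun _ => rfl) gF]
  set A := (F.submatrix (parityEquiv ρ I) (parityEquiv ρ I)).toBlocks₁₁
  set B := (F.submatrix (parityEquiv ρ I) (parityEquiv ρ I)).toBlocks₁₂
  set C := (F.submatrix (parityEquiv ρ I) (parityEquiv ρ I)).toBlocks₂₁
  set D := (F.submatrix (parityEquiv ρ I) (parityEquiv ρ I)).toBlocks₂₂ with hD
  have inv : ∀ {m : Type _} [Fintype m] [DecidableEq m] (N : Matrix m m (RhoSeries ρ d R)),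
      IsUnit N → IsUnit (N.map Φ) ∧ Ring.inverse (N.map Φ) = (Ring.inverse N).map Φ := by
    intro m _ _ N hN
    refine Ring.isUnit_and_inverse_eq ?_ ?_
    · rw [← Matrix.map_mul, Ring.mul_inverse_cancel N hN, Matrix.map_one _ (map_zero _) (map_one _)]
    · rw [← Matrix.map_mul, Ring.inverse_mul_cancel N hN, Matrix.map_one _ (map_zero _) (map_one _)]
  have gD : IsGraded (fun k => I (parityEquiv ρ I (Sum.inr k))) _ D := fun k l => hF _ _
  have uDet := isUnit_rhoDetOdd h₁ gD uD
  have e1 : Ring.inverse (Φ (rhoDetOdd ρ (fun k => I (parityEquiv ρ I (Sum.inr k))) D)) =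
      Φ (Ring.inverse (rhoDetOdd ρ (fun k => I (parityEquiv ρ I (Sum.inr k))) D)) :=
    (Ring.isUnit_and_inverse_eq
      (by rw [← map_mul, Ring.mul_inverse_cancel _ uDet, map_one])
      (by rw [← map_mul, Ring.inverse_mul_cancel _ uDet, map_one])).2
  rw [blockBer_eq uA uD, map_mul, ← e1, rhoDetOdd, ← map_rhoDetAux Φ φ hφ, rhoDetEven,
    ← map_rhoDetAux Φ φ hφ]
  refine (blockBer_eq (A := A.map Φ) (B := B.map Φ) (C := C.map Φ) (D := D.map Φ)
    (inv A uA).1 (inv D uD).1).trans ?_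
  rw [(inv D uD).2, Matrix.map_sub _ (map_sub Φ), Matrix.map_mul, Matrix.map_mul]
  rfl

end Map

end Berezinian

end RhoSeries

/-! ### Functions on an open subset of a manifold -/

section Calculus

variable {𝕜 𝕂 : Type*} [RCLike 𝕜] [RCLike 𝕂] [NormedAlgebra 𝕜 𝕂] {n : ℕ} {r : WithTop ℕ∞}
  {M : Type*} [TopologicalSpace M] [ChartedSpace (EuclideanSpace 𝕜 (Fin n)) M]
  {φ : OpenPartialHomeomorph M (EuclideanSpace 𝕜 (Fin n))} {V W : Opens M}

/-- A function on `V` in the coordinates of the chart `φ`. -/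
noncomputable def inChart (φ : OpenPartialHomeomorph M (EuclideanSpace 𝕜 (Fin n))) {V : Opens M}
    (f : V → 𝕂) (e : EuclideanSpace 𝕜 (Fin n)) : 𝕂 :=
  Function.extend Subtype.val f 0 (φ.symm e)

theorem isOpen_image_chart (hV : (V : Set M) ⊆ φ.source) : IsOpen (φ '' V) :=
  φ.isOpen_image_of_subset_source V.2 hV

theorem inChart_apply (hV : (V : Set M) ⊆ φ.source) (f : V → 𝕂) (p : V) :
    inChart φ f (φ p) = f p := by
  rw [inChart, φ.left_inv (hV p.2)]
  exact Subtype.val_injective.extend_apply f 0 p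

theorem image_chart_mem_nhds (hV : (V : Set M) ⊆ φ.source) (p : V) : φ '' V ∈ 𝓝 (φ p) :=
  (isOpen_image_chart hV).mem_nhds ⟨p, p.2, rfl⟩

theorem contDiffOn_inChart [IsManifold 𝓘(𝕜, EuclideanSpace 𝕜 (Fin n)) r M]
    (hφ : φ ∈ IsManifold.maximalAtlas 𝓘(𝕜, EuclideanSpace 𝕜 (Fin n)) r M)
    (hV : (V : Set M) ⊆ φ.source) {f : V → 𝕂}
    (hf : ContMDiff 𝓘(𝕜, EuclideanSpace 𝕜 (Fin n)) 𝓘(𝕜, 𝕂) r f) :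
    ContDiffOn 𝕜 r (inChart φ f) (φ '' V) := by
  have h1 : ContMDiffOn 𝓘(𝕜, EuclideanSpace 𝕜 (Fin n)) 𝓘(𝕜, 𝕂) r
      (Function.extend Subtype.val f 0) V := fun x hx => by
    refine ContMDiffAt.contMDiffWithinAt ?_
    rw [← contMDiffAt_subtype_iff (U := V) (x := ⟨x, hx⟩)]
    simp only [Subtype.val_injective.extend_apply]
    exact hf _
  have h2 : ContMDiffOn 𝓘(𝕜, EuclideanSpace 𝕜 (Fin n)) 𝓘(𝕜, EuclideanSpace 𝕜 (Fin n)) r φ.symm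
      (φ '' V) := (contMDiffOn_symm_of_mem_maximalAtlas hφ).mono (by
    rintro _ ⟨x, hx, rfl⟩; exact φ.map_source (hV hx))
  exact (h1.comp h2 (by
    rintro _ ⟨x, hx, rfl⟩
    rw [Set.mem_preimage, φ.left_inv (hV hx)]; exact hx)).contDiffOn

theorem contMDiff_comp_chart [IsManifold 𝓘(𝕜, EuclideanSpace 𝕜 (Fin n)) r M]
    (hφ : φ ∈ IsManifold.maximalAtlas 𝓘(𝕜, EuclideanSpace 𝕜 (Fin n)) r M)
    (hV : (V : Set M) ⊆ φ.source) {F : EuclideanSpace 𝕜 (Fin n) → 𝕂}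
    {U : Set (EuclideanSpace 𝕜 (Fin n))}
    (hF : ContDiffOn 𝕜 r F U) (hU : IsOpen U) (hVU : ∀ p ∈ V, φ p ∈ U) :
    ContMDiff 𝓘(𝕜, EuclideanSpace 𝕜 (Fin n)) 𝓘(𝕜, 𝕂) r fun p : V => F (φ p) := by
  intro p
  have h1 : ContMDiffAt 𝓘(𝕜, EuclideanSpace 𝕜 (Fin n)) 𝓘(𝕜, EuclideanSpace 𝕜 (Fin n)) r φ p.1 :=
    contMDiffAt_of_mem_maximalAtlas hφ (hV p.2)
  have h2 : ContMDiffAt 𝓘(𝕜, EuclideanSpace 𝕜 (Fin n)) 𝓘(𝕜, 𝕂) r F (φ p.1) :=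
    (hF.contDiffAt (hU.mem_nhds (hVU p p.2))).contMDiffAt
  exact (contMDiffAt_subtype_iff (f := fun x => F (φ x))).2 (h2.comp p.1 h1)

theorem differentiableAt_inChart [IsManifold 𝓘(𝕜, EuclideanSpace 𝕜 (Fin n)) r M]
    (hr : r ≠ 0)
    (hφ : φ ∈ IsManifold.maximalAtlas 𝓘(𝕜, EuclideanSpace 𝕜 (Fin n)) r M)
    (hV : (V : Set M) ⊆ φ.source) {f : V → 𝕂}
    (hf : ContMDiff 𝓘(𝕜, EuclideanSpace 𝕜 (Fin n)) 𝓘(𝕜, 𝕂) r f) (p : V) :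
    DifferentiableAt 𝕜 (inChart φ f) (φ p) :=
  ((contDiffOn_inChart hφ hV hf).contDiffAt (image_chart_mem_nhds hV p)).differentiableAt hr

/-- The derivative only sees the open image of `V`, so the extension by zero in the definition may
be replaced by any `F` that agrees with `f` there. -/
theorem basePartial_eq_of_eventuallyEq (hV : (V : Set M) ⊆ φ.source) (k : Fin n) {f : V → 𝕂}
    {F : EuclideanSpace 𝕜 (Fin n) → 𝕂} (h : ∀ p : V, F (φ p) = f p) (p : V) :
    basePartial φ k f p = fderiv 𝕜 F (φ p) (EuclideanSpace.single k 1) := by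
  refine congrArg (fun L : EuclideanSpace 𝕜 (Fin n) →L[𝕜] 𝕂 => L (EuclideanSpace.single k 1))
    (Filter.EventuallyEq.fderiv_eq ?_)
  filter_upwards [image_chart_mem_nhds hV p]
  rintro _ ⟨q, hq, rfl⟩
  exact (inChart_apply hV f ⟨q, hq⟩).trans (h ⟨q, hq⟩).symm

theorem basePartial_const (hV : (V : Set M) ⊆ φ.source) (k : Fin n) (a : 𝕂) :
    basePartial φ k (fun _ : V => a) = 0 := by
  ext p
  rw [basePartial_eq_of_eventuallyEq hV k (F := fun _ => a) (fun _ => rfl)]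
  simp

theorem basePartial_zero (hV : (V : Set M) ⊆ φ.source) (k : Fin n) :
    basePartial φ k (0 : V → 𝕂) = 0 := basePartial_const hV k 0

theorem basePartial_coord (hV : (V : Set M) ⊆ φ.source) (k l : Fin n) :
    basePartial φ k (fun p : V => algebraMap 𝕜 𝕂 (φ p l)) = fun _ => if k = l then 1 else 0 := by
  ext p
  let L : EuclideanSpace 𝕜 (Fin n) →L[𝕜] 𝕂 := (Algebra.linearMap 𝕜 𝕂).toContinuousLinearMap.comp
    (EuclideanSpace.proj l)
  refine (basePartial_eq_of_eventuallyEq hV k (F := L) (fun _ => rfl) p).trans ?_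
  rw [L.fderiv]
  change algebraMap 𝕜 𝕂 ((EuclideanSpace.single k (1 : 𝕜)) l) = _
  by_cases h : k = l
  · subst h; simp
  · simp [h, Ne.symm h]

theorem basePartial_comp_inclusion (hV : (V : Set M) ⊆ φ.source) (h : W ≤ V) (k : Fin n)
    (f : V → 𝕂) : basePartial φ k (fun p : W => f (Set.inclusion h p)) =
      fun p => basePartial φ k f (Set.inclusion h p) := by
  ext p
  exact basePartial_eq_of_eventuallyEq (fun x hx => hV (h hx)) k
    (fun q => inChart_apply hV f (Set.inclusion h q)) p

section Smooth

variable [IsManifold 𝓘(𝕜, EuclideanSpace 𝕜 (Fin n)) r M] (hr : r = ∞ ∨ r = ω)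
  (hφ : φ ∈ IsManifold.maximalAtlas 𝓘(𝕜, EuclideanSpace 𝕜 (Fin n)) r M)
  (hV : (V : Set M) ⊆ φ.source) {f g : V → 𝕂}
  (hf : ContMDiff 𝓘(𝕜, EuclideanSpace 𝕜 (Fin n)) 𝓘(𝕜, 𝕂) r f)
  (hg : ContMDiff 𝓘(𝕜, EuclideanSpace 𝕜 (Fin n)) 𝓘(𝕜, 𝕂) r g)

include hr hφ hV hf

theorem contMDiff_basePartial (k : Fin n) :
    ContMDiff 𝓘(𝕜, EuclideanSpace 𝕜 (Fin n)) 𝓘(𝕜, 𝕂) r (basePartial φ k f) := by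
  have h1 : ContDiffOn 𝕜 r (fun e => fderiv 𝕜 (inChart φ f) e (EuclideanSpace.single k 1))
      (φ '' V) := by
    refine ContDiffOn.clm_apply ?_ contDiffOn_const
    refine (contDiffOn_inChart hφ hV hf).fderiv_of_isOpen (isOpen_image_chart hV) ?_
    -- No order of differentiability is lost, since `∞ + 1 = ∞` and `ω + 1 = ω`.
    rcases hr with rfl | rfl <;> exact le_rfl
  exact contMDiff_comp_chart hφ hV h1 (isOpen_image_chart hV) fun p hp => ⟨p, hp, rfl⟩

include hg

theorem basePartial_add (k : Fin n) :
    basePartial φ k (f + g) = basePartial φ k f + basePartial φ k g := by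
  have h0 : r ≠ 0 := by rcases hr with rfl | rfl <;> simp
  ext p
  rw [basePartial_eq_of_eventuallyEq hV k (F := inChart φ f + inChart φ g) (fun q => by
    rw [Pi.add_apply, inChart_apply hV, inChart_apply hV, Pi.add_apply]),
    fderiv_add (differentiableAt_inChart h0 hφ hV hf p) (differentiableAt_inChart h0 hφ hV hg p)]
  rfl

theorem basePartial_mul (k : Fin n) :
    basePartial φ k (f * g) = basePartial φ k f * g + f * basePartial φ k g := by
  have h0 : r ≠ 0 := by rcases hr with rfl | rfl <;> simp
  ext p
  rw [basePartial_eq_of_eventuallyEq hV k (F := inChart φ f * inChart φ g) (fun q => by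
    rw [Pi.mul_apply, inChart_apply hV, inChart_apply hV, Pi.mul_apply]),
    fderiv_mul (differentiableAt_inChart h0 hφ hV hf p) (differentiableAt_inChart h0 hφ hV hg p),
    inChart_apply hV, inChart_apply hV]
  change f p * basePartial φ k g p + g p * basePartial φ k f p =
    basePartial φ k f p * g p + f p * basePartial φ k g p
  ring

omit hg in
theorem basePartial_smul (k : Fin n) (a : 𝕂) :
    basePartial φ k (a • f) = a • basePartial φ k f := by
  have h := basePartial_mul hr hφ hV (f := fun _ => a) contMDiff_const hf k
  rw [basePartial_const hV, zero_mul, zero_add] at h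
  exact h

end Smooth

theorem basePartial_sum [IsManifold 𝓘(𝕜, EuclideanSpace 𝕜 (Fin n)) r M] (hr : r = ∞ ∨ r = ω)
    (hφ : φ ∈ IsManifold.maximalAtlas 𝓘(𝕜, EuclideanSpace 𝕜 (Fin n)) r M)
    (hV : (V : Set M) ⊆ φ.source) (k : Fin n) {α : Type*} (s : Finset α) {f : α → V → 𝕂}
    (hf : ∀ a, ContMDiff 𝓘(𝕜, EuclideanSpace 𝕜 (Fin n)) 𝓘(𝕜, 𝕂) r (f a)) :
    ContMDiff 𝓘(𝕜, EuclideanSpace 𝕜 (Fin n)) 𝓘(𝕜, 𝕂) r (∑ a ∈ s, f a) ∧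
    basePartial φ k (∑ a ∈ s, f a) = ∑ a ∈ s, basePartial φ k (f a) := by
  classical
  induction s using Finset.induction_on with
  | empty =>
    rw [Finset.sum_empty, Finset.sum_empty]
    exact ⟨contMDiff_const, basePartial_zero hV k⟩
  | insert a s ha ih =>
    rw [Finset.sum_insert ha, Finset.sum_insert ha, ← ih.2]
    exact ⟨(hf a).add ih.1, basePartial_add hr hφ hV (hf a) ih.1 k⟩

end Calculus

/-! ### Graded functions and their partial derivatives -/

namespace LocalSeries

open RhoSeries

variable {𝕜 𝕂 : Type*} [RCLike 𝕜] [RCLike 𝕂] [NormedAlgebra 𝕜 𝕂] {n : ℕ} {r : WithTop ℕ∞}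
  {M : Type*} [TopologicalSpace M] [ChartedSpace (EuclideanSpace 𝕜 (Fin n)) M]
  {φ : OpenPartialHomeomorph M (EuclideanSpace 𝕜 (Fin n))} {V W : Opens M}
  {G κ : Type*} [AddCommGroup G] [Fintype κ] [LinearOrder κ] {ρ : CommutationFactor G 𝕂} {d : κ → G}
  {i j : G} {f g : LocalSeries ρ d V}

section Restrict

variable (h : W ≤ V)

theorem restrict_sub (f g : LocalSeries ρ d V) :
    (f - g).restrict h = f.restrict h - g.restrict h := rfl

theorem restrict_sum {α : Type*} (s : Finset α) (f : α → LocalSeries ρ d V) :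
    (∑ a ∈ s, f a).restrict h = ∑ a ∈ s, (f a).restrict h :=
  map_sum (⟨⟨fun f : LocalSeries ρ d V => f.restrict h, rfl⟩, fun _ _ => rfl⟩ :
    LocalSeries ρ d V →+ LocalSeries ρ d W) f s

theorem restrict_mul (f g : LocalSeries ρ d V) :
    (f * g).restrict h = f.restrict h * g.restrict h := by
  classical
  ext w p
  change (f * g).coeff w _ = _
  rw [coeff_mul, coeff_mul]
  split_ifs
  · simp only [Finset.sum_apply]
    rfl
  · rfl

theorem restrict_C (a : V → 𝕂) : LocalSeries.restrict h (C a : LocalSeries ρ d V) =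
    C fun p => a (Set.inclusion h p) := by
  classical
  ext w p
  change (C a : LocalSeries ρ d V).coeff w _ = _
  rw [coeff_C, coeff_C]
  split_ifs <;> rfl

theorem restrict_X (b : κ) : LocalSeries.restrict h (X b : LocalSeries ρ d V) = X b := by
  classical
  ext w p
  change (X b : LocalSeries ρ d V).coeff w _ = _
  rw [coeff_X, coeff_X]
  split_ifs <;> rfl

theorem restrict_one : LocalSeries.restrict h (1 : LocalSeries ρ d V) = 1 := restrict_C h 1

theorem restrict_coordSeries (a : Fin n ⊕ₗ κ) :
    (coordSeries ρ d φ V a).restrict h = coordSeries ρ d φ W a := by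
  induction a using Lex.rec with | _ a
  rcases a with k | b
  · exact restrict_C h _
  · exact restrict_X h b

theorem IsFunction.restrict (hf : f.IsFunction 𝕜 n r i) : (f.restrict h).IsFunction 𝕜 n r i :=
  ⟨fun w => (hf.1 w).comp (contMDiff_inclusion h), fun w hw => hf.2 w fun h0 => hw (by
    ext p; exact congrFun h0 _)⟩

end Restrict

section Algebra

theorem contMDiff_mul {a b : V → 𝕂}
    (ha : ContMDiff 𝓘(𝕜, EuclideanSpace 𝕜 (Fin n)) 𝓘(𝕜, 𝕂) r a)
    (hb : ContMDiff 𝓘(𝕜, EuclideanSpace 𝕜 (Fin n)) 𝓘(𝕜, 𝕂) r b) :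
    ContMDiff 𝓘(𝕜, EuclideanSpace 𝕜 (Fin n)) 𝓘(𝕜, 𝕂) r (a * b) :=
  (contDiff_mul (𝕜 := 𝕜) (𝔸 := 𝕂)).contMDiff.comp (ha.prodMk_space hb)

theorem contMDiff_smul (c : 𝕂) {b : V → 𝕂}
    (hb : ContMDiff 𝓘(𝕜, EuclideanSpace 𝕜 (Fin n)) 𝓘(𝕜, 𝕂) r b) :
    ContMDiff 𝓘(𝕜, EuclideanSpace 𝕜 (Fin n)) 𝓘(𝕜, 𝕂) r (c • b) :=
  contMDiff_mul (contMDiff_const (c := c)) hb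

theorem contMDiff_sum {α : Type*} (s : Finset α) {f : α → V → 𝕂}
    (hf : ∀ a ∈ s, ContMDiff 𝓘(𝕜, EuclideanSpace 𝕜 (Fin n)) 𝓘(𝕜, 𝕂) r (f a)) :
    ContMDiff 𝓘(𝕜, EuclideanSpace 𝕜 (Fin n)) 𝓘(𝕜, 𝕂) r (∑ a ∈ s, f a) := by
  classical
  induction s using Finset.induction_on with
  | empty => exact contMDiff_const (c := (0 : 𝕂))
  | insert a s ha ih =>
    rw [Finset.sum_insert ha]
    exact (hf a (Finset.mem_insert_self a s)).add
      (ih fun b hb => hf b (Finset.mem_insert_of_mem hb))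

theorem IsFunction.isHomogeneous (hf : f.IsFunction 𝕜 n r i) : IsHomogeneous i f := hf.2

theorem isFunction_C {a : V → 𝕂}
    (ha : ContMDiff 𝓘(𝕜, EuclideanSpace 𝕜 (Fin n)) 𝓘(𝕜, 𝕂) r a) :
    LocalSeries.IsFunction 𝕜 n r 0 (C a : LocalSeries ρ d V) := by
  classical
  refine ⟨fun w => ?_, isHomogeneous_C a⟩
  rw [coeff_C]
  split_ifs
  · exact ha
  · exact contMDiff_const

theorem isFunction_zero (i : G) : LocalSeries.IsFunction 𝕜 n r i (0 : LocalSeries ρ d V) :=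
  ⟨fun _ => contMDiff_const, isHomogeneous_zero i⟩

theorem isFunction_one : LocalSeries.IsFunction 𝕜 n r 0 (1 : LocalSeries ρ d V) :=
  isFunction_C (a := 1) (contMDiff_const (c := (1 : 𝕂)))

theorem isFunction_X (b : κ) : LocalSeries.IsFunction 𝕜 n r (d b) (X b : LocalSeries ρ d V) := by
  classical
  refine ⟨fun w => ?_, isHomogeneous_X b⟩
  rw [coeff_X]
  split_ifs
  · exact contMDiff_const
  · exact contMDiff_const

theorem IsFunction.add (hf : f.IsFunction 𝕜 n r i) (hg : g.IsFunction 𝕜 n r i) :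
    (f + g).IsFunction 𝕜 n r i := ⟨fun w => (hf.1 w).add (hg.1 w), hf.isHomogeneous.add hg.2⟩

theorem IsFunction.smul (hf : f.IsFunction 𝕜 n r i) (a : 𝕂) : (a • f).IsFunction 𝕜 n r i :=
  ⟨fun w => contMDiff_smul a (hf.1 w), hf.isHomogeneous.smul a⟩

theorem IsFunction.neg (hf : f.IsFunction 𝕜 n r i) : (-f).IsFunction 𝕜 n r i := by
  have h := hf.smul (-1)
  rwa [neg_one_smul] at h

theorem IsFunction.sub (hf : f.IsFunction 𝕜 n r i) (hg : g.IsFunction 𝕜 n r i) :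
    (f - g).IsFunction 𝕜 n r i := by
  rw [sub_eq_add_neg]; exact hf.add hg.neg

theorem IsFunction.sum {α : Type*} {s : Finset α} {f : α → LocalSeries ρ d V}
    (hf : ∀ a ∈ s, (f a).IsFunction 𝕜 n r i) : (∑ a ∈ s, f a).IsFunction 𝕜 n r i := by
  classical
  induction s using Finset.induction_on with
  | empty => exact isFunction_zero i
  | insert a s ha ih =>
    rw [Finset.sum_insert ha]
    exact (hf a (Finset.mem_insert_self a s)).add
      (ih fun b hb => hf b (Finset.mem_insert_of_mem hb))

theorem IsFunction.mul (hf : f.IsFunction 𝕜 n r i) (hg : g.IsFunction 𝕜 n r j) :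
    (f * g).IsFunction 𝕜 n r (i + j) := by
  classical
  refine ⟨fun w => ?_, hf.isHomogeneous.mul hg.2⟩
  rw [coeff_mul]
  split_ifs
  · refine contMDiff_sum _ fun p _ => ?_
    exact contMDiff_smul _ (contMDiff_mul (hf.1 p.1) (hg.1 p.2))
  · exact contMDiff_const

theorem IsFunction.pow (hf : f.IsFunction 𝕜 n r 0) (k : ℕ) : (f ^ k).IsFunction 𝕜 n r 0 := by
  induction k with
  | zero => rw [pow_zero]; exact isFunction_one
  | succ k ih =>
    rw [pow_succ, ← add_zero (0 : G)]
    exact ih.mul hf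

end Algebra

theorem coordDegree_inl (k : Fin n) : coordDegree n d (toLex (Sum.inl k)) = 0 := rfl

theorem coordPartial_inr (b : κ) (f : LocalSeries ρ d V) :
    coordPartial φ (toLex (Sum.inr b)) f = formalPartial b f := rfl

section Derivative

variable [IsManifold 𝓘(𝕜, EuclideanSpace 𝕜 (Fin n)) r M]
  (hφ : φ ∈ IsManifold.maximalAtlas 𝓘(𝕜, EuclideanSpace 𝕜 (Fin n)) r M)
  (hV : (V : Set M) ⊆ φ.source) (hr : r = ∞ ∨ r = ω)

include hV

theorem coeff_coordPartial_inl (k : Fin n) (f : LocalSeries ρ d V) (w) :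
    (coordPartial φ (toLex (Sum.inl k)) f).coeff w = basePartial φ k (f.coeff w) := by
  classical
  refine (coeff_ofCoeff _ w).trans ?_
  split_ifs with h
  · rfl
  · rw [f.coeff_eq_zero w h, basePartial_zero hV]

theorem coordPartial_restrict (h : W ≤ V) (a : Fin n ⊕ₗ κ) (f : LocalSeries ρ d V) :
    (coordPartial φ a f).restrict h = coordPartial φ a (f.restrict h) := by
  classical
  induction a using Lex.rec with | _ a
  rcases a with k | b
  · ext w p
    rw [coeff_coordPartial_inl fun x hx => hV (h hx)]
    change (coordPartial φ (toLex (Sum.inl k)) f).coeff w _ = _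
    rw [coeff_coordPartial_inl hV]
    exact (congrFun (basePartial_comp_inclusion hV h k (f.coeff w)) p).symm
  · ext w p
    change (formalPartial b f).coeff w _ = (formalPartial b (f.restrict h)).coeff w p
    rw [coeff_formalPartial, coeff_formalPartial]
    split_ifs <;> rfl

theorem coordPartial_C_const (a : Fin n ⊕ₗ κ) (x : 𝕂) :
    coordPartial φ a (C (fun _ => x) : LocalSeries ρ d V) = 0 := by
  classical
  induction a using Lex.rec with | _ a
  rcases a with k | b
  · ext1
    funext w
    rw [coeff_coordPartial_inl hV, coeff_C]
    split_ifs
    · exact basePartial_const hV k x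
    · exact basePartial_zero hV k
  · exact formalPartial_C b _

theorem coordPartial_coordSeries (a b : Fin n ⊕ₗ κ) :
    coordPartial φ b (coordSeries ρ d φ V a) = if a = b then 1 else 0 := by
  classical
  induction a using Lex.rec with | _ a
  induction b using Lex.rec with | _ b
  rcases a with k | a <;> rcases b with l | b
  · ext1
    funext w
    rw [coeff_coordPartial_inl hV]
    change basePartial φ l ((C fun p : V => algebraMap 𝕜 𝕂 (φ p k) : LocalSeries ρ d V).coeff w) = _
    rw [coeff_C]
    by_cases hkl : k = l
    · subst hkl
      rw [if_pos rfl, coeff_one]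
      split_ifs
      · rw [basePartial_coord hV]; simp; rfl
      · exact basePartial_zero hV k
    · rw [if_neg (fun h => hkl (Sum.inl_injective (toLex.injective h)))]
      split_ifs
      · rw [basePartial_coord hV]; simp [Ne.symm hkl]; rfl
      · exact basePartial_zero hV l
  · rw [if_neg (fun h => by cases toLex.injective h)]
    exact formalPartial_C b _
  · rw [if_neg (fun h => by cases toLex.injective h)]
    ext1
    funext w
    rw [coeff_coordPartial_inl hV]
    change basePartial φ l ((X a : LocalSeries ρ d V).coeff w) = _
    rw [coeff_X]
    split_ifs
    · exact basePartial_const hV l 1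
    · exact basePartial_zero hV l
  · refine (formalPartial_X b a).trans (if_congr ⟨fun h => by rw [h], fun h =>
      Sum.inr_injective (toLex.injective h)⟩ rfl rfl)

include hφ

theorem isFunction_coordSeries (a : Fin n ⊕ₗ κ) :
    (coordSeries ρ d φ V a).IsFunction 𝕜 n r (coordDegree n d a) := by
  induction a using Lex.rec with | _ a
  rcases a with k | a
  · refine isFunction_C (contMDiff_comp_chart hφ hV (F := fun e => algebraMap 𝕜 𝕂 (e k))
      (U := Set.univ) ?_ isOpen_univ fun _ _ => trivial)
    exact ((LinearMap.toContinuousLinearMap (Algebra.linearMap 𝕜 𝕂)).comp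
      (EuclideanSpace.proj k)).contDiff.contDiffOn
  · exact isFunction_X a

include hr

theorem IsFunction.coordPartial (hf : f.IsFunction 𝕜 n r i) (a : Fin n ⊕ₗ κ) :
    (coordPartial φ a f).IsFunction 𝕜 n r (i - coordDegree n d a) := by
  classical
  induction a using Lex.rec with | _ a
  rcases a with k | b
  · rw [coordDegree_inl, sub_zero]
    refine ⟨fun w => ?_, fun w hw => ?_⟩
    · rw [coeff_coordPartial_inl hV]
      exact contMDiff_basePartial hr hφ hV (hf.1 w) k
    · rw [coeff_coordPartial_inl hV] at hw
      exact hf.2 w fun h => hw (by rw [h, basePartial_zero hV])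
  · refine ⟨fun w => ?_, hf.isHomogeneous.formalPartial b⟩
    rw [coordPartial_inr, coeff_formalPartial]
    split_ifs
    · exact contMDiff_smul _ (hf.1 _)
    · exact contMDiff_const

theorem coordPartial_add (hf : f.IsFunction 𝕜 n r i) (hg : g.IsFunction 𝕜 n r j)
    (a : Fin n ⊕ₗ κ) :
    _root_.coordPartial φ a (f + g) = _root_.coordPartial φ a f + _root_.coordPartial φ a g := by
  induction a using Lex.rec with | _ a
  rcases a with k | b
  · ext1
    funext w
    rw [coeff_add, coeff_coordPartial_inl hV, coeff_coordPartial_inl hV, coeff_coordPartial_inl hV,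
      coeff_add]
    exact basePartial_add hr hφ hV (hf.1 w) (hg.1 w) k
  · exact formalPartial_add b f g

theorem coordPartial_mul (hf : f.IsFunction 𝕜 n r i) (hg : g.IsFunction 𝕜 n r j)
    (a : Fin n ⊕ₗ κ) : _root_.coordPartial φ a (f * g) = _root_.coordPartial φ a f * g +
      ρ (-coordDegree n d a) i • (f * _root_.coordPartial φ a g) := by
  classical
  induction a using Lex.rec with | _ a
  rcases a with k | b
  · rw [coordDegree_inl, neg_zero, ρ.zero_left, one_smul]
    ext1
    funext w
    rw [coeff_add, coeff_coordPartial_inl hV]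
    by_cases hw : Admissible ρ d w
    · rw [coeff_mul, coeff_mul, coeff_mul, if_pos hw, if_pos hw, if_pos hw,
        (basePartial_sum hr hφ hV k _ fun p => ?_).2, ← Finset.sum_add_distrib]
      -- Base coordinates have degree `0`, so no commutation factor appears and the ordinary product
      -- rule applies to the coefficients.
      · refine Finset.sum_congr rfl fun p _ => ?_
        rw [basePartial_smul hr hφ hV (contMDiff_mul (hf.1 p.1) (hg.1 p.2)),
          basePartial_mul hr hφ hV (hf.1 p.1) (hg.1 p.2), smul_add, coeff_coordPartial_inl hV,
          coeff_coordPartial_inl hV]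
      · exact contMDiff_smul _ (contMDiff_mul (hf.1 p.1) (hg.1 p.2))
    · rw [coeff_eq_zero _ w hw, coeff_eq_zero _ w hw, coeff_eq_zero _ w hw, basePartial_zero hV,
        add_zero]
  · exact formalPartial_mul hf.isHomogeneous b g

end Derivative

end LocalSeries

/-! ### Decomposition with respect to the coordinates -/

namespace RhoSeries

variable {G 𝕂 κ : Type*} [AddCommGroup G] [Field 𝕂] [Fintype κ] [LinearOrder κ]
  {ρ : CommutationFactor G 𝕂} {d : κ → G} {R : Type*} [CommRing R] [Algebra 𝕂 R]

theorem coeff_X_mul_add_single (b : κ) (g : RhoSeries ρ d R) {u : κ →₀ ℕ}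
    (hu : Admissible ρ d (u + Finsupp.single b 1)) :
    (X b * g).coeff (u + Finsupp.single b 1) =
      exchange ρ d (Finsupp.single b 1) u • g.coeff u := by
  classical
  rw [coeff_mul, if_pos hu, Finset.sum_eq_single (Finsupp.single b 1, u)]
  · rw [coeff_X, if_pos rfl, one_mul]
  · rintro ⟨v, v'⟩ hp hne
    rw [Finset.HasAntidiagonal.mem_antidiagonal] at hp
    have hv : v ≠ Finsupp.single b 1 := by
      rintro rfl
      have h : (Finsupp.single b 1 : κ →₀ ℕ) + v' = u + Finsupp.single b 1 := hp
      rw [add_comm] at h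
      exact hne (Prod.ext rfl (add_right_cancel h))
    rw [coeff_X, if_neg hv, zero_mul, smul_zero]
  · intro h
    exact absurd (Finset.HasAntidiagonal.mem_antidiagonal.2 (add_comm _ _)) h

theorem coeff_X_mul_of_eq_zero (b : κ) (g : RhoSeries ρ d R) {w : κ →₀ ℕ} (hw : w b = 0) :
    (X b * g).coeff w = 0 := by
  classical
  rw [coeff_mul]
  split_ifs
  · refine Finset.sum_eq_zero fun p hp => ?_
    rw [Finset.HasAntidiagonal.mem_antidiagonal] at hp
    have hv : p.1 ≠ Finsupp.single b 1 := by
      intro h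
      have := DFunLike.congr_fun hp b
      simp [h, hw] at this
    rw [coeff_X, if_neg hv, zero_mul, smul_zero]
  · rfl

open Classical in
/-- The quotient by `x b` of the sum of the monomials whose least index is `b`. -/
noncomputable def leastPart (b : κ) (f : RhoSeries ρ d R) : RhoSeries ρ d R :=
  ofCoeff fun u => if ∀ c < b, u c = 0 then f.coeff (u + Finsupp.single b 1) else 0

open Classical in
theorem coeff_leastPart (b : κ) (f : RhoSeries ρ d R) (u : κ →₀ ℕ) : (leastPart b f).coeff u =
    if ∀ c < b, u c = 0 then f.coeff (u + Finsupp.single b 1) else 0 := by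
  refine (coeff_ofCoeff _ u).trans ?_
  by_cases h : Admissible ρ d u
  · rw [if_pos h]
  · rw [if_neg h, f.coeff_eq_zero (u + Finsupp.single b 1)
      (fun h' => h (h'.mono le_self_add)), ite_self]

theorem IsHomogeneous.leastPart {i : G} {f : RhoSeries ρ d R} (hf : IsHomogeneous i f) (b : κ) :
    IsHomogeneous (i - d b) (leastPart b f) := by
  classical
  intro w hw
  rw [coeff_leastPart] at hw
  split_ifs at hw
  · have := hf _ hw
    rw [monomialDegree_add, monomialDegree_single, one_smul] at this
    rw [← this, add_sub_cancel_right]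
  · exact absurd rfl hw

/-- Every nonconstant monomial is assigned to its least index. That indeterminate stands in front
and can be split off without any exchange. -/
theorem eq_C_add_sum_X_mul (f : RhoSeries ρ d R) :
    f = C (f.coeff 0) + ∑ b, X b * leastPart b f := by
  classical
  ext w
  rw [coeff_add, coeff_C, coeff_sum]
  by_cases hw : Admissible ρ d w
  swap
  · have h0 : w ≠ 0 := fun h => hw (h ▸ admissible_zero ρ d)
    rw [f.coeff_eq_zero w hw, if_neg h0, zero_add]
    exact (Finset.sum_eq_zero fun b _ => coeff_eq_zero _ w hw).symm
  by_cases h0 : w = 0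
  · subst h0
    rw [if_pos rfl, Finset.sum_eq_zero fun b _ => coeff_X_mul_of_eq_zero b _ rfl, add_zero]
  rw [if_neg h0, zero_add]
  have hne : w.support.Nonempty := Finsupp.support_nonempty_iff.2 h0
  -- Only the least index of `w` contributes; for a larger `b` in the support, `leastPart b`
  -- excludes the monomial because `b₀` still occurs in it.
  set b₀ := w.support.min' hne with hb₀
  have hmem : w b₀ ≠ 0 := Finsupp.mem_support_iff.1 (Finset.min'_mem _ hne)
  have hlt : ∀ c < b₀, w c = 0 := fun c hc => by
    by_contra h
    exact absurd (Finset.min'_le _ c (Finsupp.mem_support_iff.2 h)) (not_le.2 hc)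
  have hsub : ∀ b, w b ≠ 0 → w - Finsupp.single b 1 + Finsupp.single b 1 = w := fun b hb =>
    tsub_add_cancel_of_le (Finsupp.single_le_iff.2 (Nat.one_le_iff_ne_zero.2 hb))
  have hcoeff : ∀ b, w b ≠ 0 → (X b * leastPart b f).coeff w =
      exchange ρ d (Finsupp.single b 1) (w - Finsupp.single b 1) •
        (leastPart b f).coeff (w - Finsupp.single b 1) := fun b hb => by
    conv_lhs => rw [← hsub b hb]
    exact coeff_X_mul_add_single b _ (by rw [hsub b hb]; exact hw)
  rw [Finset.sum_eq_single b₀]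
  · have h1 : ∀ c < b₀, (w - Finsupp.single b₀ 1 : κ →₀ ℕ) c = 0 := fun c hc => by
      rw [Finsupp.tsub_apply, hlt c hc, zero_tsub]
    rw [hcoeff b₀ hmem, coeff_leastPart, if_pos h1, hsub b₀ hmem, exchange_single_left,
      Finset.prod_eq_one, one_smul]
    intro c hc
    rw [h1 c (Finset.mem_filter.1 hc).2, pow_zero]
  · intro b _ hb
    by_cases hwb : w b = 0
    · exact coeff_X_mul_of_eq_zero b _ hwb
    · have hlt' : b₀ < b := lt_of_le_of_ne
        (Finset.min'_le _ b (Finsupp.mem_support_iff.2 hwb)) (Ne.symm hb)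
      rw [hcoeff b hwb, coeff_leastPart, if_neg, smul_zero]
      intro h
      have := h b₀ hlt'
      rw [Finsupp.tsub_apply, Finsupp.single_apply, if_neg hb, tsub_zero] at this
      exact hmem this
  · exact fun h => absurd (Finset.mem_univ _) h

end RhoSeries

/-! ### Inversion and Hadamard decomposition of graded functions. -/

namespace LocalSeries

open RhoSeries

variable {𝕜 𝕂 : Type*} [RCLike 𝕜] [RCLike 𝕂] [NormedAlgebra 𝕜 𝕂] {n : ℕ} {r : WithTop ℕ∞}
  {M : Type*} [TopologicalSpace M] [ChartedSpace (EuclideanSpace 𝕜 (Fin n)) M]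
  {φ : OpenPartialHomeomorph M (EuclideanSpace 𝕜 (Fin n))} {V W : Opens M}
  {G κ : Type*} [AddCommGroup G] [Fintype κ] [LinearOrder κ] {ρ : CommutationFactor G 𝕂} {d : κ → G}
  {i j : G} {f g : LocalSeries ρ d V}

/-- A function of degree `0` is invertible where its body does not vanish. -/
theorem IsFunction.exists_mul_eq_one (hf : f.IsFunction 𝕜 n r 0) (h0 : ∀ p, f.coeff 0 p ≠ 0) :
    ∃ g : LocalSeries ρ d V, g.IsFunction 𝕜 n r 0 ∧ f * g = 1 := by
  classical
  have ha : ContMDiff 𝓘(𝕜, EuclideanSpace 𝕜 (Fin n)) 𝓘(𝕜, 𝕂) r fun p => (f.coeff 0 p)⁻¹ := by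
    intro p
    exact (contDiffAt_inv 𝕜 (h0 p)).contMDiffAt.comp p (hf.1 0 p)
  set a : V → 𝕂 := fun p => (f.coeff 0 p)⁻¹ with ha'
  have hCf : LocalSeries.IsFunction 𝕜 n r 0 (C a * f) := by
    have := (isFunction_C (ρ := ρ) (d := d) ha).mul hf
    rwa [add_zero] at this
  -- After normalising the body to `1`, the rest `h` has no constant term, so `h ^ k` only contains
  -- monomials of total degree at least `k`.
  set h : LocalSeries ρ d V := 1 - C a * f with hh
  have hfun : h.IsFunction 𝕜 n r 0 := isFunction_one.sub hCf
  have hzero : h.coeff 0 = 0 := by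
    ext p
    rw [hh, coeff_sub, coeff_C_mul, coeff_one, if_pos rfl]
    change 1 - (f.coeff 0 p)⁻¹ * f.coeff 0 p = 0
    rw [inv_mul_cancel₀ (h0 p), sub_self]
  have hpow : ∀ k w, Finsupp.degree w < k → (h ^ k).coeff w = 0 := by
    intro k
    induction k with
    | zero => intro w hw; exact absurd hw (Nat.not_lt_zero _)
    | succ k ih =>
      intro w hw
      rw [pow_succ, coeff_mul]
      split_ifs
      · refine Finset.sum_eq_zero fun p hp => ?_
        rw [Finset.HasAntidiagonal.mem_antidiagonal] at hp
        by_cases hp2 : p.2 = 0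
        · rw [hp2, hzero, mul_zero, smul_zero]
        · have h1 : Finsupp.degree p.2 ≠ 0 := fun h => hp2 (Finsupp.degree_eq_zero_iff _ |>.1 h)
          rw [← hp, map_add] at hw
          rw [ih p.1 (by omega), zero_mul, smul_zero]
      · rfl
  have hgeom : ∀ N w, Finsupp.degree w < N → (∑ k ∈ Finset.range N, h ^ k).coeff w =
      (∑ k ∈ Finset.range (Finsupp.degree w + 1), h ^ k).coeff w := by
    intro N w hN
    rw [coeff_sum, coeff_sum]
    refine (Finset.sum_subset (Finset.range_mono hN) fun k _ hk => hpow k w ?_).symm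
    rw [Finset.mem_range] at hk
    omega
  -- The geometric series of `h`, truncated separately for each coefficient; by `hgeom` longer
  -- truncations give the same coefficient.
  let g : LocalSeries ρ d V :=
    ⟨fun w => (∑ k ∈ Finset.range (Finsupp.degree w + 1), h ^ k).coeff w,
      fun w hw => coeff_eq_zero _ w hw⟩
  have hg : g.IsFunction 𝕜 n r 0 := by
    have h1 : ∀ N, LocalSeries.IsFunction 𝕜 n r 0 (∑ k ∈ Finset.range N, h ^ k) := fun N =>
      IsFunction.sum fun k _ => hfun.pow k
    exact ⟨fun w => (h1 _).1 w, fun w hw => (h1 _).2 w hw⟩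
  have hmul : C a * f * g = 1 := by
    have h1 : C a * f = 1 - h := by rw [hh, sub_sub_cancel]
    ext1
    funext w
    have h2 : ((1 - h) * g).coeff w =
        ((1 - h) * ∑ k ∈ Finset.range (Finsupp.degree w + 1), h ^ k).coeff w := by
      rw [coeff_mul, coeff_mul]
      split_ifs
      · refine Finset.sum_congr rfl fun p hp => ?_
        rw [Finset.HasAntidiagonal.mem_antidiagonal] at hp
        rw [hgeom (Finsupp.degree w + 1) p.2 (by rw [← hp, map_add]; omega)]
      · rfl
    rw [h1, h2, mul_neg_geom_sum, coeff_sub, hpow _ w (Nat.lt_succ_self _), sub_zero]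
  refine ⟨C a * g, ?_, ?_⟩
  · have := (isFunction_C (ρ := ρ) (d := d) ha).mul hg
    rwa [add_zero] at this
  · rw [← mul_assoc, ← (isHomogeneous_C a).mul_comm hf.isHomogeneous, hmul]

/-- A nonzero body forces `i = 0`. Otherwise the constant is zero, which belongs to every degree. -/
theorem isFunction_C_coeff_zero (hf : f.IsFunction 𝕜 n r i) (p : V) :
    LocalSeries.IsFunction 𝕜 n r i (C (fun _ => f.coeff 0 p) : LocalSeries ρ d W) := by
  by_cases h0 : f.coeff 0 = 0
  · have : (C (fun _ => f.coeff 0 p) : LocalSeries ρ d W) = 0 := by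
      rw [h0]
      ext1
      funext w
      exact (coeff_C _ w).trans (ite_self _)
    rw [this]
    exact isFunction_zero i
  · have hi := hf.2 0 h0
    rw [monomialDegree_zero] at hi
    rw [← hi]
    exact isFunction_C contMDiff_const

variable [IsManifold 𝓘(𝕜, EuclideanSpace 𝕜 (Fin n)) r M]
  (hφ : φ ∈ IsManifold.maximalAtlas 𝓘(𝕜, EuclideanSpace 𝕜 (Fin n)) r M)
  (hV : (V : Set M) ⊆ φ.source) (hr : r = ∞ ∨ r = ω)

include hφ hV hr

theorem exists_eq_add_sum_coord_mul {a : V → 𝕂}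
    (ha : ContMDiff 𝓘(𝕜, EuclideanSpace 𝕜 (Fin n)) 𝓘(𝕜, 𝕂) r a) (p : V) :
    ∃ (W : Opens M) (h : W ≤ V), p.1 ∈ W ∧ ∃ b : Fin n → W → 𝕂,
      (∀ k, ContMDiff 𝓘(𝕜, EuclideanSpace 𝕜 (Fin n)) 𝓘(𝕜, 𝕂) r (b k)) ∧
      ∀ q : W, a (Set.inclusion h q) =
        a p + ∑ k, (algebraMap 𝕜 𝕂 (φ q k) - algebraMap 𝕜 𝕂 (φ p k)) * b k q := by
  obtain ⟨ε, hε, hball⟩ := Metric.mem_nhds_iff.1 (image_chart_mem_nhds hV p)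
  obtain ⟨δ, hδ, D, hD, hF⟩ :=
    ((contDiffOn_inChart hφ hV ha).mono hball).exists_contDiffOn_sub_apply hr hε
  let W : Opens M := ⟨V ∩ (φ.source ∩ φ ⁻¹' Metric.ball (φ p) δ),
    V.2.inter (φ.isOpen_inter_preimage Metric.isOpen_ball)⟩
  have hWV : W ≤ V := fun x hx => hx.1
  refine ⟨W, hWV, ⟨p.2, hV p.2, Metric.mem_ball_self hδ⟩,
    fun k q => D (φ q) (EuclideanSpace.single k 1), fun k => ?_, fun q => ?_⟩
  · exact contMDiff_comp_chart (V := W) hφ (fun x hx => hx.2.1)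
      (hD.clm_apply contDiffOn_const) Metric.isOpen_ball fun x hx => hx.2.2
  · have h1 := hF (φ q) q.2.2.2
    rw [inChart_apply hV, show φ q = φ (Set.inclusion hWV q) from rfl, inChart_apply hV] at h1
    rw [h1]
    congr 1
    have h2 : φ q - φ p = ∑ k, (φ q k - φ p k) • EuclideanSpace.single k (1 : 𝕜) := by
      ext l
      simp [Pi.single_apply]
    change D (φ q) (φ q - φ p) = _
    rw [h2, map_sum]
    refine Finset.sum_congr rfl fun k _ => ?_
    rw [map_smul, Algebra.smul_def, map_sub]

/-- The body is treated by Hadamard's lemma in the chart, and the remaining monomials by splitting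
off their least indeterminate. -/
theorem IsFunction.exists_eq_C_add_sum (hf : f.IsFunction 𝕜 n r i) (p : V) :
    ∃ (W : Opens M) (h : W ≤ V), p.1 ∈ W ∧ ∃ g : Fin n ⊕ₗ κ → LocalSeries ρ d W,
      (∀ a, (g a).IsFunction 𝕜 n r (i - coordDegree n d a)) ∧
      f.restrict h = C (fun _ => f.coeff 0 p) +
        ∑ a, (coordSeries ρ d φ W a - C (fun _ => (coordSeries ρ d φ V a).coeff 0 p)) * g a := by
  classical
  obtain ⟨W, h, hp, b, hb, hab⟩ : ∃ (W : Opens M) (h : W ≤ V), p.1 ∈ W ∧ ∃ b : Fin n → W → 𝕂,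
      (∀ k, LocalSeries.IsFunction 𝕜 n r i (C (b k) : LocalSeries ρ d W)) ∧
      ∀ q : W, f.coeff 0 (Set.inclusion h q) =
        f.coeff 0 p + ∑ k, (algebraMap 𝕜 𝕂 (φ q k) - algebraMap 𝕜 𝕂 (φ p k)) * b k q := by
    -- With vanishing body the degree `i` may be nonzero, so zero must be chosen for the quotients
    -- to keep them homogeneous of degree `i`.
    by_cases h0 : f.coeff 0 = 0
    · refine ⟨V, le_rfl, p.2, fun _ => 0, fun k => ?_, fun q => by simp [h0]⟩
      have : (C 0 : LocalSeries ρ d V) = 0 := by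
        ext1
        funext w
        exact (coeff_C _ w).trans (ite_self _)
      rw [this]
      exact isFunction_zero i
    · obtain ⟨W, h, hp, b, hb, hab⟩ := exists_eq_add_sum_coord_mul hφ hV hr (hf.1 0) p
      refine ⟨W, h, hp, b, fun k => ?_, hab⟩
      have hi := hf.2 0 h0
      rw [monomialDegree_zero] at hi
      rw [← hi]
      exact isFunction_C (hb k)
  have hfW : LocalSeries.IsFunction 𝕜 n r i (f.restrict h) := hf.restrict h
  refine ⟨W, h, hp, fun a => Sum.elim (fun k => C (b k)) (fun c => leastPart c (f.restrict h))
    (ofLex a), fun a => ?_, ?_⟩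
  · induction a using Lex.rec with | _ a
    rcases a with k | c
    · rw [coordDegree_inl, sub_zero]
      exact hb k
    · refine ⟨fun w => ?_, hfW.isHomogeneous.leastPart c⟩
      change ContMDiff _ _ _ ((leastPart c (f.restrict h)).coeff w)
      rw [coeff_leastPart]
      split_ifs
      · exact hfW.1 _
      · exact contMDiff_const (c := (0 : 𝕂))
  · have hsum : ∀ F : Fin n ⊕ₗ κ → LocalSeries ρ d W, ∑ a, F a =
        ∑ k, F (toLex (Sum.inl k)) + ∑ c, F (toLex (Sum.inr c)) := fun F =>
      (Fintype.sum_equiv toLex (fun a => F (toLex a)) F fun _ => rfl).symm.trans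
        (Fintype.sum_sum_type _)
    conv_lhs => rw [eq_C_add_sum_X_mul (f.restrict h)]
    rw [hsum, ← add_assoc]
    refine congrArg₂ (· + ·) ?_ (Finset.sum_congr rfl fun c _ => ?_)
    · ext1
      funext w
      rw [coeff_add, coeff_sum, coeff_C, coeff_C]
      have hk : ∀ k, ((coordSeries ρ d φ W (toLex (Sum.inl k)) -
          C (fun _ => (coordSeries ρ d φ V (toLex (Sum.inl k))).coeff 0 p)) *
          (C (b k) : LocalSeries ρ d W)).coeff w = if w = 0 then
            (fun q : W => (algebraMap 𝕜 𝕂 (φ q k) - algebraMap 𝕜 𝕂 (φ p k)) * b k q) else 0 := by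
        intro k
        have h1 : (coordSeries ρ d φ V (toLex (Sum.inl k))).coeff 0 p = algebraMap 𝕜 𝕂 (φ p k) := by
          change (C _ : LocalSeries ρ d V).coeff 0 p = _
          rw [coeff_C, if_pos rfl]
        have h2 : (coordSeries ρ d φ W (toLex (Sum.inl k)) -
          C (fun _ => algebraMap 𝕜 𝕂 (φ p k)) : LocalSeries ρ d W) =
          C (fun q : W => algebraMap 𝕜 𝕂 (φ q k) - algebraMap 𝕜 𝕂 (φ p k)) := by
          ext1
          funext w
          change (C _ : LocalSeries ρ d W).coeff w - _ = _
          rw [coeff_C, coeff_C, coeff_C]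
          split_ifs
          · rfl
          · exact sub_zero _
        rw [h1, h2, coeff_C_mul, coeff_C]
        split_ifs
        · rfl
        · exact mul_zero _
      refine Eq.trans ?_ (congrArg _ (Finset.sum_congr rfl fun k _ => (hk k).symm))
      split_ifs
      · funext q
        rw [Pi.add_apply, Finset.sum_apply]
        exact hab q
      · rw [Finset.sum_const_zero, add_zero]
    · have h1 : (coordSeries ρ d φ V (toLex (Sum.inr c))).coeff 0 = 0 := by
        change (X c : LocalSeries ρ d V).coeff 0 = 0
        rw [coeff_X, if_neg]
        intro h
        have := DFunLike.congr_fun h c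
        simp at this
      have h2 : (C (fun _ => (coordSeries ρ d φ V (toLex (Sum.inr c))).coeff 0 p) :
          LocalSeries ρ d W) = 0 := by
        rw [h1]
        ext1
        funext w
        exact (coeff_C _ w).trans (ite_self _)
      rw [h2, sub_zero]
      rfl

end LocalSeries

/-! ### The chain rule -/

namespace LocalSeries

open RhoSeries

variable {𝕜 𝕂 : Type*} [RCLike 𝕜] [RCLike 𝕂] [NormedAlgebra 𝕜 𝕂] {n : ℕ} {r : WithTop ℕ∞}
  {M : Type*} [TopologicalSpace M] [ChartedSpace (EuclideanSpace 𝕜 (Fin n)) M]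
  {G κ : Type*} [AddCommGroup G] [Fintype κ] [LinearOrder κ] {ρ : CommutationFactor G 𝕂} {d : κ → G}

/-- A family of maps, compatible with restrictions, that is an algebra homomorphism on the functions
of each degree. -/
structure IsTransition (𝕜 : Type*) [RCLike 𝕜] [NormedAlgebra 𝕜 𝕂] (n : ℕ) (r : WithTop ℕ∞)
    [ChartedSpace (EuclideanSpace 𝕜 (Fin n)) M] {U : Opens M}
    (T : ∀ V : Opens M, V ≤ U → LocalSeries ρ d V → LocalSeries ρ d V) : Prop where
  isFunction : ∀ {V : Opens M} (h : V ≤ U) {i : G} {f : LocalSeries ρ d V},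
    f.IsFunction 𝕜 n r i → (T V h f).IsFunction 𝕜 n r i
  add : ∀ {V : Opens M} (h : V ≤ U) {i : G} {f g : LocalSeries ρ d V},
    f.IsFunction 𝕜 n r i → g.IsFunction 𝕜 n r i → T V h (f + g) = T V h f + T V h g
  smul : ∀ {V : Opens M} (h : V ≤ U) {i : G} {f : LocalSeries ρ d V} (x : 𝕂),
    f.IsFunction 𝕜 n r i → T V h (x • f) = x • T V h f
  mul : ∀ {V : Opens M} (h : V ≤ U) {i j : G} {f g : LocalSeries ρ d V},
    f.IsFunction 𝕜 n r i → g.IsFunction 𝕜 n r j → T V h (f * g) = T V h f * T V h g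
  one : ∀ {V : Opens M} (h : V ≤ U), T V h 1 = 1
  restrict : ∀ {W V : Opens M} (hWV : W ≤ V) (h : V ≤ U) {i : G} {f : LocalSeries ρ d V},
    f.IsFunction 𝕜 n r i → (T V h f).restrict hWV = T W (hWV.trans h) (f.restrict hWV)

namespace IsTransition

variable {U V : Opens M} {T : ∀ V : Opens M, V ≤ U → LocalSeries ρ d V → LocalSeries ρ d V}
  (hT : IsTransition 𝕜 n r T) (h : V ≤ U) {i : G} {f g : LocalSeries ρ d V}

theorem _root_.RhoSeries.C_const (x : 𝕂) : (C (fun _ => x) : LocalSeries ρ d V) = x • 1 := by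
  classical
  ext1
  funext w
  rw [coeff_smul, coeff_one, coeff_C]
  split_ifs
  · funext p; exact (mul_one x).symm
  · exact (smul_zero x).symm

include hT

theorem zero : T V h 0 = 0 := by
  have h1 := hT.smul h (f := 0) (i := 0) 0 (isFunction_zero 0)
  rwa [zero_smul, zero_smul] at h1

theorem sub (hf : f.IsFunction 𝕜 n r i) (hg : g.IsFunction 𝕜 n r i) :
    T V h (f - g) = T V h f - T V h g := by
  rw [sub_eq_add_neg, ← neg_one_smul 𝕂 g, hT.add h hf (hg.smul _), hT.smul h _ hg, neg_one_smul,
    ← sub_eq_add_neg]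

theorem C_const (x : 𝕂) : T V h (C fun _ => x) = C fun _ => x := by
  rw [RhoSeries.C_const, hT.smul h x isFunction_one, hT.one]

theorem sum {α : Type*} (s : Finset α) {f : α → LocalSeries ρ d V}
    (hf : ∀ a ∈ s, (f a).IsFunction 𝕜 n r i) : T V h (∑ a ∈ s, f a) = ∑ a ∈ s, T V h (f a) := by
  classical
  induction s using Finset.induction_on with
  | empty => exact hT.zero h
  | insert a s ha ih =>
    have hf' : ∀ b ∈ s, (f b).IsFunction 𝕜 n r i := fun b hb => hf b (Finset.mem_insert_of_mem hb)
    rw [Finset.sum_insert ha, Finset.sum_insert ha,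
      hT.add h (hf a (Finset.mem_insert_self a s)) (IsFunction.sum hf'), ih hf']

/-- Transition maps do not change the body. -/
theorem coeff_zero (hf : f.IsFunction 𝕜 n r 0) : (T V h f).coeff 0 = f.coeff 0 := by
  classical
  funext p
  by_contra hne
  set y := (T V h f).coeff 0 p with hy
  have hy' : LocalSeries.IsFunction 𝕜 n r 0 (C (fun _ => y) : LocalSeries ρ d V) :=
    isFunction_C contMDiff_const
  have hfy := hf.sub hy'
  have hc : ∀ (g : LocalSeries ρ d V) q,
      (g - C fun _ => y).coeff 0 q = g.coeff 0 q - y := fun g q => by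
    rw [coeff_sub, coeff_C, if_pos rfl]; rfl
  -- If the body at `p` changed to `y`, then `f - y` would be invertible near `p`. Its image under
  -- the transition map would be invertible too, although the body of that image vanishes at `p`.
  let W : Opens M := ⟨Subtype.val '' ((f - C fun _ => y).coeff 0 ⁻¹' {x | x ≠ 0}),
    V.2.isOpenMap_subtype_val _ (isOpen_ne.preimage (hfy.1 0).continuous)⟩
  have hW : W ≤ V := by rintro _ ⟨q, -, rfl⟩; exact q.2
  have hpne : (f - C (fun _ => y) : LocalSeries ρ d V).coeff 0 p ≠ (0 : 𝕂) := by
    rw [hc]; exact sub_ne_zero.2 (Ne.symm hne)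
  have hp : p.1 ∈ W := ⟨p, hpne, rfl⟩
  obtain ⟨g, hg, hfg⟩ := (hfy.restrict hW).exists_mul_eq_one (by
    rintro ⟨_, q, hq, rfl⟩; exact hq)
  have h1 := congrArg (T W (hW.trans h)) hfg
  rw [hT.mul _ (hfy.restrict hW) hg, hT.one, ← hT.restrict hW h hfy, hT.sub h hf hy',
    hT.C_const] at h1
  have h2 := congrFun (congrArg (fun g => RhoSeries.coeff g 0) h1) ⟨p.1, hp⟩
  simp only [coeff_zero_mul, Pi.mul_apply] at h2
  rw [show (LocalSeries.restrict hW (T V h f - C fun _ => y)).coeff 0 ⟨p.1, hp⟩ =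
    (T V h f - C fun _ => y).coeff 0 p from rfl, hc, sub_self, zero_mul, coeff_one, if_pos rfl] at h2
  exact zero_ne_one h2

variable [IsManifold 𝓘(𝕜, EuclideanSpace 𝕜 (Fin n)) r M] (hr : r = ∞ ∨ r = ω)
  {φ ψ : OpenPartialHomeomorph M (EuclideanSpace 𝕜 (Fin n))}
  (hφ : φ ∈ IsManifold.maximalAtlas 𝓘(𝕜, EuclideanSpace 𝕜 (Fin n)) r M)
  (hψ : ψ ∈ IsManifold.maximalAtlas 𝓘(𝕜, EuclideanSpace 𝕜 (Fin n)) r M)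
  (hU : (U : Set M) ⊆ φ.source) (hU' : (U : Set M) ⊆ ψ.source)

omit hT in
variable (T φ ψ) in
/-- The failure of the chain rule. -/
noncomputable def chainError (b : Fin n ⊕ₗ κ) (V : Opens M) (h : V ≤ U) (f : LocalSeries ρ d V) :
    LocalSeries ρ d V :=
  coordPartial φ b (T V h f) - ∑ a, coordPartial φ b (T V h (coordSeries ρ d ψ V a)) *
    T V h (coordPartial ψ a f)

include hr hφ hψ hU hU'

theorem chainError_add (b : Fin n ⊕ₗ κ) (hf : f.IsFunction 𝕜 n r i) (hg : g.IsFunction 𝕜 n r i) :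
    chainError T φ ψ b V h (f + g) = chainError T φ ψ b V h f + chainError T φ ψ b V h g := by
  have hV : (V : Set M) ⊆ φ.source := fun x hx => hU (h hx)
  have hV' : (V : Set M) ⊆ ψ.source := fun x hx => hU' (h hx)
  simp only [chainError]
  rw [hT.add h hf hg, coordPartial_add hφ hV hr (hT.isFunction h hf) (hT.isFunction h hg)]
  simp only [coordPartial_add hψ hV' hr hf hg,
    hT.add h (hf.coordPartial hψ hV' hr _) (hg.coordPartial hψ hV' hr _), mul_add,
    Finset.sum_add_distrib]
  abel

theorem chainError_sum (b : Fin n ⊕ₗ κ) {α : Type*} (s : Finset α) {f : α → LocalSeries ρ d V}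
    (hf : ∀ a ∈ s, (f a).IsFunction 𝕜 n r i) :
    chainError T φ ψ b V h (∑ a ∈ s, f a) = ∑ a ∈ s, chainError T φ ψ b V h (f a) := by
  classical
  induction s using Finset.induction_on with
  | empty =>
    have h1 := chainError_add hT h hr hφ hψ hU hU' b (f := 0) (g := 0) (i := 0) (isFunction_zero 0)
      (isFunction_zero 0)
    rw [add_zero] at h1
    exact left_eq_add.1 h1
  | insert a s ha ih =>
    have hf' : ∀ b ∈ s, (f b).IsFunction 𝕜 n r i := fun b hb => hf b (Finset.mem_insert_of_mem hb)
    rw [Finset.sum_insert ha, Finset.sum_insert ha, chainError_add hT h hr hφ hψ hU hU' b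
      (hf a (Finset.mem_insert_self a s)) (IsFunction.sum hf'), ih hf']

theorem chainError_C_const (b : Fin n ⊕ₗ κ) (x : 𝕂) :
    chainError T φ ψ b V h (C fun _ => x) = 0 := by
  have hV : (V : Set M) ⊆ φ.source := fun x hx => hU (h hx)
  have hV' : (V : Set M) ⊆ ψ.source := fun x hx => hU' (h hx)
  simp only [chainError, hT.C_const, coordPartial_C_const hV, coordPartial_C_const hV', hT.zero,
    mul_zero, Finset.sum_const_zero, sub_zero]

theorem chainError_coordSeries (a b : Fin n ⊕ₗ κ) :
    chainError T φ ψ b V h (coordSeries ρ d ψ V a) = 0 := by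
  have hV' : (V : Set M) ⊆ ψ.source := fun x hx => hU' (h hx)
  rw [chainError, Finset.sum_eq_single a]
  · rw [coordPartial_coordSeries hV', if_pos rfl, hT.one, mul_one, sub_self]
  · intro c _ hc
    rw [coordPartial_coordSeries hV', if_neg (Ne.symm hc), hT.zero, mul_zero]
  · exact fun h => absurd (Finset.mem_univ _) h

/-- Both terms of the error satisfy the graded Leibniz rule along `T`, hence so does their
difference. -/
theorem chainError_mul {j : G} (b : Fin n ⊕ₗ κ) (hf : f.IsFunction 𝕜 n r i)
    (hg : g.IsFunction 𝕜 n r j) : chainError T φ ψ b V h (f * g) =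
      chainError T φ ψ b V h f * T V h g +
        ρ (-coordDegree n d b) i • (T V h f * chainError T φ ψ b V h g) := by
  have hV : (V : Set M) ⊆ φ.source := fun x hx => hU (h hx)
  have hV' : (V : Set M) ⊆ ψ.source := fun x hx => hU' (h hx)
  have hTf := hT.isFunction h hf
  have hTg := hT.isFunction h hg
  have key : ∀ a, coordPartial φ b (T V h (coordSeries ρ d ψ V a)) *
      T V h (coordPartial ψ a (f * g)) =
      coordPartial φ b (T V h (coordSeries ρ d ψ V a)) * T V h (coordPartial ψ a f) * T V h g +
      ρ (-coordDegree n d b) i • (T V h f * (coordPartial φ b (T V h (coordSeries ρ d ψ V a)) *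
        T V h (coordPartial ψ a g))) := by
    intro a
    have hfa := hf.coordPartial hψ hV' hr a
    have hga := hg.coordPartial hψ hV' hr a
    have hy := (hT.isFunction h (isFunction_coordSeries (ρ := ρ) (d := d) hψ hV' a)).coordPartial
      hφ hV hr b
    have e1 : (_root_.coordPartial ψ a f * g).IsFunction 𝕜 n r (i + j - coordDegree n d a) := by
      rw [← sub_add_eq_add_sub]; exact hfa.mul hg
    have e2 : (f * _root_.coordPartial ψ a g).IsFunction 𝕜 n r (i + j - coordDegree n d a) := by
      rw [add_sub_assoc]; exact hf.mul hga
    -- Moving `∂y^a/∂x^b` past `T f` gives `ρ (|y^a| - |x^b|, i)`, which combines with `ρ (-|y^a|,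
    -- i)` from the Leibniz rule to `ρ (-|x^b|, i)`, independent of `a`.
    rw [coordPartial_mul hψ hV' hr hf hg, hT.add h e1 (e2.smul _), hT.smul h _ e2,
      hT.mul h hfa hg, hT.mul h hf hga, mul_add, mul_smul_comm, ← mul_assoc, ← mul_assoc,
      hy.isHomogeneous.mul_swap hTf.isHomogeneous, smul_mul_assoc, smul_smul, mul_assoc (T V h f)]
    congr 2
    rw [← ρ.add_left]
    congr 1
    abel
  simp only [chainError, key, Finset.sum_add_distrib, ← Finset.smul_sum, ← Finset.mul_sum,
    ← Finset.sum_mul]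
  rw [hT.mul h hf hg, coordPartial_mul hφ hV hr hTf hTg, sub_mul, mul_sub, smul_sub]
  abel

theorem chainError_restrict {W : Opens M} (hW : W ≤ V) (b : Fin n ⊕ₗ κ)
    (hf : f.IsFunction 𝕜 n r i) : (chainError T φ ψ b V h f).restrict hW =
      chainError T φ ψ b W (hW.trans h) (f.restrict hW) := by
  have hV : (V : Set M) ⊆ φ.source := fun x hx => hU (h hx)
  have hV' : (V : Set M) ⊆ ψ.source := fun x hx => hU' (h hx)
  rw [chainError, restrict_sub, restrict_sum, coordPartial_restrict hV, hT.restrict hW h hf,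
    chainError]
  refine congrArg _ (Finset.sum_congr rfl fun a _ => ?_)
  rw [restrict_mul, coordPartial_restrict hV, hT.restrict hW h (isFunction_coordSeries hψ hV' a),
    hT.restrict hW h (hf.coordPartial hψ hV' hr a), coordPartial_restrict hV',
    restrict_coordSeries]

/-- Near `p` the function is a constant plus a combination of `y^a - y^a(p)`, and the error vanishes
on constants and on these differences. What remains at `p` is the image of `y^a - y^a(p)` times the
error of `g a`. The first factor has zero body at `p`, so the coefficient at `w` only involves
errors of strictly smaller total degree. The induction runs over all open sets and functions because
`g a` lives on a smaller set. -/
theorem coeff_chainError (b : Fin n ⊕ₗ κ) (m : ℕ) : ∀ {V : Opens M} (h : V ≤ U) {i : G}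
    {f : LocalSeries ρ d V}, f.IsFunction 𝕜 n r i → ∀ w, Finsupp.degree w < m → ∀ p : V,
      (chainError T φ ψ b V h f).coeff w p = 0 := by
  classical
  induction m with
  | zero => intro V h i f _ w hw; exact absurd hw (Nat.not_lt_zero _)
  | succ m ih =>
    intro V h i f hf w hw p
    have hV' : (V : Set M) ⊆ ψ.source := fun x hx => hU' (h hx)
    obtain ⟨W, hW, hp, g, hg, hfg⟩ := hf.exists_eq_C_add_sum hψ hV' hr p
    have hWU := hW.trans h
    have hW' : (W : Set M) ⊆ ψ.source := fun x hx => hV' (hW hx)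
    have hy := fun a => isFunction_coordSeries (ρ := ρ) (d := d) hψ hW' a
    have hy' := fun a => isFunction_C_coeff_zero (W := W)
      (isFunction_coordSeries (ρ := ρ) (d := d) hψ hV' a) p
    have hyy := fun a => (hy a).sub (hy' a)
    have hmul : ∀ a, LocalSeries.IsFunction 𝕜 n r i ((coordSeries ρ d ψ W a -
        C (fun _ => (coordSeries ρ d ψ V a).coeff 0 p)) * g a) := fun a => by
      have := (hyy a).mul (hg a)
      rwa [add_sub_cancel] at this
    have hE0 : ∀ a, chainError T φ ψ b W hWU (coordSeries ρ d ψ W a -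
        C (fun _ => (coordSeries ρ d ψ V a).coeff 0 p)) = 0 := fun a => by
      rw [sub_eq_add_neg, ← neg_one_smul 𝕂, RhoSeries.C_const, smul_smul, ← RhoSeries.C_const,
        chainError_add hT hWU hr hφ hψ hU hU' b (hy a) (by
          have := (hy' a).smul (-1)
          rwa [RhoSeries.C_const, smul_smul, ← RhoSeries.C_const] at this),
        chainError_coordSeries hT hWU hr hφ hψ hU hU', chainError_C_const hT hWU hr hφ hψ hU hU',
        add_zero]
    have e1 : (chainError T φ ψ b V h f).coeff w p =
        ((chainError T φ ψ b V h f).restrict hW).coeff w ⟨p.1, hp⟩ := rfl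
    rw [e1, chainError_restrict hT h hr hφ hψ hU hU' hW b hf, hfg,
      chainError_add hT hWU hr hφ hψ hU hU' b (isFunction_C_coeff_zero hf p)
        (IsFunction.sum fun a _ => hmul a),
      chainError_C_const hT hWU hr hφ hψ hU hU', zero_add,
      chainError_sum hT hWU hr hφ hψ hU hU' b _ (fun a _ => hmul a), coeff_sum, Finset.sum_apply]
    refine Finset.sum_eq_zero fun a _ => ?_
    rw [chainError_mul hT hWU hr hφ hψ hU hU' b (hyy a) (hg a), hE0, zero_mul, zero_add, coeff_smul,
      Pi.smul_apply, coeff_mul]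
    -- In degree zero transition maps preserve the body. In any other degree homogeneity excludes a
    -- body.
    have hbody : (T W hWU (coordSeries ρ d ψ W a -
        C (fun _ => (coordSeries ρ d ψ V a).coeff 0 p))).coeff 0 ⟨p.1, hp⟩ = 0 := by
      by_cases ha : coordDegree n d a = 0
      · rw [hT.coeff_zero hWU (ha ▸ hyy a), coeff_sub, coeff_C, if_pos rfl, ← restrict_coordSeries hW]
        exact sub_self _
      · have h3 : (T W hWU (coordSeries ρ d ψ W a -
            C (fun _ => (coordSeries ρ d ψ V a).coeff 0 p))).coeff 0 = 0 := by
          by_contra h4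
          have h5 := (hT.isFunction hWU (hyy a)).2 0 h4
          rw [monomialDegree_zero] at h5
          exact ha h5.symm
        rw [h3]; rfl
    split_ifs
    · rw [Finset.sum_apply]
      rw [Finset.sum_eq_zero, smul_zero]
      intro u hu
      rw [Finset.HasAntidiagonal.mem_antidiagonal] at hu
      rw [Pi.smul_apply, Pi.mul_apply]
      by_cases hu1 : u.1 = 0
      · rw [hu1, hbody, zero_mul, smul_zero]
      · have h1 : Finsupp.degree u.1 ≠ 0 := fun h => hu1 (Finsupp.degree_eq_zero_iff _ |>.1 h)
        rw [← hu, map_add] at hw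
        rw [ih hWU (hg a) u.2 (by omega), mul_zero, smul_zero]
    · exact smul_zero _

/-- The chain rule. -/
theorem coordPartial_apply (b : Fin n ⊕ₗ κ) (hf : f.IsFunction 𝕜 n r i) :
    coordPartial φ b (T V h f) = ∑ a, coordPartial φ b (T V h (coordSeries ρ d ψ V a)) *
      T V h (coordPartial ψ a f) := by
  rw [← sub_eq_zero]
  ext w p
  exact coeff_chainError hT hr hφ hψ hU hU' b (Finsupp.degree w + 1) h hf w (Nat.lt_succ_self _) p

end IsTransition

end LocalSeries

/-! ### Coordinate changes of a `ρ`-manifold -/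

namespace RhoManifold

open RhoSeries LocalSeries

variable {𝕜 𝕂 G κ : Type*} [RCLike 𝕜] [RCLike 𝕂] [NormedAlgebra 𝕜 𝕂]
    [AddCommGroup G] [Fintype κ] [LinearOrder κ] {r : WithTop ℕ∞} {n : ℕ}
    {ρ : CommutationFactor G 𝕂} {d : κ → G} {M : Type*} [TopologicalSpace M]
    [ChartedSpace (EuclideanSpace 𝕜 (Fin n)) M] (X : RhoManifold 𝕜 r n ρ d M)
    (c c' : X.atlas.Chart) {V : Opens M} (hc : V ≤ X.atlas.dom c) (hc' : V ≤ X.atlas.dom c')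

/-- The transition maps use `Function.invFun` and are meaningful only on the image of `expand`.
Homogeneous functions lie in it, hence the homogeneity hypotheses in what follows. -/
theorem exists_expand_eq {i : G} {f : LocalSeries ρ d V} (hf : f.IsFunction 𝕜 n r i) :
    ∃ s ∈ X.gr V i, c.2.expand V hc s = f := by
  have h : f ∈ {s : LocalSeries ρ d V | s.IsFunction 𝕜 n r i} := hf
  rwa [← c.2.image_gr V hc i] at h

theorem isFunction_expand {i : G} {s : X.obj V} (hs : s ∈ X.gr V i) :
    LocalSeries.IsFunction 𝕜 n r i (c.2.expand V hc s) := by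
  have h : c.2.expand V hc s ∈ c.2.expand V hc '' (X.gr V i) := ⟨s, hs, rfl⟩
  rw [c.2.image_gr V hc i] at h
  exact h

theorem trans_expand (s : X.obj V) :
    X.atlas.trans c c' V hc hc' (c'.2.expand V hc' s) = c.2.expand V hc s :=
  congrArg (c.2.expand V hc) (Function.leftInverse_invFun (c'.2.expand_injective V hc') s)

theorem trans_trans {i : G} {f : LocalSeries ρ d V} (hf : f.IsFunction 𝕜 n r i) :
    X.atlas.trans c c' V hc hc' (X.atlas.trans c' c V hc' hc f) = f := by
  obtain ⟨s, -, rfl⟩ := X.exists_expand_eq c hc hf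
  rw [trans_expand, trans_expand]

/-- Both charts expand the same sections of the structure sheaf, and the two expansions are
homomorphisms compatible with restriction. -/
theorem isTransition : LocalSeries.IsTransition 𝕜 n r (U := X.atlas.dom c ⊓ X.atlas.dom c')
    fun V h => X.atlas.trans c c' V (h.trans inf_le_left) (h.trans inf_le_right) where
  isFunction h _ f hf := by
    obtain ⟨s, hs, rfl⟩ := X.exists_expand_eq c' (h.trans inf_le_right) hf
    rw [trans_expand]
    exact X.isFunction_expand c _ hs
  add h _ f g hf hg := by
    obtain ⟨s, hs, rfl⟩ := X.exists_expand_eq c' (h.trans inf_le_right) hf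
    obtain ⟨t, ht, rfl⟩ := X.exists_expand_eq c' (h.trans inf_le_right) hg
    rw [← map_add, trans_expand, trans_expand, trans_expand, map_add]
  smul h _ f x hf := by
    obtain ⟨s, hs, rfl⟩ := X.exists_expand_eq c' (h.trans inf_le_right) hf
    rw [← map_smul, trans_expand, trans_expand, map_smul]
  mul h _ _ f g hf hg := by
    obtain ⟨s, hs, rfl⟩ := X.exists_expand_eq c' (h.trans inf_le_right) hf
    obtain ⟨t, ht, rfl⟩ := X.exists_expand_eq c' (h.trans inf_le_right) hg
    rw [← map_mul, trans_expand, trans_expand, trans_expand, map_mul]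
  one {V} h := (congrArg (X.atlas.trans c c' V _ _)
    (map_one (c'.2.expand V (h.trans inf_le_right))).symm).trans
      ((X.trans_expand c c' _ _ 1).trans (map_one _))
  restrict hWV h _ f hf := by
    obtain ⟨s, hs, rfl⟩ := X.exists_expand_eq c' (h.trans inf_le_right) hf
    exact (congrArg (LocalSeries.restrict hWV) (X.trans_expand c c' _ _ s)).trans
      ((c.2.expand_res hWV _ s).symm.trans ((X.trans_expand c c' _ _ (X.res hWV s)).symm.trans
        (congrArg _ (c'.2.expand_res hWV _ s))))

include hc in
theorem subset_source : (V : Set M) ⊆ (X.atlas.base c).source := by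
  change _ ⊆ c.2.chart.source
  rw [c.2.source_eq]
  exact hc

variable [IsManifold 𝓘(𝕜, EuclideanSpace 𝕜 (Fin n)) r M] (hr : r = ∞ ∨ r = ω)

include hr

theorem isFunction_trans_coordSeries (a : Fin n ⊕ₗ κ) : LocalSeries.IsFunction 𝕜 n r
    (coordDegree n d a) (X.atlas.trans c c' V hc hc' (coordSeries ρ d (X.atlas.base c') V a)) :=
  (X.isTransition c c').isFunction (le_inf hc hc')
    (isFunction_coordSeries c'.2.chart_mem (X.subset_source c' hc') a)

theorem isFunction_derivative (a b : Fin n ⊕ₗ κ) : LocalSeries.IsFunction 𝕜 n r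
    (coordDegree n d a - coordDegree n d b) (X.atlas.derivative c c' V hc hc' a b) :=
  (X.isFunction_trans_coordSeries c c' hc hc' hr a).coordPartial c.2.chart_mem
    (X.subset_source c hc) hr b

theorem isFunction_inverseDerivative (a b : Fin n ⊕ₗ κ) : LocalSeries.IsFunction 𝕜 n r
    (coordDegree n d b - coordDegree n d a) (X.atlas.inverseDerivative c c' V hc hc' a b) :=
  (X.isTransition c c').isFunction (le_inf hc hc') (X.isFunction_derivative c' c hc' hc hr b a)

/-- The chain rule for the composition of a coordinate change with its inverse. -/
theorem sum_derivative_mul_inverseDerivative (a b : Fin n ⊕ₗ κ) :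
    ∑ e, X.atlas.derivative c c' V hc hc' e b * X.atlas.inverseDerivative c c' V hc hc' e a =
      if a = b then 1 else 0 := by
  have h1 := (X.isTransition c c').coordPartial_apply (le_inf hc hc') hr c.2.chart_mem
    c'.2.chart_mem (X.subset_source c inf_le_left) (X.subset_source c' inf_le_right) b
    (X.isFunction_trans_coordSeries c' c hc' hc hr a)
  have h2 : X.atlas.trans c c' V hc hc' (X.atlas.trans c' c V hc' hc
      (coordSeries ρ d (X.atlas.base c) V a)) = coordSeries ρ d (X.atlas.base c) V a :=
    X.trans_trans c c' hc hc'
      (isFunction_coordSeries c.2.chart_mem (X.subset_source c hc) a)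
  exact h1.symm.trans ((congrArg (coordPartial c.2.chart b) h2).trans
    (coordPartial_coordSeries (X.subset_source c hc) a b))

/-- The matrix `(∂y^b/∂x^a)_{a,b}`. -/
noncomputable def derivativeMatrix (X : RhoManifold 𝕜 r n ρ d M)
    (c c' : X.atlas.Chart) {V : Opens M} (hc : V ≤ X.atlas.dom c) (hc' : V ≤ X.atlas.dom c') :
    Matrix (Fin n ⊕ₗ κ) (Fin n ⊕ₗ κ) (LocalSeries ρ d V) :=
  Matrix.of fun a b => X.atlas.derivative c c' V hc hc' b a

/-- The matrix `(∂x^b/∂y^a)_{a,b}`. -/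
noncomputable def inverseDerivativeMatrix (X : RhoManifold 𝕜 r n ρ d M)
    (c c' : X.atlas.Chart) {V : Opens M} (hc : V ≤ X.atlas.dom c) (hc' : V ≤ X.atlas.dom c') :
    Matrix (Fin n ⊕ₗ κ) (Fin n ⊕ₗ κ) (LocalSeries ρ d V) :=
  Matrix.of fun a b => X.atlas.inverseDerivative c c' V hc hc' a b

theorem derivativeMatrix_mul_inverseDerivativeMatrix :
    X.derivativeMatrix c c' hc hc' * X.inverseDerivativeMatrix c c' hc hc' = 1 := by
  ext1 a b
  rw [Matrix.mul_apply, Matrix.one_apply]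
  refine (X.sum_derivative_mul_inverseDerivative c c' hc hc' hr b a).trans ?_
  exact if_congr eq_comm rfl rfl

/-- The chain rule with the charts exchanged is an identity in the coordinates `y`. The transition
map carries it to the coordinates `x`, where `trans_trans` restores the `∂y/∂x`. -/
theorem inverseDerivativeMatrix_mul_derivativeMatrix :
    X.inverseDerivativeMatrix c c' hc hc' * X.derivativeMatrix c c' hc hc' = 1 := by
  ext1 a b
  rw [Matrix.mul_apply, Matrix.one_apply]
  have hT := X.isTransition c c'
  have h1 := congrArg (X.atlas.trans c c' V hc hc')
    (X.sum_derivative_mul_inverseDerivative c' c hc' hc hr b a)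
  have h2 := fun e => X.isFunction_derivative c' c hc' hc hr e a
  have h3 := fun e => X.isFunction_inverseDerivative c' c hc' hc hr e b
  rw [hT.sum (le_inf hc hc') (i := coordDegree n d b - coordDegree n d a) _ (fun e _ => by
    have := (h2 e).mul (h3 e)
    rwa [sub_add_sub_comm, add_comm, add_sub_add_right_eq_sub] at this)] at h1
  have h4 : ∀ e, X.atlas.trans c c' V hc hc' (X.atlas.derivative c' c V hc' hc e a *
      X.atlas.inverseDerivative c' c V hc' hc e b) =
      X.inverseDerivativeMatrix c c' hc hc' a e * X.derivativeMatrix c c' hc hc' e b := fun e => by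
    rw [hT.mul (le_inf hc hc') (h2 e) (h3 e)]
    exact congrArg (X.atlas.inverseDerivative c c' V hc hc' a e * ·)
      (X.trans_trans c c' hc hc' (X.isFunction_derivative c c' hc hc' hr b e))
  rw [← Finset.sum_congr rfl fun e _ => h4 e]
  refine h1.trans ?_
  by_cases hab : a = b
  · rw [if_pos hab, if_pos hab.symm]
    exact hT.one (le_inf hc hc')
  · rw [if_neg hab, if_neg (Ne.symm hab)]
    exact hT.zero (le_inf hc hc')

theorem isHomogeneous_derivativeMatrix (a b : Fin n ⊕ₗ κ) :
    IsHomogeneous (coordDegree n d b - coordDegree n d a) (X.derivativeMatrix c c' hc hc' a b) :=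
  (X.isFunction_derivative c c' hc hc' hr b a).isHomogeneous

theorem isHomogeneous_inverseDerivativeMatrix (a b : Fin n ⊕ₗ κ) :
    IsHomogeneous (coordDegree n d b - coordDegree n d a)
      (X.inverseDerivativeMatrix c c' hc hc' a b) :=
  (X.isFunction_inverseDerivative c c' hc hc' hr a b).isHomogeneous

omit hr in
theorem jacobian_eq : X.atlas.jacobian c c' V hc hc' =
    gradedTranspose ρ (coordDegree n d) (coordDegree n d) (X.derivativeMatrix c c' hc hc') := rfl

/-- The inverse of the Jacobian matrix. -/
noncomputable def inverseJacobian (X : RhoManifold 𝕜 r n ρ d M)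
    (c c' : X.atlas.Chart) {V : Opens M} (hc : V ≤ X.atlas.dom c) (hc' : V ≤ X.atlas.dom c') :
    Matrix (Fin n ⊕ₗ κ) (Fin n ⊕ₗ κ) (LocalSeries ρ d V) :=
  gradedTranspose ρ (coordDegree n d) (coordDegree n d) (X.inverseDerivativeMatrix c c' hc hc')

theorem isGraded_jacobian : IsGraded (coordDegree n d) (coordDegree n d)
    (X.atlas.jacobian c c' V hc hc') :=
  isGraded_gradedTranspose (X.isHomogeneous_derivativeMatrix c c' hc hc' hr)

theorem isGraded_inverseJacobian : IsGraded (coordDegree n d) (coordDegree n d)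
    (X.inverseJacobian c c' hc hc') :=
  isGraded_gradedTranspose (X.isHomogeneous_inverseDerivativeMatrix c c' hc hc' hr)

theorem jacobian_mul_inverseJacobian :
    X.atlas.jacobian c c' V hc hc' * X.inverseJacobian c c' hc hc' = 1 := by
  rw [jacobian_eq, inverseJacobian, ← gradedTranspose_mul
    (X.isHomogeneous_inverseDerivativeMatrix c c' hc hc' hr)
    (X.isHomogeneous_derivativeMatrix c c' hc hc' hr),
    X.inverseDerivativeMatrix_mul_derivativeMatrix c c' hc hc' hr, gradedTranspose_one]

theorem inverseJacobian_mul_jacobian :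
    X.inverseJacobian c c' hc hc' * X.atlas.jacobian c c' V hc hc' = 1 := by
  rw [jacobian_eq, inverseJacobian, ← gradedTranspose_mul
    (X.isHomogeneous_derivativeMatrix c c' hc hc' hr)
    (X.isHomogeneous_inverseDerivativeMatrix c c' hc hc' hr),
    X.derivativeMatrix_mul_inverseDerivativeMatrix c c' hc hc' hr, gradedTranspose_one]

theorem isHomogeneous_berJacobian : IsHomogeneous 0 (X.atlas.berJacobian c c' V hc hc') :=
  isHomogeneous_rhoBer (X.isGraded_jacobian c c' hc hc' hr)

/-- The Jacobian matrix is the graded transpose of the matrix of derivatives, so its Berezinian is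
that of the latter with opposite degrees. The matrix of inverse derivatives is inverse to it. -/
theorem rhoBer_inverseDerivativeMatrix_mul_berJacobian :
    rhoBer ρ (fun a => - coordDegree n d a) (X.inverseDerivativeMatrix c c' hc hc') *
      X.atlas.berJacobian c c' V hc hc' = 1 := by
  rw [CoordAtlas.berJacobian, jacobian_eq, ← rhoBer_gradedTranspose
    (X.derivativeMatrix_mul_inverseDerivativeMatrix c c' hc hc' hr)
    (X.inverseDerivativeMatrix_mul_derivativeMatrix c c' hc hc' hr)
    (X.isHomogeneous_derivativeMatrix c c' hc hc' hr)
    (X.isHomogeneous_inverseDerivativeMatrix c c' hc hc' hr)]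
  refine rhoBer_mul_eq_one (fun a b => ?_) (fun a b => ?_)
    (X.inverseDerivativeMatrix_mul_derivativeMatrix c c' hc hc' hr)
    (X.derivativeMatrix_mul_inverseDerivativeMatrix c c' hc hc' hr)
  · rw [neg_sub_neg]
    exact X.isHomogeneous_inverseDerivativeMatrix c c' hc hc' hr a b
  · rw [neg_sub_neg]
    exact X.isHomogeneous_derivativeMatrix c c' hc hc' hr a b

end RhoManifold

/-! ### Pullback to the total space of a vector bundle -/

theorem Fintype.prod_lex_sum {α β S : Type*} [Fintype α] [Fintype β] [CommMonoid S]
    (F : α ⊕ₗ β → S) : ∏ a, F a = (∏ k, F (toLex (Sum.inl k))) * ∏ c, F (toLex (Sum.inr c)) :=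
  (Fintype.prod_equiv toLex (fun a => F (toLex a)) F fun _ => rfl).symm.trans
    (Fintype.prod_sum_type _)

theorem Fintype.sum_lex_sum {α β S : Type*} [Fintype α] [Fintype β] [AddCommMonoid S]
    (F : α ⊕ₗ β → S) : ∑ a, F a = (∑ k, F (toLex (Sum.inl k))) + ∑ c, F (toLex (Sum.inr c)) :=
  (Fintype.sum_equiv toLex (fun a => F (toLex a)) F fun _ => rfl).symm.trans
    (Fintype.sum_sum_type _)

namespace CoordAtlas

open RhoSeries LocalSeries

section Exponents

variable {κ ι : Type*} [Fintype ι] [LinearOrder ι] [Fintype κ] [LinearOrder κ]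

theorem fibreExponent_apply (w : (κ ⊕ₗ ι) →₀ ℕ) (a : ι) :
    fibreExponent w a = w (toLex (Sum.inr a)) := rfl

theorem joinExponent_inl (u : κ →₀ ℕ) (v : ι →₀ ℕ) (b : κ) :
    joinExponent u v (toLex (Sum.inl b)) = u b := rfl

theorem joinExponent_inr (u : κ →₀ ℕ) (v : ι →₀ ℕ) (a : ι) :
    joinExponent u v (toLex (Sum.inr a)) = v a := rfl

@[simp] theorem baseExponent_joinExponent (u : κ →₀ ℕ) (v : ι →₀ ℕ) :
    baseExponent (joinExponent u v) = u := by ext; rfl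

@[simp] theorem fibreExponent_joinExponent (u : κ →₀ ℕ) (v : ι →₀ ℕ) :
    fibreExponent (joinExponent u v) = v := by ext; rfl

@[simp] theorem joinExponent_base_fibre (w : (κ ⊕ₗ ι) →₀ ℕ) :
    joinExponent (baseExponent w) (fibreExponent w) = w := by
  ext a
  induction a using Lex.rec with | _ a
  rcases a with b | a <;> rfl

theorem baseExponent_add (w w' : (κ ⊕ₗ ι) →₀ ℕ) :
    baseExponent (w + w') = baseExponent w + baseExponent w' := by ext; rfl

theorem fibreExponent_add (w w' : (κ ⊕ₗ ι) →₀ ℕ) :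
    fibreExponent (w + w') = fibreExponent w + fibreExponent w' := by ext; rfl

theorem joinExponent_add (u u' : κ →₀ ℕ) (v v' : ι →₀ ℕ) :
    joinExponent (u + u') (v + v') = joinExponent u v + joinExponent u' v' := by
  ext a
  induction a using Lex.rec with | _ a
  rcases a with b | a <;> rfl

@[simp] theorem joinExponent_zero : joinExponent (0 : κ →₀ ℕ) (0 : ι →₀ ℕ) = 0 := by
  ext a
  induction a using Lex.rec with | _ a
  rcases a with b | a <;> rfl

theorem joinExponent_single_zero (b : κ) : joinExponent (Finsupp.single b 1) (0 : ι →₀ ℕ) =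
    Finsupp.single (toLex (Sum.inl b)) 1 := by
  classical
  ext a
  induction a using Lex.rec with | _ a
  rcases a with c | c
  · rw [joinExponent_inl, Finsupp.single_apply, Finsupp.single_apply]
    exact if_congr ⟨fun h => by rw [h], fun h => Sum.inl_injective (toLex.injective h)⟩ rfl rfl
  · rw [joinExponent_inr, Finsupp.single_apply, if_neg (fun h => by cases toLex.injective h)]
    rfl

theorem joinExponent_zero_single (a : ι) : joinExponent (0 : κ →₀ ℕ) (Finsupp.single a 1) =
    Finsupp.single (toLex (Sum.inr a)) 1 := by
  classical
  ext c
  induction c using Lex.rec with | _ c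
  rcases c with c | c
  · rw [joinExponent_inl, Finsupp.single_apply, if_neg (fun h => by cases toLex.injective h)]
    rfl
  · rw [joinExponent_inr, Finsupp.single_apply, Finsupp.single_apply]
    exact if_congr ⟨fun h => by rw [h], fun h => Sum.inr_injective (toLex.injective h)⟩ rfl rfl

theorem joinExponent_injective {u u' : κ →₀ ℕ} {v v' : ι →₀ ℕ} :
    joinExponent u v = joinExponent u' v' ↔ u = u' ∧ v = v' :=
  ⟨fun h => ⟨by simpa using congrArg baseExponent h, by simpa using congrArg fibreExponent h⟩,
    fun h => by rw [h.1, h.2]⟩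

end Exponents

variable {𝕜 𝕂 G κ : Type*} [RCLike 𝕜] [RCLike 𝕂] [NormedAlgebra 𝕜 𝕂]
  [AddCommGroup G] [Fintype κ] [LinearOrder κ] {n : ℕ} {ρ : CommutationFactor G 𝕂} {d : κ → G}
  {M : Type*} [TopologicalSpace M]
  {G' ι : Type*} [AddCommGroup G'] [Fintype ι] [LinearOrder ι]
  {σ : CommutationFactor G' 𝕂} {φ : G →+ G'} {d' : κ → G'} {e : ι → G'} {V W : Opens M}
  {f g : LocalSeries ρ d V} {i j : G}

variable (hφ : ∀ i j, σ (φ i) (φ j) = ρ i j) (hd : ∀ b, d' b = φ (d b))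

include hφ hd

/-- Here and below `φ` relates the two gradings. It is the identity for plain bundles and `j ↦ (0,
j)` for the shifted ones, and `hφ` makes parities and commutation factors of base coordinates agree.
-/
theorem admissible_of_fibreExponent_eq_zero {w : (κ ⊕ₗ ι) →₀ ℕ} (hw : fibreExponent w = 0) :
    Admissible σ (bundleDegree d' e) w ↔ Admissible ρ d (baseExponent w) := by
  constructor
  · intro h b hb
    refine h (toLex (Sum.inl b)) ?_
    change σ (d' b) (d' b) = -1
    rw [hd, hφ]
    exact hb
  · intro h a ha
    induction a using Lex.rec with | _ a
    rcases a with b | a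
    · refine h b ?_
      change σ (d' b) (d' b) = -1 at ha
      rw [hd, hφ] at ha
      exact ha
    · exact (DFunLike.congr_fun hw a).trans_le zero_le_one

open Classical in
theorem coeff_pullback (f : LocalSeries ρ d V) (w) :
    (pullback f : LocalSeries σ (bundleDegree d' e) V).coeff w =
      if fibreExponent w = 0 then f.coeff (baseExponent w) else 0 := by
  refine (coeff_ofCoeff _ w).trans ?_
  by_cases hw : fibreExponent w = 0
  · rw [if_pos hw]
    split_ifs with h
    · rfl
    · exact (f.coeff_eq_zero _ fun h' =>
        h ((admissible_of_fibreExponent_eq_zero hφ hd hw).2 h')).symm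
  · rw [if_neg hw, ite_self]

theorem restrict_pullback (h : W ≤ V) (f : LocalSeries ρ d V) :
    (pullback f : LocalSeries σ (bundleDegree d' e) V).restrict h = pullback (f.restrict h) := by
  classical
  ext w p
  change (pullback f : LocalSeries σ (bundleDegree d' e) V).coeff w _ = _
  rw [coeff_pullback hφ hd, coeff_pullback hφ hd]
  split_ifs <;> rfl

theorem exchange_of_fibreExponent_eq_zero {w w' : (κ ⊕ₗ ι) →₀ ℕ} (hw : fibreExponent w = 0)
    (hw' : fibreExponent w' = 0) : exchange σ (bundleDegree d' e) w w' =
      exchange ρ d (baseExponent w) (baseExponent w') := by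
  classical
  have h1 : ∀ a, w (toLex (Sum.inr a)) = 0 := fun a => DFunLike.congr_fun hw a
  have h2 : ∀ a, w' (toLex (Sum.inr a)) = 0 := fun a => DFunLike.congr_fun hw' a
  rw [exchange, Fintype.prod_lex_sum, exchange]
  have h3 : ∀ a : ι, ∏ c ∈ Finset.univ.filter (toLex (Sum.inr a) < ·),
      σ (bundleDegree d' e c) (bundleDegree d' e (toLex (Sum.inr a))) ^
        (w c * w' (toLex (Sum.inr a))) = 1 := fun a =>
    Finset.prod_eq_one fun c _ => by rw [h2, mul_zero, pow_zero]
  rw [Finset.prod_eq_one (fun a _ => h3 a), mul_one]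
  refine Finset.prod_congr rfl fun b _ => ?_
  rw [Finset.prod_filter, Fintype.prod_lex_sum, Finset.prod_filter,
    Finset.prod_eq_one (s := Finset.univ (α := ι))
      (fun a _ => by rw [h1, zero_mul, pow_zero, ite_self]), mul_one]
  refine Finset.prod_congr rfl fun c _ => ?_
  refine if_congr Sum.Lex.inl_lt_inl_iff ?_ rfl
  change σ (d' c) (d' b) ^ _ = _
  rw [hd, hd, hφ]
  rfl

theorem pullback_mul (f g : LocalSeries ρ d V) :
    (pullback (f * g) : LocalSeries σ (bundleDegree d' e) V) = pullback f * pullback g := by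
  classical
  ext1
  funext w
  rw [coeff_pullback hφ hd]
  by_cases hw : fibreExponent w = 0
  · rw [if_pos hw, RhoSeries.coeff_mul, RhoSeries.coeff_mul]
    refine if_congr (admissible_of_fibreExponent_eq_zero hφ hd hw).symm ?_ rfl
    have hz : ∀ p ∈ Finset.HasAntidiagonal.antidiagonal w,
        fibreExponent p.1 = 0 ∧ fibreExponent p.2 = 0 := by
      intro p hp
      rw [Finset.HasAntidiagonal.mem_antidiagonal] at hp
      rw [← hp, fibreExponent_add] at hw
      constructor <;> ext a <;> have := DFunLike.congr_fun hw a <;>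
        simp only [Finsupp.add_apply, Finsupp.coe_zero, Pi.zero_apply] at this ⊢ <;> omega
    -- A monomial without linear coordinates splits only into such monomials, so its splittings are
    -- those of the base exponent.
    refine Finset.sum_nbij' (fun q => (joinExponent q.1 0, joinExponent q.2 0))
      (fun p => (baseExponent p.1, baseExponent p.2)) ?_ ?_ ?_ ?_ ?_
    · rintro ⟨u, v⟩ h
      rw [Finset.HasAntidiagonal.mem_antidiagonal] at h ⊢
      rw [← joinExponent_add, add_zero, h, ← hw, joinExponent_base_fibre]
    · rintro ⟨u, v⟩ h
      rw [Finset.HasAntidiagonal.mem_antidiagonal] at h ⊢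
      rw [← baseExponent_add, h]
    · rintro ⟨u, v⟩ _; simp
    · rintro p hp
      obtain ⟨h1, h2⟩ := hz p hp
      refine Prod.ext ?_ ?_
      · change joinExponent (baseExponent p.1) 0 = p.1
        rw [← h1, joinExponent_base_fibre]
      · change joinExponent (baseExponent p.2) 0 = p.2
        rw [← h2, joinExponent_base_fibre]
    · rintro ⟨u, v⟩ _
      rw [coeff_pullback hφ hd, coeff_pullback hφ hd, exchange_of_fibreExponent_eq_zero hφ hd]
      all_goals simp
  · rw [if_neg hw, RhoSeries.coeff_mul]
    split_ifs
    · refine (Finset.sum_eq_zero fun p hp => ?_).symm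
      rw [Finset.HasAntidiagonal.mem_antidiagonal] at hp
      rw [coeff_pullback hφ hd, coeff_pullback hφ hd]
      by_cases h1 : fibreExponent p.1 = 0
      · by_cases h2 : fibreExponent p.2 = 0
        · exact absurd (by rw [← hp, fibreExponent_add, h1, h2, add_zero]) hw
        · rw [if_neg h2, mul_zero, smul_zero]
      · rw [if_neg h1, zero_mul, smul_zero]
    · rfl

theorem pullback_C (a : V → 𝕂) :
    (pullback (C a : LocalSeries ρ d V) : LocalSeries σ (bundleDegree d' e) V) = C a := by
  classical
  ext1
  funext w
  rw [coeff_pullback hφ hd, coeff_C, coeff_C]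
  by_cases hw : w = 0
  · subst hw
    have h1 : fibreExponent (0 : (κ ⊕ₗ ι) →₀ ℕ) = 0 := by ext; rfl
    have h2 : baseExponent (0 : (κ ⊕ₗ ι) →₀ ℕ) = 0 := by ext; rfl
    rw [if_pos h1, if_pos h2, if_pos rfl]
  · rw [if_neg hw]
    split_ifs with h1 h2
    · exact absurd (by rw [← joinExponent_base_fibre w, h1, h2, joinExponent_zero]) hw
    · rfl
    · rfl

theorem pullback_one :
    (pullback (1 : LocalSeries ρ d V) : LocalSeries σ (bundleDegree d' e) V) = 1 :=
  pullback_C hφ hd 1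

theorem pullback_X (b : κ) :
    (pullback (X b : LocalSeries ρ d V) : LocalSeries σ (bundleDegree d' e) V) =
      X (toLex (Sum.inl b)) := by
  classical
  ext1
  funext w
  rw [coeff_pullback hφ hd, coeff_X, coeff_X, ← ite_and]
  refine if_congr ?_ rfl rfl
  rw [← joinExponent_single_zero (ι := ι), ← joinExponent_base_fibre w, joinExponent_injective]
  simp [and_comm]

/-- The pullback, as a homomorphism of algebras. -/
noncomputable def pullbackHom : LocalSeries ρ d V →ₐ[𝕂] LocalSeries σ (bundleDegree d' e) V where
  toFun := pullback
  map_one' := pullback_one hφ hd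
  map_mul' := pullback_mul hφ hd
  map_zero' := by
    classical
    ext1
    funext w
    rw [coeff_pullback hφ hd]
    exact ite_self _
  map_add' f g := by
    classical
    ext1
    funext w
    rw [coeff_add, coeff_pullback hφ hd, coeff_pullback hφ hd, coeff_pullback hφ hd, coeff_add]
    split_ifs
    · rfl
    · exact (add_zero 0).symm
  commutes' x := by
    rw [Algebra.algebraMap_eq_smul_one, Algebra.algebraMap_eq_smul_one, ← C_const, ← C_const]
    exact pullback_C hφ hd _

theorem IsHomogeneous.pullback (hf : IsHomogeneous i f) :
    IsHomogeneous (φ i) (pullback f : LocalSeries σ (bundleDegree d' e) V) := by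
  classical
  intro w hw
  rw [coeff_pullback hφ hd] at hw
  split_ifs at hw with h
  · have h1 : ∀ a, w (toLex (Sum.inr a)) = 0 := fun a => DFunLike.congr_fun h a
    rw [← hf _ hw, monomialDegree, Fintype.sum_lex_sum, Finset.sum_eq_zero (s := Finset.univ (α := ι))
      (fun a _ => by rw [h1, zero_smul]), add_zero, monomialDegree, map_sum]
    refine Finset.sum_congr rfl fun b _ => ?_
    rw [map_nsmul, ← hd]
    rfl
  · exact absurd rfl hw

theorem fibreCoeff_pullback_zero (f : LocalSeries ρ d V) :
    fibreCoeff (ρ := ρ) (d := d) (pullback f : LocalSeries σ (bundleDegree d' e) V) 0 = f := by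
  classical
  ext1
  funext u
  refine (coeff_ofCoeff _ u).trans ?_
  split_ifs with h
  · rw [coeff_pullback hφ hd, fibreExponent_joinExponent, if_pos rfl, baseExponent_joinExponent]
  · exact (f.coeff_eq_zero u h).symm

theorem fibreCoeff_pullback (f : LocalSeries ρ d V) {v : ι →₀ ℕ} (hv : v ≠ 0) :
    fibreCoeff (ρ := ρ) (d := d) (pullback f : LocalSeries σ (bundleDegree d' e) V) v = 0 := by
  classical
  ext1
  funext u
  refine (coeff_ofCoeff _ u).trans ?_
  split_ifs with h
  · rw [coeff_pullback hφ hd, fibreExponent_joinExponent, if_neg hv]; rfl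
  · rfl

omit hφ hd in
open Classical in
theorem fibreCoeff_linearCoord (a : ι) (v : ι →₀ ℕ) :
    fibreCoeff (ρ := ρ) (d := d) (linearCoord a : LocalSeries σ (bundleDegree d' e) V) v =
      if v = Finsupp.single a 1 then 1 else 0 := by
  ext1
  funext u
  have h1 : (linearCoord a : LocalSeries σ (bundleDegree d' e) V).coeff (joinExponent u v) =
      if u = 0 ∧ v = Finsupp.single a 1 then 1 else 0 := by
    rw [linearCoord, coeff_X, ← joinExponent_zero_single]
    exact if_congr joinExponent_injective rfl rfl
  refine (coeff_ofCoeff _ u).trans ?_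
  rw [h1]
  by_cases hv : v = Finsupp.single a 1
  · by_cases hu : u = 0
    · subst hu
      simp [hv, coeff_one, admissible_zero]
    · simp [hv, hu, coeff_one]
  · simp [hv]

theorem formalPartial_inr_pullback (a : ι) (f : LocalSeries ρ d V) :
    formalPartial (toLex (Sum.inr a)) (pullback f : LocalSeries σ (bundleDegree d' e) V) = 0 := by
  classical
  ext1
  funext w
  have h1 : fibreExponent (w + Finsupp.single (toLex (Sum.inr a)) 1) ≠ 0 := fun h => by
    have := DFunLike.congr_fun h a
    rw [fibreExponent_apply] at this
    simp at this
  rw [coeff_formalPartial, coeff_pullback hφ hd, if_neg h1, smul_zero, ite_self]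
  rfl

theorem formalPartial_inl_pullback (b : κ) (f : LocalSeries ρ d V) :
    formalPartial (toLex (Sum.inl b)) (pullback f : LocalSeries σ (bundleDegree d' e) V) =
      pullback (formalPartial b f) := by
  classical
  ext1
  funext w
  have h1 : fibreExponent (w + Finsupp.single (toLex (Sum.inl b)) 1) = fibreExponent w := by
    rw [← joinExponent_single_zero, fibreExponent_add, fibreExponent_joinExponent, add_zero]
  have h2 : baseExponent (w + Finsupp.single (toLex (Sum.inl b)) 1) =
      baseExponent w + Finsupp.single b 1 := by
    rw [← joinExponent_single_zero, baseExponent_add, baseExponent_joinExponent]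
  rw [coeff_formalPartial, coeff_pullback hφ hd, coeff_pullback hφ hd, h1, h2]
  by_cases hw : fibreExponent w = 0
  · rw [if_pos hw, if_pos hw, coeff_formalPartial]
    refine if_congr (admissible_of_fibreExponent_eq_zero hφ hd hw) ?_ rfl
    congr 2
    -- The linear coordinates come after the base coordinates in the order, so the derivation passes
    -- none of them.
    rw [Finset.prod_filter, Fintype.prod_lex_sum, Finset.prod_filter,
      Finset.prod_eq_one (s := Finset.univ (α := ι)) (fun a _ => if_neg (by
        simp)), mul_one]
    refine Finset.prod_congr rfl fun c _ => ?_
    refine if_congr Sum.Lex.inl_lt_inl_iff ?_ rfl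
    change σ (-d' b) (d' c) ^ _ = _
    rw [hd, hd, ← map_neg, hφ]
    rfl
  · rw [if_neg hw, if_neg hw, smul_zero, ite_self]

end CoordAtlas

/-! ### Coordinates and transition rules of the total space -/

theorem List.prod_map_eq_of_forall_ne {α S : Type*} [Monoid S] (F : α → S) (a : α)
    (hF : ∀ b, b ≠ a → F b = 1) {l : List α} (hl : l.Nodup) (ha : a ∈ l) :
    (l.map F).prod = F a := by
  induction l with
  | nil => cases ha
  | cons b l ih =>
    rw [List.map_cons, List.prod_cons]
    rw [List.nodup_cons] at hl
    by_cases hb : b = a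
    · subst hb
      rw [List.prod_eq_one (fun x hx => ?_), mul_one]
      obtain ⟨c, hc, rfl⟩ := List.mem_map.1 hx
      exact hF c fun h => hl.1 (h ▸ hc)
    · rw [hF b hb, one_mul]
      exact ih hl.2 ((List.mem_cons.1 ha).resolve_left fun h => hb h.symm)

section OrderedProd

variable {𝕂 ι A : Type*} [Field 𝕂] [Fintype ι] [LinearOrder ι] [Ring A] [Algebra 𝕂 A]

theorem orderedProd_eq_of_forall_ne {F : ι → A} (a : ι) (hF : ∀ b, b ≠ a → F b = 1) :
    orderedProd F = F a :=
  List.prod_map_eq_of_forall_ne F a hF (Finset.sort_nodup _ _)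
    ((Finset.mem_sort _).2 (Finset.mem_univ a))

theorem orderedProd_one : orderedProd (fun _ : ι => (1 : A)) = 1 :=
  List.prod_eq_one fun x hx => by
    obtain ⟨c, hc, rfl⟩ := List.mem_map.1 hx
    rfl

end OrderedProd

namespace RhoSeries

theorem formalPartial_sum {G 𝕂 κ R α : Type*} [AddCommGroup G] [Field 𝕂] [Fintype κ]
    [LinearOrder κ] {ρ : CommutationFactor G 𝕂} {d : κ → G} [CommRing R] [Algebra 𝕂 R] (b : κ)
    (s : Finset α) (f : α → RhoSeries ρ d R) :
    formalPartial b (∑ a ∈ s, f a) = ∑ a ∈ s, formalPartial b (f a) :=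
  map_sum (⟨⟨formalPartial b, formalPartial_zero b⟩, formalPartial_add b⟩ :
    RhoSeries ρ d R →+ RhoSeries ρ d R) f s

end RhoSeries

namespace CoordAtlas

open RhoSeries LocalSeries

variable {𝕜 𝕂 G κ : Type*} [RCLike 𝕜] [RCLike 𝕂] [NormedAlgebra 𝕜 𝕂]
  [AddCommGroup G] [Fintype κ] [LinearOrder κ] {n : ℕ} {ρ : CommutationFactor G 𝕂} {d : κ → G}
  {M : Type*} [TopologicalSpace M]
  {G' ι : Type*} [AddCommGroup G'] [Fintype ι] [LinearOrder ι]
  {σ : CommutationFactor G' 𝕂} {φ : G →+ G'} {d' : κ → G'} {e : ι → G'} {V W : Opens M}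
  {f g : LocalSeries ρ d V} {i j : G}

/-- The coordinates of the total space: those of the base and the linear ones. -/
def indexEquiv (n : ℕ) (κ ι : Type*) : (Fin n ⊕ₗ κ) ⊕ ι ≃ Fin n ⊕ₗ (κ ⊕ₗ ι) where
  toFun := Sum.elim (fun a => toLex (Sum.map id (fun b => toLex (Sum.inl b)) (ofLex a)))
    fun a => toLex (Sum.inr (toLex (Sum.inr a)))
  invFun a := Sum.elim (fun k => Sum.inl (toLex (Sum.inl k)))
    (fun c => Sum.elim (fun b => Sum.inl (toLex (Sum.inr b))) Sum.inr (ofLex c)) (ofLex a)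
  left_inv := by
    rintro (a | a)
    · induction a using Lex.rec with | _ a
      rcases a with k | b <;> rfl
    · rfl
  right_inv a := by
    induction a using Lex.rec with | _ a
    rcases a with k | c
    · rfl
    · induction c using Lex.rec with | _ c
      rcases c with b | a <;> rfl

/-- `f` is homogeneous of polynomial degree `m` in the linear coordinates. -/
def IsFibreHomogeneous (m : ℕ) (f : LocalSeries σ (bundleDegree d' e) V) : Prop :=
  ∀ w, f.coeff w ≠ 0 → ∑ a, fibreExponent w a = m

theorem IsFibreHomogeneous.mul {m m' : ℕ} {f g : LocalSeries σ (bundleDegree d' e) V}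
    (hf : IsFibreHomogeneous m f) (hg : IsFibreHomogeneous m' g) :
    IsFibreHomogeneous (m + m') (f * g) := by
  classical
  intro w hw
  rw [RhoSeries.coeff_mul] at hw
  split_ifs at hw
  · obtain ⟨p, hp, h⟩ := Finset.exists_ne_zero_of_sum_ne_zero hw
    rw [Finset.HasAntidiagonal.mem_antidiagonal] at hp
    rw [← hp, fibreExponent_add, ← hf p.1 (fun h0 => h (by rw [h0, zero_mul, smul_zero])),
      ← hg p.2 (fun h0 => h (by rw [h0, mul_zero, smul_zero])), ← Finset.sum_add_distrib]
    rfl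
  · exact absurd rfl hw

theorem IsFibreHomogeneous.sum {α : Type*} {s : Finset α} {m : ℕ}
    {f : α → LocalSeries σ (bundleDegree d' e) V} (hf : ∀ a ∈ s, IsFibreHomogeneous m (f a)) :
    IsFibreHomogeneous m (∑ a ∈ s, f a) := by
  intro w hw
  rw [RhoSeries.coeff_sum] at hw
  obtain ⟨a, ha, h⟩ := Finset.exists_ne_zero_of_sum_ne_zero hw
  exact hf a ha w h

theorem isFibreHomogeneous_linearCoord (a : ι) :
    IsFibreHomogeneous 1 (linearCoord a : LocalSeries σ (bundleDegree d' e) V) := by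
  classical
  intro w hw
  rw [linearCoord, coeff_X] at hw
  split_ifs at hw with h
  · rw [h, ← joinExponent_zero_single, fibreExponent_joinExponent]
    simp [Finsupp.single_apply]
  · exact absurd rfl hw

variable (hφ : ∀ i j, σ (φ i) (φ j) = ρ i j) (hd : ∀ b, d' b = φ (d b))

include hφ hd

theorem isFibreHomogeneous_pullback (f : LocalSeries ρ d V) :
    IsFibreHomogeneous 0 (pullback f : LocalSeries σ (bundleDegree d' e) V) := by
  classical
  intro w hw
  rw [coeff_pullback hφ hd] at hw
  split_ifs at hw with h
  · rw [h]; exact Finset.sum_const_zero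
  · exact absurd rfl hw

theorem pullback_zero :
    (pullback (0 : LocalSeries ρ d V) : LocalSeries σ (bundleDegree d' e) V) = 0 :=
  map_zero (pullbackHom hφ hd)

theorem IsFunction.pullback [ChartedSpace (EuclideanSpace 𝕜 (Fin n)) M] {r : WithTop ℕ∞}
    (hf : f.IsFunction 𝕜 n r i) :
    LocalSeries.IsFunction 𝕜 n r (φ i) (pullback f : LocalSeries σ (bundleDegree d' e) V) := by
  classical
  refine ⟨fun w => ?_, IsHomogeneous.pullback hφ hd hf.isHomogeneous⟩
  rw [coeff_pullback hφ hd]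
  split_ifs
  · exact hf.1 _
  · exact contMDiff_const

section Coordinates

variable {ψ : OpenPartialHomeomorph M (EuclideanSpace 𝕜 (Fin n))}

omit hφ in
theorem coordDegree_indexEquiv_inl (a : Fin n ⊕ₗ κ) :
    coordDegree n (bundleDegree d' e) (indexEquiv n κ ι (Sum.inl a)) = φ (coordDegree n d a) := by
  induction a using Lex.rec with | _ a
  rcases a with k | b
  · exact (map_zero φ).symm
  · exact hd b

theorem coordSeries_indexEquiv_inl (a : Fin n ⊕ₗ κ) :
    coordSeries σ (bundleDegree d' e) ψ V (indexEquiv n κ ι (Sum.inl a)) =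
      pullback (coordSeries ρ d ψ V a) := by
  induction a using Lex.rec with | _ a
  rcases a with k | b
  · exact (pullback_C hφ hd _).symm
  · exact (pullback_X hφ hd b).symm

theorem coordPartial_indexEquiv_inl_pullback [ChartedSpace (EuclideanSpace 𝕜 (Fin n)) M]
    (hV : (V : Set M) ⊆ ψ.source) (a : Fin n ⊕ₗ κ)
    (f : LocalSeries ρ d V) :
    coordPartial ψ (indexEquiv n κ ι (Sum.inl a))
      (pullback f : LocalSeries σ (bundleDegree d' e) V) = pullback (coordPartial ψ a f) := by
  classical
  induction a using Lex.rec with | _ a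
  rcases a with k | b
  · ext1
    funext w
    refine (coeff_coordPartial_inl hV k _ w).trans ?_
    rw [coeff_pullback hφ hd, coeff_pullback hφ hd, apply_ite (basePartial ψ k),
      coeff_coordPartial_inl hV, basePartial_zero hV]
  · exact formalPartial_inl_pullback hφ hd b f

end Coordinates

section Transition

variable {A : CoordAtlas 𝕜 n ρ d M}
  {fibre : ∀ (c c' : A.Chart) (V : Opens M), V ≤ A.dom c → V ≤ A.dom c' →
    ι → LocalSeries σ (bundleDegree d' e) V} {c c' : A.Chart} {hc : V ≤ A.dom c}
  {hc' : V ≤ A.dom c'} (h0 : A.trans c c' V hc hc' 0 = 0)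

include h0

/-- A pullback has the single fibre coefficient `v = 0`, so nothing is substituted for the linear
coordinates. The hypothesis `h0` makes the other terms vanish. -/
theorem totalSpace_trans_pullback (f : LocalSeries ρ d V) :
    (A.totalSpace σ d' e fibre).trans c c' V hc hc' (pullback f) =
      pullback (A.trans c c' V hc hc' f) := by
  classical
  have h1 : ∀ w, ∑ v ∈ Finset.finsuppAntidiag Finset.univ (∑ a, fibreExponent w a),
      RhoSeries.coeff (pullback (A.trans c c' V hc hc' (fibreCoeff
        (pullback f : LocalSeries σ (bundleDegree d' e) V) v)) *
        orderedProd fun a => fibre c c' V hc hc' a ^ v a) w =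
      (pullback (A.trans c c' V hc hc' f) : LocalSeries σ (bundleDegree d' e) V).coeff w := by
    intro w
    by_cases hw : ∑ a, fibreExponent w a = 0
    · rw [Finset.sum_eq_single 0]
      · rw [fibreCoeff_pullback_zero hφ hd]
        simp only [Finsupp.coe_zero, Pi.zero_apply, pow_zero]
        rw [orderedProd_one, mul_one]
      · intro v _ hv
        rw [fibreCoeff_pullback hφ hd f hv, h0, pullback_zero hφ hd, zero_mul]
        rfl
      · intro h
        exact absurd (Finset.mem_finsuppAntidiag.2 ⟨by rw [hw]; exact Finset.sum_const_zero,
          Finset.subset_univ _⟩) h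
    · rw [Finset.sum_eq_zero]
      · exact (of_not_not fun h => hw (isFibreHomogeneous_pullback hφ hd _ w (Ne.symm h)))
      · intro v hv
        rw [Finset.mem_finsuppAntidiag] at hv
        have hv0 : v ≠ 0 := fun h => hw (by rw [← hv.1, h]; exact Finset.sum_const_zero)
        rw [fibreCoeff_pullback hφ hd f hv0, h0, pullback_zero hφ hd, zero_mul]
        rfl
  ext1
  funext w
  refine (coeff_ofCoeff _ w).trans ?_
  split_ifs with h
  · exact h1 w
  · exact (RhoSeries.coeff_eq_zero _ w h).symm

/-- Only `v = single a 1` contributes. Since the fibre expression is linear, nothing is lost by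
admitting only exponents `v` of the same total degree as `w`. -/
theorem totalSpace_trans_linearCoord (hone : A.trans c c' V hc hc' 1 = 1) {a : ι}
    (ha : IsFibreHomogeneous 1 (fibre c c' V hc hc' a)) :
    (A.totalSpace σ d' e fibre).trans c c' V hc hc' (linearCoord a) = fibre c c' V hc hc' a := by
  classical
  have h2 : ∀ v : ι →₀ ℕ, v ≠ Finsupp.single a 1 → ∀ w, RhoSeries.coeff (pullback
      (A.trans c c' V hc hc' (fibreCoeff
        (linearCoord a : LocalSeries σ (bundleDegree d' e) V) v)) *
        orderedProd fun a => fibre c c' V hc hc' a ^ v a) w = 0 := by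
    intro v hv w
    rw [fibreCoeff_linearCoord, if_neg hv, h0, pullback_zero hφ hd, zero_mul]
    rfl
  have h1 : ∀ w, ∑ v ∈ Finset.finsuppAntidiag Finset.univ (∑ a, fibreExponent w a),
      RhoSeries.coeff (pullback (A.trans c c' V hc hc' (fibreCoeff
        (linearCoord a : LocalSeries σ (bundleDegree d' e) V) v)) *
        orderedProd fun a => fibre c c' V hc hc' a ^ v a) w =
      (fibre c c' V hc hc' a).coeff w := by
    intro w
    have hsum : ∑ b, Finsupp.single a 1 b = 1 := by simp [Finsupp.single_apply]
    by_cases hw : ∑ a, fibreExponent w a = 1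
    · rw [Finset.sum_eq_single (Finsupp.single a 1)]
      · rw [fibreCoeff_linearCoord, if_pos rfl, hone, pullback_one hφ hd, one_mul,
          orderedProd_eq_of_forall_ne a, Finsupp.single_eq_same, pow_one]
        intro b hb
        rw [Finsupp.single_eq_of_ne hb, pow_zero]
      · exact fun v _ hv => h2 v hv w
      · intro h
        exact absurd (Finset.mem_finsuppAntidiag.2 ⟨by rw [hw]; exact hsum,
          Finset.subset_univ _⟩) h
    · rw [Finset.sum_eq_zero]
      · exact (of_not_not fun h => hw (ha w (Ne.symm h)))
      · intro v hv
        rw [Finset.mem_finsuppAntidiag] at hv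
        exact h2 v (fun h => hw (by rw [← hv.1, h]; exact hsum)) w
  ext1
  funext w
  refine (coeff_ofCoeff _ w).trans ?_
  split_ifs with h
  · exact h1 w
  · exact (RhoSeries.coeff_eq_zero _ w h).symm

end Transition

end CoordAtlas

/-! ### The Jacobian of the coordinate changes of the total space -/

namespace RhoManifold

open RhoSeries LocalSeries CoordAtlas

variable {𝕜 𝕂 G κ : Type*} [RCLike 𝕜] [RCLike 𝕂] [NormedAlgebra 𝕜 𝕂]
    [AddCommGroup G] [Fintype κ] [LinearOrder κ] {r : WithTop ℕ∞} {n : ℕ}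
    {ρ : CommutationFactor G 𝕂} {d : κ → G} {M : Type*} [TopologicalSpace M]
    [ChartedSpace (EuclideanSpace 𝕜 (Fin n)) M] (X : RhoManifold 𝕜 r n ρ d M)
    (c c' : X.atlas.Chart) {V : Opens M} (hc : V ≤ X.atlas.dom c) (hc' : V ≤ X.atlas.dom c')
    {G' ι : Type*} [AddCommGroup G'] [Fintype ι] [LinearOrder ι]
    {σ : CommutationFactor G' 𝕂} {φ : G →+ G'} {d' : κ → G'} {e : ι → G'}

section TotalSpace

variable (hφ : ∀ i j, σ (φ i) (φ j) = ρ i j) (hd : ∀ b, d' b = φ (d b))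
    (hr : r = ∞ ∨ r = ω)
    [IsManifold 𝓘(𝕜, EuclideanSpace 𝕜 (Fin n)) r M]
    {fibre : ∀ (c c' : X.atlas.Chart) (V : Opens M), V ≤ X.atlas.dom c → V ≤ X.atlas.dom c' →
      ι → LocalSeries σ (bundleDegree d' e) V}

include hφ hd hr

/-- The Jacobian matrix is lower triangular because pullbacks do not depend on the linear
coordinates. The base block is the pulled back `J_xy`, and `F` is the fibre block. Its inverse `H`
is required so that the Berezinian of the triangular matrix factors. -/
theorem totalSpace_berJacobian
    (hfun : ∀ a, (fibre c c' V hc hc' a).IsFunction 𝕜 n r (e a))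
    (hlin : ∀ a, IsFibreHomogeneous 1 (fibre c c' V hc hc' a))
    {F H : Matrix ι ι (LocalSeries σ (bundleDegree d' e) V)}
    (hF : ∀ a b, σ (e b) (e a - e b) •
      formalPartial (toLex (Sum.inr b)) (fibre c c' V hc hc' a) = F a b)
    (gH : IsGraded e e H) (hFH : F * H = 1) (hHF : H * F = 1) :
    (X.atlas.totalSpace σ d' e fibre).berJacobian c c' V hc hc' =
      pullback (X.atlas.berJacobian c c' V hc hc') * rhoBer σ e F := by
  have hzero : X.atlas.trans c c' V hc hc' 0 = 0 := (X.isTransition c c').zero (le_inf hc hc')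
  have hone : X.atlas.trans c c' V hc hc' 1 = 1 := (X.isTransition c c').one (le_inf hc hc')
  have hV := X.subset_source c hc
  have hbase : ∀ a, (X.atlas.totalSpace σ d' e fibre).trans c c' V hc hc'
      (coordSeries σ (bundleDegree d' e) (X.atlas.base c') V (indexEquiv n κ ι (Sum.inl a))) =
      pullback (X.atlas.trans c c' V hc hc' (coordSeries ρ d (X.atlas.base c') V a)) := fun a => by
    rw [coordSeries_indexEquiv_inl hφ hd]
    exact totalSpace_trans_pullback hφ hd hzero _
  have hfib : ∀ a, (X.atlas.totalSpace σ d' e fibre).trans c c' V hc hc'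
      (coordSeries σ (bundleDegree d' e) (X.atlas.base c') V (indexEquiv n κ ι (Sum.inr a))) =
      fibre c c' V hc hc' a := fun a => totalSpace_trans_linearCoord hφ hd hzero hone (hlin a)
  have hgraded : IsGraded (coordDegree n (bundleDegree d' e)) (coordDegree n (bundleDegree d' e))
      ((X.atlas.totalSpace σ d' e fibre).jacobian c c' V hc hc') := by
    have h1 : ∀ a, LocalSeries.IsFunction 𝕜 n r (coordDegree n (bundleDegree d' e) a)
        ((X.atlas.totalSpace σ d' e fibre).trans c c' V hc hc'
          (coordSeries σ (bundleDegree d' e) (X.atlas.base c') V a)) := fun a => by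
      obtain ⟨a, rfl⟩ := (indexEquiv n κ ι).surjective a
      rcases a with a | a
      · rw [hbase, coordDegree_indexEquiv_inl hd]
        exact IsFunction.pullback hφ hd (X.isFunction_trans_coordSeries c c' hc hc' hr a)
      · rw [hfib]
        exact hfun a
    exact fun a b => ((h1 a).coordPartial c.2.chart_mem hV hr b).isHomogeneous.smul _
  have hJ : ∀ {a f} b, (X.atlas.totalSpace σ d' e fibre).trans c c' V hc hc'
      (coordSeries σ (bundleDegree d' e) (X.atlas.base c') V a) = f →
      (X.atlas.totalSpace σ d' e fibre).jacobian c c' V hc hc' a b =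
        σ (coordDegree n (bundleDegree d' e) b) (coordDegree n (bundleDegree d' e) a -
          coordDegree n (bundleDegree d' e) b) • coordPartial (X.atlas.base c) b f :=
    fun b h => by rw [← h]; rfl
  have hΦ : ∀ i f, IsHomogeneous i f → IsHomogeneous (φ i)
      ((pullbackHom hφ hd : LocalSeries ρ d V →ₐ[𝕂] LocalSeries σ (bundleDegree d' e) V) f) :=
    fun i f hf => IsHomogeneous.pullback hφ hd hf
  have hmap : ∀ N N' : Matrix (Fin n ⊕ₗ κ) (Fin n ⊕ₗ κ) (LocalSeries ρ d V), N * N' = 1 →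
      N.map (pullbackHom (σ := σ) (e := e) hφ hd) * N'.map (pullbackHom hφ hd) = 1 := by
    intro N N' h
    rw [← Matrix.map_mul, h, Matrix.map_one _ (map_zero _) (map_one _)]
  refine (rhoBer_blockTriangular (indexEquiv n κ ι) hgraded (fun a b => ?_)
    (coordDegree_indexEquiv_inl hd) (fun _ => rfl)
    (F₁ := (X.atlas.jacobian c c' V hc hc').map (pullbackHom hφ hd))
    (H₁ := (X.inverseJacobian c c' hc hc').map (pullbackHom hφ hd))
    (fun a b => ?_) (fun a b => ?_) (fun a b => ?_) gH
    (hmap _ _ (X.jacobian_mul_inverseJacobian c c' hc hc' hr))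
    (hmap _ _ (X.inverseJacobian_mul_jacobian c c' hc hc' hr)) hFH hHF).trans
    (congrArg (· * rhoBer σ e F) (map_rhoBer (X.isGraded_jacobian c c' hc hc' hr)
      (X.isGraded_inverseJacobian c c' hc hc' hr) (X.jacobian_mul_inverseJacobian c c' hc hc' hr)
      (X.inverseJacobian_mul_jacobian c c' hc hc' hr) (pullbackHom hφ hd) φ hφ hΦ))
  · refine (hJ _ (hbase a)).trans ((congrArg (_ • ·) ?_).trans (smul_zero _))
    exact formalPartial_inr_pullback hφ hd b _
  · refine (hJ _ (hbase a)).trans ?_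
    rw [coordPartial_indexEquiv_inl_pullback hφ hd hV, coordDegree_indexEquiv_inl hd,
      coordDegree_indexEquiv_inl hd, ← map_sub, hφ]
    exact (map_smul (pullbackHom hφ hd) _ _).symm
  · exact (hJ _ (hfib a)).trans (hF a b)
  · rw [← map_sub]
    exact hΦ _ _ (X.isGraded_inverseJacobian c c' hc hc' hr a b)

end TotalSpace

end RhoManifold

/-! ### Berezinians and volume forms of the tangent and cotangent bundles -/

namespace RhoManifold

open RhoSeries LocalSeries CoordAtlas

variable {𝕜 𝕂 G κ : Type*} [RCLike 𝕜] [RCLike 𝕂] [NormedAlgebra 𝕜 𝕂]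
    [AddCommGroup G] [Fintype κ] [LinearOrder κ] {r : WithTop ℕ∞} {n : ℕ}
    {ρ : CommutationFactor G 𝕂} {d : κ → G} {M : Type*} [TopologicalSpace M]
    [ChartedSpace (EuclideanSpace 𝕜 (Fin n)) M] (X : RhoManifold 𝕜 r n ρ d M)
    {G' ι : Type*} [AddCommGroup G'] [Fintype ι] [LinearOrder ι]
    {σ : CommutationFactor G' 𝕂} {φ : G →+ G'} {d' : κ → G'}

section VolumeForm

variable {e : ι → G'} (hφ : ∀ i j, σ (φ i) (φ j) = ρ i j) (hd : ∀ b, d' b = φ (d b))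
    {fibre : ∀ (c c' : X.atlas.Chart) (V : Opens M), V ≤ X.atlas.dom c → V ≤ X.atlas.dom c' →
      ι → LocalSeries σ (bundleDegree d' e) V}

include hφ hd

theorem totalSpace_isVolumeForm_one (hB : ∀ c c' V (hc : V ≤ X.atlas.dom c)
    (hc' : V ≤ X.atlas.dom c'),
      (X.atlas.totalSpace σ d' e fibre).berJacobian c c' V hc hc' = 1) :
    (X.atlas.totalSpace σ d' e fibre).IsVolumeForm r fun _ => 1 := by
  refine ⟨fun (c c' : X.atlas.Chart) V (hc : V ≤ X.atlas.dom c) (hc' : V ≤ X.atlas.dom c') => ?_,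
    fun c => ⟨isFunction_one, 1, isFunction_one, one_mul _,
    one_mul _⟩⟩
  have h1 := totalSpace_trans_pullback hφ hd (fibre := fibre)
    ((X.isTransition c c').zero (le_inf hc hc')) 1
  rw [pullback_one hφ hd] at h1
  have h2 : X.atlas.trans c c' V hc hc' 1 = 1 := (X.isTransition c c').one (le_inf hc hc')
  refine (restrict_one hc).trans (Eq.symm ?_)
  refine (congrArg (· * _) (hB c c' V hc hc')).trans ((one_mul _).trans ?_)
  refine (congrArg _ (restrict_one hc')).trans (h1.trans ?_)
  exact (congrArg pullback h2).trans (pullback_one hφ hd)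

theorem totalSpace_isVolumeForm_sq
    [IsManifold 𝓘(𝕜, EuclideanSpace 𝕜 (Fin n)) r M] (hr : r = ∞ ∨ r = ω)
    (hB : ∀ c c' V (hc : V ≤ X.atlas.dom c) (hc' : V ≤ X.atlas.dom c'),
      (X.atlas.totalSpace σ d' e fibre).berJacobian c c' V hc hc' =
        pullback (X.atlas.berJacobian c c' V hc hc') ^ 2)
    {s : ∀ c : X.atlas.Chart, LocalSeries ρ d (X.atlas.dom c)} (hs : X.atlas.IsVolumeForm r s) :
    (X.atlas.totalSpace σ d' e fibre).IsVolumeForm r fun c => pullback (s c) ^ 2 := by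
  have hsq : ∀ {V : Opens M} (f : LocalSeries ρ d V), (pullback f ^ 2 :
      LocalSeries σ (bundleDegree d' e) V) = pullback (f ^ 2) :=
    fun f => (map_pow (pullbackHom hφ hd) f 2).symm
  refine ⟨fun (c c' : X.atlas.Chart) V (hc : V ≤ X.atlas.dom c) (hc' : V ≤ X.atlas.dom c') => ?_,
    fun c => ?_⟩
  · have hT := X.isTransition c c'
    have hV := le_inf hc hc'
    have h1 := (hs.2 c').1.restrict hc'
    have h2 : X.atlas.trans c c' V hc hc' ((s c').restrict hc' ^ 2) =
        X.atlas.trans c c' V hc hc' ((s c').restrict hc') ^ 2 := by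
      rw [pow_two, pow_two]
      exact hT.mul hV h1 h1
    -- The Berezinian has degree zero and commutes with the density, so the square of their product
    -- is the product of their squares.
    have h3 : Commute (X.atlas.berJacobian c c' V hc hc')
        (X.atlas.trans c c' V hc hc' ((s c').restrict hc')) :=
      (X.isHomogeneous_berJacobian c c' hc hc' hr).mul_comm (hT.isFunction hV h1).isHomogeneous
    have h4 : ∀ c (hc : V ≤ X.atlas.dom c), LocalSeries.restrict hc
        (pullback (s c) ^ 2 : LocalSeries σ (bundleDegree d' e) (X.atlas.dom c)) =
        pullback ((s c).restrict hc ^ 2) := fun c hc => by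
      rw [hsq, restrict_pullback hφ hd, pow_two, pow_two, restrict_mul]
    refine (h4 c hc).trans (Eq.symm ?_)
    refine (congrArg₂ (· * ·) ((hB c c' V hc hc').trans (hsq _)) ((congrArg _ (h4 c' hc')).trans
      (totalSpace_trans_pullback hφ hd (hT.zero hV) _))).trans ?_
    refine (pullback_mul hφ hd _ _).symm.trans (congrArg pullback ?_)
    rw [h2, ← h3.mul_pow, ← hs.1 c c' V hc hc']
  · obtain ⟨h1, t, h2, h3, h4⟩ := hs.2 c
    have h5 : ∀ {f : LocalSeries ρ d (X.atlas.dom c)}, f.IsFunction 𝕜 n r 0 →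
        LocalSeries.IsFunction 𝕜 n r 0
          (pullback f ^ 2 : LocalSeries σ (bundleDegree d' e) (X.atlas.dom c)) := fun hf => by
      have h := IsFunction.pullback (σ := σ) (φ := φ) (e := e) hφ hd hf
      rw [map_zero] at h
      exact h.pow 2
    have h6 : ∀ {f g : LocalSeries ρ d (X.atlas.dom c)}, f * g = 1 → g * f = 1 →
        (pullback f ^ 2 * pullback g ^ 2 :
          LocalSeries σ (bundleDegree d' e) (X.atlas.dom c)) = 1 := fun {f g} h h' => by
      rw [hsq, hsq, ← pullback_mul hφ hd, ← Commute.mul_pow (h.trans h'.symm), h, one_pow,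
        pullback_one hφ hd]
    exact ⟨h5 h1, pullback t ^ 2, h5 h2, h6 h3 h4, h6 h4 h3⟩

end VolumeForm

variable {e : Fin n ⊕ₗ κ → G'} {i : G'}
    (c c' : X.atlas.Chart) {V : Opens M} (hc : V ≤ X.atlas.dom c) (hc' : V ≤ X.atlas.dom c')
    (hφ : ∀ i j, σ (φ i) (φ j) = ρ i j) (hd : ∀ b, d' b = φ (d b))
    [IsManifold 𝓘(𝕜, EuclideanSpace 𝕜 (Fin n)) r M] (hr : r = ∞ ∨ r = ω)

include hφ hd hr

section Shift

variable {N N' : Matrix (Fin n ⊕ₗ κ) (Fin n ⊕ₗ κ) (LocalSeries ρ d V)} {I : Fin n ⊕ₗ κ → G}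

omit hr in
theorem map_pullbackHom_mul_eq_one (h : N * N' = 1) :
    N.map (pullbackHom (σ := σ) (e := e) hφ hd) * N'.map (pullbackHom hφ hd) = 1 := by
  rw [← Matrix.map_mul, h, Matrix.map_one _ (map_zero _) (map_one _)]

omit hr in
theorem isGraded_map_pullbackHom (he : ∀ a, e a = φ (I a) + i) (hN : IsGraded I I N) :
    IsGraded e e (N.map (pullbackHom (σ := σ) (e := e) hφ hd)) := fun a b => by
  rw [he, he, add_sub_add_right_eq_sub, ← map_sub]
  exact IsHomogeneous.pullback hφ hd (hN a b)

variable (hN : IsGraded I I N) (hN' : IsGraded I I N') (h : N * N' = 1) (h' : N' * N = 1)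
  (he : ∀ a, e a = φ (I a) + i)

include hN hN' h h' he

-- Pullback preserves the Berezinian, and so does an even shift. The odd counterpart below gives the
-- inverse instead.
omit hr in
theorem rhoBer_map_pullbackHom_of_isEven (hi : σ.IsEven i) :
    rhoBer σ e (N.map (pullbackHom (σ := σ) (e := e) hφ hd)) = pullback (rhoBer ρ I N) := by
  obtain rfl : e = fun a => φ (I a) + i := funext he
  refine (rhoBer_shift_of_isEven ?_ hi).trans
    (map_rhoBer hN hN' h h' (pullbackHom hφ hd) φ hφ fun i f hf => IsHomogeneous.pullback hφ hd hf)
  exact fun a b => by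
    rw [← map_sub]
    exact IsHomogeneous.pullback hφ hd (hN a b)

omit hr in
theorem pullback_rhoBer_mul_of_isOdd (hi : σ.IsOdd i) :
    pullback (rhoBer ρ I N) * rhoBer σ e (N.map (pullbackHom (σ := σ) (e := e) hφ hd)) = 1 := by
  obtain rfl : e = fun a => φ (I a) + i := funext he
  have hg : ∀ {N : Matrix (Fin n ⊕ₗ κ) (Fin n ⊕ₗ κ) (LocalSeries ρ d V)}, IsGraded I I N →
      IsGraded (fun a => φ (I a)) (fun a => φ (I a))
        (N.map (pullbackHom (σ := σ) (e := fun a => φ (I a) + i) hφ hd)) := fun hN a b => by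
    rw [← map_sub]
    exact IsHomogeneous.pullback hφ hd (hN a b)
  refine (congrArg (· * _) ?_).trans (rhoBer_shift_of_isOdd_mul (hg hN) (hg hN')
    (map_pullbackHom_mul_eq_one hφ hd h) (map_pullbackHom_mul_eq_one hφ hd h') hi)
  exact (map_rhoBer hN hN' h h' (pullbackHom hφ hd) φ hφ
    fun i f hf => IsHomogeneous.pullback hφ hd hf).symm

end Shift

variable (hi : ∀ j, σ i (φ j) = 1)

/-! ### Tangent bundles. -/

section Tangent

variable (he : ∀ a, e a = φ (coordDegree n d a) + i)

include hi he

/-- The Jacobian matrix of the coordinates `η_a = ∑ b, ξ_b ∂y^a/∂x^b`. -/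
theorem totalSpace_tangent_berJacobian :
    (X.atlas.totalSpace σ d' e fun c c' V hc hc' a =>
      ∑ b, linearCoord b * pullback (X.atlas.derivative c c' V hc hc' a b)).berJacobian
        c c' V hc hc' = pullback (X.atlas.berJacobian c c' V hc hc') *
      rhoBer σ e ((X.atlas.jacobian c c' V hc hc').map (pullbackHom hφ hd)) := by
  refine X.totalSpace_berJacobian c c' hc hc' hφ hd hr (fun a => ?_) (fun a => ?_)
    (H := (X.inverseJacobian c c' hc hc').map (pullbackHom hφ hd)) (fun a b => ?_)
    (isGraded_map_pullbackHom hφ hd he (X.isGraded_inverseJacobian c c' hc hc' hr))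
    (map_pullbackHom_mul_eq_one hφ hd (X.jacobian_mul_inverseJacobian c c' hc hc' hr))
    (map_pullbackHom_mul_eq_one hφ hd (X.inverseJacobian_mul_jacobian c c' hc hc' hr))
  · refine IsFunction.sum fun b _ => ?_
    have h1 : LocalSeries.IsFunction 𝕜 n r (e b)
      (linearCoord b : LocalSeries σ (bundleDegree d' e) V) := isFunction_X _
    have h2 := h1.mul (IsFunction.pullback hφ hd (X.isFunction_derivative c c' hc hc' hr a b))
    rwa [show e b + φ (coordDegree n d a - coordDegree n d b) = e a by
      rw [he, he, map_sub]; abel] at h2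
  · exact IsFibreHomogeneous.sum fun b _ =>
      (isFibreHomogeneous_linearCoord b).mul (isFibreHomogeneous_pullback hφ hd _)
  · have h1 : e a - e b = φ (coordDegree n d a - coordDegree n d b) := by
      rw [he, he, map_sub]; abel
    have h2 : formalPartial (toLex (Sum.inr b))
        (∑ k, linearCoord k * pullback (X.atlas.derivative c c' V hc hc' a k) :
          LocalSeries σ (bundleDegree d' e) V) =
        pullback (X.atlas.derivative c c' V hc hc' a b) := by
      rw [formalPartial_sum, Finset.sum_eq_single b]
      · rw [linearCoord, formalPartial_mul (isHomogeneous_X _), formalPartial_X, if_pos rfl,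
          one_mul, formalPartial_inr_pullback hφ hd, mul_zero, smul_zero, add_zero]
      · intro k _ hk
        rw [linearCoord, formalPartial_mul (isHomogeneous_X _), formalPartial_X, if_neg,
          zero_mul, formalPartial_inr_pullback hφ hd, mul_zero, smul_zero, add_zero]
        exact fun h => hk (by simpa using h)
      · exact fun h => absurd (Finset.mem_univ b) h
    -- By `hi` the shift `i` does not interact with degrees of the base, so the sign in the fibre
    -- block is the one in `J_xy` and the block is exactly the pulled back Jacobian matrix.
    rw [h2, h1, he b, σ.add_left, hφ, hi, mul_one]
    exact (map_smul (pullbackHom hφ hd) _ _).symm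

theorem totalSpace_tangent_berJacobian_of_isEven (hieven : σ.IsEven i) :
    (X.atlas.totalSpace σ d' e fun c c' V hc hc' a =>
      ∑ b, linearCoord b * pullback (X.atlas.derivative c c' V hc hc' a b)).berJacobian
        c c' V hc hc' = pullback (X.atlas.berJacobian c c' V hc hc') ^ 2 := by
  rw [X.totalSpace_tangent_berJacobian c c' hc hc' hφ hd hr hi he,
    rhoBer_map_pullbackHom_of_isEven hφ hd (X.isGraded_jacobian c c' hc hc' hr)
      (X.isGraded_inverseJacobian c c' hc hc' hr) (X.jacobian_mul_inverseJacobian c c' hc hc' hr)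
      (X.inverseJacobian_mul_jacobian c c' hc hc' hr) he hieven, pow_two]
  rfl

theorem totalSpace_tangent_berJacobian_of_isOdd (hodd : σ.IsOdd i) :
    (X.atlas.totalSpace σ d' e fun c c' V hc hc' a =>
      ∑ b, linearCoord b * pullback (X.atlas.derivative c c' V hc hc' a b)).berJacobian
        c c' V hc hc' = 1 :=
  (X.totalSpace_tangent_berJacobian c c' hc hc' hφ hd hr hi he).trans
    (pullback_rhoBer_mul_of_isOdd hφ hd (X.isGraded_jacobian c c' hc hc' hr)
      (X.isGraded_inverseJacobian c c' hc hc' hr) (X.jacobian_mul_inverseJacobian c c' hc hc' hr)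
      (X.inverseJacobian_mul_jacobian c c' hc hc' hr) he hodd)

end Tangent

/-! ### Cotangent bundles. -/

section Cotangent

variable (he : ∀ a, e a = φ (- coordDegree n d a) + i)

include he

omit hi

omit hφ hd he in
theorem isGraded_inverseDerivativeMatrix : IsGraded (fun a => - coordDegree n d a)
    (fun a => - coordDegree n d a) (X.inverseDerivativeMatrix c c' hc hc') := fun a b => by
  rw [neg_sub_neg]
  exact X.isHomogeneous_inverseDerivativeMatrix c c' hc hc' hr a b

omit hφ hd he in
theorem isGraded_derivativeMatrix : IsGraded (fun a => - coordDegree n d a)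
    (fun a => - coordDegree n d a) (X.derivativeMatrix c c' hc hc') := fun a b => by
  rw [neg_sub_neg]
  exact X.isHomogeneous_derivativeMatrix c c' hc hc' hr a b

/-- The Jacobian matrix of the coordinates `η_a = ∑ b, (∂x^b/∂y^a) ξ_b`. -/
theorem totalSpace_cotangent_berJacobian :
    (X.atlas.totalSpace σ d' e fun c c' V hc hc' a =>
      ∑ b, pullback (X.atlas.inverseDerivative c c' V hc hc' a b) * linearCoord b).berJacobian
        c c' V hc hc' = pullback (X.atlas.berJacobian c c' V hc hc') *
      rhoBer σ e ((X.inverseDerivativeMatrix c c' hc hc').map (pullbackHom hφ hd)) := by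
  refine X.totalSpace_berJacobian c c' hc hc' hφ hd hr (fun a => ?_) (fun a => ?_)
    (H := (X.derivativeMatrix c c' hc hc').map (pullbackHom hφ hd)) (fun a b => ?_)
    (isGraded_map_pullbackHom hφ hd he (X.isGraded_derivativeMatrix c c' hc hc' hr))
    (map_pullbackHom_mul_eq_one hφ hd
      (X.inverseDerivativeMatrix_mul_derivativeMatrix c c' hc hc' hr))
    (map_pullbackHom_mul_eq_one hφ hd
      (X.derivativeMatrix_mul_inverseDerivativeMatrix c c' hc hc' hr))
  · refine IsFunction.sum fun b _ => ?_
    have h1 : LocalSeries.IsFunction 𝕜 n r (e b)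
      (linearCoord b : LocalSeries σ (bundleDegree d' e) V) := isFunction_X _
    have h2 := (IsFunction.pullback hφ hd
      (X.isFunction_inverseDerivative c c' hc hc' hr a b)).mul h1
    rwa [show φ (coordDegree n d b - coordDegree n d a) + e b = e a by
      rw [he, he, map_sub, map_neg, map_neg]; abel] at h2
  · exact IsFibreHomogeneous.sum fun b _ =>
      (isFibreHomogeneous_pullback hφ hd _).mul (isFibreHomogeneous_linearCoord b)
  · have h1 : e a - e b = φ (coordDegree n d b - coordDegree n d a) := by
      rw [he, he, map_sub, map_neg, map_neg]; abel
    have h3 := fun k => IsHomogeneous.pullback (σ := σ) (φ := φ) (e := e) hφ hd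
      (X.isFunction_inverseDerivative c c' hc hc' hr a k).isHomogeneous
    have h2 : formalPartial (toLex (Sum.inr b))
        (∑ k, pullback (X.atlas.inverseDerivative c c' V hc hc' a k) * linearCoord k :
          LocalSeries σ (bundleDegree d' e) V) =
        σ (- e b) (e a - e b) • pullback (X.atlas.inverseDerivative c c' V hc hc' a b) := by
      rw [formalPartial_sum, Finset.sum_eq_single b]
      · rw [linearCoord, formalPartial_mul (h3 b), formalPartial_X, if_pos rfl,
          formalPartial_inr_pullback hφ hd, zero_mul, zero_add, mul_one, h1]
        rfl
      · intro k _ hk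
        rw [linearCoord, formalPartial_mul (h3 k), formalPartial_X, if_neg,
          formalPartial_inr_pullback hφ hd, zero_mul, zero_add, mul_zero, smul_zero]
        exact fun h => hk (by simpa using h)
      · exact fun h => absurd (Finset.mem_univ b) h
    -- The sign from moving `∂/∂ξ_b` past the coefficient cancels the sign in the definition of the
    -- Jacobian matrix, so here no condition on the interaction of `i` with the base is needed.
    rw [h2, smul_smul, ← σ.add_left, add_neg_cancel, CommutationFactor.zero_left, one_smul]
    rfl

theorem totalSpace_cotangent_berJacobian_of_isEven (hieven : σ.IsEven i) :
    (X.atlas.totalSpace σ d' e fun c c' V hc hc' a =>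
      ∑ b, pullback (X.atlas.inverseDerivative c c' V hc hc' a b) * linearCoord b).berJacobian
        c c' V hc hc' = 1 := by
  rw [X.totalSpace_cotangent_berJacobian c c' hc hc' hφ hd hr he,
    rhoBer_map_pullbackHom_of_isEven hφ hd (X.isGraded_inverseDerivativeMatrix c c' hc hc' hr)
      (X.isGraded_derivativeMatrix c c' hc hc' hr)
      (X.inverseDerivativeMatrix_mul_derivativeMatrix c c' hc hc' hr)
      (X.derivativeMatrix_mul_inverseDerivativeMatrix c c' hc hc' hr) he hieven,
    ← pullback_mul hφ hd, (X.isHomogeneous_berJacobian c c' hc hc' hr).mul_comm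
      (isHomogeneous_rhoBer (X.isGraded_inverseDerivativeMatrix c c' hc hc' hr)),
    X.rhoBer_inverseDerivativeMatrix_mul_berJacobian c c' hc hc' hr, pullback_one hφ hd]

/-- The fibre block and `J_xy` both have a Berezinian inverse to that of the unshifted matrix of
inverse derivatives, so the two Berezinians coincide. -/
theorem totalSpace_cotangent_berJacobian_of_isOdd (hodd : σ.IsOdd i) :
    (X.atlas.totalSpace σ d' e fun c c' V hc hc' a =>
      ∑ b, pullback (X.atlas.inverseDerivative c c' V hc hc' a b) * linearCoord b).berJacobian
        c c' V hc hc' = pullback (X.atlas.berJacobian c c' V hc hc') ^ 2 := by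
  have h1 := pullback_rhoBer_mul_of_isOdd hφ hd
    (X.isGraded_inverseDerivativeMatrix c c' hc hc' hr)
    (X.isGraded_derivativeMatrix c c' hc hc' hr)
    (X.inverseDerivativeMatrix_mul_derivativeMatrix c c' hc hc' hr)
    (X.derivativeMatrix_mul_inverseDerivativeMatrix c c' hc hc' hr) he hodd
  have h2 := congrArg (pullback (σ := σ) (d' := d') (e := e))
    (X.rhoBer_inverseDerivativeMatrix_mul_berJacobian c c' hc hc' hr)
  rw [(isHomogeneous_rhoBer (X.isGraded_inverseDerivativeMatrix c c' hc hc' hr)).mul_comm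
    (X.isHomogeneous_berJacobian c c' hc hc' hr), pullback_mul hφ hd, pullback_one hφ hd] at h2
  rw [X.totalSpace_cotangent_berJacobian c c' hc hc' hφ hd hr he,
    ← left_inv_eq_right_inv h2 h1, pow_two]

end Cotangent

end RhoManifold

/-! ### The commutation factor on `ℤ × G` and the final assembly. -/

namespace CommutationFactor

variable {G 𝕂 : Type*} [AddCommGroup G] [Field 𝕂] (ρ : CommutationFactor G 𝕂)

theorem prime_inr (i j : G) : ρ.prime (AddMonoidHom.inr ℤ G i) (AddMonoidHom.inr ℤ G j) = ρ i j := by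
  change (-1 : 𝕂) ^ ((0 : ℤ) * 0) * ρ i j = _
  simp

theorem prime_one_zero_inr (j : G) : ρ.prime (1, 0) (AddMonoidHom.inr ℤ G j) = 1 := by
  change (-1 : 𝕂) ^ ((1 : ℤ) * 0) * ρ 0 j = _
  simp

theorem isOdd_prime_one_zero : ρ.prime.IsOdd (1, 0) := by
  change (-1 : 𝕂) ^ ((1 : ℤ) * 1) * ρ 0 0 = _
  simp

theorem neg_neg (i j : G) : ρ (-i) (-j) = ρ i j := by
  rw [ρ.neg_left, ρ.neg_right, inv_inv]

end CommutationFactor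

theorem mainTheorem9 {𝕜 𝕂 G κ M : Type*} [RCLike 𝕜] [RCLike 𝕂] [NormedAlgebra 𝕜 𝕂]
    [AddCommGroup G] [Fintype κ] [LinearOrder κ] (r : WithTop ℕ∞) (hr : r = ∞ ∨ r = ω) (n : ℕ)
    [TopologicalSpace M] [ConnectedSpace M] [ChartedSpace (EuclideanSpace 𝕜 (Fin n)) M]
    [IsManifold 𝓘(𝕜, EuclideanSpace 𝕜 (Fin n)) r M]
    (ρ : CommutationFactor G 𝕂) (d : κ → G) (X : RhoManifold 𝕜 r n ρ d M) :
    -- the shifted tangent bundle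
    ((∀ (c c' : X.atlas.Chart) (V : TopologicalSpace.Opens M)
        (hc : V ≤ X.atlas.dom c) (hc' : V ≤ X.atlas.dom c'),
        X.atlas.shiftedTangentBundle.berJacobian c c' V hc hc' = 1) ∧
      X.atlas.shiftedTangentBundle.IsVolumeForm r fun _ => 1) ∧
    -- the cotangent bundle
    ((∀ (c c' : X.atlas.Chart) (V : TopologicalSpace.Opens M)
        (hc : V ≤ X.atlas.dom c) (hc' : V ≤ X.atlas.dom c'),
        X.atlas.cotangentBundle.berJacobian c c' V hc hc' = 1) ∧
      X.atlas.cotangentBundle.IsVolumeForm r fun _ => 1) ∧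
    -- the tangent bundle
    ((∀ (c c' : X.atlas.Chart) (V : TopologicalSpace.Opens M)
        (hc : V ≤ X.atlas.dom c) (hc' : V ≤ X.atlas.dom c'),
        X.atlas.tangentBundle.berJacobian c c' V hc hc' =
          CoordAtlas.pullback (X.atlas.berJacobian c c' V hc hc') ^ 2) ∧
      ∀ s, X.atlas.IsVolumeForm r s →
        X.atlas.tangentBundle.IsVolumeForm r fun c => CoordAtlas.pullback (s c) ^ 2) ∧
    -- the shifted cotangent bundle
    ((∀ (c c' : X.atlas.Chart) (V : TopologicalSpace.Opens M)
        (hc : V ≤ X.atlas.dom c) (hc' : V ≤ X.atlas.dom c'),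
        X.atlas.shiftedCotangentBundle.berJacobian c c' V hc hc' =
          CoordAtlas.pullback (X.atlas.berJacobian c c' V hc hc') ^ 2) ∧
      ∀ s, X.atlas.IsVolumeForm r s →
        X.atlas.shiftedCotangentBundle.IsVolumeForm r fun c => CoordAtlas.pullback (s c) ^ 2) ∧
    -- the degree shifts of the cotangent bundle by an even degree
    (∀ i : G, ρ.IsEven i →
      (∀ (c c' : X.atlas.Chart) (V : TopologicalSpace.Opens M)
        (hc : V ≤ X.atlas.dom c) (hc' : V ≤ X.atlas.dom c'),
        (X.atlas.degreeShiftedCotangentBundle i).berJacobian c c' V hc hc' = 1) ∧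
      (X.atlas.degreeShiftedCotangentBundle i).IsVolumeForm r fun _ => 1) ∧
    -- the degree shifts of the cotangent bundle by an odd degree
    (∀ i : G, ρ.IsOdd i →
      (∀ (c c' : X.atlas.Chart) (V : TopologicalSpace.Opens M)
        (hc : V ≤ X.atlas.dom c) (hc' : V ≤ X.atlas.dom c'),
        (X.atlas.degreeShiftedCotangentBundle i).berJacobian c c' V hc hc' =
          CoordAtlas.pullback (X.atlas.berJacobian c c' V hc hc') ^ 2) ∧
      ∀ s, X.atlas.IsVolumeForm r s →
        (X.atlas.degreeShiftedCotangentBundle i).IsVolumeForm r fun c =>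
          CoordAtlas.pullback (s c) ^ 2) := by
  -- Every bundle is a case of the same construction. For `TM`, `T^*M` and `[-i]T^*M` the map `φ` is
  -- the identity and the shift is `0` or `-i`; for `ΠTM` and `ΠT^*M` it is `AddMonoidHom.inr` with
  -- the odd shift `(1, 0)`.
  have hG : ∀ i j, ρ (AddMonoidHom.id G i) (AddMonoidHom.id G j) = ρ i j := fun _ _ => rfl
  have hd : ∀ b, d b = AddMonoidHom.id G (d b) := fun _ => rfl
  have hd' : ∀ b, ((0 : ℤ), d b) = AddMonoidHom.inr ℤ G (d b) := fun _ => rfl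
  have h0 : ∀ a, coordDegree n d a = AddMonoidHom.id G (coordDegree n d a) + 0 :=
    fun a => (add_zero _).symm
  have h0' : ∀ a, - coordDegree n d a = AddMonoidHom.id G (- coordDegree n d a) + 0 :=
    fun a => (add_zero _).symm
  have hi : ∀ i a, - coordDegree n d a - i = AddMonoidHom.id G (- coordDegree n d a) + -i :=
    fun i a => sub_eq_add_neg _ _
  have h1 : ∀ j : G, ((1 : ℤ), j) = AddMonoidHom.inr ℤ G j + (1, 0) := fun j =>
    Prod.ext (zero_add 1).symm (add_zero j).symm
  have heven : ρ.IsEven 0 := ρ.zero_left 0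
  have hodd := ρ.isOdd_prime_one_zero
  have k1 := fun c c' V (hc : V ≤ X.atlas.dom c) (hc' : V ≤ X.atlas.dom c') =>
    X.totalSpace_tangent_berJacobian_of_isOdd c c' hc hc' ρ.prime_inr hd' hr
      ρ.prime_one_zero_inr (fun a => h1 (coordDegree n d a)) hodd
  have k2 := fun c c' V (hc : V ≤ X.atlas.dom c) (hc' : V ≤ X.atlas.dom c') =>
    X.totalSpace_cotangent_berJacobian_of_isEven c c' hc hc' hG hd hr h0' heven
  have k3 := fun c c' V (hc : V ≤ X.atlas.dom c) (hc' : V ≤ X.atlas.dom c') =>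
    X.totalSpace_tangent_berJacobian_of_isEven c c' hc hc' hG hd hr ρ.zero_left h0 heven
  have k4 := fun c c' V (hc : V ≤ X.atlas.dom c) (hc' : V ≤ X.atlas.dom c') =>
    X.totalSpace_cotangent_berJacobian_of_isOdd c c' hc hc' ρ.prime_inr hd' hr
      (fun a => h1 (- coordDegree n d a)) hodd
  -- The shift is `-i`, which has the parity of `i`.
  have k5 := fun (i : G) (hρ : ρ.IsEven i) c c' V (hc : V ≤ X.atlas.dom c)
      (hc' : V ≤ X.atlas.dom c') =>
    X.totalSpace_cotangent_berJacobian_of_isEven c c' hc hc' hG hd hr (hi i)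
      ((ρ.neg_neg i i).trans hρ)
  have k6 := fun (i : G) (hρ : ρ.IsOdd i) c c' V (hc : V ≤ X.atlas.dom c)
      (hc' : V ≤ X.atlas.dom c') =>
    X.totalSpace_cotangent_berJacobian_of_isOdd c c' hc hc' hG hd hr (hi i)
      ((ρ.neg_neg i i).trans hρ)
  exact ⟨⟨k1, X.totalSpace_isVolumeForm_one ρ.prime_inr hd' k1⟩,
    ⟨k2, X.totalSpace_isVolumeForm_one hG hd k2⟩,
    ⟨k3, fun _ hs => X.totalSpace_isVolumeForm_sq hG hd hr k3 hs⟩,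
    ⟨k4, fun _ hs => X.totalSpace_isVolumeForm_sq ρ.prime_inr hd' hr k4 hs⟩,
    fun i hρ => ⟨k5 i hρ, X.totalSpace_isVolumeForm_one hG hd (k5 i hρ)⟩,
    fun i hρ => ⟨k6 i hρ, fun _ hs => X.totalSpace_isVolumeForm_sq hG hd hr (k6 i hρ) hs⟩⟩
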